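/- Throughout, contact $3$-manifolds are closed, connected and smooth, with a smooth co-oriented contact structure, and they carry the orientation $\alpha\wedge d\alpha>0$ induced by the contact structure. A Darboux ball in $(Y,\xi)$ is (the image $B$ of) a smooth embedding $\phi$ of the closed unit ball $\mathbb B^3\subset\mathbb R^3$ carrying the co-oriented structure $\xi_{\mathrm{st}}=\ker(dz+\tfrac12x\,dy-\tfrac12y\,dx)$ to $\xi$. Let $\mathcal C(Y,\xi)$ be the path component of $\xi$ in the space of co-oriented contact structures on $Y$ with the $C^\infty$ topology, and let $\mathcal C(Y,\xi,B)\subset\mathcal C(Y,\xi)$ be the subspace of those structures that agree with $\xi$ over $B$; both are based at $\xi$. Let $ev_B:\mathcal C(Y,\xi)\to S^2$ send $\xi'$ to the co-oriented plane $\xi'(\phi(0))$, where $S^2$ is identified, by means of $d\phi_0$ and unit normals, with the sphere of co-oriented planes in $\mathbb R^3$. The obstruction class $\mathcal O_\xi=\delta(1)\in\pi_1\mathcal C(Y,\xi,B)$ is the image of the positive generator $1\in\pi_2(S^2)=\mathbb Z$ under the connecting map $\delta$ of $ev_B$. That is, $\mathcal O_\xi$ is the class of the boundary loop of any based disc $(D^2,\partial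 D^2)\to(\mathcal C(Y,\xi),\mathcal C(Y,\xi,B))$ whose composition with $ev_B$ represents $1$. Let $(Y_\pm,\xi_\pm)$ be two contact $3$-manifolds with Darboux balls $B_\pm$, and let $(Y_\#,\xi_\#)=(Y_-,\xi_-)\#(Y_+,\xi_+)$ be their contact connected sum along $B_\pm$. It is obtained from $Y_\pm\setminus \mathrm{int}\,B_\pm$ by attaching the neck $[-1,1]\times\partial\mathbb B^3$, which is part of the boundary of the $1$-handle $\{|(x,y,z)|\le1,\ |t|\le1\}\subset\mathbb R^4$ and carries the contact structure $\ker(\iota_v\omega)$ with $\omega=dx\wedge dy+dz\wedge dt$ and $v=\tfrac12x\partial_x+\tfrac12y\partial_y+2z\partial_z-t\partial_t$. Here $B_+$ is identified with $\mathbb B^3\subset\{t=1\}$, $B_-$ is identified with $\mathbb B^3\subset\{t=-1\}$ by $(x,y,z)\mapsto(x,y,-z)$, and the corners are smoothed along the flow lines of $v$. Let $B_\#\subset Y_\#$ be any Darboux ball of $(Y_\#,\xi_\#)$ contained in the neck. Then extension by $\xi_\#$ outside $Y_-\setminus B_-$, resp. outside $Y_+\setminus B_+$, defines continuous based maps $\mathcal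 C(Y_\pm,\xi_\pm,B_\pm)\to\mathcal C(Y_\#,\xi_\#,B_\#)$. Denote the maps that they induce on $\pi_1$ by $$(-)\#\xi_+:\pi_1\mathcal C(Y_-,\xi_-,B_-)\to\pi_1\mathcal C(Y_\#,\xi_\#,B_\#),\qquad \xi_-\#(-):\pi_1\mathcal C(Y_+,\xi_+,B_+)\to\pi_1\mathcal C(Y_\#,\xi_\#,B_\#).$$ The obstruction classes of $(Y_\pm,\xi_\pm,B_\pm)$ and $(Y_\#,\xi_\#,B_\#)$ exist and are unique, and $$\mathcal O_{\xi_\#}=(\mathcal O_{\xi_-}\#\xi_+)\cdot(\xi_-\#\mathcal O_{\xi_+})\in\pi_1\mathcal C(Y_\#,\xi_\#,B_\#).$$ -/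

import Mathlib

open Set Metric Topology
open scoped Manifold ContDiff UniformConvergence

noncomputable section

namespace ContactSum

/-! ### Linear algebra in `ℝ³` -/

/-- Euclidean `3`-space with coordinates `(x, y, z) = (u 0, u 1, u 2)`. -/
abbrev E3 : Type := EuclideanSpace ℝ (Fin 3)

/-- The unit sphere `S² ⊆ ℝ³`. -/
abbrev S2 : Type := sphere (0 : E3) 1

/-- A set of vectors `H ⊆ ℝ³` that is an open half-space through the origin, i.e. the positive
side of a co-oriented plane. -/
def IsHalfSpace (H : Set E3) : Prop :=
  ∃ n : E3, ‖n‖ = 1 ∧ H = {v | 0 < inner ℝ n v}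

open Classical in
/-- The unit normal vector of a co-oriented plane in `ℝ³`, which is given by its positive side `H`
(and `0` if `H` is not a half-space). -/
def unitNormal (H : Set E3) : E3 :=
  if h : IsHalfSpace H then h.choose else 0

theorem norm_unitNormal {H : Set E3} (h : IsHalfSpace H) : ‖unitNormal H‖ = 1 := by
  rw [unitNormal, dif_pos h]
  exact h.choose_spec.1

theorem mem_iff_inner_unitNormal {H : Set E3} (h : IsHalfSpace H) (v : E3) :
    v ∈ H ↔ 0 < inner ℝ (unitNormal H) v := by
  rw [unitNormal, dif_pos h]
  have := h.choose_spec.2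
  exact Set.ext_iff.1 this v

/-- The unit normal is determined by the half-space. -/
theorem unitNormal_eq {H : Set E3} {m : E3} (hm : m ≠ 0) (hH : H = {v | 0 < inner ℝ m v}) :
    unitNormal H = ‖m‖⁻¹ • m := by
  have hm' : 0 < ‖m‖ := norm_pos_iff.2 hm
  have hs : IsHalfSpace H := by
    refine ⟨‖m‖⁻¹ • m, by rw [norm_smul, norm_inv, norm_norm, inv_mul_cancel₀ hm'.ne'], ?_⟩
    rw [hH]
    ext v
    simp only [mem_ofPred_eq, real_inner_smul_left]
    constructor
    · intro h; positivity
    · intro h; exact pos_of_mul_pos_right h (by positivity)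
  set n := unitNormal H with hn
  have hn1 : ‖n‖ = 1 := norm_unitNormal hs
  have key : ∀ v : E3, 0 < inner ℝ n v ↔ 0 < inner ℝ m v := fun v => by
    rw [← mem_iff_inner_unitNormal hs v, hH]; rfl
  -- the vector `w = m - ⟪n, m⟫ n` is orthogonal to `n`, hence to `m`
  set w : E3 := m - inner ℝ n m • n with hw
  have hnn : inner ℝ n n = (1 : ℝ) := by rw [real_inner_self_eq_norm_sq, hn1]; norm_num
  have hnw : inner ℝ n w = 0 := by
    rw [hw, inner_sub_right, real_inner_smul_right, hnn]; ring
  have h1 : ¬ 0 < inner ℝ m w := by rw [← key, hnw]; exact lt_irrefl _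
  have hw0 : w = 0 := by
    have h2 : inner ℝ m w = ‖w‖ ^ 2 := by
      have : m = w + inner ℝ n m • n := by rw [hw]; abel
      rw [← real_inner_self_eq_norm_sq]
      nth_rewrite 1 [this]
      rw [inner_add_left, real_inner_smul_left, hnw]; ring
    rw [h2] at h1
    by_contra hne
    exact h1 (by have := norm_pos_iff.2 hne; positivity)
  have hmn : m = inner ℝ n m • n := by rw [hw, sub_eq_zero] at hw0; exact hw0
  have hpos : 0 < inner ℝ n m := by
    rw [key]; exact real_inner_self_pos.2 hm
  have hnorm : ‖m‖ = inner ℝ n m := by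
    conv_lhs => rw [hmn]
    rw [norm_smul, hn1, mul_one, Real.norm_of_nonneg hpos.le]
  rw [hnorm]
  conv_rhs => rw [hmn]
  rw [inner_smul_right, hnn, mul_one, smul_smul, inv_mul_cancel₀ hpos.ne', one_smul]

/-- The positive side of a nonzero covector is a half-space. -/
theorem isHalfSpace_of_covector {ℓ : E3 →L[ℝ] ℝ} (hℓ : ℓ ≠ 0) :
    IsHalfSpace {v | 0 < ℓ v} := by
  set m : E3 := (InnerProductSpace.toDual ℝ E3).symm ℓ with hm
  have hm0 : m ≠ 0 := by simpa [hm] using hℓ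
  have hm' : 0 < ‖m‖ := norm_pos_iff.2 hm0
  refine ⟨‖m‖⁻¹ • m, by rw [norm_smul, norm_inv, norm_norm, inv_mul_cancel₀ hm'.ne'], ?_⟩
  ext v
  have : inner ℝ m v = ℓ v := InnerProductSpace.toDual_symm_apply
  simp only [mem_ofPred_eq, real_inner_smul_left, this]
  constructor
  · intro h; positivity
  · intro h; exact pos_of_mul_pos_right h (by positivity)

/-! ### Co-oriented contact structures -/

/-- The value `(a ∧ da)(v₁, v₂, v₃)` at `u` for a `1`-form `a` on (an open subset of) `ℝ³`. -/
def wedgeD (a : E3 → E3 →L[ℝ] ℝ) (u v₁ v₂ v₃ : E3) : ℝ :=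
  let d : E3 → E3 → ℝ := fun v w => fderiv ℝ a u v w - fderiv ℝ a u w v
  a u v₁ * d v₂ v₃ + a u v₂ * d v₃ v₁ + a u v₃ * d v₁ v₂

/-- The standard contact form `dz + ½ (x dy - y dx)` on `ℝ³`, at the point `u`, on the
vector `v`. -/
def stdForm (u v : E3) : ℝ := v 2 + (1 / 2) * (u 0 * v 1 - u 1 * v 0)

section Manifold

variable {Y : Type*} [TopologicalSpace Y] [ChartedSpace E3 Y]

/-- The differential at `u` of the inverse of the preferred chart around `p₀`. -/
def dChartSymm (p₀ : Y) (u : E3) :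
    E3 →L[ℝ] TangentSpace (𝓡 3) ((chartAt E3 p₀).symm u) :=
  mfderiv (𝓡 3) (𝓡 3) (chartAt E3 p₀).symm u

variable (Y) in
/-- A smooth co-oriented contact structure on a `3`-manifold. The co-oriented plane at `p` is
recorded by its positive side `pos p`, an open half-space of the tangent space; the plane itself is
the set of `v` such that neither `v` nor `-v` is in `pos p`. Around every point, the
co-oriented plane field is the kernel of a smooth `1`-form `a` with `a ∧ da ≠ 0` that is positive on
the positive side. -/
@[ext]
structure ContactStructure where
  pos : ∀ p : Y, Set (TangentSpace (𝓡 3) p)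
  locally_contact : ∀ p₀ : Y, ∃ a : E3 → E3 →L[ℝ] ℝ,
    ContDiffOn ℝ ∞ a (chartAt E3 p₀).target ∧
    ∀ u ∈ (chartAt E3 p₀).target,
      (∃ v₁ v₂ v₃ : E3, wedgeD a u v₁ v₂ v₃ ≠ 0) ∧
      ∀ v : E3, dChartSymm p₀ u v ∈ pos ((chartAt E3 p₀).symm u) ↔ 0 < a u v

/-- The unit normal vector field of a co-oriented plane field in the preferred chart around `p₀`. -/
def ContactStructure.chartNormal (ξ : ContactStructure Y) (p₀ : Y) (u : E3) : E3 :=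
  unitNormal (dChartSymm p₀ u ⁻¹' ξ.pos ((chartAt E3 p₀).symm u))

/-- The `C^∞` topology on the space of contact structures: convergence means that, in charts, the
unit normal vector fields converge with all derivatives, uniformly on compact subsets. -/
instance : TopologicalSpace (ContactStructure Y) :=
  ⨅ (p₀ : Y) (k : ℕ), TopologicalSpace.induced
    (fun ξ : ContactStructure Y =>
      UniformOnFun.ofFun {K : Set E3 | IsCompact K ∧ K ⊆ (chartAt E3 p₀).target}
        (iteratedFDeriv ℝ k (ξ.chartNormal p₀)))
    inferInstance

theorem ContactStructure.exists_covector_chart [IsManifold (𝓡 3) ∞ Y] (ξ : ContactStructure Y)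
    (p₀ : Y) (u : E3) (hu : u ∈ (chartAt E3 p₀).target) :
    ∃ ℓ : TangentSpace (𝓡 3) ((chartAt E3 p₀).symm u) →L[ℝ] ℝ,
      ℓ ≠ 0 ∧ ξ.pos ((chartAt E3 p₀).symm u) = {v | 0 < ℓ v} := by
  have : IsManifold (𝓡 3) 1 Y := IsManifold.of_le (n := ∞) (by simp)
  obtain ⟨a, -, ha⟩ := ξ.locally_contact p₀
  obtain ⟨⟨v₁, v₂, v₃, hv⟩, hpos⟩ := ha u hu
  have hc := mdifferentiable_chart (I := 𝓡 3) p₀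
  have hs : (chartAt E3 p₀).symm u ∈ (chartAt E3 p₀).source := (chartAt E3 p₀).map_target hu
  have hA := hc.comp_symm_deriv hu
  have hB := hc.symm_comp_deriv hs
  rw [(chartAt E3 p₀).right_inv hu] at hB
  refine ⟨(a u).comp (mfderiv (𝓡 3) (𝓡 3) (chartAt E3 p₀) ((chartAt E3 p₀).symm u)), ?_, ?_⟩
  · intro h0
    have ha0 : a u = 0 := by
      ext v
      have h1 := DFunLike.congr_fun h0 (mfderiv (𝓡 3) (𝓡 3) (chartAt E3 p₀).symm u v)
      have h2 := DFunLike.congr_fun hA v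
      exact (congrArg (a u) h2).symm.trans h1
    apply hv
    simp [wedgeD, ha0]
  · ext v
    have h2 := DFunLike.congr_fun hB v
    have h3 := hpos (mfderiv (𝓡 3) (𝓡 3) (chartAt E3 p₀) ((chartAt E3 p₀).symm u) v)
    have h4 : dChartSymm p₀ u (mfderiv (𝓡 3) (𝓡 3) (chartAt E3 p₀) ((chartAt E3 p₀).symm u) v)
        = v := h2
    rw [h4] at h3
    exact h3

/-- The positive side of a contact structure at a point is given by a nonzero covector. -/
theorem ContactStructure.exists_covector [IsManifold (𝓡 3) ∞ Y] (ξ : ContactStructure Y) (p : Y) :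
    ∃ ℓ : TangentSpace (𝓡 3) p →L[ℝ] ℝ, ℓ ≠ 0 ∧ ξ.pos p = {v | 0 < ℓ v} := by
  have h := ξ.exists_covector_chart p (chartAt E3 p p) (mem_chart_target E3 p)
  rwa [(chartAt E3 p).left_inv (mem_chart_source E3 p)] at h

/-- A Darboux ball in `(Y, ξ)`: a smooth embedding of the closed unit ball of `ℝ³` under which `ξ`
corresponds to the standard co-oriented contact structure `ker (dz + ½ (x dy - y dx))`. -/
structure DarbouxBall (ξ : ContactStructure Y) where
  toFun : E3 → Y
  smooth : ∃ U : Set E3, IsOpen U ∧ closedBall 0 1 ⊆ U ∧ ContMDiffOn (𝓡 3) (𝓡 3) ∞ toFun U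
  injOn : InjOn toFun (closedBall 0 1)
  bijective_mfderiv : ∀ u ∈ closedBall (0 : E3) 1,
    Function.Bijective (mfderiv (𝓡 3) (𝓡 3) toFun u)
  contact : ∀ u ∈ closedBall (0 : E3) 1, ∀ v : E3,
    mfderiv (𝓡 3) (𝓡 3) toFun u v ∈ ξ.pos (toFun u) ↔ 0 < stdForm u v

/-- The ball `B ⊆ Y`. -/
def DarbouxBall.image {ξ : ContactStructure Y} (B : DarbouxBall ξ) : Set Y :=
  B.toFun '' closedBall 0 1

/-- The centre of the Darboux ball. -/
def DarbouxBall.center {ξ : ContactStructure Y} (B : DarbouxBall ξ) : Y := B.toFun 0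

/-! ### Spaces of contact structures, evaluation map and obstruction class -/

/-- `𝒞(Y, ξ)`: the path component of `ξ` in the space of contact structures. -/
abbrev SpaceC (ξ : ContactStructure Y) : Type _ :=
  {η : ContactStructure Y // η ∈ pathComponent ξ}

/-- `ξ` as a point of `𝒞(Y, ξ)`. -/
def baseC (ξ : ContactStructure Y) : SpaceC ξ := ⟨ξ, mem_pathComponent_self ξ⟩

/-- `𝒞(Y, ξ, B)`: the subspace of `𝒞(Y, ξ)` of contact structures that agree with `ξ` over `B`. -/
abbrev SpaceCB {ξ : ContactStructure Y} (B : DarbouxBall ξ) : Type _ :=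
  {η : SpaceC ξ // ∀ p ∈ B.image, η.1.pos p = ξ.pos p}

/-- `ξ` as a point of `𝒞(Y, ξ, B)`. -/
def baseCB {ξ : ContactStructure Y} (B : DarbouxBall ξ) : SpaceCB B :=
  ⟨baseC ξ, fun _ _ => rfl⟩

/-- The evaluation map `ev_B : 𝒞(Y, ξ) → S²` at the centre `0` of the Darboux ball `B`. Here `S²` is
identified with the space of co-oriented planes in `T₀B = ℝ³` (a co-oriented plane corresponds to
its unit normal in the Darboux coordinates). -/
def evB [IsManifold (𝓡 3) ∞ Y] {ξ : ContactStructure Y} (B : DarbouxBall ξ) (η : SpaceC ξ) : S2 :=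
  ⟨unitNormal (mfderiv (𝓡 3) (𝓡 3) B.toFun 0 ⁻¹' η.1.pos B.center), by
    obtain ⟨ℓ, hℓ, hpos⟩ := η.1.exists_covector B.center
    have hb := B.bijective_mfderiv 0 (by simp)
    rw [mem_sphere_zero_iff_norm]
    apply norm_unitNormal
    have hne : ℓ.comp (mfderiv (𝓡 3) (𝓡 3) B.toFun 0) ≠ 0 := by
      intro h0
      apply hℓ
      ext v
      obtain ⟨w, rfl⟩ := hb.2 v
      exact DFunLike.congr_fun h0 w
    have := isHalfSpace_of_covector hne
    rw [hpos]
    exact this⟩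

/-- The north pole `(0, 0, 1)` of `S²`: the unit normal of the standard contact structure at the
centre of a Darboux ball. -/
def northPole : S2 := ⟨!₂[0, 0, 1], by
  rw [mem_sphere_zero_iff_norm, EuclideanSpace.norm_eq, Fin.sum_univ_three]; simp⟩

/-- A nowhere vanishing vector field along the square, whose normalization collapses the boundary
of the square to the north pole and has degree one. -/
def squareVec (x : Fin 2 → unitInterval) : E3 :=
  let s : ℝ := x 0
  let t : ℝ := x 1
  let b : ℝ := 16 * (s * (1 - s) * (t * (1 - t)))
  !₂[b * (2 * t - 1), b * (2 * s - 1), 1 - 2 * b]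

theorem squareVec_ne_zero (x : Fin 2 → unitInterval) : squareVec x ≠ 0 := by
  intro h
  have h0 := congrArg (fun v : E3 => v 0) h
  have h1 := congrArg (fun v : E3 => v 1) h
  have h2 := congrArg (fun v : E3 => v 2) h
  simp only [squareVec, PiLp.toLp_apply, Matrix.cons_val_zero, Matrix.cons_val_one,
    Matrix.cons_val, PiLp.zero_apply] at h0 h1 h2
  have hb : 16 * ((x 0 : ℝ) * (1 - x 0) * (x 1 * (1 - x 1))) = 1 / 2 := by linarith
  rw [hb] at h0 h1
  have ht : (x 1 : ℝ) = 1 / 2 := by linarith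
  have hs : (x 0 : ℝ) = 1 / 2 := by linarith
  rw [hs, ht] at hb
  norm_num at hb

/-- The map `([0,1]², ∂[0,1]²) → (S², north pole)` of degree one (it covers the south pole once, at
the centre of the square, preserving orientations), which represents `1 ∈ ℤ = π₂(S²)`. -/
def squareToSphere : GenLoop (Fin 2) S2 northPole :=
  ⟨⟨fun x => ⟨‖squareVec x‖⁻¹ • squareVec x, by
      rw [mem_sphere_zero_iff_norm, norm_smul, norm_inv, norm_norm,
        inv_mul_cancel₀ (norm_ne_zero_iff.2 (squareVec_ne_zero x))]⟩, by
      refine Continuous.subtype_mk ?_ _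
      have hc : Continuous squareVec := by
        unfold squareVec
        fun_prop
      exact (hc.norm.inv₀ fun x => norm_ne_zero_iff.2 (squareVec_ne_zero x)).smul hc⟩, by
    rintro x ⟨i, hi⟩
    have hb : squareVec x = !₂[0, 0, 1] := by
      fin_cases i <;> rcases hi with hi | hi <;> simp [squareVec] at hi ⊢ <;> simp [hi]
    apply Subtype.ext
    have hn : ‖squareVec x‖ = 1 := by
      rw [hb]; exact mem_sphere_zero_iff_norm.1 northPole.2
    change ‖squareVec x‖⁻¹ • squareVec x = !₂[0, 0, 1]
    rw [hn, hb, inv_one, one_smul]⟩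

/-- `o ∈ π₁ 𝒞(Y, ξ, B)` is the obstruction class `𝒪_ξ = δ(1)`, where
`δ : π₂ S² → π₁ 𝒞(Y, ξ, B)` is the connecting map of the fibration `ev_B`: there is a disc `D` in
`𝒞(Y, ξ)`, parametrized by the square with three sides sent to `ξ`, which lifts a representative
`f` of `1 ∈ π₂ S²` along `ev_B` and whose fourth side is a loop in `𝒞(Y, ξ, B)` in the class `o`. -/
def IsObstructionClass [IsManifold (𝓡 3) ∞ Y] {ξ : ContactStructure Y} (B : DarbouxBall ξ)
    (o : FundamentalGroup (SpaceCB B) (baseCB B)) : Prop :=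
  ∃ (D : C(unitInterval × unitInterval, SpaceC ξ)) (f : GenLoop (Fin 2) S2 northPole)
    (γ : Path (baseCB B) (baseCB B)),
    GenLoop.Homotopic f squareToSphere ∧
    (∀ r φ : unitInterval, evB B (D (r, φ)) = f ![r, φ]) ∧
    (∀ φ : unitInterval, D (0, φ) = baseC ξ) ∧
    (∀ r : unitInterval, D (r, 0) = baseC ξ ∧ D (r, 1) = baseC ξ) ∧
    (∀ φ : unitInterval, D (1, φ) = (γ φ).1) ∧
    o = FundamentalGroup.fromPath (Path.Homotopic.Quotient.mk γ)

end Manifold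

/-! ### Contact connected sums -/

section ConnectedSum

variable {Y₁ Y₂ : Type*} [TopologicalSpace Y₁] [ChartedSpace E3 Y₁]
  [TopologicalSpace Y₂] [ChartedSpace E3 Y₂]

/-- `f` restricts on the open set `U` to an open contact embedding, i.e. to a diffeomorphism from
`U` onto an open set, which carries `ξ₁` to `ξ₂` (with co-orientations). -/
structure IsContactEmbeddingOn (ξ₁ : ContactStructure Y₁) (ξ₂ : ContactStructure Y₂)
    (f : Y₁ → Y₂) (U : Set Y₁) : Prop where
  isLocalDiffeomorphOn : IsLocalDiffeomorphOn (𝓡 3) (𝓡 3) ∞ f U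
  injOn : InjOn f U
  contact : ∀ p ∈ U, ∀ v : TangentSpace (𝓡 3) p,
    mfderiv (𝓡 3) (𝓡 3) f p v ∈ ξ₂.pos (f p) ↔ v ∈ ξ₁.pos p

/-- On `ℝ⁴` with coordinates `(x, y, z, t)` and `ω = dx ∧ dy + dz ∧ dt`, the Liouville field
`½ x ∂_x + ½ y ∂_y + 2 z ∂_z - t ∂_t` has the flow `(x, y, z, t) ↦ (eˢᐟ² x, eˢᐟ² y, e²ˢ z, e⁻ˢ t)`.
It carries the point `(w, t)`, `t ≠ 0`, to a point of the hyperplane `{t = 1}` or `{t = -1}`,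
at time `s = log |t|`, whose first three coordinates are `handlePoint w t`. -/
def handlePoint (w : E3) (t : ℝ) : E3 := !₂[√|t| * w 0, √|t| * w 1, t ^ 2 * w 2]

/-- The reflection `(x, y, z) ↦ (x, y, -z)`. -/
def reflectZ (w : E3) : E3 := !₂[w 0, w 1, -w 2]

/-- The `1`-form `ι_v ω = ½ (x dy - y dx) + 2 z dt + t dz` on `ℝ⁴ = ℝ³ × ℝ` induced by the
Liouville field `v`, at the point `(w, t)`, on the vector `(a, τ)`. -/
def liouvilleForm (w : E3) (t : ℝ) (a : E3) (τ : ℝ) : ℝ :=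
  (1 / 2) * (w 0 * a 1 - w 1 * a 0) + 2 * w 2 * τ + t * a 2

variable {Ym Yp Y : Type*} [TopologicalSpace Ym] [ChartedSpace E3 Ym]
  [TopologicalSpace Yp] [ChartedSpace E3 Yp] [TopologicalSpace Y] [ChartedSpace E3 Y]

/-- A presentation of the contact manifold `(Y, ξ)` as the contact connected sum of
`(Ym, ξm)` and `(Yp, ξp)` along the Darboux balls `Bm` and `Bp`.

`Y` is obtained from `Ym ∖ int Bm` and `Yp ∖ int Bp` by attaching the piece `[-1,1] × S²` of the
boundary of the `1`-handle `[-1,1] × 𝔹³ ⊆ ℝ⁴`, with the contact form induced by the Liouville field.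
Here `{±1} × 𝔹³ ⊆ {t = ±1}` is identified with `B_±` (with `Bm` through the
reflection `z ↦ -z`), and the corner along `{±1} × S²` is smoothed along the flow lines of the
Liouville field, to which all pieces are transverse. By following the flow lines to the hyperplanes
`{t = ±1}`, the part `t > 0` (resp. `t < 0`) of the handle becomes the punctured ball `Bp ∖ {0}`
(resp. `Bm ∖ {0}`). So `Y` is the union of `Ym ∖ {0}`, `Yp ∖ {0}` and the sphere `{t = 0}`, glued
by means of `(-1,1) × S²`. -/
structure ContactConnectedSum (ξm : ContactStructure Ym) (Bm : DarbouxBall ξm)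
    (ξp : ContactStructure Yp) (Bp : DarbouxBall ξp) (ξ : ContactStructure Y) where
  /-- the inclusion of `Ym ∖ {0}` (its value at the centre of the ball is irrelevant) -/
  inl : Ym → Y
  /-- the inclusion of `Yp ∖ {0}` (its value at the centre of the ball is irrelevant) -/
  inr : Yp → Y
  /-- the inclusion of the neck `S² × (-1,1)` (its values for `1 ≤ |t|` are irrelevant) -/
  neck : S2 × ℝ → Y
  inl_emb : IsContactEmbeddingOn ξm ξ inl {Bm.center}ᶜ
  inr_emb : IsContactEmbeddingOn ξp ξ inr {Bp.center}ᶜ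
  neck_diffeo :
    IsLocalDiffeomorphOn ((𝓡 2).prod 𝓘(ℝ, ℝ)) (𝓡 3) ∞ neck (univ ×ˢ Ioo (-1) 1)
  neck_inj : InjOn neck (univ ×ˢ Ioo (-1) 1)
  /-- the contact structure on the handle is the one induced by the Liouville field -/
  neck_contact : ∀ (w : S2) (t : ℝ), t ∈ Ioo (-1 : ℝ) 1 →
    ∀ (a : TangentSpace (𝓡 2) w) (τ : ℝ),
      mfderiv ((𝓡 2).prod 𝓘(ℝ, ℝ)) (𝓡 3) neck (w, t) (a, τ) ∈ ξ.pos (neck (w, t)) ↔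
        0 < liouvilleForm w t (mfderiv (𝓡 2) 𝓘(ℝ, E3) (fun p : S2 => (p : E3)) w a) τ
  neck_neg : ∀ (w : S2) (t : ℝ), t ∈ Ioo (-1 : ℝ) 0 →
    neck (w, t) = inl (Bm.toFun (reflectZ (handlePoint w t)))
  neck_pos : ∀ (w : S2) (t : ℝ), t ∈ Ioo (0 : ℝ) 1 →
    neck (w, t) = inr (Bp.toFun (handlePoint w t))
  inl_ne_inr : ∀ p, p ≠ Bm.center → ∀ q, q ≠ Bp.center → inl p ≠ inr q
  neck_ne_inl : ∀ (w : S2) p, p ≠ Bm.center → neck (w, 0) ≠ inl p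
  neck_ne_inr : ∀ (w : S2) q, q ≠ Bp.center → neck (w, 0) ≠ inr q
  cover : ∀ y : Y, (∃ p, p ≠ Bm.center ∧ inl p = y) ∨ (∃ q, q ≠ Bp.center ∧ inr q = y) ∨
    ∃ w : S2, neck (w, 0) = y

variable {ξm : ContactStructure Ym} {Bm : DarbouxBall ξm}
  {ξp : ContactStructure Yp} {Bp : DarbouxBall ξp} {ξ : ContactStructure Y}

namespace ContactConnectedSum

/-- The image of `Ym ∖ Bm` in the connected sum. -/
def left (S : ContactConnectedSum ξm Bm ξp Bp ξ) : Set Y := S.inl '' Bm.imageᶜ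

/-- The image of `Yp ∖ Bp` in the connected sum. -/
def right (S : ContactConnectedSum ξm Bm ξp Bp ξ) : Set Y := S.inr '' Bp.imageᶜ

/-- The closed neck region `[-1,1] × ∂𝔹³` of the connected sum, i.e. the complement
of `Ym ∖ Bm` and `Yp ∖ Bp`. -/
def neckRegion (S : ContactConnectedSum ξm Bm ξp Bp ξ) : Set Y := (S.left ∪ S.right)ᶜ

/-- `η' = η # ξp`: the plane field `η'` on the sum is `η` on `Ym ∖ Bm`, and `ξ` elsewhere. -/
def IsSumLeft (S : ContactConnectedSum ξm Bm ξp Bp ξ) (η : ContactStructure Ym)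
    (η' : ContactStructure Y) : Prop :=
  (∀ p ∉ Bm.image, ∀ v : TangentSpace (𝓡 3) p,
    mfderiv (𝓡 3) (𝓡 3) S.inl p v ∈ η'.pos (S.inl p) ↔ v ∈ η.pos p) ∧
  ∀ y ∉ S.left, η'.pos y = ξ.pos y

/-- `η' = ξm # η`: the plane field `η'` on the sum is `η` on `Yp ∖ Bp`, and `ξ` elsewhere. -/
def IsSumRight (S : ContactConnectedSum ξm Bm ξp Bp ξ) (η : ContactStructure Yp)
    (η' : ContactStructure Y) : Prop :=
  (∀ p ∉ Bp.image, ∀ v : TangentSpace (𝓡 3) p,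
    mfderiv (𝓡 3) (𝓡 3) S.inr p v ∈ η'.pos (S.inr p) ↔ v ∈ η.pos p) ∧
  ∀ y ∉ S.right, η'.pos y = ξ.pos y

end ContactConnectedSum

end ConnectedSum

end ContactSum

end

/-!
The obstruction class of `B` is the boundary of a disc in `𝒞(Y, ξ)` over the generator of
`π₂(S²)`.

*Uniqueness.* Two such discs, glued along the base point, form a square in `𝒞(Y, ξ)` with boundary
in `𝒞(Y, ξ, B)` whose evaluation at the centre of `B` is null-homotopic. Such a square can be
deformed into `𝒞(Y, ξ, B)` without changing its boundary, up to reparametrization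
(`exists_cube_deformation`): a homotopy of the planes at the centre is lifted by rotations
(`exists_lift_homotopy`), so that all planes at the centre are the standard one; interpolation of
the contact forms by a logarithmic cutoff makes the structures standard on a small ball
(`exists_standardize`); contact scalings expand this ball to `B` (`exists_expand`). Hence the two
boundary loops are homotopic (`homotopic_of_discs`). The same deformation applied to paths, with
the sphere simply connected, shows that `𝒞(Y, ξ, B)` is path connected, so that sums of structures
in `𝒞(Yₘ, ξₘ, Bₘ)` and `𝒞(Yₚ, ξₚ, Bₚ)` lie in the path component of `ξ` (`exists_sumMap`).

*Existence.* In a rotationally symmetric chart, pull `ξ` back under twists that rotate each sphere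
about the origin. The rotations are taken from the disc `discQ` of nonzero quaternions, whose
boundary consists of rotations about the `z`-axis and whose evaluation on the `z`-axis has degree
one (`axisMap_homotopic`); they are cut off in the radius. If `ξ` is invariant under rotations
about the `z`-axis on a region where the cutoff is `1`, then the boundary of the disc is
constant on it. The evaluation at a point of this region still has degree one, as its normal
vectors are nowhere opposite to the `z`-axis (`homotopicRel_of_rotations`,
`exists_obstruction_path`). This applies to the Darboux balls of the summands
(`exists_core_disc`), and to the neck in polar coordinates (`exists_neck_disc`), whatever the ball
in the neck is.

*The product formula.* The sphere of radius `2 ± t` in the coordinates of the neck is the sphere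
of radius `t` in those of the balls. This identification intertwines the rotations, hence outside
of the neck the loop of the sum restricts to the loops of the summands (`mem_neck_iff_mem_core`).
So it is the image of the pair of these loops under the map
`𝒞(Yₘ, ξₘ, Bₘ) × 𝒞(Yₚ, ξₚ, Bₚ) → 𝒞(Y, ξ, B)`, and a loop in a product is the product of its components (`fromPath_eq_mul`).
-/

noncomputable section

namespace ContactSum

/-! ### Continuous families of smooth maps -/

section Families

variable {K : Type*} [TopologicalSpace K]
variable {E V V' V'' : Type} [NormedAddCommGroup E] [NormedSpace ℝ E]
  [NormedAddCommGroup V] [NormedSpace ℝ V] [NormedAddCommGroup V'] [NormedSpace ℝ V']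
  [NormedAddCommGroup V''] [NormedSpace ℝ V'']

/-- `FamC W n F`: on the (open) set `W` of pairs of a parameter `k` and a point `u`, the maps
`u ↦ F k u` are `n` times differentiable, and their derivatives of order at most `n` are continuous
in `(k, u)` jointly. The parameter space is an arbitrary topological space. -/
def FamC (W : Set (K × E)) : ∀ (_ : ℕ) {V : Type} [NormedAddCommGroup V] [NormedSpace ℝ V]
    (_ : K → E → V), Prop
  | 0, _, _, _, F => ContinuousOn (fun q : K × E => F q.1 q.2) W
  | n + 1, _, _, _, F => ContinuousOn (fun q : K × E => F q.1 q.2) W ∧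
      (∀ q ∈ W, DifferentiableAt ℝ (F q.1) q.2) ∧ FamC W n (fun k u => fderiv ℝ (F k) u)

/-- A continuous family of `C^∞` maps: all derivatives are jointly continuous. -/
def FamS (W : Set (K × E)) (F : K → E → V) : Prop := ∀ n, FamC W n F

variable {W W₂ : Set (K × E)} {n : ℕ} {F G : K → E → V}

theorem FamC.continuousOn (h : FamC W n F) : ContinuousOn (fun q : K × E => F q.1 q.2) W := by
  cases n with
  | zero => exact h
  | succ n => exact h.1

theorem FamC.of_succ (h : FamC W (n + 1) F) : FamC W n F := by
  induction n generalizing V with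
  | zero => exact h.1
  | succ n ih => exact ⟨h.1, h.2.1, ih h.2.2⟩

theorem FamC.mono (h : FamC W n F) (hs : W₂ ⊆ W) : FamC W₂ n F := by
  induction n generalizing V with
  | zero => exact ContinuousOn.mono h hs
  | succ n ih => exact ⟨h.1.mono hs, fun q hq => h.2.1 q (hs hq), ih h.2.2⟩

theorem slice_mem_nhds {X : Type*} [TopologicalSpace X] {W : Set (K × X)} (hW : IsOpen W)
    {q : K × X} (hq : q ∈ W) :
    ∀ᶠ u in 𝓝 q.2, (q.1, u) ∈ W :=
  (Continuous.prodMk_right q.1).continuousAt.eventually (hW.mem_nhds hq)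

theorem FamC.congr (hW : IsOpen W) (h : FamC W n F) (hFG : ∀ q ∈ W, G q.1 q.2 = F q.1 q.2) :
    FamC W n G := by
  induction n generalizing V with
  | zero => exact ContinuousOn.congr h hFG
  | succ n ih =>
    have key : ∀ q ∈ W, G q.1 =ᶠ[𝓝 q.2] F q.1 := fun q hq => by
      filter_upwards [slice_mem_nhds hW hq] with u hu using hFG _ hu
    exact ⟨h.1.congr hFG, fun q hq => (h.2.1 q hq).congr_of_eventuallyEq (key q hq),
      ih h.2.2 fun q hq => (key q hq).fderiv_eq⟩

theorem FamC.add (hF : FamC W n F) (hG : FamC W n G) (hW : IsOpen W) :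
    FamC W n (fun k u => F k u + G k u) := by
  induction n generalizing V with
  | zero => exact ContinuousOn.add hF hG
  | succ n ih =>
    exact ⟨hF.1.add hG.1, fun q hq => (hF.2.1 q hq).add (hG.2.1 q hq),
      (ih hF.2.2 hG.2.2).congr hW fun q hq => fderiv_fun_add (hF.2.1 q hq) (hG.2.1 q hq)⟩

theorem FamC.clm (L : V →L[ℝ] V') (hF : FamC W n F) (hW : IsOpen W) :
    FamC W n (fun k u => L (F k u)) := by
  induction n generalizing V V' with
  | zero => exact L.continuous.comp_continuousOn hF
  | succ n ih =>
    refine ⟨L.continuous.comp_continuousOn hF.1,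
      fun q hq => L.differentiableAt.comp q.2 (hF.2.1 q hq),
      (ih (ContinuousLinearMap.compL ℝ E V V' L) hF.2.2).congr hW fun q hq => ?_⟩
    exact (L.hasFDerivAt.comp q.2 (hF.2.1 q hq).hasFDerivAt).fderiv

theorem FamC.bilin (B : V →L[ℝ] V' →L[ℝ] V'') {G : K → E → V'} (hF : FamC W n F)
    (hG : FamC W n G) (hW : IsOpen W) : FamC W n (fun k u => B (F k u) (G k u)) := by
  induction n generalizing V V' V'' with
  | zero =>
    exact (B.isBoundedBilinearMap.continuous).comp_continuousOn (ContinuousOn.prodMk hF hG)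
  | succ n ih =>
    refine ⟨(B.isBoundedBilinearMap.continuous).comp_continuousOn (hF.1.prodMk hG.1),
      fun q hq => B.differentiableAt.comp q.2 (hF.2.1 q hq) |>.clm_apply (hG.2.1 q hq), ?_⟩
    refine FamC.congr hW (FamC.add (ih (B.precompR E) hF.of_succ hG.2.2)
      (ih (B.precompL E) hF.2.2 hG.of_succ) hW) fun q hq => ?_
    exact B.fderiv_of_bilinear (hF.2.1 q hq) (hG.2.1 q hq)

theorem FamC.prodMk {G : K → E → V'} (hF : FamC W n F) (hG : FamC W n G) (hW : IsOpen W) :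
    FamC W n (fun k u => (F k u, G k u)) := by
  have h1 := FamC.clm (ContinuousLinearMap.inl ℝ V V') hF hW
  have h2 := FamC.clm (ContinuousLinearMap.inr ℝ V V') hG hW
  simpa using FamC.add h1 h2 hW

theorem FamC.comp {G : K → V → V'} {W' : Set (K × V)} (hG : FamC W' n G) (hF : FamC W n F)
    (hW : IsOpen W) (hm : ∀ q ∈ W, (q.1, F q.1 q.2) ∈ W') : FamC W n (fun k u => G k (F k u)) := by
  induction n generalizing V' with
  | zero =>
    exact ContinuousOn.comp (g := fun q : K × V => G q.1 q.2) (t := W')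
      (f := fun q : K × E => (q.1, F q.1 q.2)) hG (continuousOn_fst.prodMk hF) hm
  | succ n ih =>
    refine ⟨ContinuousOn.comp (g := fun q : K × V => G q.1 q.2) (t := W')
      (f := fun q : K × E => (q.1, F q.1 q.2)) hG.1 (continuousOn_fst.prodMk hF.1) hm,
      fun q hq => (hG.2.1 _ (hm q hq)).comp q.2 (hF.2.1 q hq), ?_⟩
    refine FamC.congr hW (FamC.bilin (ContinuousLinearMap.compL ℝ E V V')
      (ih hG.2.2 hF.of_succ) hF.2.2 hW) fun q hq => ?_
    exact fderiv_comp q.2 (hG.2.1 _ (hm q hq)) (hF.2.1 q hq)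

theorem FamC.of_contDiffOn {f : E → V} {U : Set E} (hU : IsOpen U) (hf : ContDiffOn ℝ n f U) :
    FamC (K := K) {q | q.2 ∈ U} n (fun _ u => f u) := by
  induction n generalizing V with
  | zero => exact hf.continuousOn.comp continuousOn_snd fun q hq => hq
  | succ n ih =>
    refine ⟨hf.continuousOn.comp continuousOn_snd fun q hq => hq, fun q hq =>
      (hf.contDiffAt (hU.mem_nhds hq)).differentiableAt (by simp), ih ?_⟩
    exact hf.fderiv_of_isOpen hU (by simp)

theorem FamC.contDiffAt (h : FamC W n F) (hW : IsOpen W) {q : K × E} (hq : q ∈ W) :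
    ContDiffAt ℝ n (F q.1) q.2 := by
  induction n generalizing V with
  | zero =>
    rw [Nat.cast_zero, contDiffAt_zero]
    refine ⟨{u | (q.1, u) ∈ W}, slice_mem_nhds hW hq, ?_⟩
    exact ContinuousOn.comp (g := fun q : K × E => F q.1 q.2) h
      (Continuous.prodMk_right q.1).continuousOn fun u hu => hu
  | succ n ih =>
    rw [Nat.cast_succ, contDiffAt_succ_iff_hasFDerivAt]
    refine ⟨fderiv ℝ (F q.1), ⟨{u | (q.1, u) ∈ W}, slice_mem_nhds hW hq, fun u hu =>
      (h.2.1 (q.1, u) hu).hasFDerivAt⟩, ih h.2.2⟩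

theorem FamC.continuousOn_iteratedFDeriv (h : FamC W n F) :
    ContinuousOn (fun q : K × E => iteratedFDeriv ℝ n (F q.1) q.2) W := by
  induction n generalizing V with
  | zero =>
    have : (fun q : K × E => iteratedFDeriv ℝ 0 (F q.1) q.2) =
      fun q => (continuousMultilinearCurryFin0 ℝ E V).symm (F q.1 q.2) := by
        ext q; simp
    rw [this]
    exact (LinearIsometryEquiv.continuous _).comp_continuousOn h
  | succ n ih =>
    have : (fun q : K × E => iteratedFDeriv ℝ (n + 1) (F q.1) q.2) =
      fun q => (continuousMultilinearCurryRightEquiv' ℝ n E V).symm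
        (iteratedFDeriv ℝ n (fun u => fderiv ℝ (F q.1) u) q.2) := by
        ext q; rw [iteratedFDeriv_succ_eq_comp_right]; rfl
    rw [this]
    exact (LinearIsometryEquiv.continuous _).comp_continuousOn (ih h.2.2)

theorem FamS.of_continuousOn_iteratedFDeriv
    (hd : ∀ q ∈ W, ContDiffAt ℝ ∞ (F q.1) q.2)
    (hc : ∀ n : ℕ, ContinuousOn (fun q : K × E => iteratedFDeriv ℝ n (F q.1) q.2) W) :
    FamS W F := by
  intro m
  have h0 : ∀ {V : Type} [NormedAddCommGroup V] [NormedSpace ℝ V] (F : K → E → V),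
    ContinuousOn (fun q : K × E => iteratedFDeriv ℝ 0 (F q.1) q.2) W →
      ContinuousOn (fun q : K × E => F q.1 q.2) W := by
    intro V _ _ F h
    have : (fun q : K × E => F q.1 q.2) = fun q => (continuousMultilinearCurryFin0 ℝ E V)
      (iteratedFDeriv ℝ 0 (F q.1) q.2) := by ext q; simp
    rw [this]
    exact (LinearIsometryEquiv.continuous _).comp_continuousOn h
  induction m generalizing V with
  | zero => exact h0 F (hc 0)
  | succ m ih =>
    refine ⟨h0 F (hc 0), fun q hq => (hd q hq).differentiableAt (by simp), ih
      (fun q hq => (hd q hq).fderiv_right (m := ∞) (by simp)) fun j => ?_⟩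
    have : (fun q : K × E => iteratedFDeriv ℝ j (fun u => fderiv ℝ (F q.1) u) q.2) =
      fun q => (continuousMultilinearCurryRightEquiv' ℝ j E V)
        (iteratedFDeriv ℝ (j + 1) (F q.1) q.2) := by
        ext q; rw [iteratedFDeriv_succ_eq_comp_right]; simp
    rw [this]
    exact (LinearIsometryEquiv.continuous _).comp_continuousOn (hc (j + 1))

/-! The same closure properties for `FamS`. -/

theorem FamS.continuousOn (h : FamS W F) : ContinuousOn (fun q : K × E => F q.1 q.2) W :=
  (h 0).continuousOn

theorem FamS.mono (h : FamS W F) (hs : W₂ ⊆ W) : FamS W₂ F := fun n => (h n).mono hs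

theorem FamS.congr (hW : IsOpen W) (h : FamS W F) (hFG : ∀ q ∈ W, G q.1 q.2 = F q.1 q.2) :
    FamS W G := fun n => (h n).congr hW hFG

theorem FamS.add (hW : IsOpen W) (hF : FamS W F) (hG : FamS W G) :
    FamS W (fun k u => F k u + G k u) := fun n => (hF n).add (hG n) hW

theorem FamS.bilin (hW : IsOpen W) (B : V →L[ℝ] V' →L[ℝ] V'') {G : K → E → V'} (hF : FamS W F)
    (hG : FamS W G) : FamS W (fun k u => B (F k u) (G k u)) :=
  fun n => (hF n).bilin B (hG n) hW

theorem FamS.prodMk (hW : IsOpen W) {G : K → E → V'} (hF : FamS W F) (hG : FamS W G) :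
    FamS W (fun k u => (F k u, G k u)) := fun n => (hF n).prodMk (hG n) hW

theorem FamS.comp (hW : IsOpen W) {G : K → V → V'} {W' : Set (K × V)} (hG : FamS W' G)
    (hF : FamS W F) (hm : ∀ q ∈ W, (q.1, F q.1 q.2) ∈ W') : FamS W (fun k u => G k (F k u)) :=
  fun n => (hG n).comp (hF n) hW hm

theorem FamS.fderiv (hF : FamS W F) : FamS W (fun k u => fderiv ℝ (F k) u) :=
  fun n => (hF (n + 1)).2.2

theorem FamS.differentiableAt (hF : FamS W F) {q : K × E} (hq : q ∈ W) :
    DifferentiableAt ℝ (F q.1) q.2 := (hF 1).2.1 q hq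

theorem FamS.contDiffAt (hW : IsOpen W) (h : FamS W F) {q : K × E} (hq : q ∈ W) :
    ContDiffAt ℝ ∞ (F q.1) q.2 :=
  contDiffAt_infty.2 fun n => (h n).contDiffAt hW hq

theorem FamS.of_contDiffOn {f : E → V} {U : Set E} (hU : IsOpen U) (hf : ContDiffOn ℝ ∞ f U) :
    FamS (K := K) {q | q.2 ∈ U} (fun _ u => f u) :=
  fun _ => FamC.of_contDiffOn hU (hf.of_le (mod_cast le_top))

theorem FamS.id : FamS W (fun _ u => u) :=
  (FamS.of_contDiffOn isOpen_univ contDiffOn_id).mono fun _ _ => mem_univ _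

theorem FamS.param {p : K → V} (hp : Continuous p) : FamS W (fun k _ => p k) := by
  have h0 : ∀ {V : Type} [NormedAddCommGroup V] [NormedSpace ℝ V] (n : ℕ) (p : K → V),
      Continuous p → FamC W n (fun k _ => p k) := by
    intro V _ _ n
    induction n generalizing V with
    | zero => intro p hp; exact (hp.comp continuous_fst).continuousOn
    | succ _ ih =>
      intro p hp
      refine ⟨(hp.comp continuous_fst).continuousOn, fun q _ => differentiableAt_const _, ?_⟩
      have : (fun (k : K) (u : E) => _root_.fderiv ℝ (fun _ : E => p k) u) =
        fun (k : K) (_ : E) => (0 : E →L[ℝ] V) := by ext; simp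
      rw [this]
      exact ih _ continuous_const
  exact fun n => h0 n p hp

/-- Post-composition of a family with a fixed smooth map. -/
theorem FamS.comp_contDiffOn (hW : IsOpen W) {f : V → V'} {U : Set V} (hU : IsOpen U)
    (hf : ContDiffOn ℝ ∞ f U) (hF : FamS W F) (hm : ∀ q ∈ W, F q.1 q.2 ∈ U) :
    FamS W (fun k u => f (F k u)) :=
  FamS.comp hW (G := fun _ v => f v) (FamS.of_contDiffOn hU hf) hF hm

/-- A map that is smooth in a point and a parameter of a normed space, with the parameter depending
continuously on `k`, is a continuous family of smooth maps. -/
theorem FamS.of_contDiffOn_param {P : Type} [NormedAddCommGroup P] [NormedSpace ℝ P] {p : K → P}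
    (hp : Continuous p) (hW : IsOpen W) {f : P × E → V} {U : Set (P × E)} (hU : IsOpen U)
    (hf : ContDiffOn ℝ ∞ f U) (hm : ∀ q ∈ W, (p q.1, q.2) ∈ U) :
    FamS W (fun k u => f (p k, u)) :=
  FamS.comp_contDiffOn hW (F := fun k u => (p k, u)) hU hf ((FamS.param hp).prodMk hW FamS.id) hm

end Families

/-! ### The contact condition in coordinates -/

section Wedge

variable {F : Type} [NormedAddCommGroup F] [NormedSpace ℝ F]

/-- The value of `α ∧ β` on three vectors, where `α` is a covector and `β` is the antisymmetrization
of the bilinear form `B`. For `α = a u` and `B = da(u)` (the Fréchet derivative), this is `a ∧ da`. -/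
def wedge (α : F →L[ℝ] ℝ) (B : F →L[ℝ] F →L[ℝ] ℝ) (v₁ v₂ v₃ : F) : ℝ :=
  α v₁ * (B v₂ v₃ - B v₃ v₂) + α v₂ * (B v₃ v₁ - B v₁ v₃) + α v₃ * (B v₁ v₂ - B v₂ v₁)

/-- The standard basis of `ℝ³`. -/
def stdE (i : Fin 3) : E3 := EuclideanSpace.single i 1

/-- The coefficient of `a ∧ da` with respect to the standard volume form of `ℝ³`. -/
def contactVol (a : E3 → E3 →L[ℝ] ℝ) (u : E3) : ℝ :=
  wedge (a u) (fderiv ℝ a u) (stdE 0) (stdE 1) (stdE 2)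

theorem sum_stdE (v : E3) : v = v 0 • stdE 0 + v 1 • stdE 1 + v 2 • stdE 2 := by
  ext i; fin_cases i <;> simp [stdE]

theorem det_eq_coords (M : E3 →L[ℝ] E3) : LinearMap.det (M : E3 →ₗ[ℝ] E3) =
    M (stdE 0) 0 * M (stdE 1) 1 * M (stdE 2) 2 - M (stdE 0) 0 * M (stdE 2) 1 * M (stdE 1) 2
    - M (stdE 1) 0 * M (stdE 0) 1 * M (stdE 2) 2 + M (stdE 1) 0 * M (stdE 2) 1 * M (stdE 0) 2
    + M (stdE 2) 0 * M (stdE 0) 1 * M (stdE 1) 2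
    - M (stdE 2) 0 * M (stdE 1) 1 * M (stdE 0) 2 := by
  rw [← LinearMap.det_toMatrix (EuclideanSpace.basisFun (Fin 3) ℝ).toBasis, Matrix.det_fin_three]
  simp [LinearMap.toMatrix_apply, stdE]

theorem wedge_map (α : E3 →L[ℝ] ℝ) (B : E3 →L[ℝ] E3 →L[ℝ] ℝ) (M : E3 →L[ℝ] E3) :
    wedge α B (M (stdE 0)) (M (stdE 1)) (M (stdE 2)) =
      LinearMap.det (M : E3 →ₗ[ℝ] E3) * wedge α B (stdE 0) (stdE 1) (stdE 2) := by
  rw [det_eq_coords]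
  rw [sum_stdE (M (stdE 0)), sum_stdE (M (stdE 1)), sum_stdE (M (stdE 2))]
  generalize M (stdE 0) = x
  generalize M (stdE 1) = y
  generalize M (stdE 2) = z
  have h : ∀ w : E3, (w 0 • stdE 0 + w 1 • stdE 1 + w 2 • stdE 2 : E3) = w :=
    fun w => (sum_stdE w).symm
  simp only [h]
  simp only [wedge]
  have hα : ∀ w : E3, α w = w 0 * α (stdE 0) + w 1 * α (stdE 1) + w 2 * α (stdE 2) := fun w => by
    conv_lhs => rw [sum_stdE w]
    simp
  have hB : ∀ v w : E3, B v w = v 0 * B (stdE 0) w + v 1 * B (stdE 1) w + v 2 * B (stdE 2) w :=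
    fun v w => by
      conv_lhs => rw [sum_stdE v]
      simp
  have hB' : ∀ v w : E3, B v w = w 0 * B v (stdE 0) + w 1 * B v (stdE 1) + w 2 * B v (stdE 2) :=
    fun v w => by
      conv_lhs => rw [sum_stdE w]
      simp
  rw [hα x, hα y, hα z, hB y z, hB z y, hB z x, hB x z, hB x y, hB y x]
  simp only [hB' _ x, hB' _ y, hB' _ z]
  ring

theorem wedge_eq_det (α : E3 →L[ℝ] ℝ) (B : E3 →L[ℝ] E3 →L[ℝ] ℝ) (x y z : E3) :
    ∃ c : ℝ, wedge α B x y z = c * wedge α B (stdE 0) (stdE 1) (stdE 2) := by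
  let M : E3 →ₗ[ℝ] E3 := (EuclideanSpace.basisFun (Fin 3) ℝ).toBasis.constr ℝ ![x, y, z]
  have hM : ∀ i, M (stdE i) = ![x, y, z] i := fun i => by
    rw [show stdE i = (EuclideanSpace.basisFun (Fin 3) ℝ).toBasis i by simp [stdE]]
    exact (EuclideanSpace.basisFun (Fin 3) ℝ).toBasis.constr_basis ℝ ![x, y, z] i
  have := wedge_map α B M.toContinuousLinearMap
  change wedge α B (M (stdE 0)) (M (stdE 1)) (M (stdE 2)) = _ at this
  rw [hM 0, hM 1, hM 2] at this
  exact ⟨_, this⟩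

theorem exists_wedgeD_ne_zero_iff {a : E3 → E3 →L[ℝ] ℝ} {u : E3} :
    (∃ v₁ v₂ v₃ : E3, wedgeD a u v₁ v₂ v₃ ≠ 0) ↔ contactVol a u ≠ 0 := by
  constructor
  · rintro ⟨v₁, v₂, v₃, h⟩ h0
    obtain ⟨c, hc⟩ := wedge_eq_det (a u) (fderiv ℝ a u) v₁ v₂ v₃
    apply h
    change wedge (a u) (fderiv ℝ a u) v₁ v₂ v₃ = 0
    rw [hc]
    change c * contactVol a u = 0
    rw [h0, mul_zero]
  · intro h
    exact ⟨_, _, _, h⟩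

theorem contactVol_ne_zero_imp {a : E3 → E3 →L[ℝ] ℝ} {u : E3} (h : contactVol a u ≠ 0) :
    a u ≠ 0 := by
  intro h0
  apply h
  simp [contactVol, wedge, h0]

theorem contactVol_congr {a b : E3 → E3 →L[ℝ] ℝ} {u : E3} (h : a =ᶠ[𝓝 u] b) :
    contactVol a u = contactVol b u := by
  rw [contactVol, contactVol, h.eq_of_nhds, h.fderiv_eq]

theorem contactVol_smul {f : E3 → ℝ} {a : E3 → E3 →L[ℝ] ℝ} {u : E3} (hf : DifferentiableAt ℝ f u)
    (ha : DifferentiableAt ℝ a u) :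
    contactVol (fun x => f x • a x) u = f u ^ 2 * contactVol a u := by
  simp only [contactVol, wedge]
  rw [fderiv_fun_smul hf ha]
  simp
  ring

theorem wedge_pullback {E : Type} [NormedAddCommGroup E] [NormedSpace ℝ E]
    {a : F → F →L[ℝ] ℝ} {ψ : E → F} {u : E} (ha : DifferentiableAt ℝ a (ψ u))
    (hψ : ContDiffAt ℝ 2 ψ u) (v₁ v₂ v₃ : E) :
    wedge ((a (ψ u)).comp (fderiv ℝ ψ u)) (fderiv ℝ (fun x => (a (ψ x)).comp (fderiv ℝ ψ x)) u)
      v₁ v₂ v₃ =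
    wedge (a (ψ u)) (fderiv ℝ a (ψ u)) (fderiv ℝ ψ u v₁) (fderiv ℝ ψ u v₂) (fderiv ℝ ψ u v₃) := by
  have hψ1 : DifferentiableAt ℝ ψ u := hψ.differentiableAt (by norm_num)
  have hψ2 : DifferentiableAt ℝ (fderiv ℝ ψ) u :=
    (hψ.fderiv_right (m := 1) (by norm_num)).differentiableAt (by norm_num)
  have haψ : DifferentiableAt ℝ (fun x => a (ψ x)) u := ha.comp u hψ1
  have hsymm : IsSymmSndFDerivAt ℝ ψ u := hψ.isSymmSndFDerivAt (by simp)
  have hd : ∀ v w, fderiv ℝ (fun x => (a (ψ x)).comp (fderiv ℝ ψ x)) u v w =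
      a (ψ u) (fderiv ℝ (fderiv ℝ ψ) u v w) +
        fderiv ℝ a (ψ u) (fderiv ℝ ψ u v) (fderiv ℝ ψ u w) := by
    intro v w
    rw [fderiv_clm_comp haψ hψ2]
    have : fderiv ℝ (fun x => a (ψ x)) u = (fderiv ℝ a (ψ u)).comp (fderiv ℝ ψ u) :=
      (ha.hasFDerivAt.comp u hψ1.hasFDerivAt).fderiv
    rw [this]
    simp
  simp only [wedge, hd, ContinuousLinearMap.comp_apply]
  rw [hsymm v₂ v₃, hsymm v₃ v₁, hsymm v₁ v₂]
  ring

theorem contactVol_pullback {a : E3 → E3 →L[ℝ] ℝ} {ψ : E3 → E3} {u : E3}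
    (ha : DifferentiableAt ℝ a (ψ u)) (hψ : ContDiffAt ℝ 2 ψ u) :
    contactVol (fun x => (a (ψ x)).comp (fderiv ℝ ψ x)) u =
      LinearMap.det (fderiv ℝ ψ u : E3 →ₗ[ℝ] E3) * contactVol a (ψ u) := by
  rw [contactVol, wedge_pullback ha hψ, wedge_map]
  rfl

theorem det_ne_zero_of_injective {M : E3 →L[ℝ] E3} (hM : Function.Injective M) :
    LinearMap.det (M : E3 →ₗ[ℝ] E3) ≠ 0 := by
  have hb : Function.Bijective (M : E3 →ₗ[ℝ] E3) :=
    ⟨hM, (LinearMap.injective_iff_surjective (f := (M : E3 →ₗ[ℝ] E3))).1 hM⟩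
  exact (LinearEquiv.isUnit_det' (LinearEquiv.ofBijective (M : E3 →ₗ[ℝ] E3) hb)).ne_zero

end Wedge

/-! ### Continuous families of contact structures in coordinates -/

section HalfFam

variable {K : Type*} [TopologicalSpace K]

/-- The family `h` of fields of half-spaces is, near `q`, a continuous family of co-oriented contact
structures: it is the positive side of a continuous family of smooth contact forms. -/
def HalfFam (h : K → E3 → Set E3) (q : K × E3) : Prop :=
  ∃ (W : Set (K × E3)) (a : K → E3 → E3 →L[ℝ] ℝ), IsOpen W ∧ q ∈ W ∧ FamS W a ∧
    ∀ p ∈ W, contactVol (a p.1) p.2 ≠ 0 ∧ h p.1 p.2 = {v | 0 < a p.1 p.2 v}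

theorem HalfFam.congr {h h' : K → E3 → Set E3} {q : K × E3} (H : HalfFam h q)
    (e : ∀ᶠ p in 𝓝 q, h' p.1 p.2 = h p.1 p.2) : HalfFam h' q := by
  obtain ⟨W, a, hW, hq, ha, H⟩ := H
  obtain ⟨W', hW', hW'o, hq'⟩ := _root_.eventually_nhds_iff.1 e
  refine ⟨W ∩ W', a, hW.inter hW'o, ⟨hq, hq'⟩, ha.mono inter_subset_left, fun p hp => ?_⟩
  rw [hW' p hp.2]
  exact H p hp.1

theorem HalfFam.pullback {h : K → E3 → Set E3} {q : K × E3} {ψ : K → E3 → E3} {W : Set (K × E3)}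
    (hW : IsOpen W) (hq : q ∈ W) (hψ : FamS W ψ)
    (hinj : ∀ p ∈ W, Function.Injective (fderiv ℝ (ψ p.1) p.2))
    (H : HalfFam h (q.1, ψ q.1 q.2)) :
    HalfFam (fun k u => fderiv ℝ (ψ k) u ⁻¹' h k (ψ k u)) q := by
  obtain ⟨W', a, hW', hq', ha, H⟩ := H
  set W₁ : Set (K × E3) := W ∩ {p | (p.1, ψ p.1 p.2) ∈ W'} with hW₁
  have ho : IsOpen W₁ :=
    ContinuousOn.isOpen_inter_preimage (f := fun p : K × E3 => (p.1, ψ p.1 p.2))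
      (continuousOn_fst.prodMk hψ.continuousOn) hW hW'
  refine ⟨W₁, fun k u => (a k (ψ k u)).comp (fderiv ℝ (ψ k) u), ho, ⟨hq, hq'⟩, ?_, ?_⟩
  · have h1 : FamS W₁ (fun k u => a k (ψ k u)) :=
      ha.comp ho (hψ.mono inter_subset_left) fun p hp => hp.2
    exact h1.bilin ho (ContinuousLinearMap.compL ℝ E3 E3 ℝ)
      (hψ.fderiv.mono inter_subset_left)
  · intro p hp
    obtain ⟨h1, h2⟩ := H _ hp.2
    constructor
    · rw [contactVol_pullback (ha.differentiableAt hp.2)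
        ((hψ.contDiffAt hW hp.1).of_le (by norm_cast))]
      exact mul_ne_zero (det_ne_zero_of_injective (hinj p hp.1)) h1
    · ext v
      simp only at h2
      simp only [mem_preimage, h2, mem_ofPred_eq, ContinuousLinearMap.comp_apply]

/-- The covector `⟪n, ·⟫`. -/
abbrev covec (n : E3) : E3 →L[ℝ] ℝ := innerSL ℝ n

theorem unitNormal_covector {ℓ : E3 →L[ℝ] ℝ} (hℓ : ℓ ≠ 0) :
    unitNormal {v | 0 < ℓ v} =
      ‖(InnerProductSpace.toDual ℝ E3).symm ℓ‖⁻¹ • (InnerProductSpace.toDual ℝ E3).symm ℓ :=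
  unitNormal_eq (by simpa using hℓ) (by
    ext v
    simp only [mem_ofPred_eq]
    rw [InnerProductSpace.toDual_symm_apply])

theorem contactVol_normal {h : E3 → Set E3} {a : E3 → E3 →L[ℝ] ℝ} {u : E3}
    (ha : DifferentiableAt ℝ a u) (h0 : a u ≠ 0) (H : ∀ᶠ x in 𝓝 u, h x = {v | 0 < a x v}) :
    contactVol (fun x => covec (unitNormal (h x))) u = ‖a u‖⁻¹ ^ 2 * contactVol a u := by
  have hne : ∀ᶠ x in 𝓝 u, a x ≠ 0 := ha.continuousAt.eventually_ne h0
  have : (fun x => covec (unitNormal (h x))) =ᶠ[𝓝 u] fun x => ‖a x‖⁻¹ • a x := by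
    filter_upwards [H, hne] with x hx hx0
    rw [hx, unitNormal_covector hx0]
    ext v
    simp [InnerProductSpace.toDual_symm_apply]
  rw [contactVol_congr this, contactVol_smul (f := fun x => ‖a x‖⁻¹) _ ha]
  have h1 : DifferentiableAt ℝ (fun x => ‖(InnerProductSpace.toDual ℝ E3).symm (a x)‖) u := by
    refine DifferentiableAt.norm ℝ ?_ (by simpa using h0)
    exact (InnerProductSpace.toDual ℝ E3).symm.toContinuousLinearEquiv.differentiableAt.comp u ha
  have h2 : (fun x => ‖(InnerProductSpace.toDual ℝ E3).symm (a x)‖) = fun x => ‖a x‖ := by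
    ext x; simp
  rw [h2] at h1
  exact h1.inv (by simpa using h0)

/-- A continuous family of contact structures is described by its unit normals. -/
theorem HalfFam.normal {h : K → E3 → Set E3} {q : K × E3} (H : HalfFam h q) :
    ∃ W : Set (K × E3), IsOpen W ∧ q ∈ W ∧ FamS W (fun k u => unitNormal (h k u)) ∧
      ∀ p ∈ W, IsHalfSpace (h p.1 p.2) ∧
        contactVol (fun u => covec (unitNormal (h p.1 u))) p.2 ≠ 0 := by
  obtain ⟨W, a, hW, hq, ha, H⟩ := H
  have hne : ∀ p ∈ W, a p.1 p.2 ≠ 0 := fun p hp => contactVol_ne_zero_imp (H p hp).1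
  refine ⟨W, hW, hq, ?_, fun p hp => ⟨?_, ?_⟩⟩
  · have h1 : FamS W (fun k u => (InnerProductSpace.toDual ℝ E3).symm (a k u)) :=
      FamS.comp_contDiffOn hW (f := (InnerProductSpace.toDual ℝ E3).symm) isOpen_univ
        (InnerProductSpace.toDual ℝ E3).symm.contDiff.contDiffOn ha fun _ _ => mem_univ _
    have h2 : FamS W (fun k u => ‖(InnerProductSpace.toDual ℝ E3).symm (a k u)‖⁻¹ •
        (InnerProductSpace.toDual ℝ E3).symm (a k u)) := by
      refine FamS.comp_contDiffOn hW (f := fun v : E3 => ‖v‖⁻¹ • v) (U := {0}ᶜ)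
        isOpen_compl_singleton ?_ h1 fun p hp => by simpa using hne p hp
      intro v hv
      have hv' : v ≠ 0 := hv
      exact (((contDiffAt_norm ℝ hv').inv (by simpa using hv')).smul
        contDiffAt_id).contDiffWithinAt
    refine h2.congr hW fun p hp => ?_
    rw [(H p hp).2, unitNormal_covector (hne p hp)]
  · rw [(H p hp).2]
    exact isHalfSpace_of_covector (hne p hp)
  · rw [contactVol_normal (ha.differentiableAt hp) (hne p hp)]
    · exact mul_ne_zero (by simpa using hne p hp) (H p hp).1
    · filter_upwards [slice_mem_nhds hW hp] with x hx using (H _ hx).2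

theorem setOf_covec_unitNormal {H : Set E3} (h : IsHalfSpace H) :
    H = {v | 0 < covec (unitNormal H) v} := by
  ext v
  simp [mem_iff_inner_unitNormal h v]

end HalfFam

/-! ### Plane fields in local parametrizations of a manifold -/

section Param

variable {Y : Type*} [TopologicalSpace Y] [ChartedSpace E3 Y]

/-- The pull-back at `u` of a field of half-spaces on `Y` under a map `ψ : ℝ³ → Y`. -/
def pb (ψ : E3 → Y) (P : ∀ p : Y, Set (TangentSpace (𝓡 3) p)) (u : E3) : Set E3 :=
  {v | mfderiv (𝓡 3) (𝓡 3) ψ u v ∈ P (ψ u)}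

theorem mem_congr_point (P : ∀ p : Y, Set (TangentSpace (𝓡 3) p)) {p q : Y} (h : p = q) {v w : E3}
    (hvw : v = w) : ((v : TangentSpace (𝓡 3) p) ∈ P p) = ((w : TangentSpace (𝓡 3) q) ∈ P q) := by
  subst h; subst hvw; rfl

theorem pb_congr {ψ ψ' : E3 → Y} {u : E3} (h : ψ =ᶠ[𝓝 u] ψ')
    (P : ∀ p : Y, Set (TangentSpace (𝓡 3) p)) : pb ψ P u = pb ψ' P u := by
  ext v
  refine iff_of_eq (mem_congr_point P h.eq_of_nhds ?_)
  rw [h.mfderiv_eq]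
  rfl

theorem pb_congr_field {ψ : E3 → Y} {u : E3} {P P' : ∀ p : Y, Set (TangentSpace (𝓡 3) p)}
    (h : P (ψ u) = P' (ψ u)) : pb ψ P u = pb ψ P' u := by
  simp only [pb, h]

theorem pb_comp {ψ : E3 → Y} {τ : E3 → E3} {u : E3}
    (hψ : MDifferentiableAt (𝓡 3) (𝓡 3) ψ (τ u)) (hτ : DifferentiableAt ℝ τ u)
    (P : ∀ p : Y, Set (TangentSpace (𝓡 3) p)) :
    pb (ψ ∘ τ) P u = fderiv ℝ τ u ⁻¹' pb ψ P (τ u) := by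
  ext v
  simp only [pb, mem_ofPred_eq, mem_preimage]
  rw [mfderiv_comp u hψ hτ.mdifferentiableAt, mfderiv_eq_fderiv]
  rfl

theorem surjective_of_injective {L : E3 →L[ℝ] E3} (h : Function.Injective L) :
    Function.Surjective L := by
  have h' : Function.Injective (L : E3 →ₗ[ℝ] E3) := h
  exact LinearMap.injective_iff_surjective.1 h'

/-- `ψ` is a smooth immersion (i.e. a local diffeomorphism) on the open set `U ⊆ ℝ³`. -/
structure ImmOn (ψ : E3 → Y) (U : Set E3) : Prop where
  isOpen : IsOpen U
  contMDiffOn : ContMDiffOn (𝓡 3) (𝓡 3) ∞ ψ U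
  injective : ∀ u ∈ U, Function.Injective (mfderiv (𝓡 3) (𝓡 3) ψ u)

theorem ImmOn.contMDiffAt {ψ : E3 → Y} {U : Set E3} (h : ImmOn ψ U) {u : E3} (hu : u ∈ U) :
    ContMDiffAt (𝓡 3) (𝓡 3) ∞ ψ u := h.contMDiffOn.contMDiffAt (h.isOpen.mem_nhds hu)

theorem ImmOn.mdifferentiableAt {ψ : E3 → Y} {U : Set E3} (h : ImmOn ψ U) {u : E3} (hu : u ∈ U) :
    MDifferentiableAt (𝓡 3) (𝓡 3) ψ u := (h.contMDiffAt hu).mdifferentiableAt (by simp)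

theorem ImmOn.mono {ψ : E3 → Y} {U V : Set E3} (h : ImmOn ψ U) (hV : IsOpen V) (hVU : V ⊆ U) :
    ImmOn ψ V :=
  ⟨hV, h.contMDiffOn.mono hVU, fun u hu => h.injective u (hVU hu)⟩

theorem ImmOn.congr {ψ ψ' : E3 → Y} {U : Set E3} (h : ImmOn ψ U) (e : ∀ u ∈ U, ψ' u = ψ u) :
    ImmOn ψ' U := by
  refine ⟨h.isOpen, h.contMDiffOn.congr e, fun u hu => ?_⟩
  have : ψ' =ᶠ[𝓝 u] ψ := by filter_upwards [h.isOpen.mem_nhds hu] with x hx using e x hx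
  rw [this.mfderiv_eq]
  exact h.injective u hu

theorem ImmOn.comp {ψ : E3 → Y} {U : Set E3} (h : ImmOn ψ U) {τ : E3 → E3} {V : Set E3}
    (hV : IsOpen V) (hτ : ContDiffOn ℝ ∞ τ V)
    (hinj : ∀ u ∈ V, Function.Injective (fderiv ℝ τ u)) (hm : MapsTo τ V U) :
    ImmOn (ψ ∘ τ) V := by
  refine ⟨hV, h.contMDiffOn.comp hτ.contMDiffOn hm, fun u hu => ?_⟩
  have hd : DifferentiableAt ℝ τ u :=
    (hτ.contDiffAt (hV.mem_nhds hu)).differentiableAt (by simp)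
  rw [mfderiv_comp u (h.mdifferentiableAt (hm hu)) hd.mdifferentiableAt, mfderiv_eq_fderiv]
  exact (h.injective _ (hm hu)).comp (hinj u hu)

theorem ImmOn.surjective {ψ : E3 → Y} {U : Set E3} (h : ImmOn ψ U) {u : E3} (hu : u ∈ U) :
    Function.Surjective (mfderiv (𝓡 3) (𝓡 3) ψ u) := by
  exact surjective_of_injective (L := (mfderiv (𝓡 3) (𝓡 3) ψ u : E3 →L[ℝ] E3)) (h.injective u hu)

theorem chartNormal_eq (η : ContactStructure Y) (p₀ : Y) (u : E3) :
    η.chartNormal p₀ u = unitNormal (pb (chartAt E3 p₀).symm η.pos u) := rfl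

theorem ContactStructure.halfFam_chart (η : ContactStructure Y) (p₀ : Y) {u : E3}
    (hu : u ∈ (chartAt E3 p₀).target) :
    HalfFam (fun _ : Unit => pb (chartAt E3 p₀).symm η.pos) ((), u) := by
  obtain ⟨a, ha, H⟩ := η.locally_contact p₀
  refine ⟨{q | q.2 ∈ (chartAt E3 p₀).target}, fun _ => a,
    (chartAt E3 p₀).open_target.preimage continuous_snd, hu,
    FamS.of_contDiffOn (chartAt E3 p₀).open_target ha, fun p hp => ⟨?_, ?_⟩⟩
  · exact exists_wedgeD_ne_zero_iff.1 (H _ hp).1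
  · ext v
    exact (H _ hp).2 v

variable {K : Type*} [TopologicalSpace K]

/-- A continuous family of contact structures is, in the charts of the manifold, a continuous family
of contact structures in coordinates. -/
theorem halfFam_chart {η : K → ContactStructure Y} (hη : Continuous η) (p₀ : Y) {k : K} {u : E3}
    (hu : u ∈ (chartAt E3 p₀).target) :
    HalfFam (fun k => pb (chartAt E3 p₀).symm (η k).pos) (k, u) := by
  set T := (chartAt E3 p₀).target with hT
  have hTo : IsOpen T := (chartAt E3 p₀).open_target
  have hW : IsOpen {q : K × E3 | q.2 ∈ T} := hTo.preimage continuous_snd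
  have hcd : ∀ k, ∀ x ∈ T, ContDiffAt ℝ ∞ ((η k).chartNormal p₀) x := fun k x hx => by
    obtain ⟨W, hWo, hxW, hF, -⟩ := ((η k).halfFam_chart p₀ hx).normal
    exact hF.contDiffAt hWo hxW
  refine ⟨{q | q.2 ∈ T}, fun k u => covec ((η k).chartNormal p₀ u), hW, hu, ?_, fun p hp => ?_⟩
  · have h1 : FamS {q : K × E3 | q.2 ∈ T} (fun k => (η k).chartNormal p₀) := by
      apply FamS.of_continuousOn_iteratedFDeriv
      · intro q hq
        exact hcd _ _ hq
      · intro n q hq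
        -- the topology on contact structures is induced by the derivatives of the normal field,
        -- with uniform convergence on compact sets; evaluation at a point is continuous for it
        have hc : Continuous (fun k => UniformOnFun.ofFun {C : Set E3 | IsCompact C ∧ C ⊆ T}
            (iteratedFDeriv ℝ n ((η k).chartNormal p₀))) := by
          have h2 : Continuous (fun ξ : ContactStructure Y =>
              UniformOnFun.ofFun {C : Set E3 | IsCompact C ∧ C ⊆ (chartAt E3 p₀).target}
                (iteratedFDeriv ℝ n (ξ.chartNormal p₀))) := by
            rw [continuous_iff_le_induced]
            exact le_trans (iInf_le _ p₀) (iInf_le _ n)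
          exact h2.comp hη
        have hV : ∃ V ∈ {C : Set E3 | IsCompact C ∧ C ⊆ T}, V ∈ 𝓝 q.2 := by
          obtain ⟨V, hV, hVT, hVc⟩ := local_compact_nhds (hTo.mem_nhds hq)
          exact ⟨V, ⟨hVc, hVT⟩, hV⟩
        have hcont : ContinuousAt (iteratedFDeriv ℝ n ((η q.1).chartNormal p₀)) q.2 :=
          ((hcd q.1 q.2 hq).iteratedFDeriv_right (m := 0) (i := n)
            (by simp; exact_mod_cast le_top)).continuousAt
        have h3 := UniformOnFun.continuousAt_eval₂ (𝔖 := {C : Set E3 | IsCompact C ∧ C ⊆ T})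
          (f := UniformOnFun.ofFun {C : Set E3 | IsCompact C ∧ C ⊆ T}
            (iteratedFDeriv ℝ n ((η q.1).chartNormal p₀))) (x := q.2) hV hcont
        have h4 : ContinuousAt (fun q : K × E3 => (UniformOnFun.ofFun
            {C : Set E3 | IsCompact C ∧ C ⊆ T}
            (iteratedFDeriv ℝ n ((η q.1).chartNormal p₀)), q.2)) q :=
          ((hc.comp continuous_fst).prodMk continuous_snd).continuousAt
        exact (ContinuousAt.comp (f := fun q : K × E3 => (UniformOnFun.ofFun
            {C : Set E3 | IsCompact C ∧ C ⊆ T}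
            (iteratedFDeriv ℝ n ((η q.1).chartNormal p₀)), q.2)) h3 h4).continuousWithinAt
    exact h1.comp_contDiffOn hW (f := covec) isOpen_univ
      (ContinuousLinearMap.contDiff (innerSL ℝ)).contDiffOn fun _ _ => mem_univ _
  · obtain ⟨W, hWo, hxW, -, H⟩ := ((η p.1).halfFam_chart p₀ hp).normal
    exact ⟨(H _ hxW).2, setOf_covec_unitNormal (H _ hxW).1⟩

variable [IsManifold (𝓡 3) ∞ Y]

theorem immOn_chart_symm (p₀ : Y) : ImmOn (chartAt E3 p₀).symm (chartAt E3 p₀).target := by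
  have : IsManifold (𝓡 3) 1 Y := IsManifold.of_le (n := ∞) (by simp)
  refine ⟨(chartAt E3 p₀).open_target, contMDiffOn_chart_symm, fun u hu => ?_⟩
  exact (mdifferentiable_chart (I := 𝓡 3) p₀).symm.mfderiv_injective hu

theorem ImmOn.chart_comp {ψ : E3 → Y} {U : Set E3} (h : ImmOn ψ U) (p₀ : Y) :
    ∃ V : Set E3, IsOpen V ∧ V ⊆ U ∧ (∀ u ∈ U, ψ u ∈ (chartAt E3 p₀).source → u ∈ V) ∧
      (∀ u ∈ V, ψ u ∈ (chartAt E3 p₀).source) ∧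
      ContDiffOn ℝ ∞ (chartAt E3 p₀ ∘ ψ) V ∧
      ∀ u ∈ V, Function.Injective (fderiv ℝ (chartAt E3 p₀ ∘ ψ) u) := by
  have : IsManifold (𝓡 3) 1 Y := IsManifold.of_le (n := ∞) (by simp)
  have hV : IsOpen (U ∩ ψ ⁻¹' (chartAt E3 p₀).source) :=
    h.contMDiffOn.continuousOn.isOpen_inter_preimage h.isOpen (chartAt E3 p₀).open_source
  refine ⟨U ∩ ψ ⁻¹' (chartAt E3 p₀).source, hV, inter_subset_left, fun u hu hs => ⟨hu, hs⟩,
    fun u hu => hu.2, ?_, fun u hu => ?_⟩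
  · rw [← contMDiffOn_iff_contDiffOn]
    exact (contMDiffOn_chart (I := 𝓡 3) (n := ∞)).comp (h.contMDiffOn.mono inter_subset_left)
      fun u hu => hu.2
  · have hc := (mdifferentiable_chart (I := 𝓡 3) p₀)
    have := mfderiv_comp u (hc.mdifferentiableAt hu.2) (h.mdifferentiableAt hu.1)
    rw [← mfderiv_eq_fderiv, this]
    exact (hc.mfderiv_injective hu.2).comp (h.injective u hu.1)

/-- The inverse function theorem for immersions of an open subset of `ℝ³` into `ℝ³`. -/
theorem exists_local_inverse {θ : E3 → E3} {V : Set E3} (hV : IsOpen V)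
    (hθ : ContDiffOn ℝ ∞ θ V) (hinj : ∀ u ∈ V, Function.Injective (fderiv ℝ θ u)) {u : E3}
    (hu : u ∈ V) : ∃ (τ : E3 → E3) (T : Set E3), IsOpen T ∧ θ u ∈ T ∧ ContDiffOn ℝ ∞ τ T ∧
      MapsTo τ T V ∧ τ (θ u) = u ∧ ∀ y ∈ T, θ (τ y) = y := by
  have heq : ∀ x ∈ V, ∃ L : E3 ≃L[ℝ] E3, (L : E3 →L[ℝ] E3) = fderiv ℝ θ x := fun x hx => by
    have hb : Function.Bijective ((fderiv ℝ θ x : E3 →L[ℝ] E3) : E3 →ₗ[ℝ] E3) :=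
      ⟨hinj x hx, LinearMap.injective_iff_surjective.1 (hinj x hx)⟩
    refine ⟨(LinearEquiv.ofBijective _ hb).toContinuousLinearEquiv, ?_⟩
    ext v
    rfl
  have hca : ∀ x ∈ V, ContDiffAt ℝ ∞ θ x := fun x hx => hθ.contDiffAt (hV.mem_nhds hx)
  have hd : ∀ x ∈ V, DifferentiableAt ℝ θ x := fun x hx => (hca x hx).differentiableAt (by simp)
  obtain ⟨L, hL⟩ := heq u hu
  have hL' : HasFDerivAt θ (L : E3 →L[ℝ] E3) u := by rw [hL]; exact (hd u hu).hasFDerivAt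
  let e := (hca u hu).toOpenPartialHomeomorph θ hL' (by simp)
  have hes : u ∈ e.source := (hca u hu).mem_toOpenPartialHomeomorph_source hL' (by simp)
  refine ⟨e.symm, e.target ∩ e.symm ⁻¹' V, e.isOpen_inter_preimage_symm hV, ?_, ?_,
    fun y hy => hy.2, e.left_inv hes, fun y hy => e.right_inv hy.1⟩
  · refine ⟨e.map_source hes, ?_⟩
    change e.symm (e u) ∈ V
    rwa [e.left_inv hes]
  · intro y hy
    obtain ⟨L', hL'⟩ := heq _ hy.2
    refine (e.contDiffAt_symm hy.1 (f₀' := L') ?_ (hca _ hy.2)).contDiffWithinAt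
    rw [hL']
    exact (hd _ hy.2).hasFDerivAt

/-- Two local parametrizations of a manifold differ by a change of coordinates. -/
theorem ImmOn.exists_transition {ψ ψ' : E3 → Y} {U U' : Set E3} (h : ImmOn ψ U) (h' : ImmOn ψ' U')
    {u u' : E3} (hu : u ∈ U) (hu' : u' ∈ U') (huu : ψ u = ψ' u') :
    ∃ (τ : E3 → E3) (T : Set E3), IsOpen T ∧ u' ∈ T ∧ T ⊆ U' ∧ ContDiffOn ℝ ∞ τ T ∧
      (∀ x ∈ T, Function.Injective (fderiv ℝ τ x)) ∧ MapsTo τ T U ∧ τ u' = u ∧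
      ∀ x ∈ T, ψ' x = ψ (τ x) := by
  set c := chartAt E3 (ψ u) with hc
  obtain ⟨V, hVo, hVU, hV, hVs, hVd, hVi⟩ := h.chart_comp (ψ u)
  obtain ⟨V', hVo', hVU', hV', hVs', hVd', hVi'⟩ := h'.chart_comp (ψ u)
  have huV : u ∈ V := hV u hu (mem_chart_source E3 _)
  have huV' : u' ∈ V' := hV' u' hu' (by rw [← huu]; exact mem_chart_source E3 _)
  -- the transition is `(c ∘ ψ)⁻¹ ∘ (c ∘ ψ')`, for a chart `c`
  obtain ⟨τ, T, hTo, huT, hτ, hτV, hτu, hτr⟩ := exists_local_inverse hVo hVd hVi huV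
  have hθu : (c ∘ ψ') u' = (c ∘ ψ) u := by simp [huu]
  have ho : IsOpen (V' ∩ (c ∘ ψ') ⁻¹' T) :=
    hVd'.continuousOn.isOpen_inter_preimage hVo' hTo
  have hmaps : MapsTo (c ∘ ψ') (V' ∩ (c ∘ ψ') ⁻¹' T) T := fun x hx => hx.2
  have hcd : ContDiffOn ℝ ∞ (τ ∘ (c ∘ ψ')) (V' ∩ (c ∘ ψ') ⁻¹' T) :=
    hτ.comp (hVd'.mono inter_subset_left) hmaps
  have key : ∀ x ∈ V' ∩ (c ∘ ψ') ⁻¹' T, (c ∘ ψ) ((τ ∘ (c ∘ ψ')) x) = (c ∘ ψ') x :=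
    fun x hx => hτr _ hx.2
  have hd : ∀ x ∈ V' ∩ (c ∘ ψ') ⁻¹' T, DifferentiableAt ℝ (τ ∘ (c ∘ ψ')) x := fun x hx =>
    (hcd.contDiffAt (ho.mem_nhds hx)).differentiableAt (by simp)
  refine ⟨τ ∘ (c ∘ ψ'), V' ∩ (c ∘ ψ') ⁻¹' T, ho, ⟨huV', ?_⟩,
    inter_subset_left.trans hVU', hcd, fun x hx => ?_, fun x hx => hVU (hτV hx.2), ?_,
    fun x hx => ?_⟩
  · change (c ∘ ψ') u' ∈ T
    rw [hθu]; exact huT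
  · have hm : (τ ∘ (c ∘ ψ')) x ∈ V := hτV hx.2
    have e : (c ∘ ψ) ∘ (τ ∘ (c ∘ ψ')) =ᶠ[𝓝 x] c ∘ ψ' := by
      filter_upwards [ho.mem_nhds hx] with y hy using key y hy
    have e' := e.fderiv_eq (𝕜 := ℝ)
    rw [fderiv_comp x ((hVd.contDiffAt (hVo.mem_nhds hm)).differentiableAt (by simp)) (hd x hx)]
      at e'
    have := hVi' x hx.1
    rw [← e'] at this
    exact Function.Injective.of_comp this
  · change τ ((c ∘ ψ') u') = u
    rw [hθu]; exact hτu
  · have h1 := key x hx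
    have h2 : (τ ∘ (c ∘ ψ')) x ∈ V := hτV hx.2
    exact (c.injOn (hVs _ h2) (hVs' x hx.1) h1).symm

/-- Being a continuous family of contact structures near a point does not depend on the local
parametrization. -/
theorem HalfFam.change {P : K → ∀ p : Y, Set (TangentSpace (𝓡 3) p)} {ψ ψ' : E3 → Y}
    {U U' : Set E3} (h : ImmOn ψ U) (h' : ImmOn ψ' U') {u u' : E3} (hu : u ∈ U) (hu' : u' ∈ U')
    (huu : ψ u = ψ' u') {k : K} (H : HalfFam (fun k => pb ψ (P k)) (k, u)) :
    HalfFam (fun k => pb ψ' (P k)) (k, u') := by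
  obtain ⟨τ, T, hTo, huT, hTU, hτ, hτi, hτm, hτu, hτe⟩ := h.exists_transition h' hu hu' huu
  have hW : IsOpen {q : K × E3 | q.2 ∈ T} := hTo.preimage continuous_snd
  have := HalfFam.pullback (q := (k, u')) (ψ := fun _ => τ) (h := fun k => pb ψ (P k)) hW huT
    (FamS.of_contDiffOn hTo hτ) (fun p hp => hτi _ hp) (by rw [← hτu] at H; exact H)
  refine this.congr ?_
  filter_upwards [hW.mem_nhds (show (k, u') ∈ {q : K × E3 | q.2 ∈ T} from huT)] with p hp
  rw [← pb_comp (h.mdifferentiableAt (hτm hp))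
    ((hτ.contDiffAt (hTo.mem_nhds hp)).differentiableAt (by simp))]
  apply pb_congr
  filter_upwards [hTo.mem_nhds hp] with y hy using hτe y hy

/-- A continuous family of contact structures on `Y`, in a local parametrization. -/
theorem halfFam_of_continuous {η : K → ContactStructure Y} (hη : Continuous η) {ψ : E3 → Y}
    {U : Set E3} (h : ImmOn ψ U) {u : E3} (hu : u ∈ U) (k : K) :
    HalfFam (fun k => pb ψ (η k).pos) (k, u) := by
  refine HalfFam.change (u := chartAt E3 (ψ u) (ψ u)) (immOn_chart_symm (ψ u)) h
    (mem_chart_target E3 _) hu ?_ (halfFam_chart hη (ψ u) (mem_chart_target E3 _))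
  exact (chartAt E3 (ψ u)).left_inv (mem_chart_source E3 _)

/-- A family of fields of half-spaces that locally, in suitable parametrizations, is a continuous
family of contact structures, is a continuous family of contact structures. -/
theorem exists_continuous_contactStructure {P : K → ∀ p : Y, Set (TangentSpace (𝓡 3) p)}
    (H : ∀ (k : K) (p : Y), ∃ (ψ : E3 → Y) (U : Set E3) (u : E3), ImmOn ψ U ∧ u ∈ U ∧ ψ u = p ∧
      HalfFam (fun k => pb ψ (P k)) (k, u)) :
    ∃ η : C(K, ContactStructure Y), ∀ k, (η k).pos = P k := by
  have H' : ∀ (k : K) (p₀ : Y), ∀ u ∈ (chartAt E3 p₀).target,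
      HalfFam (fun k => pb (chartAt E3 p₀).symm (P k)) (k, u) := fun k p₀ u hu => by
    obtain ⟨ψ, U, u', hψ, hu', huu, h⟩ := H k ((chartAt E3 p₀).symm u)
    exact HalfFam.change hψ (immOn_chart_symm p₀) hu' hu huu h
  -- the unit normals in the charts are a continuous family of smooth maps
  have hN : ∀ p₀, FamS {q : K × E3 | q.2 ∈ (chartAt E3 p₀).target}
      (fun k u => unitNormal (pb (chartAt E3 p₀).symm (P k) u)) := fun p₀ => by
    have hloc : ∀ q ∈ {q : K × E3 | q.2 ∈ (chartAt E3 p₀).target}, ∃ W, IsOpen W ∧ q ∈ W ∧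
        FamS W (fun k u => unitNormal (pb (chartAt E3 p₀).symm (P k) u)) := fun q hq => by
      obtain ⟨W, hW, hqW, hF, -⟩ := (H' q.1 p₀ q.2 hq).normal
      exact ⟨W, hW, hqW, hF⟩
    apply FamS.of_continuousOn_iteratedFDeriv
    · intro q hq
      obtain ⟨W, hW, hqW, hF⟩ := hloc q hq
      exact hF.contDiffAt hW hqW
    · intro n q hq
      obtain ⟨W, hW, hqW, hF⟩ := hloc q hq
      exact ((hF n).continuousOn_iteratedFDeriv.continuousAt (hW.mem_nhds hqW)).continuousWithinAt
  have hS : ∀ k, ∃ η : ContactStructure Y, η.pos = P k := fun k => by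
    refine ⟨⟨P k, fun p₀ => ⟨fun u => covec (unitNormal (pb (chartAt E3 p₀).symm (P k) u)), ?_,
      fun u hu => ?_⟩⟩, rfl⟩
    · intro u hu
      have h1 := (hN p₀).contDiffAt ((chartAt E3 p₀).open_target.preimage continuous_snd)
        (q := (k, u)) hu
      exact ((ContinuousLinearMap.contDiff (innerSL ℝ)).contDiffAt.comp u h1).contDiffWithinAt
    · obtain ⟨W, hW, hqW, -, h⟩ := (H' k p₀ u hu).normal
      refine ⟨exists_wedgeD_ne_zero_iff.2 (h _ hqW).2, fun v => ?_⟩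
      have := setOf_covec_unitNormal (h _ hqW).1
      exact Set.ext_iff.1 this v
  choose η hη using hS
  have hcont : Continuous η := by
    refine continuous_iInf_rng.2 fun p₀ => continuous_iInf_rng.2 fun n => ?_
    rw [continuous_induced_rng, continuous_iff_continuousAt]
    intro k
    rw [ContinuousAt, UniformOnFun.tendsto_iff_tendstoUniformlyOn]
    rintro C ⟨hC, hCT⟩ s hs
    have hj : ContinuousOn (Function.uncurry fun (k : K) (u : E3) =>
        iteratedFDeriv ℝ n ((η k).chartNormal p₀) u) (univ ×ˢ C) := by
      have := ((hN p₀) n).continuousOn_iteratedFDeriv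
      have e : ∀ k, (η k).chartNormal p₀ =
          fun u => unitNormal (pb (chartAt E3 p₀).symm (P k) u) := fun k => by
        funext u
        rw [chartNormal_eq, hη]
      simp only [e]
      exact this.mono fun q hq => hCT hq.2
    -- joint continuity gives uniform convergence on compact sets
    obtain ⟨v, hv, hv'⟩ := hC.mem_uniformity_of_prod hj (mem_univ k) (symm_le_uniformity hs)
    rw [nhdsWithin_univ] at hv
    filter_upwards [hv] with k' hk' x hx using hv' k' hk' x hx
  exact ⟨⟨η, hcont⟩, hη⟩

end Param

/-! ### Modifying contact structures inside a chart -/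

section Glue

variable {Y : Type*} [TopologicalSpace Y] [ChartedSpace E3 Y]

theorem ImmOn.field_eq_of_pb_eq {N : E3 → Y} {A : Set E3} (hN : ImmOn N A) {u : E3} (hu : u ∈ A)
    {P P' : ∀ p : Y, Set (TangentSpace (𝓡 3) p)} (h : pb N P u = pb N P' u) :
    P (N u) = P' (N u) := by
  ext w
  obtain ⟨v, rfl⟩ := hN.surjective hu w
  exact Set.ext_iff.1 h v

theorem ContactStructure.ext_of_pb {N : E3 → Y} {A : Set E3} (hN : ImmOn N A)
    {η₁ η₂ : ContactStructure Y} (h : ∀ u ∈ A, pb N η₁.pos u = pb N η₂.pos u)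
    (h' : ∀ y ∉ N '' A, η₁.pos y = η₂.pos y) : η₁ = η₂ := by
  apply ContactStructure.ext
  funext y
  by_cases hy : y ∈ N '' A
  · obtain ⟨u, hu, rfl⟩ := hy
    exact hN.field_eq_of_pb_eq hu (h u hu)
  · exact h' y hy

variable [IsManifold (𝓡 3) ∞ Y] [T2Space Y] {K : Type*} [TopologicalSpace K]

/-- A continuous family of contact structures on `Y` can be replaced, in an embedded open subset `A`
of `ℝ³`, by a continuous family that agrees with it outside a compact subset of `A`. -/
theorem exists_glue {N : E3 → Y} {A C : Set E3} (hN : ImmOn N A) (hinj : InjOn N A)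
    (hC : IsCompact C) (hCA : C ⊆ A) {η : K → ContactStructure Y} (hη : Continuous η)
    {h : K → E3 → Set E3} (hfam : ∀ k, ∀ u ∈ A, HalfFam h (k, u))
    (hag : ∀ k, ∀ u ∈ A, u ∉ C → h k u = pb N (η k).pos u) :
    ∃ η' : C(K, ContactStructure Y), (∀ k, ∀ u ∈ A, pb N (η' k).pos u = h k u) ∧
      ∀ k, ∀ y ∉ N '' C, (η' k).pos y = (η k).pos y := by
  classical
  -- the field `h` transported to the image of `A`, and the given field elsewhere
  let P : K → ∀ p : Y, Set (TangentSpace (𝓡 3) p) := fun k y =>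
    if y ∈ N '' A then
      {w | ∃ u ∈ A, N u = y ∧ ∃ v ∈ h k u, (mfderiv (𝓡 3) (𝓡 3) N u v : E3) = (w : E3)}
    else (η k).pos y
  have hP1 : ∀ k, ∀ u ∈ A, pb N (P k) u = h k u := fun k u hu => by
    ext v
    have hNu : N u ∈ N '' A := mem_image_of_mem N hu
    simp only [pb, P, if_pos hNu, mem_ofPred_eq]
    constructor
    · rintro ⟨u', hu', huu, v', hv', e⟩
      obtain rfl := hinj hu' hu huu
      have := hN.injective u' hu' e
      subst this
      exact hv'
    · intro hv
      exact ⟨u, hu, rfl, v, hv, rfl⟩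
  have hP2 : ∀ k, ∀ y ∉ N '' C, P k y = (η k).pos y := fun k y hy => by
    by_cases hyA : y ∈ N '' A
    · obtain ⟨u, hu, rfl⟩ := hyA
      have huC : u ∉ C := fun hc => hy (mem_image_of_mem N hc)
      exact hN.field_eq_of_pb_eq hu ((hP1 k u hu).trans (hag k u hu huC))
    · simp only [P, if_neg hyA]
  -- the modification is supported in a closed set, so that both descriptions are local
  have hcl : IsClosed (N '' C) :=
    (hC.image_of_continuousOn (hN.contMDiffOn.continuousOn.mono hCA)).isClosed
  obtain ⟨η', hη'⟩ := exists_continuous_contactStructure (P := P) fun k p => by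
    by_cases hp : p ∈ N '' A
    · obtain ⟨u, hu, rfl⟩ := hp
      refine ⟨N, A, u, hN, hu, rfl, (hfam k u hu).congr ?_⟩
      have : IsOpen {q : K × E3 | q.2 ∈ A} := hN.isOpen.preimage continuous_snd
      filter_upwards [this.mem_nhds (show (k, u) ∈ {q : K × E3 | q.2 ∈ A} from hu)] with q hq
        using hP1 _ _ hq
    · have hψ := immOn_chart_symm p
      have hpt := mem_chart_target E3 p
      have hl := (chartAt E3 p).left_inv (mem_chart_source E3 p)
      refine ⟨_, _, chartAt E3 p p, hψ, hpt, hl, (halfFam_of_continuous hη hψ hpt k).congr ?_⟩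
      have hpC : p ∉ N '' C := fun hc => hp (image_mono hCA hc)
      have hca : ContinuousAt (fun q : K × E3 => (chartAt E3 p).symm q.2)
          (k, chartAt E3 p p) :=
        ContinuousAt.comp (g := (chartAt E3 p).symm) (f := fun q : K × E3 => q.2)
          ((chartAt E3 p).continuousAt_symm hpt) continuousAt_snd
      have hev : ∀ᶠ q : K × E3 in 𝓝 (k, chartAt E3 p p), (chartAt E3 p).symm q.2 ∈ (N '' C)ᶜ :=
        hca.eventually (hcl.isOpen_compl.mem_nhds (by simpa [hl] using hpC))
      filter_upwards [hev] with q hq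
      exact pb_congr_field (hP2 q.1 _ hq)
  exact ⟨η', fun k u hu => by rw [hη']; exact hP1 k u hu, fun k y hy => by
    rw [hη']; exact hP2 k y hy⟩

/-- A continuous family of contact structures on `Y` can be pulled back along a continuous family of
local diffeomorphisms that are supported in a compact subset of a chart domain. -/
theorem exists_pullback {N : E3 → Y} {A C : Set E3} (hN : ImmOn N A) (hinj : InjOn N A)
    (hC : IsCompact C) (hCA : C ⊆ A) {η : K → ContactStructure Y} (hη : Continuous η)
    {ρ : K → E3 → E3} (hρ : FamS {q | q.2 ∈ A} ρ) (hm : ∀ k, MapsTo (ρ k) A A)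
    (hi : ∀ k, ∀ u ∈ A, Function.Injective (fderiv ℝ (ρ k) u))
    (hid : ∀ k, ∀ u ∈ A, u ∉ C → ρ k u = u) :
    ∃ η' : C(K, ContactStructure Y), (∀ k, ∀ u ∈ A, pb N (η' k).pos u =
        fderiv ℝ (ρ k) u ⁻¹' pb N (η k).pos (ρ k u)) ∧
      ∀ k, ∀ y ∉ N '' C, (η' k).pos y = (η k).pos y := by
  have hW : IsOpen {q : K × E3 | q.2 ∈ A} := hN.isOpen.preimage continuous_snd
  refine exists_glue hN hinj hC hCA hη (fun k u hu => ?_) fun k u hu huC => ?_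
  · exact HalfFam.pullback (h := fun k => pb N (η k).pos) hW hu hρ (fun p hp => hi _ _ hp)
      (halfFam_of_continuous hη hN (hm k hu) k)
  · have e : ρ k =ᶠ[𝓝 u] id := by
      filter_upwards [hN.isOpen.mem_nhds hu, hC.isClosed.isOpen_compl.mem_nhds huC] with x hx hxC
        using hid k x hx hxC
    rw [e.fderiv_eq, hid k u hu huC, fderiv_id]
    rfl

end Glue

/-! ### Darboux balls -/

section Darboux

variable {Y : Type*} [TopologicalSpace Y] [ChartedSpace E3 Y] [IsManifold (𝓡 3) ∞ Y]

/-- A smooth map with injective derivative at a point is an open embedding near this point. -/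
theorem exists_immOn_of_injective {ψ : E3 → Y} {U : Set E3} (hU : IsOpen U)
    (hψ : ContMDiffOn (𝓡 3) (𝓡 3) ∞ ψ U) {u : E3} (hu : u ∈ U)
    (hi : Function.Injective (mfderiv (𝓡 3) (𝓡 3) ψ u)) :
    ∃ V, u ∈ V ∧ ImmOn ψ V ∧ InjOn ψ V := by
  have : IsManifold (𝓡 3) 1 Y := IsManifold.of_le (n := ∞) (by simp)
  set c := chartAt E3 (ψ u) with hc
  have hcd := (mdifferentiable_chart (I := 𝓡 3) (ψ u))
  set V := U ∩ ψ ⁻¹' c.source with hV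
  have hVo : IsOpen V := hψ.continuousOn.isOpen_inter_preimage hU c.open_source
  have huV : u ∈ V := ⟨hu, mem_chart_source E3 _⟩
  have hd : ContDiffOn ℝ ∞ (c ∘ ψ) V := by
    rw [← contMDiffOn_iff_contDiffOn]
    exact (contMDiffOn_chart (I := 𝓡 3) (n := ∞)).comp (hψ.mono inter_subset_left)
      fun u hu => hu.2
  have hmd : ∀ x ∈ V, MDifferentiableAt (𝓡 3) (𝓡 3) ψ x := fun x hx =>
    (hψ.contMDiffAt (hU.mem_nhds hx.1)).mdifferentiableAt (by simp)
  have hder : ∀ x ∈ V, (fderiv ℝ (c ∘ ψ) x : E3 → E3) =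
      (mfderiv (𝓡 3) (𝓡 3) c (ψ x)) ∘ (mfderiv (𝓡 3) (𝓡 3) ψ x) := fun x hx => by
    rw [← mfderiv_eq_fderiv, mfderiv_comp x (hcd.mdifferentiableAt hx.2) (hmd x hx)]
    rfl
  have hinju : Function.Injective (fderiv ℝ (c ∘ ψ) u) := by
    rw [hder u huV]
    exact (hcd.mfderiv_injective huV.2).comp hi
  -- apply the inverse function theorem in the chart `c`
  let L : E3 ≃L[ℝ] E3 := (LinearEquiv.ofBijective ((fderiv ℝ (c ∘ ψ) u : E3 →L[ℝ] E3) : E3 →ₗ[ℝ] E3)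
    ⟨hinju, surjective_of_injective hinju⟩).toContinuousLinearEquiv
  have hL : (L : E3 →L[ℝ] E3) = fderiv ℝ (c ∘ ψ) u := by ext v; rfl
  have hca := hd.contDiffAt (hVo.mem_nhds huV)
  have hL' : HasFDerivAt (c ∘ ψ) (L : E3 →L[ℝ] E3) u := by
    rw [hL]; exact (hca.differentiableAt (by simp)).hasFDerivAt
  let e := hca.toOpenPartialHomeomorph (c ∘ ψ) hL' (by simp)
  have hes : u ∈ e.source := hca.mem_toOpenPartialHomeomorph_source hL' (by simp)
  have hcont : ContinuousAt (fderiv ℝ (c ∘ ψ)) u :=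
    (hca.fderiv_right (m := 0) (by simp)).continuousAt
  have hev : ∀ᶠ x in 𝓝 u, fderiv ℝ (c ∘ ψ) x ∈ range ((↑) : (E3 ≃L[ℝ] E3) → E3 →L[ℝ] E3) :=
    hcont.eventually (ContinuousLinearEquiv.isOpen.mem_nhds ⟨L, hL⟩)
  obtain ⟨T, hT, hTo, huT⟩ := _root_.eventually_nhds_iff.1 hev
  refine ⟨V ∩ e.source ∩ T, ⟨⟨huV, hes⟩, huT⟩, ⟨(hVo.inter e.open_source).inter hTo,
    hψ.mono fun x hx => hx.1.1.1, fun x hx => ?_⟩, fun x hx y hy hxy => ?_⟩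
  · obtain ⟨Lx, hLx⟩ := hT x hx.2
    have h1 : Function.Injective (fderiv ℝ (c ∘ ψ) x) := by rw [← hLx]; exact Lx.injective
    rw [hder x hx.1.1] at h1
    exact h1.of_comp
  · refine e.injOn hx.1.2 hy.1.2 ?_
    change c (ψ x) = c (ψ y)
    rw [hxy]

/-- The parametrization of a Darboux ball is an open embedding on a slightly larger open ball. -/
theorem DarbouxBall.exists_collar [T2Space Y] {ξ : ContactStructure Y} (B : DarbouxBall ξ) :
    ∃ ε : ℝ, 0 < ε ∧ ImmOn B.toFun (ball 0 (1 + ε)) ∧ InjOn B.toFun (ball 0 (1 + ε)) := by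
  obtain ⟨U, hU, hBU, hd⟩ := B.smooth
  have hloc : ∀ x ∈ closedBall (0 : E3) 1, ∃ V, x ∈ V ∧ ImmOn B.toFun V ∧ InjOn B.toFun V :=
    fun x hx => exists_immOn_of_injective hU hd (hBU hx) (B.bijective_mfderiv x hx).1
  -- injectivity on the compact ball and local injectivity give injectivity on a neighbourhood
  obtain ⟨t, ht, hti⟩ := B.injOn.exists_mem_nhdsSet (isCompact_closedBall (0 : E3) 1)
    (fun x hx => (hd.contMDiffAt (hU.mem_nhds (hBU hx))).continuousAt)
    (fun x hx => by
      obtain ⟨V, hxV, hV, hVi⟩ := hloc x hx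
      exact ⟨V, hV.isOpen.mem_nhds hxV, hVi⟩)
  obtain ⟨T, hTo, hBT, hTt⟩ := mem_nhdsSet_iff_exists.1 ht
  set G : Set E3 := T ∩ ⋃₀ {V | ImmOn B.toFun V} with hG
  have hGo : IsOpen G := hTo.inter (isOpen_sUnion fun V hV => hV.isOpen)
  have hBG : closedBall (0 : E3) 1 ⊆ G := fun x hx => ⟨hBT hx, by
    obtain ⟨V, hxV, hV, -⟩ := hloc x hx
    exact ⟨V, hV, hxV⟩⟩
  obtain ⟨ε, hε, hεG⟩ := (isCompact_closedBall (0 : E3) 1).exists_thickening_subset_open hGo hBG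
  rw [thickening_closedBall hε zero_le_one] at hεG
  refine ⟨ε, hε, ?_, ?_⟩
  · rw [add_comm]
    refine ⟨isOpen_ball, fun x hx => ?_, fun x hx => ?_⟩
    · obtain ⟨V, hV, hxV⟩ := (hεG hx).2
      exact (ImmOn.contMDiffAt hV hxV).contMDiffWithinAt
    · obtain ⟨V, hV, hxV⟩ := (hεG hx).2
      exact ImmOn.injective hV x hxV
  · rw [add_comm]
    exact hti.mono fun x hx => hTt (hεG hx).1

theorem DarbouxBall.pb_eq {Y : Type*} [TopologicalSpace Y] [ChartedSpace E3 Y]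
    {ξ : ContactStructure Y} (B : DarbouxBall ξ) {u : E3} (hu : u ∈ closedBall (0 : E3) 1) :
    pb B.toFun ξ.pos u = {v | 0 < stdForm u v} := by
  ext v
  exact B.contact u hu v

end Darboux

/-! ### Rotations of `ℝ³` and twists -/

section Rotations

/-- The cross product on `ℝ³`. -/
def cross (p v : E3) : E3 :=
  !₂[p 1 * v 2 - p 2 * v 1, p 2 * v 0 - p 0 * v 2, p 0 * v 1 - p 1 * v 0]

@[simp] theorem cross_zero (p v : E3) : cross p v 0 = p 1 * v 2 - p 2 * v 1 := rfl
@[simp] theorem cross_one (p v : E3) : cross p v 1 = p 2 * v 0 - p 0 * v 2 := rfl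
@[simp] theorem cross_two (p v : E3) : cross p v 2 = p 0 * v 1 - p 1 * v 0 := rfl

theorem inner_coords (v w : E3) : inner ℝ v w = v 0 * w 0 + v 1 * w 1 + v 2 * w 2 := by
  simp [PiLp.inner_apply, Fin.sum_univ_three]
  ring

theorem norm_sq_coords (v : E3) : ‖v‖ ^ 2 = v 0 ^ 2 + v 1 ^ 2 + v 2 ^ 2 := by
  rw [← real_inner_self_eq_norm_sq, inner_coords]; ring

theorem E3_ext {v w : E3} (h0 : v 0 = w 0) (h1 : v 1 = w 1) (h2 : v 2 = w 2) : v = w := by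
  ext i; fin_cases i <;> assumption

/-- The squared norm of a quaternion `q = a + p`, with real part `a` and imaginary part `p`. -/
def qnorm (q : ℝ × E3) : ℝ := q.1 ^ 2 + q.2 0 ^ 2 + q.2 1 ^ 2 + q.2 2 ^ 2

theorem qnorm_pos {q : ℝ × E3} (hq : q ≠ 0) : 0 < qnorm q := by
  by_contra h
  apply hq
  have h' : q.1 ^ 2 + (q.2 0) ^ 2 + (q.2 1) ^ 2 + (q.2 2) ^ 2 ≤ 0 := not_lt.1 h
  have k := sq_nonneg q.1
  have k0 := sq_nonneg (q.2 0)
  have k1 := sq_nonneg (q.2 1)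
  have k2 := sq_nonneg (q.2 2)
  have e : q.1 = 0 := sq_eq_zero_iff.1 (by linarith)
  have e0 : q.2 0 = 0 := sq_eq_zero_iff.1 (by linarith)
  have e1 : q.2 1 = 0 := sq_eq_zero_iff.1 (by linarith)
  have e2 : q.2 2 = 0 := sq_eq_zero_iff.1 (by linarith)
  exact Prod.ext e (E3_ext e0 e1 e2)

/-- The rotation `v ↦ q v q⁻¹` of `ℝ³ = Im ℍ` defined by the nonzero quaternion `q = a + p`, with real
part `a` and imaginary part `p`. -/
def qrot (q : ℝ × E3) : E3 →L[ℝ] E3 :=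
  LinearMap.toContinuousLinearMap
    { toFun := fun v => (qnorm q)⁻¹ • ((2 * q.1 ^ 2 - qnorm q) • v + (2 * inner ℝ q.2 v) • q.2 +
        (2 * q.1) • cross q.2 v)
      map_add' := fun v w => by
        apply E3_ext <;> simp [inner_coords] <;> ring
      map_smul' := fun c v => by
        apply E3_ext <;> simp [inner_coords] <;> ring }

theorem qrot_apply (q : ℝ × E3) (v : E3) : qrot q v =
    (qnorm q)⁻¹ • ((2 * q.1 ^ 2 - qnorm q) • v + (2 * inner ℝ q.2 v) • q.2 +
      (2 * q.1) • cross q.2 v) := rfl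

theorem norm_qrot {q : ℝ × E3} (hq : q ≠ 0) (v : E3) : ‖qrot q v‖ = ‖v‖ := by
  have h := (qnorm_pos hq).ne'
  rw [← sq_eq_sq₀ (norm_nonneg _) (norm_nonneg _), norm_sq_coords, norm_sq_coords, qrot_apply]
  simp only [PiLp.smul_apply, PiLp.add_apply, smul_eq_mul, inner_coords, cross_zero, cross_one,
    cross_two]
  rw [mul_pow, mul_pow, mul_pow, ← mul_add, ← mul_add]
  rw [inv_pow, inv_mul_eq_iff_eq_mul₀ (pow_ne_zero 2 h)]
  simp only [qnorm]
  ring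

theorem qrot_real {a : ℝ} (ha : a ≠ 0) : qrot (a, 0) = ContinuousLinearMap.id ℝ E3 := by
  ext v : 1
  rw [qrot_apply]
  apply E3_ext <;> simp [qnorm] <;> field_simp <;> ring

theorem contDiffOn_qrot : ContDiffOn ℝ ∞ qrot {0}ᶜ := by
  rw [contDiffOn_clm_apply]
  intro v
  have hq : ContDiff ℝ ∞ qnorm := by unfold qnorm; fun_prop
  have hi : ContDiffOn ℝ ∞ (fun q => (qnorm q)⁻¹) {0}ᶜ :=
    hq.contDiffOn.inv fun q hq => (qnorm_pos hq).ne'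
  have hc : ContDiff ℝ ∞ fun q : ℝ × E3 => cross q.2 v := by
    rw [contDiff_euclidean]
    intro i
    fin_cases i <;> simp <;> fun_prop
  simp only [qrot_apply]
  refine hi.smul (ContDiff.contDiffOn ?_)
  simp only [inner_coords]
  fun_prop

/-- The quaternion `(1 + ⟪g, n⟫) + g × n` rotates the unit vector `g` to the unit vector `n`. -/
theorem qrot_between {g n : E3} (hg : ‖g‖ = 1) (hn : ‖n‖ = 1) (h : -1 < inner ℝ g n) :
    qrot (1 + inner ℝ g n, cross g n) g = n := by
  have hg' := norm_sq_coords g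
  have hn' := norm_sq_coords n
  rw [hg] at hg'
  rw [hn] at hn'
  have hq : qnorm (1 + inner ℝ g n, cross g n) = 2 * (1 + inner ℝ g n) := by
    simp only [qnorm, cross_zero, cross_one, cross_two, inner_coords]
    linear_combination (-(n 0 ^ 2 + n 1 ^ 2 + n 2 ^ 2)) * hg' - hn'
  have h0 : (2 * (1 + inner ℝ g n) : ℝ) ≠ 0 := by
    have : (0 : ℝ) < 2 * (1 + inner ℝ g n) := by linarith
    exact this.ne'
  rw [qrot_apply, hq, inv_smul_eq_iff₀ h0]
  simp only [inner_coords]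
  apply E3_ext <;> simp
  · linear_combination (-2 * (1 + (g 0 * n 0 + g 1 * n 1 + g 2 * n 2)) * n 0) * hg'
  · linear_combination (-2 * (1 + (g 0 * n 0 + g 1 * n 1 + g 2 * n 2)) * n 1) * hg'
  · linear_combination (-2 * (1 + (g 0 * n 0 + g 1 * n 1 + g 2 * n 2)) * n 2) * hg'

theorem cross_self (g : E3) : cross g g = 0 := by
  apply E3_ext <;> simp <;> ring

/-- The twist of `ℝ³` that rotates the sphere of radius `√s` by `T s`. -/
def twist (T : ℝ → E3 →L[ℝ] E3) (u : E3) : E3 := T (‖u‖ ^ 2) u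

theorem norm_twist {T : ℝ → E3 →L[ℝ] E3} (hT : ∀ s v, ‖T s v‖ = ‖v‖) (u : E3) :
    ‖twist T u‖ = ‖u‖ := hT _ _

theorem hasFDerivAt_twist {T : ℝ → E3 →L[ℝ] E3} {u : E3}
    (hd : DifferentiableAt ℝ T (‖u‖ ^ 2)) :
    HasFDerivAt (twist T) (T (‖u‖ ^ 2) +
      ((2 : ℝ) • innerSL ℝ u).smulRight (deriv T (‖u‖ ^ 2) u)) u := by
  have h1 : HasFDerivAt (fun x : E3 => ‖x‖ ^ 2) ((2 : ℝ) • innerSL ℝ u) u :=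
    (hasStrictFDerivAt_norm_sq u).hasFDerivAt.congr_fderiv (by ext v; simp)
  have h2 := (hd.hasDerivAt.hasFDerivAt.comp u h1).clm_apply (hasFDerivAt_id u)
  refine h2.congr_fderiv ?_
  ext v
  simp [mul_assoc]

theorem fderiv_twist_apply {T : ℝ → E3 →L[ℝ] E3} {u : E3}
    (hd : DifferentiableAt ℝ T (‖u‖ ^ 2)) (v : E3) :
    fderiv ℝ (twist T) u v = T (‖u‖ ^ 2) v + (2 * inner ℝ u v) • deriv T (‖u‖ ^ 2) u := by
  rw [(hasFDerivAt_twist hd).fderiv]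
  simp

theorem inner_of_norm_eq {L : E3 →L[ℝ] E3} (hL : ∀ v, ‖L v‖ = ‖v‖) (v w : E3) :
    inner ℝ (L v) (L w) = inner ℝ v w := by
  exact LinearIsometry.inner_map_map ⟨(L : E3 →ₗ[ℝ] E3), hL⟩ v w

theorem injective_of_norm_eq {L : E3 →L[ℝ] E3} (hL : ∀ v, ‖L v‖ = ‖v‖) : Function.Injective L := by
  rw [injective_iff_map_eq_zero]
  intro v hv
  rw [← norm_eq_zero, ← hL, hv, norm_zero]

theorem injective_fderiv_twist {T : ℝ → E3 →L[ℝ] E3} {u : E3}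
    (hd : DifferentiableAt ℝ T (‖u‖ ^ 2)) (hT : ∀ s v, ‖T s v‖ = ‖v‖) :
    Function.Injective (fderiv ℝ (twist T) u) := by
  rw [injective_iff_map_eq_zero]
  intro v hv
  rw [fderiv_twist_apply hd] at hv
  set s := ‖u‖ ^ 2 with hs
  -- the curve `s ↦ T s u` stays on a sphere, so its velocity is tangent to that sphere
  have h0 : inner ℝ (T s u) (deriv T s u) = 0 := by
    have h1 : HasDerivAt (fun r => T r u) (deriv T s u) s := by
      simpa using hd.hasDerivAt.clm_apply (hasDerivAt_const s u)
    have h2 : HasDerivAt (fun r => ‖T r u‖ ^ 2) (2 * inner ℝ (T s u) (deriv T s u)) s :=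
      h1.norm_sq
    have h3 : (fun r => ‖T r u‖ ^ 2) = fun _ => ‖u‖ ^ 2 := by ext r; rw [hT]
    rw [h3] at h2
    have := h2.unique (hasDerivAt_const s _)
    linarith
  have h4 : inner ℝ u v = 0 := by
    have h5 : inner ℝ (T s u) (T s v + (2 * inner ℝ u v) • deriv T s u) = 0 := by
      rw [hv, inner_zero_right]
    rw [inner_add_right, inner_smul_right, h0, inner_of_norm_eq (hT s), mul_zero, add_zero] at h5
    exact h5
  rw [h4] at hv
  simp only [mul_zero, zero_smul, add_zero] at hv
  rw [← norm_eq_zero, ← hT s, hv, norm_zero]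

end Rotations

section TwistFamily

variable {Y : Type*} [TopologicalSpace Y] [ChartedSpace E3 Y] {K : Type*} [TopologicalSpace K]

/-- The unit normal, in Darboux coordinates, of a contact structure at the centre of a Darboux
ball. -/
def normalB {ξ : ContactStructure Y} (B : DarbouxBall ξ) (η : ContactStructure Y) : E3 :=
  unitNormal (pb B.toFun η.pos 0)

variable [IsManifold (𝓡 3) ∞ Y] [T2Space Y]

/-- Twisting a continuous family of contact structures inside a rotationally invariant chart. -/
theorem exists_twist {N : E3 → Y} {J : Set ℝ} {a b : ℝ}
    (hN : ImmOn N {u | ‖u‖ ^ 2 ∈ J}) (hinj : InjOn N {u | ‖u‖ ^ 2 ∈ J})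
    (hab : ∀ s, 0 ≤ s → s ∈ Icc a b → s ∈ J)
    {η : K → ContactStructure Y} (hη : Continuous η)
    {T : K → ℝ → E3 →L[ℝ] E3} (hT : FamS {q | q.2 ∈ J} T) (hTn : ∀ k s v, ‖T k s v‖ = ‖v‖)
    (hTid : ∀ k, ∀ s ∈ J, 0 ≤ s → s ∉ Icc a b → T k s = ContinuousLinearMap.id ℝ E3) :
    ∃ η' : C(K, ContactStructure Y),
      (∀ k u, ‖u‖ ^ 2 ∈ J → pb N (η' k).pos u =
        fderiv ℝ (twist (T k)) u ⁻¹' pb N (η k).pos (twist (T k) u)) ∧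
      (∀ k, ∀ y ∉ N '' {u | ‖u‖ ^ 2 ∈ Icc a b}, (η' k).pos y = (η k).pos y) ∧
      ∀ k, (∀ s ∈ J, T k s = ContinuousLinearMap.id ℝ E3) → η' k = η k := by
  set A : Set E3 := {u | ‖u‖ ^ 2 ∈ J} with hA
  set C : Set E3 := {u | ‖u‖ ^ 2 ∈ Icc a b} with hC
  have hCA : C ⊆ A := fun u hu => hab _ (by positivity) hu
  -- `twist` preserves norms, hence the radially defined sets `A` and `C`
  have hCc : IsCompact C := by
    refine Metric.isCompact_of_isClosed_isBounded ?_ ?_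
    · exact isClosed_Icc.preimage (by fun_prop)
    · refine (isBounded_iff_forall_norm_le (s := C)).2 ⟨b + 1, fun u hu => ?_⟩
      have := hu.2
      nlinarith [sq_nonneg (‖u‖ - 1 / 2), norm_nonneg u]
  have hW : IsOpen {q : K × E3 | q.2 ∈ A} := hN.isOpen.preimage continuous_snd
  have hFam : FamS {q : K × E3 | q.2 ∈ A} (fun k => twist (T k)) := by
    have h1 : FamS {q : K × E3 | q.2 ∈ A} (fun _ u => ‖u‖ ^ 2) :=
      (FamS.of_contDiffOn isOpen_univ (contDiff_norm_sq ℝ).contDiffOn).mono fun _ _ => mem_univ _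
    have h2 : FamS {q : K × E3 | q.2 ∈ A} (fun k u => T k (‖u‖ ^ 2)) :=
      hT.comp hW h1 fun q hq => hq
    exact h2.bilin hW (ContinuousLinearMap.id ℝ (E3 →L[ℝ] E3)) FamS.id
  have hTd : ∀ k u, u ∈ A → DifferentiableAt ℝ (T k) (‖u‖ ^ 2) := fun k u hu =>
    hT.differentiableAt (q := (k, ‖u‖ ^ 2)) hu
  obtain ⟨η', h1, h2⟩ := exists_pullback hN hinj hCc hCA hη hFam
    (fun k u hu => by
      change ‖twist (T k) u‖ ^ 2 ∈ J
      rw [norm_twist (hTn k)]; exact hu)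
    (fun k u hu => injective_fderiv_twist (hTd k u hu) (hTn k))
    (fun k u hu huC => by
      rw [twist, hTid k _ hu (by positivity) huC]; rfl)
  refine ⟨η', h1, h2, fun k hk => ?_⟩
  have e : ∀ u ∈ A, twist (T k) =ᶠ[𝓝 u] id := fun u hu => by
    filter_upwards [hN.isOpen.mem_nhds hu] with x hx
    rw [twist, hk _ hx]; rfl
  refine ContactStructure.ext_of_pb hN (fun u hu => ?_)
    fun y hy => h2 k y fun hc => hy (image_mono hCA hc)
  rw [h1 k u hu, (e u hu).fderiv_eq, (e u hu).eq_of_nhds, fderiv_id]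
  rfl

/-- A smooth cut-off function, equal to `1` on `(-∞, a]` and to `0` on `[b, ∞)`. -/
def cutoff (a b s : ℝ) : ℝ := Real.smoothTransition ((b - s) / (b - a))

theorem contDiff_cutoff (a b : ℝ) : ContDiff ℝ ∞ (cutoff a b) := by
  unfold cutoff
  exact Real.smoothTransition.contDiff.comp (by fun_prop)

theorem cutoff_eq_one {a b s : ℝ} (hab : a < b) (hs : s ≤ a) : cutoff a b s = 1 :=
  Real.smoothTransition.one_of_one_le ((one_le_div (by linarith)).2 (by linarith))

theorem cutoff_eq_zero {a b s : ℝ} (hab : a < b) (hs : b ≤ s) : cutoff a b s = 0 :=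
  Real.smoothTransition.zero_of_nonpos (div_nonpos_of_nonpos_of_nonneg (by linarith) (by linarith))

theorem cutoff_nonneg (a b s : ℝ) : 0 ≤ cutoff a b s := Real.smoothTransition.nonneg _

theorem cutoff_le_one (a b s : ℝ) : cutoff a b s ≤ 1 := Real.smoothTransition.le_one _

theorem DarbouxBall.exists_collar_sq {ξ : ContactStructure Y} (B : DarbouxBall ξ) :
    ∃ R : ℝ, 1 < R ∧ ImmOn B.toFun {u | ‖u‖ ^ 2 ∈ Iio R} ∧ InjOn B.toFun {u | ‖u‖ ^ 2 ∈ Iio R} := by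
  obtain ⟨ε, hε, h1, h2⟩ := B.exists_collar
  have : {u : E3 | ‖u‖ ^ 2 ∈ Iio ((1 + ε) ^ 2)} = ball 0 (1 + ε) := by
    ext u
    simp only [mem_Iio, mem_ofPred_eq, mem_ball_zero_iff]
    exact sq_lt_sq₀ (norm_nonneg _) (by linarith)
  exact ⟨(1 + ε) ^ 2, by nlinarith, by rw [this]; exact h1, by rw [this]; exact h2⟩

theorem zero_mem_Iio {R : ℝ} (hR : 1 < R) : (0 : E3) ∈ {u : E3 | ‖u‖ ^ 2 ∈ Iio R} := by
  simp; linarith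

theorem norm_normalB {ξ : ContactStructure Y} (B : DarbouxBall ξ) (η : ContactStructure Y) :
    IsHalfSpace (pb B.toFun η.pos 0) := by
  obtain ⟨R, hR, h1, h2⟩ := B.exists_collar_sq
  obtain ⟨W, -, hq, -, H⟩ := (halfFam_of_continuous (K := Unit) (η := fun _ => η)
    continuous_const h1 (zero_mem_Iio hR) ()).normal
  exact (H _ hq).1

theorem continuous_normalB {ξ : ContactStructure Y} (B : DarbouxBall ξ) :
    Continuous (normalB B) := by
  rw [continuous_iff_continuousAt]
  intro η
  obtain ⟨R, hR, h1, h2⟩ := B.exists_collar_sq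
  obtain ⟨W, hW, hq, hF, -⟩ := (halfFam_of_continuous (K := ContactStructure Y) (η := fun η => η)
    continuous_id h1 (zero_mem_Iio hR) η).normal
  have := hF.continuousOn.continuousAt (hW.mem_nhds hq)
  exact ContinuousAt.comp (f := fun η : ContactStructure Y => (η, (0 : E3))) this
    (by fun_prop)

/-- Moving the plane at the centre of a Darboux ball by rotations. The plane is unchanged wherever
it already is in the prescribed position. -/
theorem exists_move_normal {ξ : ContactStructure Y} (B : DarbouxBall ξ)
    (η : C(K, ContactStructure Y)) {g : K → E3} (hg : Continuous g) (hg1 : ∀ k, ‖g k‖ = 1)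
    (hgn : ∀ k, -1 < inner ℝ (g k) (normalB B (η k))) :
    ∃ η' : C(K, ContactStructure Y), (∀ k, normalB B (η' k) = g k) ∧
      ∀ k, normalB B (η k) = g k → η' k = η k := by
  obtain ⟨R, hR, h1, h2⟩ := B.exists_collar_sq
  obtain ⟨b, hb1, hbR⟩ := exists_between hR
  have hn : ∀ k, ‖normalB B (η k)‖ = 1 := fun k => norm_unitNormal (norm_normalB B _)
  set n : K → E3 := fun k => normalB B (η k) with hnd
  have hnc : Continuous n := (continuous_normalB B).comp η.continuous
  -- the rotation of angle depending on the radius, from `g` to `n`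
  set Q : K → ℝ → ℝ × E3 := fun k s => (1 + inner ℝ (g k) (n k), cutoff 1 b s • cross (g k) (n k))
    with hQ
  have hQ0 : ∀ k s, Q k s ≠ 0 := fun k s h => by
    have h' := congrArg Prod.fst h
    have := hgn k
    simp only [hQ, Prod.fst_zero] at h'
    linarith
  have hW : IsOpen {q : K × ℝ | q.2 ∈ Iio R} := isOpen_Iio.preimage continuous_snd
  have hcc : Continuous fun k => cross (g k) (n k) := by
    unfold cross
    fun_prop
  have hQF : FamS {q : K × ℝ | q.2 ∈ Iio R} Q := by
    refine FamS.of_contDiffOn_param (P := ℝ × E3)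
      (p := fun k => (1 + inner ℝ (g k) (n k), cross (g k) (n k)))
      (f := fun x : (ℝ × E3) × ℝ => (x.1.1, cutoff 1 b x.2 • x.1.2)) ?_ hW isOpen_univ
      (ContDiff.contDiffOn ?_) fun _ _ => mem_univ _
    · exact (continuous_const.add (hg.inner hnc)).prodMk hcc
    · have := contDiff_cutoff 1 b
      fun_prop
  obtain ⟨η', H1, H2, H3⟩ := exists_twist (a := -1) (b := b) h1 h2
    (fun s _ hs => lt_of_le_of_lt hs.2 hbR) η.continuous
    (T := fun k s => qrot (Q k s))
    (hQF.comp_contDiffOn hW isOpen_compl_singleton contDiffOn_qrot fun q _ => hQ0 _ _)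
    (fun k s v => norm_qrot (hQ0 k s) v)
    (fun k s hs h0 hsb => by
      have h : b ≤ s := by
        by_contra h'
        exact hsb ⟨by linarith, (not_le.1 h').le⟩
      simp only [hQ]
      rw [cutoff_eq_zero hb1 h, zero_smul]
      exact qrot_real (by have := hgn k; linarith))
  refine ⟨η', fun k => ?_, fun k hk => H3 k fun s _ => ?_⟩
  · have hd : DifferentiableAt ℝ (fun s => qrot (Q k s)) (‖(0 : E3)‖ ^ 2) :=
      (hQF.comp_contDiffOn hW isOpen_compl_singleton contDiffOn_qrot
        fun q _ => hQ0 _ _).differentiableAt (q := (k, ‖(0 : E3)‖ ^ 2)) (by simp; linarith)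
    have e0 : Q k 0 = (1 + inner ℝ (g k) (n k), cross (g k) (n k)) := by
      simp only [hQ]
      rw [cutoff_eq_one hb1 zero_le_one, one_smul]
    rw [normalB, H1 k 0 (zero_mem_Iio hR)]
    have e1 : twist (fun s => qrot (Q k s)) 0 = 0 := map_zero _
    have e2 : ∀ v, fderiv ℝ (twist (fun s => qrot (Q k s))) 0 v = qrot (Q k 0) v := fun v => by
      rw [fderiv_twist_apply hd]; simp
    refine (unitNormal_eq (m := g k) (by rw [← norm_ne_zero_iff, hg1]; simp) ?_).trans
      (by rw [hg1]; simp)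
    ext v
    rw [mem_preimage, e2, e1, mem_iff_inner_unitNormal (norm_normalB B (η k))]
    change 0 < inner ℝ (n k) (qrot (Q k 0) v) ↔ _
    -- at the centre, the twist has derivative `qrot (Q k 0)`, which rotates `g k` to `n k`
    have e3 : n k = qrot (Q k 0) (g k) := by
      rw [e0, qrot_between (hg1 k) (hn k) (hgn k)]
    rw [e3, inner_of_norm_eq (norm_qrot (hQ0 k 0))]
    rfl
  · have hk' : n k = g k := hk
    simp only [hQ, hk', cross_self, smul_zero]
    refine qrot_real ?_
    rw [real_inner_self_eq_norm_sq, hg1]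
    norm_num

end TwistFamily

/-! ### Making contact structures standard near a point -/

section Cutoff

theorem exists_bound_deriv_smoothTransition : ∃ M : ℝ, 0 < M ∧
    ∀ x, |deriv Real.smoothTransition x| ≤ M := by
  have hc : Continuous (deriv Real.smoothTransition) :=
    (Real.smoothTransition.contDiff (n := 1)).continuous_deriv le_rfl
  obtain ⟨M, hM⟩ := (isCompact_Icc (a := (0 : ℝ)) (b := 1)).exists_bound_of_continuousOn
    hc.continuousOn
  refine ⟨max M 1, by positivity, fun x => ?_⟩
  by_cases hx : x ∈ Icc (0 : ℝ) 1
  · exact (hM x hx).trans (le_max_left _ _)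
  · have h0 : deriv Real.smoothTransition x = 0 := by
      rw [mem_Icc, not_and_or, not_le, not_le] at hx
      rcases hx with hx | hx
      · have : Real.smoothTransition =ᶠ[𝓝 x] fun _ => 0 := by
          filter_upwards [Iio_mem_nhds hx] with y hy
            using Real.smoothTransition.zero_of_nonpos (le_of_lt hy)
        rw [this.deriv_eq, deriv_const]
      · have : Real.smoothTransition =ᶠ[𝓝 x] fun _ => 1 := by
          filter_upwards [Ioi_mem_nhds hx] with y hy
            using Real.smoothTransition.one_of_one_le (le_of_lt hy)
        rw [this.deriv_eq, deriv_const]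
    rw [h0, abs_zero]
    positivity

/-- A logarithmic cut-off function: its gradient is at most `κ / ‖u‖`, with `κ` as small as one
wants. -/
theorem exists_log_cutoff {κ r : ℝ} (hκ : 0 < κ) (hr : 0 < r) :
    ∃ (χ : E3 → ℝ) (δ : ℝ), 0 < δ ∧ δ < r ∧ ContDiff ℝ ∞ χ ∧ (∀ u, ‖u‖ ≤ δ → χ u = 1) ∧
      (∀ u, r ≤ ‖u‖ → χ u = 0) ∧ (∀ u, χ u ∈ Icc (0 : ℝ) 1) ∧
      ∀ u, ‖fderiv ℝ χ u‖ * ‖u‖ ≤ κ := by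
  obtain ⟨M, hM0, hM⟩ := exists_bound_deriv_smoothTransition
  -- the cutoff is a smooth function of `c (log r - log ‖u‖)`, which is `0` for `‖u‖ = r` and `1`
  -- for `‖u‖ = δ`; its gradient is at most `M c / ‖u‖`
  set c : ℝ := κ / M with hc
  have hc0 : 0 < c := by positivity
  set δ : ℝ := r * Real.exp (-(1 / c)) with hδ
  have hδ0 : 0 < δ := by positivity
  have hδr : δ < r := by
    have : Real.exp (-(1 / c)) < 1 := Real.exp_lt_one_iff.2 (by simp; positivity)
    nlinarith
  have hlδ : Real.log δ = Real.log r - 1 / c := by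
    rw [hδ, Real.log_mul hr.ne' (Real.exp_pos _).ne', Real.log_exp]; ring
  set g : E3 → ℝ := fun u => Real.smoothTransition (c * (Real.log r - Real.log ‖u‖)) with hg
  have hg1 : ∀ u, u ≠ 0 → ‖u‖ ≤ δ → g u = 1 := fun u hu hud => by
    apply Real.smoothTransition.one_of_one_le
    have h1 := Real.log_le_log (norm_pos_iff.2 hu) hud
    rw [hlδ] at h1
    have h2 : 1 / c ≤ Real.log r - Real.log ‖u‖ := by linarith
    rwa [div_le_iff₀' hc0] at h2
  have hg0 : ∀ u, r ≤ ‖u‖ → g u = 0 := fun u hu => by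
    apply Real.smoothTransition.zero_of_nonpos
    have h1 := Real.log_le_log hr hu
    nlinarith
  have hgd : ∀ u : E3, u ≠ 0 → ContDiffAt ℝ ∞ g u := fun u hu => by
    have h1 : ContDiffAt ℝ ∞ (fun u : E3 => c * (Real.log r - Real.log ‖u‖)) u :=
      contDiffAt_const.mul (contDiffAt_const.sub
        ((contDiffAt_norm ℝ hu).log (norm_ne_zero_iff.2 hu)))
    exact Real.smoothTransition.contDiff.contDiffAt.comp u h1
  classical
  let χ : E3 → ℝ := fun u => if ‖u‖ ≤ δ then 1 else g u
  have hχ1 : ∀ u, ‖u‖ ≤ δ → χ u = 1 := fun u hu => if_pos hu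
  have hχg : ∀ u, u ≠ 0 → χ u = g u := fun u hu => by
    by_cases h : ‖u‖ ≤ δ
    · rw [hχ1 u h, hg1 u hu h]
    · exact if_neg h
  have hχe : ∀ u, u ≠ 0 → χ =ᶠ[𝓝 u] g := fun u hu => by
    filter_upwards [isOpen_compl_singleton.mem_nhds hu] with x hx using hχg x hx
  have hχe0 : χ =ᶠ[𝓝 0] fun _ => 1 := by
    filter_upwards [ball_mem_nhds (0 : E3) hδ0] with x hx using
      hχ1 x (by simpa using (mem_ball_zero_iff.1 hx).le)
  refine ⟨χ, δ, hδ0, hδr, ?_, hχ1, fun u hu => ?_, fun u => ?_, fun u => ?_⟩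
  · rw [contDiff_iff_contDiffAt]
    intro u
    by_cases hu : u = 0
    · subst hu
      exact contDiffAt_const.congr_of_eventuallyEq hχe0
    · exact (hgd u hu).congr_of_eventuallyEq (hχe u hu)
  · have : ¬ ‖u‖ ≤ δ := by linarith
    exact (if_neg this).trans (hg0 u hu)
  · by_cases h : ‖u‖ ≤ δ
    · rw [hχ1 u h]; simp
    · have : χ u = g u := if_neg h
      rw [this]
      exact ⟨Real.smoothTransition.nonneg _, Real.smoothTransition.le_one _⟩
  · by_cases hu : u = 0
    · subst hu; simp [hκ.le]
    · have hu' : 0 < ‖u‖ := norm_pos_iff.2 hu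
      have hn : DifferentiableAt ℝ (fun x : E3 => ‖x‖) u :=
        (contDiffAt_norm ℝ (n := 1) hu).differentiableAt (by norm_num)
      have hnb : ‖fderiv ℝ (fun x : E3 => ‖x‖) u‖ ≤ 1 := by
        have := norm_fderiv_le_of_lipschitz ℝ (f := fun x : E3 => ‖x‖) (x₀ := u)
          lipschitzWith_one_norm
        simpa using this
      have h1 : HasFDerivAt (fun x : E3 => c * (Real.log r - Real.log ‖x‖))
          (c • -(‖u‖⁻¹ • fderiv ℝ (fun x : E3 => ‖x‖) u)) u :=
        ((hn.hasFDerivAt.log hu'.ne').const_sub _).const_mul c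
      have hS : HasDerivAt Real.smoothTransition
          (deriv Real.smoothTransition (c * (Real.log r - Real.log ‖u‖)))
          (c * (Real.log r - Real.log ‖u‖)) :=
        ((Real.smoothTransition.contDiff (n := 1)).differentiable (by norm_num) _).hasDerivAt
      have h2 := hS.comp_hasFDerivAt u h1
      rw [(hχe u hu).fderiv_eq]
      have h3 : fderiv ℝ g u = _ := h2.fderiv
      rw [h3, norm_smul, norm_smul, norm_neg, norm_smul, norm_inv, norm_norm,
        Real.norm_of_nonneg hc0.le]
      have h4 := hM (c * (Real.log r - Real.log ‖u‖))
      calc _ = ‖deriv Real.smoothTransition (c * (Real.log r - Real.log ‖u‖))‖ * c *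
            ‖fderiv ℝ (fun x : E3 => ‖x‖) u‖ := by field_simp
        _ ≤ M * c * 1 := by
            gcongr
            exact h4
        _ = κ := by rw [hc]; field_simp

end Cutoff

section Standardize

/-- The coefficient vector of the standard contact form. -/
def stdVec (u : E3) : E3 := !₂[-(1 / 2) * u 1, (1 / 2) * u 0, 1]

theorem inner_stdVec (u v : E3) : inner ℝ (stdVec u) v = stdForm u v := by
  rw [inner_coords]; simp [stdVec, stdForm]; ring

theorem stdVec_ne_zero (u : E3) : stdVec u ≠ 0 := fun h => by
  have := congrArg (fun v : E3 => v 2) h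
  simp [stdVec] at this

theorem contDiff_stdVec : ContDiff ℝ ∞ stdVec := by
  rw [contDiff_euclidean]
  intro i
  fin_cases i <;> simp [stdVec] <;> fun_prop

/-- The contact volume of the covector field dual to a vector field with value `v` and derivative
`L`. -/
def volV (v : E3) (L : E3 →L[ℝ] E3) : ℝ :=
  v 0 * (L (stdE 1) 2 - L (stdE 2) 1) + v 1 * (L (stdE 2) 0 - L (stdE 0) 2) +
    v 2 * (L (stdE 0) 1 - L (stdE 1) 0)

theorem contactVol_covec {V : E3 → E3} {u : E3} (hV : DifferentiableAt ℝ V u) :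
    contactVol (fun x => covec (V x)) u = volV (V u) (fderiv ℝ V u) := by
  have : fderiv ℝ (fun x => covec (V x)) u = (innerSL ℝ : E3 →L[ℝ] E3 →L[ℝ] ℝ).comp
      (fderiv ℝ V u) :=
    ((innerSL ℝ : E3 →L[ℝ] E3 →L[ℝ] ℝ).hasFDerivAt.comp u hV.hasFDerivAt).fderiv
  rw [contactVol, this]
  simp only [wedge, volV, ContinuousLinearMap.comp_apply, covec, innerSL_apply_apply, stdE,
    inner_coords]
  simp

theorem volV_add (v : E3) (L L' : E3 →L[ℝ] E3) : volV v (L + L') = volV v L + volV v L' := by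
  simp [volV]; ring

theorem volV_smul (v : E3) (c : ℝ) (L : E3 →L[ℝ] E3) : volV v (c • L) = c * volV v L := by
  simp [volV]; ring

theorem continuous_volV : Continuous fun p : E3 × (E3 →L[ℝ] E3) => volV p.1 p.2 := by
  unfold volV
  fun_prop

theorem hasFDerivAt_stdVec_apply (u v : E3) :
    fderiv ℝ stdVec u v = !₂[-(1 / 2) * v 1, (1 / 2) * v 0, 0] := by
  let L : E3 →L[ℝ] E3 := LinearMap.toContinuousLinearMap
    { toFun := fun v => !₂[-(1 / 2) * v 1, (1 / 2) * v 0, 0]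
      map_add' := fun v w => by apply E3_ext <;> simp <;> ring
      map_smul' := fun c v => by apply E3_ext <;> simp <;> ring }
  have h : stdVec = fun u => L u + !₂[0, 0, 1] := by
    funext u
    change stdVec u = !₂[-(1 / 2) * u 1, (1 / 2) * u 0, 0] + !₂[0, 0, 1]
    apply E3_ext <;> simp [stdVec]
  rw [h, fderiv_add_const, L.fderiv]
  rfl

theorem volV_stdVec (u : E3) : volV (stdVec u) (fderiv ℝ stdVec u) = 1 := by
  simp only [volV, hasFDerivAt_stdVec_apply]
  simp [stdVec, stdE]
  norm_num

theorem FamS.of_local {K : Type*} [TopologicalSpace K] {V : Type} [NormedAddCommGroup V]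
    [NormedSpace ℝ V] {W : Set (K × E3)} {F : K → E3 → V}
    (h : ∀ q ∈ W, ∃ W', IsOpen W' ∧ q ∈ W' ∧ FamS W' F) : FamS W F := by
  apply FamS.of_continuousOn_iteratedFDeriv
  · intro q hq
    obtain ⟨W', hW', hqW, hF⟩ := h q hq
    exact hF.contDiffAt hW' hqW
  · intro n q hq
    obtain ⟨W', hW', hqW, hF⟩ := h q hq
    exact ((hF n).continuousOn_iteratedFDeriv.continuousAt (hW'.mem_nhds hqW)).continuousWithinAt

variable {Y : Type*} [TopologicalSpace Y] [ChartedSpace E3 Y] {K : Type*} [TopologicalSpace K]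

theorem norm_stdVec_zero : ‖stdVec 0‖ = 1 := by
  rw [← sq_eq_sq₀ (norm_nonneg _) zero_le_one, norm_sq_coords]; simp [stdVec]

theorem setOf_stdForm (u : E3) : {v : E3 | 0 < stdForm u v} = {v | 0 < inner ℝ (stdVec u) v} := by
  simp only [inner_stdVec]

theorem normalB_self {ξ : ContactStructure Y} (B : DarbouxBall ξ) :
    normalB B ξ = stdVec 0 := by
  rw [normalB, unitNormal_eq (stdVec_ne_zero 0) ((B.pb_eq (by simp)).trans (setOf_stdForm 0)),
    norm_stdVec_zero]
  simp

/-- The continuous family `m` of vector fields on `A` stays contact when it is interpolated with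
`stdVec` by a function whose gradient contributes little. -/
theorem exists_radius_interpolation [CompactSpace K] {A : Set E3} (hA : IsOpen A) (h0 : 0 ∈ A)
    {m : K → E3 → E3} (hm : FamS {q | q.2 ∈ A} m) (hm0 : ∀ k, m k 0 = stdVec 0)
    (hvol : ∀ k, 0 < volV (m k 0) (fderiv ℝ (m k) 0)) :
    ∃ r > 0, (∀ u : E3, ‖u‖ < r → u ∈ A) ∧
      ∀ (k : K) (c : ℝ) (u : E3) (L : E3 →L[ℝ] E3), c ∈ Icc (0 : ℝ) 1 →
      ‖u‖ < r → ‖L‖ < r → 0 < volV (m k u + c • (stdVec u - m k u))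
        (fderiv ℝ (m k) u + c • (fderiv ℝ stdVec u - fderiv ℝ (m k) u) + L) := by
  set Φ : (K × ℝ) × (E3 × (E3 →L[ℝ] E3)) → ℝ := fun x =>
    volV (m x.1.1 x.2.1 + x.1.2 • (stdVec x.2.1 - m x.1.1 x.2.1))
      (fderiv ℝ (m x.1.1) x.2.1 + x.1.2 • (fderiv ℝ stdVec x.2.1 - fderiv ℝ (m x.1.1) x.2.1)
        + x.2.2) with hΦ
  set D : Set ((K × ℝ) × (E3 × (E3 →L[ℝ] E3))) := {x | x.2.1 ∈ A} with hD
  have hDo : IsOpen D := hA.preimage (by fun_prop)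
  have hΦc : ContinuousOn Φ D := by
    have h1 : ContinuousOn (fun x : (K × ℝ) × (E3 × (E3 →L[ℝ] E3)) => m x.1.1 x.2.1) D :=
      ContinuousOn.comp (f := fun x : (K × ℝ) × (E3 × (E3 →L[ℝ] E3)) => (x.1.1, x.2.1))
        hm.continuousOn (by fun_prop) fun x hx => hx
    have h2 : ContinuousOn (fun x : (K × ℝ) × (E3 × (E3 →L[ℝ] E3)) =>
        fderiv ℝ (m x.1.1) x.2.1) D :=
      ContinuousOn.comp (g := fun q : K × E3 => fderiv ℝ (m q.1) q.2)
        (f := fun x : (K × ℝ) × (E3 × (E3 →L[ℝ] E3)) => (x.1.1, x.2.1))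
        hm.fderiv.continuousOn (by fun_prop) fun x hx => hx
    have h3 : ContinuousOn (fun x : (K × ℝ) × (E3 × (E3 →L[ℝ] E3)) => stdVec x.2.1) D :=
      (contDiff_stdVec.continuous.comp (by fun_prop)).continuousOn
    have h4 : ContinuousOn (fun x : (K × ℝ) × (E3 × (E3 →L[ℝ] E3)) => fderiv ℝ stdVec x.2.1) D :=
      ((contDiff_stdVec.continuous_fderiv (by simp)).comp (by fun_prop)).continuousOn
    have h5 : ContinuousOn (fun x : (K × ℝ) × (E3 × (E3 →L[ℝ] E3)) => x.1.2) D :=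
      Continuous.continuousOn (by fun_prop)
    have h6 : ContinuousOn (fun x : (K × ℝ) × (E3 × (E3 →L[ℝ] E3)) => x.2.2) D :=
      Continuous.continuousOn (by fun_prop)
    exact continuous_volV.comp_continuousOn
      ((h1.add (h5.smul (h3.sub h1))).prodMk ((h2.add (h5.smul (h4.sub h2))).add h6))
  have hO : IsOpen (D ∩ Φ ⁻¹' Ioi 0) := hΦc.isOpen_inter_preimage hDo isOpen_Ioi
  -- for `u = 0` and `L = 0`, the volume is a convex combination of two positive numbers
  have hsub : (univ ×ˢ Icc (0 : ℝ) 1 : Set (K × ℝ)) ×ˢ {((0 : E3), (0 : E3 →L[ℝ] E3))} ⊆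
      D ∩ Φ ⁻¹' Ioi 0 := by
    rintro ⟨⟨k, c⟩, u, L⟩ ⟨⟨-, hc⟩, hu⟩
    simp only [mem_singleton_iff, Prod.mk.injEq] at hu
    obtain ⟨rfl, rfl⟩ := hu
    refine ⟨h0, ?_⟩
    change 0 < volV _ _
    simp only [hm0, sub_self, smul_zero, add_zero, volV_add, volV_smul, sub_eq_add_neg]
    have e1 := hvol k
    have e2 := volV_stdVec 0
    rw [hm0] at e1
    have e3 : volV (stdVec 0) (-fderiv ℝ (m k) 0) = -volV (stdVec 0) (fderiv ℝ (m k) 0) := by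
      rw [← neg_one_smul ℝ, volV_smul]; ring
    rw [e3, e2]
    obtain ⟨hc0, hc1⟩ := hc
    simp only at hc0 hc1
    rcases hc0.eq_or_lt with h | h
    · rw [← h]; simpa using e1
    · nlinarith
  -- by compactness, it is positive for all small `u` and `L`
  obtain ⟨U₁, U₂, -, hU₂, hs1, hs2, hUU⟩ := generalized_tube_lemma
    (isCompact_univ.prod isCompact_Icc) isCompact_singleton hO hsub
  obtain ⟨r, hr, hrU⟩ := Metric.isOpen_iff.1 hU₂ _ (hs2 rfl)
  obtain ⟨r', hr', hrA⟩ := Metric.isOpen_iff.1 hA _ h0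
  refine ⟨min r r', lt_min hr hr', fun u hu => hrA (by
    simpa using hu.trans_le (min_le_right _ _)), fun k c u L hc hu hL => ?_⟩
  have hmem : ((k, c), (u, L)) ∈ U₁ ×ˢ U₂ :=
    ⟨hs1 ⟨mem_univ _, hc⟩, hrU (by
      rw [mem_ball, Prod.dist_eq]
      simpa using ⟨hu.trans_le (min_le_left _ _), hL.trans_le (min_le_left _ _)⟩)⟩
  exact (hUU hmem).2

/-- Two continuous families that agree at `0` are at distance `O(‖u‖)`, uniformly in a compact set
of parameters. -/
theorem exists_bound_sub [CompactSpace K] {A : Set E3} {m : K → E3 → E3}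
    (hm : FamS {q | q.2 ∈ A} m) (hm0 : ∀ k, m k 0 = stdVec 0) {ρ : ℝ} (hρ : 0 < ρ)
    (hρA : closedBall 0 ρ ⊆ A) :
    ∃ M : ℝ, 0 < M ∧ ∀ k u, ‖u‖ ≤ ρ → ‖stdVec u - m k u‖ ≤ M * ‖u‖ := by
  have hcomp : IsCompact ((univ : Set K) ×ˢ closedBall (0 : E3) ρ) :=
    isCompact_univ.prod (isCompact_closedBall _ _)
  have hsd : Differentiable ℝ stdVec := contDiff_stdVec.differentiable (by simp)
  have hmd : ∀ k, ∀ u ∈ A, DifferentiableAt ℝ (m k) u := fun k u hu =>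
    hm.differentiableAt (q := (k, u)) hu
  have hc : ContinuousOn (fun q : K × E3 => fderiv ℝ stdVec q.2 - fderiv ℝ (m q.1) q.2)
      ((univ : Set K) ×ˢ closedBall (0 : E3) ρ) := by
    have h4 : Continuous (fderiv ℝ stdVec) := contDiff_stdVec.continuous_fderiv (by simp)
    exact (h4.comp continuous_snd).continuousOn.sub
      (hm.fderiv.continuousOn.mono fun q hq => hρA hq.2)
  obtain ⟨M, hM⟩ := hcomp.exists_bound_of_continuousOn hc
  refine ⟨max M 1, by positivity, fun k u hu => ?_⟩
  have := (convex_closedBall (0 : E3) ρ).norm_image_sub_le_of_norm_fderiv_le (𝕜 := ℝ)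
    (f := fun u => stdVec u - m k u) (C := max M 1) (x := 0) (y := u)
    (fun x hx => (hsd x).sub (hmd k x (hρA hx)))
    (fun x hx => by
      rw [fderiv_fun_sub (hsd x) (hmd k x (hρA hx))]
      exact (hM (k, x) ⟨mem_univ _, hx⟩).trans (le_max_left _ _))
    (by simp [hρ.le]) (by simpa using hu)
  simpa [hm0] using this

/-- Interpolation of a continuous family of contact forms with the standard one near a point, by
means of a logarithmic cut-off function. -/
theorem exists_interpolation [CompactSpace K] {A : Set E3} (hA : IsOpen A) (h0 : 0 ∈ A)
    {m : K → E3 → E3} (hm : FamS {q | q.2 ∈ A} m) (hm0 : ∀ k, m k 0 = stdVec 0)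
    (hvol : ∀ k, 0 < volV (m k 0) (fderiv ℝ (m k) 0)) :
    ∃ (χ : E3 → ℝ) (δ ρ r : ℝ), 0 < δ ∧ δ < ρ ∧ ρ < r ∧ ρ < 1 ∧ ContDiff ℝ ∞ χ ∧
      (∀ u : E3, ‖u‖ < r → u ∈ A) ∧ (∀ u, ‖u‖ ≤ δ → χ u = 1) ∧ (∀ u, ρ ≤ ‖u‖ → χ u = 0) ∧
      FamS {q : K × E3 | q.2 ∈ A} (fun k u => m k u + χ u • (stdVec u - m k u)) ∧
      ∀ k u, ‖u‖ < r → contactVol (fun x => covec (m k x + χ x • (stdVec x - m k x))) u ≠ 0 := by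
  have hW : IsOpen {q : K × E3 | q.2 ∈ A} := hA.preimage continuous_snd
  have hsd : Differentiable ℝ stdVec := contDiff_stdVec.differentiable (by simp)
  have hmd : ∀ k, ∀ u ∈ A, DifferentiableAt ℝ (m k) u := fun k u hu =>
    hm.differentiableAt (q := (k, u)) hu
  obtain ⟨r, hr0, hrA, hr⟩ := exists_radius_interpolation hA h0 hm hm0 hvol
  set ρ : ℝ := min (r / 2) (1 / 2) with hρ
  have hρ0 : 0 < ρ := by positivity
  have hρr : ρ < r := (min_le_left _ _).trans_lt (by linarith)
  have hρ1 : ρ < 1 := (min_le_right _ _).trans_lt (by norm_num)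
  obtain ⟨M, hM0, hM⟩ := exists_bound_sub hm hm0 hρ0 fun u hu =>
    hrA u ((mem_closedBall_zero_iff.1 hu).trans_lt hρr)
  -- the two families differ by at most `M ‖u‖`, so the gradient of the cutoff contributes at most
  -- `κ / ‖u‖ * (M ‖u‖) = r / 2` to the derivative
  obtain ⟨χ, δ, hδ0, hδρ, hχd, hχ1, hχ0, hχI, hχb⟩ :=
    exists_log_cutoff (κ := r / (2 * M)) (r := ρ) (by positivity) hρ0
  have hVF : FamS {q : K × E3 | q.2 ∈ A} (fun k u => m k u + χ u • (stdVec u - m k u)) := by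
    have h1 : FamS {q : K × E3 | q.2 ∈ A} (fun (_ : K) u => χ u) :=
      (FamS.of_contDiffOn isOpen_univ hχd.contDiffOn).mono fun _ _ => mem_univ _
    have h2 : FamS {q : K × E3 | q.2 ∈ A} (fun (_ : K) u => stdVec u) :=
      (FamS.of_contDiffOn isOpen_univ contDiff_stdVec.contDiffOn).mono fun _ _ => mem_univ _
    have h3 : FamS {q : K × E3 | q.2 ∈ A} (fun k u => stdVec u - m k u) := by
      have h4 : FamS {q : K × E3 | q.2 ∈ A} (fun k u => -m k u) :=
        hm.comp_contDiffOn hW (f := fun v : E3 => -v) isOpen_univ contDiff_neg.contDiffOn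
          fun _ _ => mem_univ _
      simpa only [sub_eq_add_neg] using h2.add hW h4
    exact hm.add hW (h1.bilin hW (ContinuousLinearMap.lsmul ℝ ℝ) h3)
  refine ⟨χ, δ, ρ, r, hδ0, hδρ, hρr, hρ1, hχd, hrA, hχ1, hχ0, hVF, fun k u hu => ?_⟩
  have huA := hrA u hu
  rw [contactVol_covec (hVF.differentiableAt (q := (k, u)) huA)]
  have hχdu : DifferentiableAt ℝ χ u := hχd.differentiable (by simp) u
  have hder : fderiv ℝ (fun u => m k u + χ u • (stdVec u - m k u)) u =
      fderiv ℝ (m k) u + χ u • (fderiv ℝ stdVec u - fderiv ℝ (m k) u)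
      + (fderiv ℝ χ u).smulRight (stdVec u - m k u) := by
    rw [add_assoc]
    exact ((hmd k u huA).hasFDerivAt.add (hχdu.hasFDerivAt.smul
      ((hsd u).hasFDerivAt.sub (hmd k u huA).hasFDerivAt))).fderiv
  rw [hder]
  refine (hr k (χ u) u _ (hχI u) hu ?_).ne'
  rw [ContinuousLinearMap.norm_smulRight_apply]
  by_cases hur : ‖u‖ ≤ ρ
  · calc _ ≤ ‖fderiv ℝ χ u‖ * (M * ‖u‖) := by gcongr; exact hM k u hur
      _ = M * (‖fderiv ℝ χ u‖ * ‖u‖) := by ring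
      _ ≤ M * (r / (2 * M)) := by gcongr; exact hχb u
      _ = r / 2 := by field_simp
      _ < r := by linarith
  · have : χ =ᶠ[𝓝 u] fun _ => 0 := by
      have ho : IsOpen {x : E3 | ρ < ‖x‖} := isOpen_lt continuous_const continuous_norm
      filter_upwards [ho.mem_nhds (not_le.1 hur)] with x hx using hχ0 x (le_of_lt hx)
    rw [this.fderiv_eq]
    simpa using hr0

theorem norm_stdVec_pos (u : E3) : 0 < ‖stdVec u‖ := norm_pos_iff.2 (stdVec_ne_zero u)

theorem contDiff_norm_stdVec : ContDiff ℝ ∞ fun u => ‖stdVec u‖ :=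
  contDiff_stdVec.norm ℝ stdVec_ne_zero

/-- The normal field of a contact structure in Darboux coordinates, scaled so as to be equal to
`stdVec` for the standard contact structure. -/
def scaledNormal {ξ : ContactStructure Y} (B : DarbouxBall ξ) (η : ContactStructure Y) (u : E3) :
    E3 :=
  ‖stdVec u‖ • unitNormal (pb B.toFun η.pos u)

theorem scaledNormal_eq_of_std {ξ : ContactStructure Y} (B : DarbouxBall ξ)
    {η : ContactStructure Y} {u : E3} (h : pb B.toFun η.pos u = {v | 0 < stdForm u v}) :
    scaledNormal B η u = stdVec u := by
  rw [scaledNormal, unitNormal_eq (stdVec_ne_zero u) (h.trans (setOf_stdForm u)), smul_smul,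
    mul_inv_cancel₀ (norm_stdVec_pos u).ne', one_smul]

theorem pb_eq_std_of_agree {ξ : ContactStructure Y} (B : DarbouxBall ξ)
    {η : ContactStructure Y} (h : ∀ p ∈ B.image, η.pos p = ξ.pos p) {u : E3} (hu : ‖u‖ ≤ 1) :
    pb B.toFun η.pos u = {v | 0 < stdForm u v} := by
  have hu' : u ∈ closedBall (0 : E3) 1 := by simpa using hu
  rw [← B.pb_eq hu']
  exact pb_congr_field (h _ (mem_image_of_mem _ hu'))

variable [IsManifold (𝓡 3) ∞ Y]

theorem isHalfSpace_pb {N : E3 → Y} {A : Set E3} (hN : ImmOn N A) (η : ContactStructure Y)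
    {u : E3} (hu : u ∈ A) : IsHalfSpace (pb N η.pos u) := by
  obtain ⟨W, -, hq, -, H⟩ := (halfFam_of_continuous (K := Unit) (η := fun _ => η)
    continuous_const hN hu ()).normal
  exact (H _ hq).1

theorem pb_eq_scaledNormal {ξ : ContactStructure Y} (B : DarbouxBall ξ) {A : Set E3}
    (hN : ImmOn B.toFun A) (η : ContactStructure Y) {u : E3} (hu : u ∈ A) :
    pb B.toFun η.pos u = {v | 0 < inner ℝ (scaledNormal B η u) v} := by
  ext v
  rw [mem_iff_inner_unitNormal (isHalfSpace_pb hN η hu)]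
  simp only [scaledNormal, real_inner_smul_left, mem_ofPred_eq]
  exact (mul_pos_iff_of_pos_left (norm_stdVec_pos u)).symm

theorem famS_scaledNormal {ξ : ContactStructure Y} (B : DarbouxBall ξ) {A : Set E3}
    (hN : ImmOn B.toFun A) {η : K → ContactStructure Y} (hη : Continuous η) :
    FamS {q : K × E3 | q.2 ∈ A} (fun k => scaledNormal B (η k)) ∧
    ∀ k, ∀ u ∈ A, contactVol (fun x => covec (scaledNormal B (η k) x)) u ≠ 0 := by
  have hW : IsOpen {q : K × E3 | q.2 ∈ A} := hN.isOpen.preimage continuous_snd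
  have hloc := fun (q : K × E3) (hq : q.2 ∈ A) => (halfFam_of_continuous hη hN hq q.1).normal
  have hnF : FamS {q : K × E3 | q.2 ∈ A} (fun k u => unitNormal (pb B.toFun (η k).pos u)) :=
    FamS.of_local fun q hq => by
      obtain ⟨W, h1, h2, h3, -⟩ := hloc q hq
      exact ⟨W, h1, h2, h3⟩
  refine ⟨FamS.bilin hW (ContinuousLinearMap.lsmul ℝ ℝ)
    ((FamS.of_contDiffOn isOpen_univ contDiff_norm_stdVec.contDiffOn).mono fun _ _ => mem_univ _)
    hnF, fun k u hu => ?_⟩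
  have hnd : DifferentiableAt ℝ (fun u => unitNormal (pb B.toFun (η k).pos u)) u :=
    hnF.differentiableAt (q := (k, u)) hu
  have e : (fun x => covec (scaledNormal B (η k) x)) =
      fun x => ‖stdVec x‖ • covec (unitNormal (pb B.toFun (η k).pos x)) := by
    funext x; simp [scaledNormal, covec]
  rw [e, contactVol_smul (f := fun x => ‖stdVec x‖)
    (a := fun x => covec (unitNormal (pb B.toFun (η k).pos x)))
    (contDiff_norm_stdVec.differentiable (by simp) u)
    ((innerSL ℝ : E3 →L[ℝ] E3 →L[ℝ] ℝ).differentiableAt.comp u hnd)]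
  obtain ⟨W, h1, h2, h3, h4⟩ := hloc (k, u) hu
  exact mul_ne_zero (pow_ne_zero 2 (norm_stdVec_pos u).ne') (h4 _ h2).2

/-- In a connected family of contact structures, one of which is standard in a Darboux ball, all
induce the standard orientation at the centre. -/
theorem volV_scaledNormal_pos [PreconnectedSpace K] {ξ : ContactStructure Y} (B : DarbouxBall ξ)
    {A : Set E3} (hN : ImmOn B.toFun A) (h0 : 0 ∈ A) {η : K → ContactStructure Y}
    (hη : Continuous η) (k₀ : K) (hk₀ : ∀ p ∈ B.image, (η k₀).pos p = ξ.pos p) (k : K) :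
    0 < volV (scaledNormal B (η k) 0) (fderiv ℝ (scaledNormal B (η k)) 0) := by
  obtain ⟨hmF, hne⟩ := famS_scaledNormal B hN hη
  have hW : IsOpen {q : K × E3 | q.2 ∈ A} := hN.isOpen.preimage continuous_snd
  have hcont : Continuous fun k =>
      volV (scaledNormal B (η k) 0) (fderiv ℝ (scaledNormal B (η k)) 0) := by
    have h1 : Continuous fun k : K =>
        (scaledNormal B (η k) 0, fderiv ℝ (scaledNormal B (η k)) 0) := by
      rw [continuous_iff_continuousAt]
      intro k
      have h2 := (hmF.continuousOn.prodMk hmF.fderiv.continuousOn).continuousAt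
        (hW.mem_nhds (show (k, (0 : E3)) ∈ {q : K × E3 | q.2 ∈ A} from h0))
      exact ContinuousAt.comp (f := fun k : K => (k, (0 : E3))) h2 (by fun_prop)
    exact continuous_volV.comp h1
  have hpos : 0 < volV (scaledNormal B (η k₀) 0) (fderiv ℝ (scaledNormal B (η k₀)) 0) := by
    have e : scaledNormal B (η k₀) =ᶠ[𝓝 0] stdVec := by
      filter_upwards [ball_mem_nhds (0 : E3) one_pos] with u hu
      exact scaledNormal_eq_of_std B (pb_eq_std_of_agree B hk₀ (mem_ball_zero_iff.1 hu).le)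
    rw [e.fderiv_eq, e.eq_of_nhds, volV_stdVec]
    exact one_pos
  by_contra hk
  -- the volume depends continuously on `k` and never vanishes
  obtain ⟨k', -, hk'⟩ := isPreconnected_univ.intermediate_value (mem_univ k) (mem_univ k₀)
    hcont.continuousOn ⟨not_lt.1 hk, hpos.le⟩
  apply hne k' 0 h0
  rw [contactVol_covec (hmF.differentiableAt (q := (k', 0)) h0)]
  exact hk'

/-- Contact structures that agree with the standard one at the centre of a Darboux ball can be
deformed, continuously in parameters, so as to agree with it on a smaller ball; nothing happens to
those that agree with it on the Darboux ball. -/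
theorem exists_standardize [T2Space Y] [CompactSpace K] [PreconnectedSpace K]
    {ξ : ContactStructure Y}
    (B : DarbouxBall ξ) (η : C(K, ContactStructure Y)) (hη : ∀ k, normalB B (η k) = stdVec 0)
    (k₀ : K) (hk₀ : ∀ p ∈ B.image, (η k₀).pos p = ξ.pos p) :
    ∃ (η' : C(K, ContactStructure Y)) (δ : ℝ), 0 < δ ∧ δ < 1 ∧
      (∀ k u, ‖u‖ ≤ δ → pb B.toFun (η' k).pos u = {v | 0 < stdForm u v}) ∧
      ∀ k, (∀ p ∈ B.image, (η k).pos p = ξ.pos p) → η' k = η k := by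
  obtain ⟨R, hR, hN, hinj⟩ := B.exists_collar_sq
  set A : Set E3 := {u | ‖u‖ ^ 2 ∈ Iio R} with hA
  have h0A : (0 : E3) ∈ A := zero_mem_Iio hR
  have hW : IsOpen {q : K × E3 | q.2 ∈ A} := hN.isOpen.preimage continuous_snd
  set m : K → E3 → E3 := fun k => scaledNormal B (η k) with hm
  have hmF : FamS {q : K × E3 | q.2 ∈ A} m := (famS_scaledNormal B hN η.continuous).1
  have hmpb : ∀ k, ∀ u ∈ A, pb B.toFun (η k).pos u = {v | 0 < inner ℝ (m k u) v} :=
    fun k u hu => pb_eq_scaledNormal B hN _ hu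
  have hm0 : ∀ k, m k 0 = stdVec 0 := fun k => by
    have : unitNormal (pb B.toFun (η k).pos 0) = stdVec 0 := hη k
    simp only [hm, scaledNormal, this, norm_stdVec_zero, one_smul]
  obtain ⟨χ, δ, ρ, r, hδ0, hδρ, hρr, hρ1, hχd, hrA, hχ1, hχ0, hVF, hVvol⟩ :=
    exists_interpolation hN.isOpen h0A hmF hm0
      (volV_scaledNormal_pos B hN h0A η.continuous k₀ hk₀)
  -- interpolation of the normal fields; it equals `m k` wherever `m k` is already standard
  set V : K → E3 → E3 := fun k u => m k u + χ u • (stdVec u - m k u) with hV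
  have hVout : ∀ k u, ρ ≤ ‖u‖ → V k u = m k u := fun k u hu => by
    simp only [hV, hχ0 u hu, zero_smul, add_zero]
  have hCA : closedBall (0 : E3) ρ ⊆ A := fun u hu =>
    hrA u ((mem_closedBall_zero_iff.1 hu).trans_lt hρr)
  have hout : ∀ k, ∀ u ∈ A, ρ ≤ ‖u‖ → {v | 0 < covec (V k u) v} = pb B.toFun (η k).pos u :=
    fun k u hu hur => by
      rw [hVout _ _ hur, hmpb _ _ hu]
      rfl
  have hfam : ∀ k, ∀ u ∈ A, HalfFam (fun k u => {v | 0 < covec (V k u) v}) (k, u) := by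
    intro k u hu
    by_cases hur : ‖u‖ < r
    · have ho : IsOpen {q : K × E3 | ‖q.2‖ < r} := isOpen_lt (by fun_prop) continuous_const
      refine ⟨{q | ‖q.2‖ < r}, fun k u => covec (V k u), ho, hur, ?_,
        fun p hp => ⟨hVvol _ _ hp, rfl⟩⟩
      exact (hVF.mono fun q hq => hrA _ hq).comp_contDiffOn ho (f := covec) isOpen_univ
        (ContinuousLinearMap.contDiff (innerSL ℝ)).contDiffOn fun _ _ => mem_univ _
    · refine (halfFam_of_continuous η.continuous hN hu k).congr ?_
      have ho : IsOpen {q : K × E3 | ρ < ‖q.2‖} := isOpen_lt continuous_const (by fun_prop)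
      filter_upwards [hW.mem_nhds (show (k, u) ∈ {q : K × E3 | q.2 ∈ A} from hu),
        ho.mem_nhds (show (k, u) ∈ {q : K × E3 | ρ < ‖q.2‖} from
          lt_of_lt_of_le hρr (not_lt.1 hur))] with q hq1 hq2
      exact hout _ _ hq1 (le_of_lt hq2)
  obtain ⟨η', H1, H2⟩ := exists_glue hN hinj (isCompact_closedBall (0 : E3) ρ) hCA η.continuous
    hfam fun k u hu huC => hout k u hu (by
      by_contra h
      exact huC (by simpa using (not_le.1 h).le))
  refine ⟨η', δ, hδ0, hδρ.trans hρ1, fun k u hu => ?_, fun k hk => ?_⟩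
  · rw [H1 k u (hrA u (by linarith)), setOf_stdForm]
    simp only [hV, hχ1 u hu, one_smul, add_sub_cancel]
    rfl
  · refine ContactStructure.ext_of_pb hN (fun u hu => ?_) fun y hy => H2 k y fun hc => hy
      (image_mono hCA hc)
    rw [H1 k u hu]
    by_cases h : ρ ≤ ‖u‖
    · exact hout k u hu h
    · have e : m k u = stdVec u := scaledNormal_eq_of_std B (pb_eq_std_of_agree B hk (by linarith))
      rw [hmpb k u hu]
      simp only [hV, e, sub_self, smul_zero, add_zero]
      rfl

end Standardize

/-! ### Deforming families of contact structures into `𝒞(Y, ξ, B)` -/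

section Squeeze

theorem fderiv_coord {ψ : E3 → E3} {u : E3} (hd : DifferentiableAt ℝ ψ u) (v : E3) (i : Fin 3) :
    fderiv ℝ ψ u v i = fderiv ℝ (fun x => ψ x i) u v := by
  have h : HasFDerivAt (fun x => ψ x i) ((EuclideanSpace.proj i : E3 →L[ℝ] ℝ).comp (fderiv ℝ ψ u))
      u := (EuclideanSpace.proj i : E3 →L[ℝ] ℝ).hasFDerivAt.comp u hd.hasFDerivAt
  rw [h.fderiv]
  rfl

/-- The contact scaling `(x, y, z) ↦ (h x, h y, h² z)`. -/
def scaleMap (h : ℝ) (u : E3) : E3 := !₂[h * u 0, h * u 1, h ^ 2 * u 2]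

theorem stdForm_scaleMap (h : ℝ) (u v : E3) :
    stdForm (scaleMap h u) (scaleMap h v) = h ^ 2 * stdForm u v := by
  simp [stdForm, scaleMap]; ring

theorem norm_scaleMap_le {h : ℝ} (h0 : 0 ≤ h) (h1 : h ≤ 1) (u : E3) :
    ‖scaleMap h u‖ ≤ h * ‖u‖ := by
  rw [← sq_le_sq₀ (norm_nonneg _) (by positivity), norm_sq_coords, mul_pow, norm_sq_coords]
  simp only [scaleMap, PiLp.toLp_apply, Matrix.cons_val_zero, Matrix.cons_val_one, Matrix.cons_val]
  have h2 : (h ^ 2) ^ 2 ≤ h ^ 2 := by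
    have : h ^ 2 ≤ 1 := pow_le_one₀ h0 h1
    nlinarith [sq_nonneg h]
  nlinarith [mul_le_mul_of_nonneg_right h2 (sq_nonneg (u 2))]

theorem contDiff_scaleMap : ContDiff ℝ ∞ fun x : ℝ × E3 => scaleMap x.1 x.2 := by
  rw [contDiff_euclidean]
  intro i
  fin_cases i <;> simp [scaleMap] <;> fun_prop

/-- A contact scaling by a positive factor that is nondecreasing in the distance to `0` is an
immersion. -/
theorem injective_fderiv_scaleMap {H : ℝ → ℝ} {u : E3} (hH : DifferentiableAt ℝ H (‖u‖ ^ 2))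
    (hpos : 0 < H (‖u‖ ^ 2)) (hmono : 0 ≤ deriv H (‖u‖ ^ 2)) :
    Function.Injective (fderiv ℝ (fun x : E3 => scaleMap (H (‖x‖ ^ 2)) x) u) := by
  have h1 : HasFDerivAt (fun x : E3 => ‖x‖ ^ 2) ((2 : ℝ) • innerSL ℝ u) u :=
    (hasStrictFDerivAt_norm_sq u).hasFDerivAt.congr_fderiv (by ext v; simp)
  set h := H (‖u‖ ^ 2) with hh
  set c := deriv H (‖u‖ ^ 2) with hc
  have h2 : HasFDerivAt (fun x : E3 => H (‖x‖ ^ 2)) (c • ((2 : ℝ) • innerSL ℝ u)) u :=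
    hH.hasDerivAt.comp_hasFDerivAt u h1
  have hd : DifferentiableAt ℝ (fun x : E3 => scaleMap (H (‖x‖ ^ 2)) x) u :=
    (contDiff_scaleMap.differentiable (by simp) _).comp (f := fun x : E3 => (H (‖x‖ ^ 2), x)) u
      (h2.differentiableAt.prodMk differentiableAt_id)
  have hp : ∀ i : Fin 3, HasFDerivAt (fun x : E3 => x i) (EuclideanSpace.proj i : E3 →L[ℝ] ℝ) u :=
    fun i => (EuclideanSpace.proj i : E3 →L[ℝ] ℝ).hasFDerivAt
  have e0 : ∀ v, fderiv ℝ (fun x : E3 => scaleMap (H (‖x‖ ^ 2)) x) u v 0 =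
      h * v 0 + u 0 * (c * (2 * inner ℝ u v)) := fun v => by
    rw [fderiv_coord hd, show (fun x : E3 => scaleMap (H (‖x‖ ^ 2)) x 0) =
      fun x => H (‖x‖ ^ 2) * x 0 from rfl]
    have h3 : HasFDerivAt (fun x : E3 => H (‖x‖ ^ 2) * x 0) _ u := h2.mul (hp 0)
    rw [h3.fderiv]
    simp [hh]
  have e1 : ∀ v, fderiv ℝ (fun x : E3 => scaleMap (H (‖x‖ ^ 2)) x) u v 1 =
      h * v 1 + u 1 * (c * (2 * inner ℝ u v)) := fun v => by
    rw [fderiv_coord hd, show (fun x : E3 => scaleMap (H (‖x‖ ^ 2)) x 1) =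
      fun x => H (‖x‖ ^ 2) * x 1 from rfl]
    have h3 : HasFDerivAt (fun x : E3 => H (‖x‖ ^ 2) * x 1) _ u := h2.mul (hp 1)
    rw [h3.fderiv]
    simp [hh]
  have e2 : ∀ v, fderiv ℝ (fun x : E3 => scaleMap (H (‖x‖ ^ 2)) x) u v 2 =
      h ^ 2 * v 2 + u 2 * (2 * h * (c * (2 * inner ℝ u v))) := fun v => by
    rw [fderiv_coord hd, show (fun x : E3 => scaleMap (H (‖x‖ ^ 2)) x 2) =
      fun x => H (‖x‖ ^ 2) ^ 2 * x 2 from rfl]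
    have h3 : HasFDerivAt (fun x : E3 => H (‖x‖ ^ 2) ^ 2 * x 2) _ u := (h2.pow 2).mul (hp 2)
    rw [h3.fderiv]
    simp [hh]
  rw [injective_iff_map_eq_zero]
  intro v hv
  have z0 : h * v 0 + u 0 * (c * (2 * inner ℝ u v)) = 0 := by rw [← e0, hv]; rfl
  have z1 : h * v 1 + u 1 * (c * (2 * inner ℝ u v)) = 0 := by rw [← e1, hv]; rfl
  have z2 : h ^ 2 * v 2 + u 2 * (2 * h * (c * (2 * inner ℝ u v))) = 0 := by rw [← e2, hv]; rfl
  have z2' : h * v 2 + u 2 * (2 * (c * (2 * inner ℝ u v))) = 0 := by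
    have : h * (h * v 2 + u 2 * (2 * (c * (2 * inner ℝ u v)))) = 0 := by linear_combination z2
    exact (mul_eq_zero.1 this).resolve_left hpos.ne'
  have hin := inner_coords u v
  have key : inner ℝ u v * (h + 2 * c * (u 0 ^ 2 + u 1 ^ 2 + 2 * u 2 ^ 2)) = 0 := by
    linear_combination h * hin + u 0 * z0 + u 1 * z1 + u 2 * z2'
  have hz : inner ℝ u v = 0 := by
    refine (mul_eq_zero.1 key).resolve_right (ne_of_gt ?_)
    have : 0 ≤ 2 * c * (u 0 ^ 2 + u 1 ^ 2 + 2 * u 2 ^ 2) := by positivity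
    linarith
  rw [hz] at z0 z1 z2'
  simp only [mul_zero, add_zero, mul_eq_zero, hpos.ne', false_or] at z0 z1 z2'
  exact E3_ext z0 z1 z2'

theorem deriv_cutoff_nonpos {a b : ℝ} (hab : a < b) (s : ℝ) : deriv (cutoff a b) s ≤ 0 := by
  have : Antitone (cutoff a b) := fun x y hxy => by
    apply Real.smoothTransition.monotone
    exact div_le_div_of_nonneg_right (by linarith) (by linarith)
  have h2 := this.neg
  have h3 : deriv (fun x => -cutoff a b x) s = -deriv (cutoff a b) s := deriv.fun_neg
  have h4 : 0 ≤ deriv (fun x => -cutoff a b x) s := h2.deriv_nonneg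
  linarith

variable {Y : Type*} [TopologicalSpace Y] [ChartedSpace E3 Y] [IsManifold (𝓡 3) ∞ Y] [T2Space Y]
  {K : Type*} [TopologicalSpace K]

theorem agree_of_pb {ξ : ContactStructure Y} (B : DarbouxBall ξ) {η : ContactStructure Y}
    (h : ∀ u, ‖u‖ ≤ 1 → pb B.toFun η.pos u = {v | 0 < stdForm u v}) :
    ∀ p ∈ B.image, η.pos p = ξ.pos p := by
  obtain ⟨R, hR, hN, hinj⟩ := B.exists_collar_sq
  rintro p ⟨u, hu, rfl⟩
  have hu' : ‖u‖ ≤ 1 := by simpa using hu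
  refine hN.field_eq_of_pb_eq (u := u) ?_ ((h u hu').trans (B.pb_eq hu).symm)
  exact lt_of_le_of_lt (pow_le_one₀ (norm_nonneg _) hu') hR

/-- Contact structures that are standard in a small concentric ball can be deformed so as to be
standard in the whole Darboux ball; the deformation preserves the structures that are standard
there. -/
theorem exists_expand {ξ : ContactStructure Y} (B : DarbouxBall ξ) (η : C(K, ContactStructure Y))
    {δ : ℝ} (hδ0 : 0 < δ) (hδ1 : δ < 1) :
    ∃ F : C(unitInterval × K, ContactStructure Y), (∀ k, F (0, k) = η k) ∧
      (∀ s k, (∀ p ∈ B.image, (η k).pos p = ξ.pos p) →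
        ∀ p ∈ B.image, (F (s, k)).pos p = ξ.pos p) ∧
      ∀ k, (∀ u, ‖u‖ ≤ δ → pb B.toFun (η k).pos u = {v | 0 < stdForm u v}) →
        ∀ p ∈ B.image, (F (1, k)).pos p = ξ.pos p := by
  obtain ⟨R, hR, hN, hinj⟩ := B.exists_collar_sq
  obtain ⟨a, ha1, haR⟩ := exists_between hR
  obtain ⟨b, hab, hbR⟩ := exists_between haR
  set A : Set E3 := {u | ‖u‖ ^ 2 ∈ Iio R} with hA
  set C : Set E3 := {u | ‖u‖ ^ 2 ≤ b} with hC
  have hCA : C ⊆ A := fun u hu => lt_of_le_of_lt hu hbR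
  have hCc : IsCompact C := by
    refine Metric.isCompact_of_isClosed_isBounded (isClosed_le (by fun_prop) continuous_const) ?_
    refine (isBounded_iff_forall_norm_le (s := C)).2 ⟨b + 1, fun u hu => ?_⟩
    have : ‖u‖ ^ 2 ≤ b := hu
    nlinarith [sq_nonneg (‖u‖ - 1 / 2), norm_nonneg u]
  have hW : IsOpen {q : (unitInterval × K) × E3 | q.2 ∈ A} := hN.isOpen.preimage continuous_snd
  -- pull back under contact scalings, by a factor between `δ` and `1`: at time `1`, the unit ball
  -- is shrunk to the ball of radius `δ`
  set H : ℝ → ℝ → ℝ := fun s x => 1 - s * (1 - δ) * cutoff a b x with hH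
  have hHd : ∀ s, ContDiff ℝ ∞ (H s) := fun s => by
    have := contDiff_cutoff a b
    simp only [hH]
    fun_prop
  have hHpos : ∀ (s : unitInterval) x, δ ≤ H s x := fun s x => by
    have h1 := cutoff_le_one a b x
    have h2 := cutoff_nonneg a b x
    have h3 : (s : ℝ) * cutoff a b x ≤ 1 := mul_le_one₀ s.2.2 h2 h1
    simp only [hH]
    nlinarith
  have hHle : ∀ (s : unitInterval) x, H s x ≤ 1 := fun s x => by
    have h2 := cutoff_nonneg a b x
    have h3 : 0 ≤ (s : ℝ) * (1 - δ) * cutoff a b x :=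
      mul_nonneg (mul_nonneg s.2.1 (by linarith)) h2
    simp only [hH]
    linarith
  have hHderiv : ∀ (s : unitInterval) x, 0 ≤ deriv (H s) x := fun s x => by
    have h1 : HasDerivAt (H s) (0 - s * (1 - δ) * deriv (cutoff a b) x) x :=
      (hasDerivAt_const x (1 : ℝ)).sub
        (((contDiff_cutoff a b).differentiable (by simp) x).hasDerivAt.const_mul _)
    rw [h1.deriv]
    have h2 := deriv_cutoff_nonpos hab x
    have h3 : 0 ≤ (s : ℝ) * (1 - δ) := mul_nonneg s.2.1 (by linarith)
    nlinarith
  set ρ : unitInterval × K → E3 → E3 := fun k u => scaleMap (H k.1 (‖u‖ ^ 2)) u with hρ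
  have hρF : FamS {q : (unitInterval × K) × E3 | q.2 ∈ A} ρ := by
    refine FamS.of_contDiffOn_param (P := ℝ) (p := fun k : unitInterval × K => (k.1 : ℝ))
      (f := fun x : ℝ × E3 => scaleMap (H x.1 (‖x.2‖ ^ 2)) x.2) (by fun_prop) hW isOpen_univ
      (ContDiff.contDiffOn ?_) fun _ _ => mem_univ _
    have h1 : ContDiff ℝ ∞ fun x : ℝ × E3 => H x.1 (‖x.2‖ ^ 2) := by
      have h2 : ContDiff ℝ ∞ fun x : ℝ × E3 => cutoff a b (‖x.2‖ ^ 2) :=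
        (contDiff_cutoff a b).comp ((contDiff_norm_sq ℝ).comp contDiff_snd)
      simp only [hH]
      fun_prop
    exact contDiff_scaleMap.comp (h1.prodMk contDiff_snd)
  have hρle : ∀ k u, ‖ρ k u‖ ≤ ‖u‖ := fun k u => by
    refine (norm_scaleMap_le (hδ0.le.trans (hHpos k.1 _)) (hHle k.1 _) u).trans ?_
    exact mul_le_of_le_one_left (norm_nonneg _) (hHle k.1 _)
  have hmaps : ∀ k, MapsTo (ρ k) A A := fun k u hu =>
    lt_of_le_of_lt (pow_le_pow_left₀ (norm_nonneg _) (hρle k u) 2) hu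
  obtain ⟨F, H1, H2⟩ := exists_pullback hN hinj hCc hCA
    (η := fun k : unitInterval × K => η k.2) (by fun_prop) hρF hmaps
    (fun k u _ => injective_fderiv_scaleMap ((hHd k.1).differentiable (by simp) _)
      (hδ0.trans_le (hHpos k.1 _)) (hHderiv k.1 _))
    (fun k u _ huC => by
      have : b ≤ ‖u‖ ^ 2 := (not_le.1 huC).le
      have e : H k.1 (‖u‖ ^ 2) = 1 := by simp [hH, cutoff_eq_zero hab this]
      simp only [hρ, e]
      apply E3_ext <;> simp [scaleMap])
  -- near the unit ball, the scaling factor is constant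
  have hstd : ∀ (s : unitInterval) k u, ‖u‖ ≤ 1 →
      pb B.toFun (η k).pos (scaleMap (1 - s * (1 - δ)) u) =
        {v | 0 < stdForm (scaleMap (1 - s * (1 - δ)) u) v} →
      pb B.toFun (F (s, k)).pos u = {v | 0 < stdForm u v} := by
    intro s k u hu h
    have hu2 : ‖u‖ ^ 2 ≤ 1 := pow_le_one₀ (norm_nonneg _) hu
    have huA : u ∈ A := lt_of_le_of_lt hu2 hR
    set c : ℝ := 1 - s * (1 - δ) with hc
    have hc0 : 0 < c := by nlinarith [s.2.1, s.2.2]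
    have e : ρ (s, k) =ᶠ[𝓝 u] scaleMap c := by
      have ho : IsOpen {x : E3 | ‖x‖ ^ 2 < a} := isOpen_lt (by fun_prop) continuous_const
      filter_upwards [ho.mem_nhds (lt_of_le_of_lt hu2 ha1)] with x hx
      have hx' : ‖x‖ ^ 2 < a := hx
      simp only [hρ, hH, cutoff_eq_one hab hx'.le, mul_one, hc]
    let L : E3 →L[ℝ] E3 := LinearMap.toContinuousLinearMap
      { toFun := scaleMap c
        map_add' := fun v w => by apply E3_ext <;> simp [scaleMap] <;> ring
        map_smul' := fun t v => by apply E3_ext <;> simp [scaleMap] <;> ring }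
    have hL : scaleMap c = L := rfl
    rw [H1 (s, k) u huA, e.fderiv_eq, e.eq_of_nhds, h, hL, L.fderiv]
    ext v
    change 0 < stdForm (scaleMap c u) (scaleMap c v) ↔ 0 < stdForm u v
    rw [stdForm_scaleMap]
    exact mul_pos_iff_of_pos_left (by positivity)
  refine ⟨F, fun k => ?_, fun s k hk => ?_, fun k hk => ?_⟩
  · have e : ∀ u, ρ (0, k) u = u := fun u => by
      simp only [hρ, hH]
      apply E3_ext <;> simp [scaleMap]
    have e' : ρ (0, k) = id := funext e
    refine ContactStructure.ext_of_pb hN (fun u hu => ?_) fun y hy => H2 (0, k) y fun hc => hy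
      (image_mono hCA hc)
    rw [H1 (0, k) u hu, e', fderiv_id]
    rfl
  · refine agree_of_pb B fun u hu => hstd s k u hu (pb_eq_std_of_agree B hk ?_)
    have h0 : 0 ≤ 1 - (s : ℝ) * (1 - δ) := by nlinarith [s.2.1, s.2.2]
    have h1 : 1 - (s : ℝ) * (1 - δ) ≤ 1 := by nlinarith [s.2.1, s.2.2]
    exact (norm_scaleMap_le h0 h1 u).trans (mul_le_one₀ h1 (norm_nonneg _) hu)
  · refine agree_of_pb B fun u hu => hstd 1 k u hu (hk _ ?_)
    have e : 1 - ((1 : unitInterval) : ℝ) * (1 - δ) = δ := by simp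
    rw [e]
    exact (norm_scaleMap_le hδ0.le hδ1.le u).trans (mul_le_of_le_one_right hδ0.le hu)

/-- A homotopy of the planes at the centre of a Darboux ball lifts to the contact structures. -/
theorem exists_lift_homotopy [CompactSpace K] {ξ : ContactStructure Y} (B : DarbouxBall ξ)
    (η : C(K, ContactStructure Y)) (G : C(unitInterval × K, E3)) (hG1 : ∀ x, ‖G x‖ = 1)
    (hG0 : ∀ k, G (0, k) = normalB B (η k)) :
    ∃ η' : C(K, ContactStructure Y), (∀ k, normalB B (η' k) = G (1, k)) ∧
      ∀ k, (∀ s, G (s, k) = G (0, k)) → η' k = η k := by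
  have huc : UniformContinuous G.curry :=
    CompactSpace.uniformContinuous_of_continuous G.curry.continuous
  obtain ⟨δ, hδ, hG⟩ := Metric.uniformContinuous_iff.1 huc 1 one_pos
  obtain ⟨m, hm⟩ := exists_nat_one_div_lt hδ
  -- subdivide the homotopy into steps between nowhere opposite maps, and lift these by rotations
  set t : ℕ → unitInterval := fun j => projIcc 0 1 zero_le_one (j / (m + 1 : ℝ)) with ht
  have hm0 : (0 : ℝ) < m + 1 := by positivity
  have hstep : ∀ j k, dist (G (t j, k)) (G (t (j + 1), k)) < 1 := fun j k => by
    refine lt_of_le_of_lt (ContinuousMap.dist_apply_le_dist (f := G.curry (t j))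
      (g := G.curry (t (j + 1))) k) (hG ?_)
    refine lt_of_le_of_lt ?_ hm
    refine (abs_projIcc_sub_projIcc zero_le_one).trans (le_of_eq ?_)
    rw [abs_sub_comm, ← sub_div, Nat.cast_succ, add_sub_cancel_left, abs_of_pos (by positivity)]
  have key : ∀ j, ∃ η' : C(K, ContactStructure Y), (∀ k, normalB B (η' k) = G (t j, k)) ∧
      ∀ k, (∀ s, G (s, k) = G (0, k)) → η' k = η k := by
    intro j
    induction j with
    | zero =>
      refine ⟨η, fun k => ?_, fun _ _ => rfl⟩
      rw [← hG0, ht]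
      simp
    | succ j ih =>
      obtain ⟨η₁, h1, h2⟩ := ih
      obtain ⟨η₂, h3, h4⟩ := exists_move_normal B η₁ (g := fun k => G (t (j + 1), k))
        (by fun_prop) (fun k => hG1 _) (fun k => by
          rw [h1]
          have h5 := hstep j k
          have h6 := norm_sub_sq_real (G (t j, k)) (G (t (j + 1), k))
          rw [hG1, hG1, real_inner_comm, ← dist_eq_norm] at h6
          nlinarith [dist_nonneg (x := G (t j, k)) (y := G (t (j + 1), k))])
      refine ⟨η₂, h3, fun k hk => ?_⟩
      rw [h4 k (by rw [h1, hk, hk (t (j + 1))]), h2 k hk]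
  obtain ⟨η', h1, h2⟩ := key (m + 1)
  refine ⟨η', fun k => ?_, h2⟩
  rw [h1, ht]
  simp [div_self hm0.ne']

end Squeeze

/-! ### Homotopies of maps to the sphere -/

section Sphere

/-- The point of the sphere in the direction of a nonzero vector. -/
def toSphere (v : E3) (hv : v ≠ 0) : S2 :=
  ⟨‖v‖⁻¹ • v, by
    rw [mem_sphere_zero_iff_norm, norm_smul, norm_inv, norm_norm,
      inv_mul_cancel₀ (norm_ne_zero_iff.2 hv)]⟩

theorem toSphere_eq_of_smul {v : E3} (hv : v ≠ 0) {w : S2} {c : ℝ} (hc : 0 < c)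
    (h : v = c • (w : E3)) : toSphere v hv = w := by
  apply Subtype.ext
  have hw : ‖(w : E3)‖ = 1 := by simp
  change ‖v‖⁻¹ • v = w
  rw [h, norm_smul, hw, mul_one, Real.norm_of_nonneg hc.le, smul_smul, inv_mul_cancel₀ hc.ne',
    one_smul]

theorem toSphere_coe (w : S2) (hw : (w : E3) ≠ 0) : toSphere w hw = w :=
  toSphere_eq_of_smul hw one_pos (one_smul _ _).symm

theorem sphere_ne_zero (w : S2) : (w : E3) ≠ 0 := fun h => by
  have hw : ‖(w : E3)‖ = 1 := by simp
  rw [h, norm_zero] at hw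
  exact zero_ne_one hw

theorem continuous_toSphere {X : Type*} [TopologicalSpace X] {f : X → E3} (hf : Continuous f)
    (h0 : ∀ x, f x ≠ 0) : Continuous fun x => toSphere (f x) (h0 x) :=
  Continuous.subtype_mk ((hf.norm.inv₀ fun x => norm_ne_zero_iff.2 (h0 x)).smul hf) _

theorem homotopicRel_of_ne_zero {X : Type*} [TopologicalSpace X] {A : Set X} {f g : C(X, S2)}
    (H : C(unitInterval × X, E3)) (h0 : ∀ x, H x ≠ 0)
    (hf : ∀ x, toSphere (H (0, x)) (h0 _) = f x) (hg : ∀ x, toSphere (H (1, x)) (h0 _) = g x)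
    (hA : ∀ s, ∀ x ∈ A, toSphere (H (s, x)) (h0 _) = f x) : f.HomotopicRel g A :=
  ⟨{ toFun := fun x => toSphere (H x) (h0 x)
     continuous_toFun := continuous_toSphere H.continuous h0
     map_zero_left := hf
     map_one_left := hg
     prop' := hA }⟩

/-- The linear homotopy between nowhere opposite maps. -/
theorem homotopicRel_of_linear {X : Type*} [TopologicalSpace X] {A : Set X} {f g : C(X, S2)}
    {a b : C(X, E3)} (hf : ∀ x, ∃ c > (0 : ℝ), a x = c • (f x : E3))
    (hg : ∀ x, ∃ c > (0 : ℝ), b x = c • (g x : E3))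
    (h0 : ∀ x, ∀ s ∈ Icc (0 : ℝ) 1, (1 - s) • a x + s • b x ≠ 0)
    (hA : ∀ x ∈ A, f x = g x) : f.HomotopicRel g A := by
  refine homotopicRel_of_ne_zero
    ⟨fun x => (1 - (x.1 : ℝ)) • a x.2 + (x.1 : ℝ) • b x.2, by fun_prop⟩
    (fun x => h0 x.2 x.1 x.1.2) (fun x => ?_) (fun x => ?_) fun s x hx => ?_
  · obtain ⟨c, hc, h⟩ := hf x
    exact toSphere_eq_of_smul _ hc (by simp [h])
  · obtain ⟨c, hc, h⟩ := hg x
    exact toSphere_eq_of_smul _ hc (by simp [h])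
  · obtain ⟨c, hc, h⟩ := hf x
    obtain ⟨d, hd, h'⟩ := hg x
    rw [← hA x hx] at h'
    have hpos : 0 < (1 - (s : ℝ)) * c + s * d := by
      rcases eq_or_lt_of_le s.2.1 with h1 | h1
      · rw [← h1]; simpa using hc
      · have : 0 ≤ (1 - (s : ℝ)) * c := mul_nonneg (by linarith [s.2.2]) hc.le
        have : 0 < (s : ℝ) * d := mul_pos h1 hd
        linarith
    refine toSphere_eq_of_smul _ hpos ?_
    simp only [ContinuousMap.coe_mk, h, h', smul_smul, add_smul]

/-- Maps to the sphere that omit a point are null-homotopic. -/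
theorem homotopicRel_const_of_ne {X : Type*} [TopologicalSpace X] {A : Set X} {f : C(X, S2)}
    (v e : S2) (hv : ∀ x, f x ≠ v) (he : e ≠ v) (hA : ∀ x ∈ A, f x = e) :
    f.HomotopicRel (ContinuousMap.const X e) A := by
  have hv1 : ‖(v : E3)‖ = 1 := by simp
  set σ := stereographic hv1 with hσ
  have hs : ∀ w : S2, w ≠ v → w ∈ σ.source := fun w hw => by
    rw [hσ, stereographic_source]
    exact fun h => hw (Subtype.ext (congrArg Subtype.val h))
  have hc : Continuous fun x => σ (f x) := by
    refine σ.continuousOn.comp_continuous f.continuous fun x => hs _ (hv x)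
  have hsymm : Continuous σ.symm := by
    have := σ.continuousOn_symm
    rwa [hσ, stereographic_target, continuousOn_univ] at this
  refine ⟨{ toFun := fun x => σ.symm ((1 - (x.1 : ℝ)) • σ (f x.2) + (x.1 : ℝ) • σ e)
            continuous_toFun := by
              refine hsymm.comp ?_
              have h1 := hc.comp (continuous_snd (X := unitInterval))
              have h2 : Continuous fun x : unitInterval × X => (x.1 : ℝ) := by fun_prop
              exact ((continuous_const.sub h2).smul h1).add (h2.smul continuous_const)
            map_zero_left := fun x => by simpa using σ.left_inv (hs _ (hv x))
            map_one_left := fun x => by simpa using σ.left_inv (hs _ he)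
            prop' := fun s x hx => ?_ }⟩
  simp only [ContinuousMap.coe_mk, hA x hx, ← add_smul, sub_add_cancel, one_smul]
  exact σ.left_inv (hs _ he)

/-- The sphere is simply connected. -/
theorem loop_sphere_homotopicRel_const (f : C(unitInterval, S2)) (e : S2) (h0 : f 0 = e)
    (h1 : f 1 = e) : f.HomotopicRel (ContinuousMap.const _ e) {0, 1} := by
  -- approximate the coordinates by polynomials
  have hp : ∀ i : Fin 3, ∃ p : Polynomial ℝ, ∀ t : unitInterval,
      |p.eval (t : ℝ) - (f t : E3) i| < 1 / 8 := fun i => by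
    obtain ⟨p, hp⟩ := exists_polynomial_near_continuousMap 0 1
      ⟨fun t : unitInterval => (f t : E3) i, by fun_prop⟩ (1 / 8) (by norm_num)
    refine ⟨p, fun t => ?_⟩
    exact lt_of_le_of_lt (ContinuousMap.norm_coe_le_norm (p.toContinuousMapOn _ -
      ⟨fun t : unitInterval => (f t : E3) i, by fun_prop⟩) t) hp
  choose p hp using hp
  set P : ℝ → E3 := fun t => WithLp.toLp 2 fun i =>
    (p i).eval t + (1 - t) * ((e : E3) i - (p i).eval 0) + t * ((e : E3) i - (p i).eval 1) with hP
  have hPd : ContDiff ℝ 1 P := by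
    rw [contDiff_euclidean]
    intro i
    have : ContDiff ℝ 1 fun t => (p i).eval t := Polynomial.contDiff_aeval (𝕜 := ℝ) (p i) 1
    simp only [hP]
    fun_prop
  have hP0 : P 0 = e := by ext i; simp [hP]
  have hP1 : P 1 = e := by ext i; simp [hP]
  have hclose : ∀ t : unitInterval, ‖P t - f t‖ < 1 := fun t => by
    have hc : ∀ i, |(P t - f t) i| ≤ 1 / 4 := fun i => by
      have e1 := hp i t
      have e2 := hp i 0
      have e3 := hp i 1
      rw [h0] at e2
      rw [h1] at e3
      simp only [Icc.coe_zero, Icc.coe_one] at e2 e3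
      have ht0 := t.2.1
      have ht1 := t.2.2
      have e4 : |(1 - (t : ℝ)) * ((e : E3) i - (p i).eval 0) + t * ((e : E3) i - (p i).eval 1)|
          ≤ 1 / 8 := by
        rw [abs_lt] at e2 e3
        rw [abs_le]
        constructor <;> nlinarith
      have e5 : (P t - f t) i = ((p i).eval (t : ℝ) - (f t : E3) i) +
          ((1 - (t : ℝ)) * ((e : E3) i - (p i).eval 0) + t * ((e : E3) i - (p i).eval 1)) := by
        simp [hP]; ring
      rw [e5]
      refine (abs_add_le _ _).trans ?_
      linarith
    rw [← sq_lt_sq₀ (norm_nonneg _) zero_le_one, norm_sq_coords]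
    have hsq : ∀ i, (P t - f t) i ^ 2 ≤ 1 / 16 := fun i => by
      have := sq_le_sq' (neg_le_of_abs_le (hc i)) (le_of_abs_le (hc i))
      linarith
    linarith [hsq 0, hsq 1, hsq 2]
  -- the cone over the approximation is not everything
  have hcone : ContDiff ℝ 1 fun x : ℝ × ℝ => x.1 • P x.2 := by fun_prop
  obtain ⟨v, hv⟩ := (hcone.dense_compl_range_of_finrank_lt_finrank (by simp)).nonempty
  have hv0 : v ≠ 0 := fun h => hv ⟨(0, 0), by simp [h]⟩
  have hl : ∀ t : unitInterval, ∀ s ∈ Icc (0 : ℝ) 1, (1 - s) • (f t : E3) + s • P t ≠ 0 := by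
    intro t s hs h
    have h2 : (f t : E3) = s • (f t - P t) := by
      refine sub_eq_zero.1 (Eq.trans ?_ h)
      rw [smul_sub, sub_smul, one_smul]
      abel
    have h3 : ‖(f t : E3)‖ = 1 := by simp
    rw [h2, norm_smul, Real.norm_of_nonneg hs.1, norm_sub_rev] at h3
    have := hclose t
    nlinarith [norm_nonneg (P t - f t), hs.1, hs.2]
  have hPn : ∀ t : unitInterval, P t ≠ 0 := fun t h => hl t 1 (by simp) (by simp [h])
  set g : C(unitInterval, S2) := ⟨fun t => toSphere (P t) (hPn t),
    continuous_toSphere (hPd.continuous.comp continuous_subtype_val) hPn⟩ with hg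
  have hge : ∀ t ∈ ({0, 1} : Set unitInterval), g t = e := by
    rintro t (rfl | rfl)
    · exact toSphere_eq_of_smul (hPn 0) one_pos (by simpa using hP0)
    · exact toSphere_eq_of_smul (hPn 1) one_pos (by simpa using hP1)
  have hfe : ∀ t ∈ ({0, 1} : Set unitInterval), f t = e := by
    rintro t (rfl | rfl)
    exacts [h0, h1]
  have hne : ∀ t, g t ≠ toSphere v hv0 := fun t h => by
    have h2 := congrArg Subtype.val h
    change ‖P t‖⁻¹ • P t = ‖v‖⁻¹ • v at h2
    refine hv ⟨(‖v‖ * ‖P t‖⁻¹, t), ?_⟩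
    simp only [mul_smul]
    rw [h2, smul_smul, mul_inv_cancel₀ (norm_ne_zero_iff.2 hv0), one_smul]
  refine ContinuousMap.HomotopicRel.trans (g := g) ?_ (homotopicRel_const_of_ne (toSphere v hv0) e
    hne ?_ hge)
  · refine homotopicRel_of_linear (a := ⟨fun t => f t, by fun_prop⟩)
      (b := ⟨fun t => P t, hPd.continuous.comp continuous_subtype_val⟩)
      (fun t => ⟨1, one_pos, by simp⟩) (fun t => ⟨‖P t‖, norm_pos_iff.2 (hPn t), ?_⟩) hl ?_
    · change P t = ‖P t‖ • ‖P t‖⁻¹ • P t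
      rw [smul_smul, mul_inv_cancel₀ (norm_ne_zero_iff.2 (hPn t)), one_smul]
    · exact fun t ht => (hfe t ht).trans (hge t ht).symm
  · rw [← hge 0 (by simp)]
    exact hne 0

end Sphere

/-! ### Cubes in `𝒞(Y, ξ)` with boundary in `𝒞(Y, ξ, B)` -/

section Cubes

variable {N : Type*}

/-- The map of the cube to itself which expands the middle cube and projects the rest to the
boundary. -/
def stretch (y : N → unitInterval) (i : N) : unitInterval :=
  projIcc 0 1 zero_le_one (3 * (y i : ℝ) - 1)

theorem continuous_stretch : Continuous (stretch : (N → unitInterval) → N → unitInterval) := by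
  refine continuous_pi fun i => continuous_projIcc.comp (by fun_prop)

theorem stretch_zero {y : N → unitInterval} {i : N} (h : y i = 0) : stretch y i = 0 :=
  projIcc_of_le_left _ (by simp [h])

theorem stretch_one {y : N → unitInterval} {i : N} (h : y i = 1) : stretch y i = 1 :=
  projIcc_of_right_le _ (by norm_num [h])

variable [Fintype N] [Nonempty N]
variable {Y : Type*} [TopologicalSpace Y] [ChartedSpace E3 Y] [IsManifold (𝓡 3) ∞ Y] [T2Space Y]

/-- If the planes at the centre of the Darboux ball form a null-homotopic map, then the cube can be
deformed into `𝒞(Y, ξ, B)`, where its boundary only gets reparametrized. -/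
theorem exists_cube_deformation {ξ : ContactStructure Y} (B : DarbouxBall ξ)
    (E : C(N → unitInterval, ContactStructure Y))
    (hE : ∀ y ∈ Cube.boundary N, ∀ p ∈ B.image, (E y).pos p = ξ.pos p)
    (G : C(unitInterval × (N → unitInterval), E3)) (hG : ∀ x, ‖G x‖ = 1)
    (hG0 : ∀ y, G (0, y) = normalB B (E y)) (hG1 : ∀ y, G (1, y) = stdVec 0)
    (hGb : ∀ s, ∀ y ∈ Cube.boundary N, G (s, y) = G (0, y)) :
    ∃ Γ : C(N → unitInterval, ContactStructure Y), (∀ y, ∀ p ∈ B.image, (Γ y).pos p = ξ.pos p) ∧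
      ∀ y ∈ Cube.boundary N, Γ y = E (stretch y) := by
  obtain ⟨E₁, h1, h2⟩ := exists_lift_homotopy B E G hG hG0
  have h2' : ∀ y ∈ Cube.boundary N, E₁ y = E y := fun y hy => h2 y fun s => hGb s y hy
  have hne : (fun _ => 0 : N → unitInterval) ∈ Cube.boundary N :=
    ⟨Classical.arbitrary N, Or.inl rfl⟩
  obtain ⟨E₂, δ, hδ0, hδ1, h3, h4⟩ := exists_standardize B E₁ (fun y => (h1 y).trans (hG1 y))
    (fun _ => 0) (by rw [h2' _ hne]; exact hE _ hne)
  have h4' : ∀ y ∈ Cube.boundary N, E₂ y = E y := fun y hy =>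
    (h4 y (by rw [h2' y hy]; exact hE y hy)).trans (h2' y hy)
  obtain ⟨F, h5, h6, h7⟩ := exists_expand B E₂ hδ0 hδ1
  -- the distance from `3 y - 1` to the cube
  set d : (N → unitInterval) → N → ℝ := fun y i => 3 * (y i : ℝ) - 1 - stretch y i with hd
  have hdc : Continuous d := by
    have := continuous_stretch (N := N)
    refine continuous_pi fun i => ?_
    have := (continuous_apply i).comp this
    simp only [Function.comp_def] at this
    fun_prop
  refine ⟨⟨fun y => F (projIcc 0 1 zero_le_one (1 - ‖d y‖), stretch y), ?_⟩, fun y => ?_,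
    fun y hy => ?_⟩
  · refine F.continuous.comp (Continuous.prodMk (continuous_projIcc.comp ?_) continuous_stretch)
    exact continuous_const.sub hdc.norm
  · simp only [ContinuousMap.coe_mk]
    -- in the middle cube, use the end of the deformation `F`; outside of it, the structures of the
    -- boundary, which `F` keeps standard on the ball
    by_cases h : d y = 0
    · have e : projIcc (0 : ℝ) 1 zero_le_one (1 - ‖d y‖) = 1 := by simp [h]
      rw [e]
      exact h7 _ (h3 _)
    · obtain ⟨i, hi⟩ := Function.ne_iff.1 h
      have hb : stretch y ∈ Cube.boundary N := by
        refine ⟨i, ?_⟩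
        by_contra hc
        push Not at hc
        apply hi
        have h8 : 3 * (y i : ℝ) - 1 ∈ Icc (0 : ℝ) 1 := by
          by_contra h9
          rw [mem_Icc, not_and_or, not_le, not_le] at h9
          rcases h9 with h9 | h9
          · exact hc.1 (projIcc_of_le_left _ h9.le)
          · exact hc.2 (projIcc_of_right_le _ h9.le)
        simp only [hd, stretch, projIcc_of_mem _ h8, sub_self, Pi.zero_apply]
      exact h6 _ _ (by rw [h4' _ hb]; exact hE _ hb)
  · have hb : stretch y ∈ Cube.boundary N := by
      obtain ⟨i, hi | hi⟩ := hy
      exacts [⟨i, Or.inl (stretch_zero hi)⟩, ⟨i, Or.inr (stretch_one hi)⟩]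
    have h8 : 1 ≤ ‖d y‖ := by
      obtain ⟨i, hi⟩ := hy
      refine le_trans ?_ (norm_le_pi_norm (d y) i)
      rcases hi with hi | hi
      · simp [hd, stretch_zero hi, hi]
      · norm_num [hd, stretch_one hi, hi]
    have e : projIcc (0 : ℝ) 1 zero_le_one (1 - ‖d y‖) = 0 := projIcc_of_le_left _ (by linarith)
    simp only [ContinuousMap.coe_mk]
    rw [e, h5, h4' _ hb]

end Cubes

section PathConnected

variable {Y : Type*} [TopologicalSpace Y] [ChartedSpace E3 Y]
  {ξ : ContactStructure Y}

theorem normalB_of_agree (B : DarbouxBall ξ) {η : ContactStructure Y}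
    (h : ∀ p ∈ B.image, η.pos p = ξ.pos p) : normalB B η = stdVec 0 := by
  rw [normalB, pb_eq_std_of_agree B h (by simp), ← normalB_self B, normalB, B.pb_eq (by simp)]

theorem coe_northPole : (northPole : E3) = stdVec 0 := by
  apply E3_ext <;> simp [northPole, stdVec]

variable [IsManifold (𝓡 3) ∞ Y] [T2Space Y]

/-- The unit normal at the centre of the Darboux ball as a point of the sphere. -/
def normalS (B : DarbouxBall ξ) (η : ContactStructure Y) : S2 :=
  ⟨normalB B η, by
    rw [mem_sphere_zero_iff_norm]; exact norm_unitNormal (norm_normalB B η)⟩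

theorem continuous_normalS (B : DarbouxBall ξ) : Continuous (normalS B) :=
  (continuous_normalB B).subtype_mk _

theorem normalS_of_agree (B : DarbouxBall ξ) {η : ContactStructure Y}
    (h : ∀ p ∈ B.image, η.pos p = ξ.pos p) : normalS B η = northPole :=
  Subtype.ext ((normalB_of_agree B h).trans coe_northPole.symm)

/-- Version of `exists_cube_deformation` for a null-homotopy of the evaluation as a map to the
sphere. -/
theorem exists_cube_deformation' {N : Type*} [Fintype N] [Nonempty N] (B : DarbouxBall ξ)
    (E : C(N → unitInterval, ContactStructure Y))
    (hE : ∀ y ∈ Cube.boundary N, ∀ p ∈ B.image, (E y).pos p = ξ.pos p)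
    (hG : (ContinuousMap.mk _ ((continuous_normalS B).comp E.continuous)).HomotopicRel
      (ContinuousMap.const _ northPole) (Cube.boundary N)) :
    ∃ Γ : C(N → unitInterval, ContactStructure Y), (∀ y, ∀ p ∈ B.image, (Γ y).pos p = ξ.pos p) ∧
      ∀ y ∈ Cube.boundary N, Γ y = E (stretch y) := by
  obtain ⟨H⟩ := hG
  refine exists_cube_deformation B E hE ⟨fun x => (H x : E3), by fun_prop⟩ (fun x => by simp)
    (fun y => ?_) (fun y => ?_) fun s y hy => ?_
  · simp only [ContinuousMap.coe_mk, H.apply_zero]; rfl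
  · simp only [ContinuousMap.coe_mk, H.apply_one]; exact coe_northPole
  · simp only [ContinuousMap.coe_mk]
    rw [H.eq_fst s hy, H.apply_zero]

/-- A path in `𝒞(Y, ξ)` between structures that agree with `ξ` on the ball can be deformed into
`𝒞(Y, ξ, B)`, because the sphere is simply connected. -/
theorem exists_path_spaceCB (B : DarbouxBall ξ) (η : SpaceCB B) :
    Joined (baseCB B) η := by
  have hj : Joined ξ η.1.1 := η.1.2
  obtain ⟨p⟩ := hj
  have hE : ∀ y ∈ Cube.boundary (Fin 1), ∀ q ∈ B.image, (p (y 0)).pos q = ξ.pos q := by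
    rintro y ⟨i, hi⟩ q hq
    rw [Subsingleton.elim i 0] at hi
    rcases hi with hi | hi
    · rw [hi, p.source]
    · rw [hi, p.target]; exact η.2 q hq
  have hb0 : (fun _ => 0 : Fin 1 → unitInterval) ∈ Cube.boundary (Fin 1) := ⟨0, Or.inl rfl⟩
  have hb1 : (fun _ => 1 : Fin 1 → unitInterval) ∈ Cube.boundary (Fin 1) := ⟨0, Or.inr rfl⟩
  have hE' := fun y hy => normalS_of_agree B (hE y hy)
  obtain ⟨H⟩ := loop_sphere_homotopicRel_const
    ⟨fun t => normalS B (p t), (continuous_normalS B).comp p.continuous⟩ northPole (hE' _ hb0)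
    (hE' _ hb1)
  obtain ⟨Γ, h1, h2⟩ := exists_cube_deformation' B ⟨fun y : Fin 1 → unitInterval => p (y 0),
    by fun_prop⟩ hE ⟨{ toFun := fun x => H (x.1, x.2 0)
                       continuous_toFun := by fun_prop
                       map_zero_left := fun y => by simp
                       map_one_left := fun y => by simp
                       prop' := fun s y hy => by
                        obtain ⟨i, hi⟩ := hy
                        rw [Subsingleton.elim i 0] at hi
                        exact H.eq_fst s (x := y 0) (by simpa using hi) }⟩
  have e0 : Γ (fun _ => 0) = ξ := by
    rw [h2 _ hb0]
    simp [stretch_zero (y := fun _ : Fin 1 => (0 : unitInterval)) (i := 0) rfl]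
  have e1 : Γ (fun _ => 1) = η.1.1 := by
    rw [h2 _ hb1]
    simp [stretch_one (y := fun _ : Fin 1 => (1 : unitInterval)) (i := 0) rfl]
  let path : Path ξ η.1.1 :=
    { toFun := fun t => Γ fun _ => t
      continuous_toFun := by fun_prop
      source' := e0
      target' := e1 }
  have hm : ∀ t, path t ∈ pathComponent ξ := fun t => ⟨path.truncateOfLE t.2.1 |>.cast
    (by simp) (by simp [Path.extend])⟩
  exact ⟨{ toFun := fun t => ⟨⟨path t, hm t⟩, h1 _⟩
           continuous_toFun := by fun_prop
           source' := Subtype.ext (Subtype.ext e0)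
           target' := Subtype.ext (Subtype.ext e1) }⟩

theorem pathConnectedSpace_spaceCB (B : DarbouxBall ξ) : PathConnectedSpace (SpaceCB B) where
  nonempty := ⟨baseCB B⟩
  joined := fun x y => (exists_path_spaceCB B x).symm.trans (exists_path_spaceCB B y)

end PathConnected

/-! ### Uniqueness of the obstruction class -/

section Uniqueness

variable {Y : Type*} [TopologicalSpace Y] [ChartedSpace E3 Y] [IsManifold (𝓡 3) ∞ Y] [T2Space Y]
  {ξ : ContactStructure Y}

theorem evB_eq_normalS (B : DarbouxBall ξ) (η : SpaceC ξ) : evB B η = normalS B η.1 :=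
  Subtype.ext rfl

theorem mem_pathComponent_of_continuous {X : Type*} [TopologicalSpace X] [PathConnectedSpace X]
    {Z : Type*} [TopologicalSpace Z] {f : X → Z} (hf : Continuous f) {x₀ : X} {z : Z}
    (h : f x₀ = z) (x : X) : f x ∈ pathComponent z := by
  rw [← h]
  exact (PathConnectedSpace.joined x₀ x).map hf

instance : PathConnectedSpace unitInterval :=
  isPathConnected_iff_pathConnectedSpace.1 ((convex_Icc (0 : ℝ) 1).isPathConnected (by simp))

instance : PathConnectedSpace (Fin 2 → unitInterval) where
  nonempty := inferInstance
  joined x y := ⟨Path.pi fun i => PathConnectedSpace.somePath (x i) (y i)⟩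

/-- The boundary loops of two discs over homotopic spheres are homotopic: glue the discs to a disc
over a null-homotopic sphere and deform it into `𝒞(Y, ξ, B)`. -/
theorem homotopic_of_discs (B : DarbouxBall ξ)
    {D₁ D₂ : C(unitInterval × unitInterval, SpaceC ξ)} {f₁ f₂ : GenLoop (Fin 2) S2 northPole}
    {γ₁ γ₂ : Path (baseCB B) (baseCB B)} (hf : GenLoop.Homotopic f₁ f₂)
    (he₁ : ∀ r φ : unitInterval, evB B (D₁ (r, φ)) = f₁ ![r, φ])
    (hz₁ : ∀ φ : unitInterval, D₁ (0, φ) = baseC ξ)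
    (hb₁ : ∀ r : unitInterval, D₁ (r, 0) = baseC ξ ∧ D₁ (r, 1) = baseC ξ)
    (ho₁ : ∀ φ : unitInterval, D₁ (1, φ) = (γ₁ φ).1)
    (he₂ : ∀ r φ : unitInterval, evB B (D₂ (r, φ)) = f₂ ![r, φ])
    (hz₂ : ∀ φ : unitInterval, D₂ (0, φ) = baseC ξ)
    (hb₂ : ∀ r : unitInterval, D₂ (r, 0) = baseC ξ ∧ D₂ (r, 1) = baseC ξ)
    (ho₂ : ∀ φ : unitInterval, D₂ (1, φ) = (γ₂ φ).1) : γ₁.Homotopic γ₂ := by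
  set a : unitInterval → unitInterval := fun r => projIcc 0 1 zero_le_one (1 - 2 * (r : ℝ)) with ha
  set b : unitInterval → unitInterval := fun r => projIcc 0 1 zero_le_one (2 * (r : ℝ) - 1) with hb
  have hac : Continuous a := continuous_projIcc.comp (by fun_prop)
  have hbc : Continuous b := continuous_projIcc.comp (by fun_prop)
  have ha0 : a 0 = 1 := by simp [ha]
  have hb1 : b 1 = 1 := by norm_num [hb]
  have ha2 : ∀ r : unitInterval, (1 / 2 : ℝ) ≤ r → a r = 0 := fun r hr =>
    projIcc_of_le_left _ (by linarith)
  have hb2 : ∀ r : unitInterval, (r : ℝ) ≤ 1 / 2 → b r = 0 := fun r hr =>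
    projIcc_of_le_left _ (by linarith)
  have hcube0 : ∀ r φ : unitInterval, r = 0 ∨ r = 1 ∨ φ = 0 ∨ φ = 1 →
      ![r, φ] ∈ Cube.boundary (Fin 2) := by
    rintro r φ (h | h | h | h)
    exacts [⟨0, Or.inl h⟩, ⟨0, Or.inr h⟩, ⟨1, Or.inl h⟩, ⟨1, Or.inr h⟩]
  have hbd : ∀ y ∈ Cube.boundary (Fin 2), y 0 = 0 ∨ y 0 = 1 ∨ y 1 = 0 ∨ y 1 = 1 := by
    rintro y ⟨i, hi⟩
    fin_cases i
    · rcases hi with hi | hi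
      exacts [Or.inl hi, Or.inr (Or.inl hi)]
    · rcases hi with hi | hi
      exacts [Or.inr (Or.inr (Or.inl hi)), Or.inr (Or.inr (Or.inr hi))]
  have hfb : ∀ (f : GenLoop (Fin 2) S2 northPole) (r φ : unitInterval),
      r = 0 ∨ r = 1 ∨ φ = 0 ∨ φ = 1 → f ![r, φ] = northPole := fun f r φ h =>
    f.2 _ (hcube0 r φ h)
  -- the two discs glued along the side that is mapped to the base point
  let E : C(Fin 2 → unitInterval, ContactStructure Y) :=
    ⟨fun y => if (y 0 : ℝ) ≤ 1 / 2 then (D₁ (a (y 0), y 1)).1 else (D₂ (b (y 0), y 1)).1, by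
      refine Continuous.if_le (by fun_prop) (by fun_prop) (by fun_prop) (by fun_prop) fun y hy => ?_
      rw [ha2 _ hy.ge, hb2 _ hy.le, hz₁, hz₂]⟩
  have hE0 : ∀ y, y 0 = 0 → E y = (γ₁ (y 1)).1.1 := fun y hy => by
    change (if (y 0 : ℝ) ≤ 1 / 2 then _ else _) = _
    rw [if_pos (by rw [hy]; norm_num), hy, ha0, ho₁]
  have hE1 : ∀ y, y 0 = 1 → E y = (γ₂ (y 1)).1.1 := fun y hy => by
    change (if (y 0 : ℝ) ≤ 1 / 2 then _ else _) = _
    rw [if_neg (by rw [hy]; norm_num), hy, hb1, ho₂]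
  have hEb : ∀ y, y 1 = 0 ∨ y 1 = 1 → E y = ξ := fun y hy => by
    change (if (y 0 : ℝ) ≤ 1 / 2 then _ else _) = _
    rcases hy with hy | hy <;> rw [hy] <;> split_ifs <;>
      simp [(hb₁ _).1, (hb₁ _).2, (hb₂ _).1, (hb₂ _).2, baseC]
  have hE : ∀ y ∈ Cube.boundary (Fin 2), ∀ p ∈ B.image, (E y).pos p = ξ.pos p := by
    intro y hy p hp
    rcases hbd y hy with h | h | h | h
    · rw [hE0 y h]; exact (γ₁ _).2 p hp
    · rw [hE1 y h]; exact (γ₂ _).2 p hp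
    · rw [hEb y (Or.inl h)]
    · rw [hEb y (Or.inr h)]
  -- the evaluation is null-homotopic
  obtain ⟨H⟩ := hf.symm
  let F : C(Fin 2 → unitInterval, S2) :=
    ⟨fun y => f₁ ![max (a (y 0)) (b (y 0)), y 1], by
      refine f₁.1.continuous.comp (continuous_pi fun i => ?_)
      fin_cases i <;> simp <;> fun_prop⟩
  have h1 : (ContinuousMap.mk _ ((continuous_normalS B).comp E.continuous)).HomotopicRel F
      (Cube.boundary (Fin 2)) := by
    refine ⟨{ toFun := fun x => if (x.2 0 : ℝ) ≤ 1 / 2 then f₁ ![a (x.2 0), x.2 1] else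
                H (x.1, ![b (x.2 0), x.2 1])
              continuous_toFun := ?_
              map_zero_left := fun y => ?_
              map_one_left := fun y => ?_
              prop' := fun s y hy => ?_ }⟩
    · refine Continuous.if_le (f₁.1.continuous.comp (continuous_pi fun i => ?_))
        (H.continuous.comp (Continuous.prodMk continuous_fst (continuous_pi fun i => ?_)))
        (by fun_prop) (by fun_prop) fun x hx => ?_
      · fin_cases i <;> simp <;> fun_prop
      · fin_cases i <;> simp <;> fun_prop
      · rw [ha2 _ hx.ge, hb2 _ hx.le, hfb _ _ _ (Or.inl rfl),
          H.eq_fst _ (hcube0 _ _ (Or.inl rfl))]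
        exact (hfb _ _ _ (Or.inl rfl)).symm
    · simp only [ContinuousMap.coe_mk, Function.comp_apply]
      change _ = normalS B (if (y 0 : ℝ) ≤ 1 / 2 then _ else _)
      split_ifs
      · rw [← evB_eq_normalS, he₁]
      · rw [← evB_eq_normalS, he₂]; exact H.apply_zero _
    · simp only [F, ContinuousMap.coe_mk]
      split_ifs with h
      · rw [hb2 _ h, max_eq_left unitInterval.nonneg']
      · rw [ha2 _ (not_le.1 h).le, max_eq_right unitInterval.nonneg']
        exact H.apply_one _
    · have e : normalS B (E y) = northPole := normalS_of_agree B (hE y hy)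
      simp only [ContinuousMap.coe_mk, Function.comp_apply, e]
      split_ifs with h
      · refine hfb _ _ _ ?_
        rcases hbd y hy with h | h | h | h
        · rw [h]; exact Or.inr (Or.inl ha0)
        · rw [h]; exact Or.inl (ha2 _ (by norm_num))
        · exact Or.inr (Or.inr (Or.inl h))
        · exact Or.inr (Or.inr (Or.inr h))
      · have hy' : b (y 0) = 0 ∨ b (y 0) = 1 ∨ y 1 = 0 ∨ y 1 = 1 := by
          rcases hbd y hy with h | h | h | h
          · rw [h]; exact Or.inl (hb2 _ (by norm_num))
          · rw [h]; exact Or.inr (Or.inl hb1)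
          · exact Or.inr (Or.inr (Or.inl h))
          · exact Or.inr (Or.inr (Or.inr h))
        rw [H.eq_fst _ (hcube0 _ _ hy')]
        exact hfb _ _ _ hy'
  -- contract the doubled sphere by replacing the radius `r` with `max r s`
  have hmax : ∀ y ∈ Cube.boundary (Fin 2), ∀ s : unitInterval,
      f₁ ![max (max (a (y 0)) (b (y 0))) s, y 1] = northPole := by
    intro y hy s
    refine hfb _ _ _ ?_
    rcases hbd y hy with h | h | h | h
    · rw [h, ha0, max_eq_left unitInterval.le_one', max_eq_left unitInterval.le_one']
      exact Or.inr (Or.inl rfl)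
    · rw [h, hb1, max_eq_right unitInterval.le_one', max_eq_left unitInterval.le_one']
      exact Or.inr (Or.inl rfl)
    · exact Or.inr (Or.inr (Or.inl h))
    · exact Or.inr (Or.inr (Or.inr h))
  have h2 : F.HomotopicRel (ContinuousMap.const _ northPole) (Cube.boundary (Fin 2)) := by
    refine ⟨{ toFun := fun x => f₁ ![max (max (a (x.2 0)) (b (x.2 0))) x.1, x.2 1]
              continuous_toFun := ?_
              map_zero_left := fun y => ?_
              map_one_left := fun y => ?_
              prop' := fun s y hy => ?_ }⟩
    · refine f₁.1.continuous.comp (continuous_pi fun i => ?_)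
      fin_cases i <;> simp <;> fun_prop
    · rw [max_eq_left unitInterval.nonneg']; rfl
    · rw [max_eq_right unitInterval.le_one']
      exact hfb _ _ _ (Or.inr (Or.inl rfl))
    · have := hmax y hy 0
      rw [max_eq_left unitInterval.nonneg'] at this
      simp only [ContinuousMap.coe_mk, hmax y hy]
      exact this.symm
  -- `Γ` is a homotopy between the two loops, up to the reparametrization `stretch`
  obtain ⟨Γ, h3, h4⟩ := exists_cube_deformation' B E hE (h1.trans h2)
  have hΓb : ∀ r φ : unitInterval, φ = 0 ∨ φ = 1 → Γ ![r, φ] = ξ := fun r φ h => by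
    rw [h4 _ (hcube0 r φ (Or.inr (Or.inr h)))]
    refine hEb _ ?_
    rcases h with h | h
    · exact Or.inl (stretch_zero (i := 1) h)
    · exact Or.inr (stretch_one (i := 1) h)
  have hΓm : ∀ y, Γ y ∈ pathComponent ξ :=
    mem_pathComponent_of_continuous Γ.continuous (hΓb 0 0 (Or.inl rfl))
  -- reparametrization of a path
  set st : unitInterval → unitInterval := fun t => stretch (fun _ : Fin 1 => t) 0 with hst
  have hstc : Continuous st := continuous_projIcc.comp (by fun_prop)
  have hst0 : st 0 = 0 := stretch_zero rfl
  have hst1 : st 1 = 1 := stretch_one rfl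
  have h5 : (γ₁.reparam st hstc hst0 hst1).Homotopic (γ₂.reparam st hstc hst0 hst1) := by
    refine ⟨{ toFun := fun x => ⟨⟨Γ ![x.1, x.2], hΓm _⟩, h3 _⟩
              continuous_toFun := ?_
              map_zero_left := fun φ => ?_
              map_one_left := fun φ => ?_
              prop' := fun r φ hφ => ?_ }⟩
    · refine Continuous.subtype_mk (Continuous.subtype_mk (Γ.continuous.comp
        (continuous_pi fun i => ?_)) _) _
      fin_cases i <;> simp <;> fun_prop
    · refine Subtype.ext (Subtype.ext ?_)
      change Γ ![0, φ] = _
      rw [h4 _ (hcube0 0 φ (Or.inl rfl)), hE0 _ (stretch_zero rfl)]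
      rfl
    · refine Subtype.ext (Subtype.ext ?_)
      change Γ ![1, φ] = _
      rw [h4 _ (hcube0 1 φ (Or.inr (Or.inl rfl))), hE1 _ (stretch_one rfl)]
      rfl
    · refine Subtype.ext (Subtype.ext ?_)
      change Γ ![r, φ] = ((γ₁.reparam st hstc hst0 hst1) φ).1.1
      rw [hΓb r φ (by simpa using hφ)]
      rcases hφ with rfl | hφ
      · rw [Path.source]; rfl
      · rw [mem_singleton_iff.1 hφ, Path.target]; rfl
  have h6 : γ₁.Homotopic (γ₁.reparam st hstc hst0 hst1) := ⟨Path.Homotopy.reparam γ₁ st hstc hst0 hst1⟩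
  have h7 : γ₂.Homotopic (γ₂.reparam st hstc hst0 hst1) := ⟨Path.Homotopy.reparam γ₂ st hstc hst0 hst1⟩
  exact h6.trans (h5.trans h7.symm)

theorem IsObstructionClass.unique {B : DarbouxBall ξ}
    {o₁ o₂ : FundamentalGroup (SpaceCB B) (baseCB B)} (h₁ : IsObstructionClass B o₁)
    (h₂ : IsObstructionClass B o₂) : o₁ = o₂ := by
  obtain ⟨D₁, f₁, γ₁, hf₁, he₁, hz₁, hb₁, ho₁, rfl⟩ := h₁
  obtain ⟨D₂, f₂, γ₂, hf₂, he₂, hz₂, hb₂, ho₂, rfl⟩ := h₂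
  rw [Path.Homotopic.Quotient.eq.2 (homotopic_of_discs B (hf₁.trans hf₂.symm) he₁ hz₁ hb₁ ho₁
    he₂ hz₂ hb₂ ho₂)]

end Uniqueness

/-! ### Sums of contact structures -/

section ContactEmbedding

variable {Y₁ Y₂ : Type*} [TopologicalSpace Y₁] [ChartedSpace E3 Y₁]
  [TopologicalSpace Y₂] [ChartedSpace E3 Y₂] {ξ₁ : ContactStructure Y₁} {ξ₂ : ContactStructure Y₂}
  {f : Y₁ → Y₂} {U : Set Y₁}

theorem IsContactEmbeddingOn.mdifferentiableAt (h : IsContactEmbeddingOn ξ₁ ξ₂ f U) {p : Y₁}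
    (hp : p ∈ U) : MDifferentiableAt (𝓡 3) (𝓡 3) f p :=
  (h.isLocalDiffeomorphOn ⟨p, hp⟩).mdifferentiableAt (by simp)

theorem IsContactEmbeddingOn.injective (h : IsContactEmbeddingOn ξ₁ ξ₂ f U) {p : Y₁}
    (hp : p ∈ U) : Function.Injective (mfderiv (𝓡 3) (𝓡 3) f p) := by
  have := IsLocalDiffeomorphAt.mfderivToContinuousLinearEquiv_coe
    (h.isLocalDiffeomorphOn ⟨p, hp⟩) (by simp)
  rw [← this]
  exact ContinuousLinearEquiv.injective _

theorem IsContactEmbeddingOn.surjective (h : IsContactEmbeddingOn ξ₁ ξ₂ f U) {p : Y₁}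
    (hp : p ∈ U) : Function.Surjective (mfderiv (𝓡 3) (𝓡 3) f p) :=
  surjective_of_injective (L := (mfderiv (𝓡 3) (𝓡 3) f p : E3 →L[ℝ] E3)) (h.injective hp)

/-- Two plane fields with the same pull-back under an embedding agree on its image. -/
theorem IsContactEmbeddingOn.pos_eq (h : IsContactEmbeddingOn ξ₁ ξ₂ f U) {p : Y₁} (hp : p ∈ U)
    {P P' : ∀ y : Y₂, Set (TangentSpace (𝓡 3) y)}
    (hP : ∀ v : TangentSpace (𝓡 3) p,
      mfderiv (𝓡 3) (𝓡 3) f p v ∈ P (f p) ↔ mfderiv (𝓡 3) (𝓡 3) f p v ∈ P' (f p)) :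
    P (f p) = P' (f p) := by
  ext V
  obtain ⟨v, rfl⟩ := h.surjective hp V
  exact hP v

theorem IsContactEmbeddingOn.immOn_comp (h : IsContactEmbeddingOn ξ₁ ξ₂ f U) {ψ : E3 → Y₁}
    {V : Set E3} (hψ : ImmOn ψ V) (hm : MapsTo ψ V U) : ImmOn (f ∘ ψ) V := by
  refine ⟨hψ.isOpen, h.isLocalDiffeomorphOn.contMDiffOn.comp hψ.contMDiffOn hm, fun u hu => ?_⟩
  rw [mfderiv_comp u (h.mdifferentiableAt (hm hu)) (hψ.mdifferentiableAt hu)]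
  exact (h.injective (hm hu)).comp (hψ.injective u hu)

theorem IsContactEmbeddingOn.pb_comp (h : IsContactEmbeddingOn ξ₁ ξ₂ f U) {ψ : E3 → Y₁} {u : E3}
    (hψ : MDifferentiableAt (𝓡 3) (𝓡 3) ψ u) (hu : ψ u ∈ U)
    {P : ∀ y : Y₂, Set (TangentSpace (𝓡 3) y)} {Q : ∀ y : Y₁, Set (TangentSpace (𝓡 3) y)}
    (hPQ : ∀ v : TangentSpace (𝓡 3) (ψ u),
      mfderiv (𝓡 3) (𝓡 3) f (ψ u) v ∈ P (f (ψ u)) ↔ v ∈ Q (ψ u)) :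
    pb (f ∘ ψ) P u = pb ψ Q u := by
  ext v
  simp only [pb, mem_ofPred_eq, mfderiv_comp u (h.mdifferentiableAt hu) hψ]
  exact hPQ _

theorem IsContactEmbeddingOn.pb_contact (h : IsContactEmbeddingOn ξ₁ ξ₂ f U) {ψ : E3 → Y₁} {u : E3}
    (hψ : MDifferentiableAt (𝓡 3) (𝓡 3) ψ u) (hu : ψ u ∈ U) :
    pb (f ∘ ψ) ξ₂.pos u = pb ψ ξ₁.pos u :=
  h.pb_comp hψ hu (h.contact _ hu)

end ContactEmbedding

section Sum

variable {Ym Yp Y : Type*} [TopologicalSpace Ym] [ChartedSpace E3 Ym]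
  [TopologicalSpace Yp] [ChartedSpace E3 Yp] [TopologicalSpace Y] [ChartedSpace E3 Y]
  {ξm : ContactStructure Ym} {Bm : DarbouxBall ξm}
  {ξp : ContactStructure Yp} {Bp : DarbouxBall ξp} {ξ : ContactStructure Y}

theorem DarbouxBall.center_mem {Y : Type*} [TopologicalSpace Y] [ChartedSpace E3 Y]
    {ξ : ContactStructure Y} (B : DarbouxBall ξ) : B.center ∈ B.image :=
  mem_image_of_mem _ (by simp)

theorem DarbouxBall.ne_center {Y : Type*} [TopologicalSpace Y] [ChartedSpace E3 Y]
    {ξ : ContactStructure Y} (B : DarbouxBall ξ) {p : Y} (h : p ∉ B.image) : p ≠ B.center :=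
  fun e => h (e ▸ B.center_mem)

theorem norm_sq_handlePoint (w : E3) (t : ℝ) :
    ‖handlePoint w t‖ ^ 2 = |t| * (w 0 ^ 2 + w 1 ^ 2) + t ^ 4 * w 2 ^ 2 := by
  rw [norm_sq_coords]
  simp only [handlePoint, PiLp.toLp_apply, Matrix.cons_val_zero, Matrix.cons_val_one,
    Matrix.cons_val]
  have := Real.sq_sqrt (abs_nonneg t)
  linear_combination (w 0 ^ 2 + w 1 ^ 2) * this

theorem norm_handlePoint_le {w : E3} (hw : ‖w‖ = 1) {t : ℝ} (ht : |t| ≤ 1) :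
    ‖handlePoint w t‖ ≤ 1 := by
  rw [← sq_le_one_iff₀ (norm_nonneg _), norm_sq_handlePoint]
  have h1 := norm_sq_coords w
  rw [hw] at h1
  have h2 : t ^ 4 ≤ 1 := by
    have := pow_le_one₀ (n := 4) (abs_nonneg t) ht
    rwa [show |t| ^ 4 = t ^ 4 from (by decide : Even 4).pow_abs t] at this
  nlinarith [mul_le_mul_of_nonneg_right ht (add_nonneg (sq_nonneg (w 0)) (sq_nonneg (w 1))),
    mul_le_mul_of_nonneg_right h2 (sq_nonneg (w 2))]

theorem norm_reflectZ (w : E3) : ‖reflectZ w‖ = ‖w‖ := by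
  rw [← sq_eq_sq₀ (norm_nonneg _) (norm_nonneg _), norm_sq_coords, norm_sq_coords]
  simp [reflectZ]

theorem DarbouxBall.ne_center_of_norm {Y : Type*} [TopologicalSpace Y] [ChartedSpace E3 Y]
    {ξ : ContactStructure Y} (B : DarbouxBall ξ) {u : E3} (h0 : u ≠ 0) (hu : ‖u‖ ≤ 1) :
    B.toFun u ≠ B.center := fun h =>
  h0 (B.injOn (by simpa using hu) (by simp) h)

theorem handlePoint_ne_zero {w : E3} (hw : ‖w‖ = 1) {t : ℝ} (ht : t ≠ 0) :
    handlePoint w t ≠ 0 := fun h => by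
  have h1 := norm_sq_handlePoint w t
  have h2 := norm_sq_coords w
  rw [h, norm_zero] at h1
  rw [hw] at h2
  have h3 : 0 < |t| := abs_pos.2 ht
  have h4 : 0 < t ^ 4 := by positivity
  have h5 : w 0 ^ 2 + w 1 ^ 2 = 0 := by
    by_contra hc
    have : 0 < w 0 ^ 2 + w 1 ^ 2 := lt_of_le_of_ne (by positivity) (Ne.symm hc)
    have := mul_pos h3 this
    nlinarith [sq_nonneg (w 2), mul_nonneg h4.le (sq_nonneg (w 2))]
  have h6 : w 2 ^ 2 = 1 := by linarith
  rw [h5, h6] at h1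
  linarith

namespace ContactConnectedSum

theorem inl_notMem_right (S : ContactConnectedSum ξm Bm ξp Bp ξ) {p : Ym} (hp : p ≠ Bm.center) :
    S.inl p ∉ S.right := by
  rintro ⟨q, hq, h⟩
  exact S.inl_ne_inr p hp q (Bp.ne_center hq) h.symm

theorem inr_notMem_left (S : ContactConnectedSum ξm Bm ξp Bp ξ) {q : Yp} (hq : q ≠ Bp.center) :
    S.inr q ∉ S.left := by
  rintro ⟨p, hp, h⟩
  exact S.inl_ne_inr p (Bm.ne_center hp) q hq h

theorem inl_mem_left (S : ContactConnectedSum ξm Bm ξp Bp ξ) {p : Ym} (hp : p ≠ Bm.center) :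
    S.inl p ∈ S.left ↔ p ∉ Bm.image := by
  refine ⟨?_, fun h => mem_image_of_mem _ h⟩
  rintro ⟨p', hp', h⟩
  rwa [← S.inl_emb.injOn (Bm.ne_center hp') hp h]

theorem inr_mem_right (S : ContactConnectedSum ξm Bm ξp Bp ξ) {q : Yp} (hq : q ≠ Bp.center) :
    S.inr q ∈ S.right ↔ q ∉ Bp.image := by
  refine ⟨?_, fun h => mem_image_of_mem _ h⟩
  rintro ⟨q', hq', h⟩
  rwa [← S.inr_emb.injOn (Bp.ne_center hq') hq h]

theorem inl_mem_neckRegion (S : ContactConnectedSum ξm Bm ξp Bp ξ) {p : Ym} (hp : p ≠ Bm.center) :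
    S.inl p ∈ S.neckRegion ↔ p ∈ Bm.image := by
  rw [neckRegion, mem_compl_iff, mem_union, S.inl_mem_left hp]
  simp [S.inl_notMem_right hp]

theorem inr_mem_neckRegion (S : ContactConnectedSum ξm Bm ξp Bp ξ) {q : Yp} (hq : q ≠ Bp.center) :
    S.inr q ∈ S.neckRegion ↔ q ∈ Bp.image := by
  rw [neckRegion, mem_compl_iff, mem_union, S.inr_mem_right hq]
  simp [S.inr_notMem_left hq]

theorem neck_zero_mem (S : ContactConnectedSum ξm Bm ξp Bp ξ) (w : S2) :
    S.neck (w, 0) ∈ S.neckRegion := by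
  rintro (⟨p, hp, h⟩ | ⟨p, hp, h⟩)
  · exact S.neck_ne_inl w p (Bm.ne_center hp) h.symm
  · exact S.neck_ne_inr w p (Bp.ne_center hp) h.symm

theorem neck_mem (S : ContactConnectedSum ξm Bm ξp Bp ξ) (w : S2) {t : ℝ}
    (ht : t ∈ Ioo (-1 : ℝ) 1) : S.neck (w, t) ∈ S.neckRegion := by
  have hw : ‖(w : E3)‖ = 1 := by simp
  have h1 := norm_handlePoint_le hw (abs_le.2 ⟨ht.1.le, ht.2.le⟩)
  rcases lt_trichotomy t 0 with h | h | h
  · have h0 := handlePoint_ne_zero hw h.ne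
    rw [S.neck_neg w t ⟨ht.1, h⟩, S.inl_mem_neckRegion]
    · exact mem_image_of_mem _ (by simpa [norm_reflectZ] using h1)
    · refine DarbouxBall.ne_center_of_norm _ (norm_ne_zero_iff.1 ?_) (by rwa [norm_reflectZ])
      rwa [norm_reflectZ, norm_ne_zero_iff]
  · rw [h]; exact S.neck_zero_mem w
  · have h0 := handlePoint_ne_zero hw h.ne'
    rw [S.neck_pos w t ⟨h, ht.2⟩, S.inr_mem_neckRegion (DarbouxBall.ne_center_of_norm _ h0 h1)]
    exact mem_image_of_mem _ (by simpa using h1)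

theorem neckRegion_mem_nhds (S : ContactConnectedSum ξm Bm ξp Bp ξ) (w : S2) {t : ℝ}
    (ht : t ∈ Ioo (-1 : ℝ) 1) : S.neckRegion ∈ 𝓝 (S.neck (w, t)) := by
  have hx : (w, t) ∈ (univ ×ˢ Ioo (-1) 1 : Set (S2 × ℝ)) := ⟨mem_univ _, ht⟩
  rw [← S.neck_diffeo.isLocalHomeomorphOn.map_nhds_eq hx, Filter.mem_map]
  have : IsOpen (univ ×ˢ Ioo (-1) 1 : Set (S2 × ℝ)) := isOpen_univ.prod isOpen_Ioo
  filter_upwards [this.mem_nhds hx] with x hx using S.neck_mem x.1 hx.2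

/-- The plane field on the sum given by plane fields on the summands. -/
def sumPos (S : ContactConnectedSum ξm Bm ξp Bp ξ) (ηm : ContactStructure Ym)
    (ηp : ContactStructure Yp) (y : Y) : Set (TangentSpace (𝓡 3) y) :=
  {V | (∃ p ∉ Bm.image, S.inl p = y ∧
      ∃ v ∈ ηm.pos p, (mfderiv (𝓡 3) (𝓡 3) S.inl p v : E3) = (V : E3)) ∨
    (∃ q ∉ Bp.image, S.inr q = y ∧
      ∃ v ∈ ηp.pos q, (mfderiv (𝓡 3) (𝓡 3) S.inr q v : E3) = (V : E3)) ∨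
    (y ∈ S.neckRegion ∧ V ∈ ξ.pos y)}

theorem sumPos_neckRegion (S : ContactConnectedSum ξm Bm ξp Bp ξ) (ηm : ContactStructure Ym)
    (ηp : ContactStructure Yp) {y : Y} (hy : y ∈ S.neckRegion) :
    S.sumPos ηm ηp y = ξ.pos y := by
  ext V
  constructor
  · rintro (⟨p, hp, rfl, -⟩ | ⟨p, hp, rfl, -⟩ | ⟨-, h⟩)
    · exact absurd (Or.inl (mem_image_of_mem _ hp)) hy
    · exact absurd (Or.inr (mem_image_of_mem _ hp)) hy
    · exact h
  · exact fun h => Or.inr (Or.inr ⟨hy, h⟩)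

theorem sumPos_inl (S : ContactConnectedSum ξm Bm ξp Bp ξ) {ηm : ContactStructure Ym}
    (hm : ∀ p ∈ Bm.image, ηm.pos p = ξm.pos p) (ηp : ContactStructure Yp) {p : Ym}
    (hp : p ≠ Bm.center) (v : TangentSpace (𝓡 3) p) :
    mfderiv (𝓡 3) (𝓡 3) S.inl p v ∈ S.sumPos ηm ηp (S.inl p) ↔ v ∈ ηm.pos p := by
  by_cases h : p ∈ Bm.image
  · rw [S.sumPos_neckRegion _ _ ((S.inl_mem_neckRegion hp).2 h), hm p h]
    exact S.inl_emb.contact p hp v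
  · constructor
    · rintro (⟨p', hp', he, v', hv', e⟩ | ⟨q, hq, he, -⟩ | ⟨h', -⟩)
      · obtain rfl := S.inl_emb.injOn (Bm.ne_center hp') hp he
        obtain rfl := S.inl_emb.injective hp e
        exact hv'
      · exact absurd he.symm (S.inl_ne_inr p hp q (Bp.ne_center hq))
      · exact absurd ((S.inl_mem_neckRegion hp).1 h') h
    · exact fun hv => Or.inl ⟨p, h, rfl, v, hv, rfl⟩

theorem sumPos_inr (S : ContactConnectedSum ξm Bm ξp Bp ξ) (ηm : ContactStructure Ym)
    {ηp : ContactStructure Yp} (hη : ∀ p ∈ Bp.image, ηp.pos p = ξp.pos p) {p : Yp}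
    (hp : p ≠ Bp.center) (v : TangentSpace (𝓡 3) p) :
    mfderiv (𝓡 3) (𝓡 3) S.inr p v ∈ S.sumPos ηm ηp (S.inr p) ↔ v ∈ ηp.pos p := by
  by_cases h : p ∈ Bp.image
  · rw [S.sumPos_neckRegion _ _ ((S.inr_mem_neckRegion hp).2 h), hη p h]
    exact S.inr_emb.contact p hp v
  · constructor
    · rintro (⟨q, hq, he, -⟩ | ⟨p', hp', he, v', hv', e⟩ | ⟨h', -⟩)
      · exact absurd he (S.inl_ne_inr q (Bm.ne_center hq) p hp)
      · obtain rfl := S.inr_emb.injOn (Bp.ne_center hp') hp he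
        obtain rfl := S.inr_emb.injective hp e
        exact hv'
      · exact absurd ((S.inr_mem_neckRegion hp).1 h') h
    · exact fun hv => Or.inr (Or.inl ⟨p, h, rfl, v, hv, rfl⟩)

/-- A plane field on the sum that restricts to the given ones. -/
theorem eq_sumPos (S : ContactConnectedSum ξm Bm ξp Bp ξ) {ηm : ContactStructure Ym}
    (hm : ∀ p ∈ Bm.image, ηm.pos p = ξm.pos p) {ηp : ContactStructure Yp}
    (hη : ∀ p ∈ Bp.image, ηp.pos p = ξp.pos p) {P : ∀ y : Y, Set (TangentSpace (𝓡 3) y)}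
    (h1 : ∀ y ∈ S.neckRegion, P y = ξ.pos y)
    (h2 : ∀ p ∉ Bm.image, ∀ v : TangentSpace (𝓡 3) p,
      mfderiv (𝓡 3) (𝓡 3) S.inl p v ∈ P (S.inl p) ↔ v ∈ ηm.pos p)
    (h3 : ∀ p ∉ Bp.image, ∀ v : TangentSpace (𝓡 3) p,
      mfderiv (𝓡 3) (𝓡 3) S.inr p v ∈ P (S.inr p) ↔ v ∈ ηp.pos p) :
    P = S.sumPos ηm ηp := by
  funext y
  by_cases hy : y ∈ S.neckRegion
  · rw [h1 y hy, S.sumPos_neckRegion _ _ hy]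
  · rw [neckRegion, mem_compl_iff, not_not] at hy
    obtain ⟨p, hp, rfl⟩ | ⟨p, hp, rfl⟩ := hy
    · exact S.inl_emb.pos_eq (Bm.ne_center hp)
        fun v => (h2 p hp v).trans (S.sumPos_inl hm ηp (Bm.ne_center hp) v).symm
    · exact S.inr_emb.pos_eq (Bp.ne_center hp)
        fun v => (h3 p hp v).trans (S.sumPos_inr ηm hη (Bp.ne_center hp) v).symm

theorem sumPos_base (S : ContactConnectedSum ξm Bm ξp Bp ξ) : S.sumPos ξm ξp = ξ.pos :=
  (S.eq_sumPos (fun _ _ => rfl) (fun _ _ => rfl) (fun _ _ => rfl)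
    (fun p hp => S.inl_emb.contact p (Bm.ne_center hp))
    fun p hp => S.inr_emb.contact p (Bp.ne_center hp)).symm

theorem isSumLeft (S : ContactConnectedSum ξm Bm ξp Bp ξ) {η : ContactStructure Ym}
    (hη : ∀ p ∈ Bm.image, η.pos p = ξm.pos p) {η' : ContactStructure Y}
    (h : η'.pos = S.sumPos η ξp) : S.IsSumLeft η η' := by
  refine ⟨fun p hp v => by rw [h]; exact S.sumPos_inl hη _ (Bm.ne_center hp) v, fun y hy => ?_⟩
  rw [h]
  by_cases hr : y ∈ S.right
  · obtain ⟨q, hq, rfl⟩ := hr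
    exact S.inr_emb.pos_eq (Bp.ne_center hq) fun v =>
      (S.sumPos_inr η (fun _ _ => rfl) (Bp.ne_center hq) v).trans
        (S.inr_emb.contact q (Bp.ne_center hq) v).symm
  · exact S.sumPos_neckRegion _ _ fun hc => hc.elim hy hr

theorem isSumRight (S : ContactConnectedSum ξm Bm ξp Bp ξ) {η : ContactStructure Yp}
    (hη : ∀ p ∈ Bp.image, η.pos p = ξp.pos p) {η' : ContactStructure Y}
    (h : η'.pos = S.sumPos ξm η) : S.IsSumRight η η' := by
  refine ⟨fun p hp v => by rw [h]; exact S.sumPos_inr _ hη (Bp.ne_center hp) v, fun y hy => ?_⟩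
  rw [h]
  by_cases hl : y ∈ S.left
  · obtain ⟨q, hq, rfl⟩ := hl
    exact S.inl_emb.pos_eq (Bm.ne_center hq) fun v =>
      (S.sumPos_inl (fun _ _ => rfl) η (Bm.ne_center hq) v).trans
        (S.inl_emb.contact q (Bm.ne_center hq) v).symm
  · exact S.sumPos_neckRegion _ _ fun hc => hc.elim hl hy

variable [IsManifold (𝓡 3) ∞ Ym] [IsManifold (𝓡 3) ∞ Yp] [IsManifold (𝓡 3) ∞ Y]
  [T2Space Ym] [T2Space Yp]

theorem exists_sum (S : ContactConnectedSum ξm Bm ξp Bp ξ) :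
    ∃ F : C(SpaceCB Bm × SpaceCB Bp, ContactStructure Y),
      ∀ k, (F k).pos = S.sumPos k.1.1.1 k.2.1.1 := by
  refine exists_continuous_contactStructure
    (P := fun k : SpaceCB Bm × SpaceCB Bp => S.sumPos k.1.1.1 k.2.1.1) fun k y => ?_
  -- off the balls, the sum is locally one of the given structures; on the neck, it is `ξ`
  rcases S.cover y with ⟨p, hp, rfl⟩ | ⟨p, hp, rfl⟩ | ⟨w, rfl⟩
  · set e := chartAt E3 p
    set V : Set E3 := e.target ∩ e.symm ⁻¹' {Bm.center}ᶜ with hV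
    have hVo : IsOpen V := e.isOpen_inter_preimage_symm isOpen_compl_singleton
    have hI : ImmOn e.symm V := (immOn_chart_symm p).mono hVo inter_subset_left
    have hpe : e.symm (e p) = p := e.left_inv (mem_chart_source E3 p)
    have hpV : e p ∈ V := ⟨mem_chart_target E3 p, by simpa [hpe] using hp⟩
    refine ⟨S.inl ∘ e.symm, V, e p, S.inl_emb.immOn_comp hI fun u hu => hu.2, hpV,
      by simp [hpe], (halfFam_of_continuous (η := fun k : SpaceCB Bm × SpaceCB Bp => k.1.1.1)
        (by fun_prop) hI hpV k).congr ?_⟩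
    have hW : IsOpen {q : (SpaceCB Bm × SpaceCB Bp) × E3 | q.2 ∈ V} := hVo.preimage continuous_snd
    filter_upwards [hW.mem_nhds hpV] with q hq
    exact S.inl_emb.pb_comp (hI.mdifferentiableAt hq) hq.2 (S.sumPos_inl q.1.1.2 _ hq.2)
  · set e := chartAt E3 p
    set V : Set E3 := e.target ∩ e.symm ⁻¹' {Bp.center}ᶜ with hV
    have hVo : IsOpen V := e.isOpen_inter_preimage_symm isOpen_compl_singleton
    have hI : ImmOn e.symm V := (immOn_chart_symm p).mono hVo inter_subset_left
    have hpe : e.symm (e p) = p := e.left_inv (mem_chart_source E3 p)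
    have hpV : e p ∈ V := ⟨mem_chart_target E3 p, by simpa [hpe] using hp⟩
    refine ⟨S.inr ∘ e.symm, V, e p, S.inr_emb.immOn_comp hI fun u hu => hu.2, hpV,
      by simp [hpe], (halfFam_of_continuous (η := fun k : SpaceCB Bm × SpaceCB Bp => k.2.1.1)
        (by fun_prop) hI hpV k).congr ?_⟩
    have hW : IsOpen {q : (SpaceCB Bm × SpaceCB Bp) × E3 | q.2 ∈ V} := hVo.preimage continuous_snd
    filter_upwards [hW.mem_nhds hpV] with q hq
    exact S.inr_emb.pb_comp (hI.mdifferentiableAt hq) hq.2 (S.sumPos_inr _ q.1.2.2 hq.2)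
  · set p := S.neck (w, 0)
    set e := chartAt E3 p
    have hpe : e.symm (e p) = p := e.left_inv (mem_chart_source E3 p)
    refine ⟨e.symm, e.target, e p, immOn_chart_symm p, mem_chart_target E3 p, hpe,
      (halfFam_of_continuous (η := fun k : SpaceCB Bm × SpaceCB Bp => ξ)
        (by fun_prop) (immOn_chart_symm p) (mem_chart_target E3 p) k).congr ?_⟩
    have hca : ContinuousAt (fun q : (SpaceCB Bm × SpaceCB Bp) × E3 => e.symm q.2) (k, e p) :=
      ContinuousAt.comp (g := e.symm) (f := fun q : (SpaceCB Bm × SpaceCB Bp) × E3 => q.2)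
        (e.continuousAt_symm (mem_chart_target E3 p)) continuousAt_snd
    have hn : S.neckRegion ∈ 𝓝 (e.symm (e p)) := by
      rw [hpe]; exact S.neckRegion_mem_nhds w (by norm_num)
    filter_upwards [hca.eventually_mem hn] with q hq
    exact pb_congr_field (S.sumPos_neckRegion _ _ hq)

/-- The sum of two contact structures, as a continuous map. -/
theorem exists_sumMap (S : ContactConnectedSum ξm Bm ξp Bp ξ) (B : DarbouxBall ξ)
    (hB : B.image ⊆ S.neckRegion) :
    ∃ F : C(SpaceCB Bm × SpaceCB Bp, SpaceCB B), F (baseCB Bm, baseCB Bp) = baseCB B ∧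
      ∀ k, (F k).1.1.pos = S.sumPos k.1.1.1 k.2.1.1 := by
  obtain ⟨F, hF⟩ := S.exists_sum
  have h0 : F (baseCB Bm, baseCB Bp) = ξ :=
    ContactStructure.ext ((hF _).trans S.sumPos_base)
  have := pathConnectedSpace_spaceCB Bm
  have := pathConnectedSpace_spaceCB Bp
  have hm : ∀ k, F k ∈ pathComponent ξ := mem_pathComponent_of_continuous F.continuous h0
  refine ⟨⟨fun k => ⟨⟨F k, hm k⟩, fun p hp => ?_⟩, by fun_prop⟩,
    Subtype.ext (Subtype.ext h0), hF⟩
  rw [hF, S.sumPos_neckRegion _ _ (hB hp)]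

end ContactConnectedSum

end Sum

/-! ### Rotations about the `z`-axis and maps that commute with them -/

section Radial

/-- The linear map `(x, y, z) ↦ (c x - s y, s x + c y, z)`, a rotation if `c² + s² = 1`. -/
def rotZ (c s : ℝ) : E3 →L[ℝ] E3 :=
  LinearMap.toContinuousLinearMap
    { toFun := fun v => !₂[c * v 0 - s * v 1, s * v 0 + c * v 1, v 2]
      map_add' := fun v w => by apply E3_ext <;> simp <;> ring
      map_smul' := fun t v => by apply E3_ext <;> simp <;> ring }

@[simp] theorem rotZ_zero (c s : ℝ) (v : E3) : rotZ c s v 0 = c * v 0 - s * v 1 := rfl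
@[simp] theorem rotZ_one (c s : ℝ) (v : E3) : rotZ c s v 1 = s * v 0 + c * v 1 := rfl
@[simp] theorem rotZ_two (c s : ℝ) (v : E3) : rotZ c s v 2 = v 2 := rfl

theorem norm_rotZ {c s : ℝ} (h : c ^ 2 + s ^ 2 = 1) (v : E3) : ‖rotZ c s v‖ = ‖v‖ := by
  rw [← sq_eq_sq₀ (norm_nonneg _) (norm_nonneg _), norm_sq_coords, norm_sq_coords]
  simp only [rotZ_zero, rotZ_one, rotZ_two]
  linear_combination (v 0 ^ 2 + v 1 ^ 2) * h

theorem stdForm_rotZ {c s : ℝ} (h : c ^ 2 + s ^ 2 = 1) (u v : E3) :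
    stdForm (rotZ c s u) (rotZ c s v) = stdForm u v := by
  simp only [stdForm, rotZ_zero, rotZ_one, rotZ_two]
  linear_combination (1 / 2) * (u 0 * v 1 - u 1 * v 0) * h

/-- The pull-back of the standard contact structure under a map commuting with the rotations is
invariant under the rotations. -/
theorem stdForm_fderiv_rotZ {F : E3 → E3} {u : E3} {c s : ℝ} (h : c ^ 2 + s ^ 2 = 1)
    (hF : DifferentiableAt ℝ F u) (hF' : DifferentiableAt ℝ F (rotZ c s u))
    (hc : ∀ x, F (rotZ c s x) = rotZ c s (F x)) (v : E3) :
    stdForm (F (rotZ c s u)) (fderiv ℝ F (rotZ c s u) (rotZ c s v)) =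
      stdForm (F u) (fderiv ℝ F u v) := by
  have h1 : HasFDerivAt (F ∘ rotZ c s) ((fderiv ℝ F (rotZ c s u)).comp (rotZ c s)) u :=
    hF'.hasFDerivAt.comp u (rotZ c s).hasFDerivAt
  have h2 : HasFDerivAt (rotZ c s ∘ F) ((rotZ c s).comp (fderiv ℝ F u)) u :=
    (rotZ c s).hasFDerivAt.comp u hF.hasFDerivAt
  have e : F ∘ rotZ c s = rotZ c s ∘ F := funext hc
  rw [e] at h1
  have h3 := DFunLike.congr_fun (h1.unique h2) v
  simp only [ContinuousLinearMap.comp_apply] at h3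
  rw [h3, hc, stdForm_rotZ h]

/-- The map `(x, y, z) ↦ (m x, m y, n z)`, with factors depending on the distance to `0`. -/
def radialMap (m n : ℝ → ℝ) (u : E3) : E3 :=
  !₂[m (‖u‖ ^ 2) * u 0, m (‖u‖ ^ 2) * u 1, n (‖u‖ ^ 2) * u 2]

theorem radialMap_rotZ (m n : ℝ → ℝ) {c s : ℝ} (h : c ^ 2 + s ^ 2 = 1) (u : E3) :
    radialMap m n (rotZ c s u) = rotZ c s (radialMap m n u) := by
  apply E3_ext <;> simp [radialMap, norm_rotZ h] <;> ring

theorem norm_sq_radialMap (m n : ℝ → ℝ) (u : E3) :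
    ‖radialMap m n u‖ ^ 2 =
      m (‖u‖ ^ 2) ^ 2 * (u 0 ^ 2 + u 1 ^ 2) + n (‖u‖ ^ 2) ^ 2 * u 2 ^ 2 := by
  rw [norm_sq_coords]
  simp [radialMap]
  ring

theorem contDiffOn_radialMap {m n : ℝ → ℝ} {S : Set ℝ} (hm : ContDiffOn ℝ ∞ m S)
    (hn : ContDiffOn ℝ ∞ n S) : ContDiffOn ℝ ∞ (radialMap m n) {u | ‖u‖ ^ 2 ∈ S} := by
  have hq : ContDiffOn ℝ ∞ (fun u : E3 => ‖u‖ ^ 2) {u | ‖u‖ ^ 2 ∈ S} :=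
    (contDiff_norm_sq ℝ).contDiffOn
  have h1 : ContDiffOn ℝ ∞ (fun u : E3 => m (‖u‖ ^ 2)) {u | ‖u‖ ^ 2 ∈ S} := hm.comp hq fun u hu => hu
  have h2 : ContDiffOn ℝ ∞ (fun u : E3 => n (‖u‖ ^ 2)) {u | ‖u‖ ^ 2 ∈ S} := hn.comp hq fun u hu => hu
  rw [contDiffOn_euclidean]
  intro i
  have hi : ∀ i : Fin 3, ContDiffOn ℝ ∞ (fun u : E3 => u i) {u | ‖u‖ ^ 2 ∈ S} := fun i => by fun_prop
  fin_cases i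
  exacts [h1.mul (hi 0), h1.mul (hi 1), h2.mul (hi 2)]

theorem injective_fderiv_radialMap {m n : ℝ → ℝ} {u : E3} (hm : DifferentiableAt ℝ m (‖u‖ ^ 2))
    (hn : DifferentiableAt ℝ n (‖u‖ ^ 2)) (hm0 : m (‖u‖ ^ 2) ≠ 0) (hn0 : n (‖u‖ ^ 2) ≠ 0)
    (hd : m (‖u‖ ^ 2) * n (‖u‖ ^ 2) + 2 * deriv m (‖u‖ ^ 2) * n (‖u‖ ^ 2) * (u 0 ^ 2 + u 1 ^ 2) +
      2 * deriv n (‖u‖ ^ 2) * m (‖u‖ ^ 2) * u 2 ^ 2 ≠ 0) :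
    Function.Injective (fderiv ℝ (radialMap m n) u) := by
  have h1 : HasFDerivAt (fun x : E3 => ‖x‖ ^ 2) ((2 : ℝ) • innerSL ℝ u) u :=
    (hasStrictFDerivAt_norm_sq u).hasFDerivAt.congr_fderiv (by ext v; simp)
  set a := m (‖u‖ ^ 2) with ha
  set b := n (‖u‖ ^ 2) with hb
  have h2 : HasFDerivAt (fun x : E3 => m (‖x‖ ^ 2)) (deriv m (‖u‖ ^ 2) • ((2 : ℝ) • innerSL ℝ u)) u :=
    hm.hasDerivAt.comp_hasFDerivAt u h1
  have h3 : HasFDerivAt (fun x : E3 => n (‖x‖ ^ 2)) (deriv n (‖u‖ ^ 2) • ((2 : ℝ) • innerSL ℝ u)) u :=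
    hn.hasDerivAt.comp_hasFDerivAt u h1
  set a' := deriv m (‖u‖ ^ 2)
  set b' := deriv n (‖u‖ ^ 2)
  have hp : ∀ i : Fin 3, HasFDerivAt (fun x : E3 => x i) (EuclideanSpace.proj i : E3 →L[ℝ] ℝ) u :=
    fun i => (EuclideanSpace.proj i : E3 →L[ℝ] ℝ).hasFDerivAt
  have hdiff : DifferentiableAt ℝ (radialMap m n) u := by
    rw [differentiableAt_euclidean]
    intro i
    fin_cases i
    · exact (h2.mul (hp 0)).differentiableAt
    · exact (h2.mul (hp 1)).differentiableAt
    · exact (h3.mul (hp 2)).differentiableAt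
  have e0 : ∀ v, fderiv ℝ (radialMap m n) u v 0 = a * v 0 + u 0 * (a' * (2 * inner ℝ u v)) :=
    fun v => by
      rw [fderiv_coord hdiff, show (fun x : E3 => radialMap m n x 0) =
        fun x => m (‖x‖ ^ 2) * x 0 from rfl]
      have h4 : HasFDerivAt (fun x : E3 => m (‖x‖ ^ 2) * x 0) _ u := h2.mul (hp 0)
      rw [h4.fderiv]
      simp [ha]
  have e1 : ∀ v, fderiv ℝ (radialMap m n) u v 1 = a * v 1 + u 1 * (a' * (2 * inner ℝ u v)) :=
    fun v => by
      rw [fderiv_coord hdiff, show (fun x : E3 => radialMap m n x 1) =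
        fun x => m (‖x‖ ^ 2) * x 1 from rfl]
      have h4 : HasFDerivAt (fun x : E3 => m (‖x‖ ^ 2) * x 1) _ u := h2.mul (hp 1)
      rw [h4.fderiv]
      simp [ha]
  have e2 : ∀ v, fderiv ℝ (radialMap m n) u v 2 = b * v 2 + u 2 * (b' * (2 * inner ℝ u v)) :=
    fun v => by
      rw [fderiv_coord hdiff, show (fun x : E3 => radialMap m n x 2) =
        fun x => n (‖x‖ ^ 2) * x 2 from rfl]
      have h4 : HasFDerivAt (fun x : E3 => n (‖x‖ ^ 2) * x 2) _ u := h3.mul (hp 2)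
      rw [h4.fderiv]
      simp [hb]
  rw [injective_iff_map_eq_zero]
  intro v hv
  have z0 : a * v 0 + u 0 * (a' * (2 * inner ℝ u v)) = 0 := by rw [← e0, hv]; rfl
  have z1 : a * v 1 + u 1 * (a' * (2 * inner ℝ u v)) = 0 := by rw [← e1, hv]; rfl
  have z2 : b * v 2 + u 2 * (b' * (2 * inner ℝ u v)) = 0 := by rw [← e2, hv]; rfl
  have hin := inner_coords u v
  have key : inner ℝ u v * (a * b + 2 * a' * b * (u 0 ^ 2 + u 1 ^ 2) + 2 * b' * a * u 2 ^ 2) = 0 := by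
    linear_combination a * b * hin + b * u 0 * z0 + b * u 1 * z1 + a * u 2 * z2
  have hz : inner ℝ u v = 0 := (mul_eq_zero.1 key).resolve_right hd
  rw [hz] at z0 z1 z2
  simp only [mul_zero, add_zero, mul_eq_zero, hm0, hn0, false_or] at z0 z1 z2
  exact E3_ext z0 z1 z2

/-- A positive radial factor `m`, as a function of the square of the distance to `0`, for which the
distance `t ↦ t m(t²)` is strictly increasing. -/
structure IsProfile (m : ℝ → ℝ) (S : Set ℝ) : Prop where
  isOpen : IsOpen S
  convex : Convex ℝ S
  contDiffOn : ContDiffOn ℝ ∞ m S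
  pos : ∀ s ∈ S, 0 ≤ s → 0 < m s
  deriv_pos : ∀ s ∈ S, 0 ≤ s → 0 < m s + 2 * s * deriv m s

theorem IsProfile.differentiableAt {m : ℝ → ℝ} {S : Set ℝ} (h : IsProfile m S) {s : ℝ}
    (hs : s ∈ S) : DifferentiableAt ℝ m s :=
  (h.contDiffOn.contDiffAt (h.isOpen.mem_nhds hs)).differentiableAt (by simp)

theorem IsProfile.strictMonoOn {m : ℝ → ℝ} {S : Set ℝ} (h : IsProfile m S) :
    StrictMonoOn (fun s => s * m s ^ 2) (S ∩ Ici 0) := by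
  refine strictMonoOn_of_deriv_pos (h.convex.inter (convex_Ici 0)) ?_ fun s hs => ?_
  · exact continuousOn_id.mul ((h.contDiffOn.continuousOn.mono inter_subset_left).pow 2)
  · have hs' := interior_subset hs
    have hd := (h.differentiableAt hs'.1).hasDerivAt
    have : HasDerivAt (fun s => s * m s ^ 2) _ s := (hasDerivAt_id s).mul (hd.pow 2)
    rw [this.deriv]
    have h1 := h.pos s hs'.1 hs'.2
    have h2 := h.deriv_pos s hs'.1 hs'.2
    have h3 := mul_pos h1 h2
    refine lt_of_lt_of_eq h3 ?_
    simp
    ring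

/-- Profiles define injective maps: a point is recovered from its image, since the distances to `0`
are strictly increasing in both factors. -/
theorem IsProfile.injOn {m n : ℝ → ℝ} {S : Set ℝ} (hm : IsProfile m S) (hn : IsProfile n S) :
    InjOn (radialMap m n) {u | ‖u‖ ^ 2 ∈ S} := by
  have key : ∀ u ∈ {u : E3 | ‖u‖ ^ 2 ∈ S}, ∀ v ∈ {u : E3 | ‖u‖ ^ 2 ∈ S},
      radialMap m n u = radialMap m n v → ¬ ‖u‖ ^ 2 < ‖v‖ ^ 2 := by
    intro u hu v hv h hlt
    have h0 := congrArg (fun x : E3 => x 0) h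
    have h1 := congrArg (fun x : E3 => x 1) h
    have h2 := congrArg (fun x : E3 => x 2) h
    simp only [radialMap, PiLp.toLp_apply, Matrix.cons_val_zero, Matrix.cons_val_one,
      Matrix.cons_val] at h0 h1 h2
    have hu0 : (0 : ℝ) ≤ ‖u‖ ^ 2 := sq_nonneg _
    have hv0 : (0 : ℝ) ≤ ‖v‖ ^ 2 := sq_nonneg _
    have m1 := hm.strictMonoOn ⟨hu, hu0⟩ ⟨hv, hv0⟩ hlt
    have n1 := hn.strictMonoOn ⟨hu, hu0⟩ ⟨hv, hv0⟩ hlt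
    have pm := hm.pos _ hu hu0
    have pn := hn.pos _ hu hu0
    have pm' := hm.pos _ hv hv0
    have pn' := hn.pos _ hv hv0
    have hnu := norm_sq_coords u
    have hnv := norm_sq_coords v
    simp only at m1 n1
    set s := ‖u‖ ^ 2
    set s' := ‖v‖ ^ 2
    have hs' : 0 < s' := lt_of_le_of_lt hu0 hlt
    -- compare `s' |u|²` and `s |v|²`, coordinate by coordinate
    have c1 : s * (v 0 ^ 2 + v 1 ^ 2) ≤ s' * (u 0 ^ 2 + u 1 ^ 2) := by
      have e : m s ^ 2 * (u 0 ^ 2 + u 1 ^ 2) = m s' ^ 2 * (v 0 ^ 2 + v 1 ^ 2) := by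
        linear_combination (m s * u 0 + m s' * v 0) * h0 + (m s * u 1 + m s' * v 1) * h1
      have : m s ^ 2 * (s * (v 0 ^ 2 + v 1 ^ 2)) ≤ m s ^ 2 * (s' * (u 0 ^ 2 + u 1 ^ 2)) := by
        nlinarith [mul_nonneg (sub_nonneg.2 m1.le) (add_nonneg (sq_nonneg (v 0)) (sq_nonneg (v 1)))]
      exact le_of_mul_le_mul_left this (by positivity)
    have c2 : s * v 2 ^ 2 ≤ s' * u 2 ^ 2 := by
      have e : n s ^ 2 * u 2 ^ 2 = n s' ^ 2 * v 2 ^ 2 := by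
        linear_combination (n s * u 2 + n s' * v 2) * h2
      have : n s ^ 2 * (s * v 2 ^ 2) ≤ n s ^ 2 * (s' * u 2 ^ 2) := by
        nlinarith [mul_nonneg (sub_nonneg.2 n1.le) (sq_nonneg (v 2))]
      exact le_of_mul_le_mul_left this (by positivity)
    have hsum : s * s' = s' * s := mul_comm _ _
    have d1 : s' * (u 0 ^ 2 + u 1 ^ 2) = s * (v 0 ^ 2 + v 1 ^ 2) := by nlinarith
    have d2 : s' * u 2 ^ 2 = s * v 2 ^ 2 := by nlinarith
    have e1 : m s ^ 2 * (u 0 ^ 2 + u 1 ^ 2) = m s' ^ 2 * (v 0 ^ 2 + v 1 ^ 2) := by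
      linear_combination (m s * u 0 + m s' * v 0) * h0 + (m s * u 1 + m s' * v 1) * h1
    have e2 : n s ^ 2 * u 2 ^ 2 = n s' ^ 2 * v 2 ^ 2 := by
      linear_combination (n s * u 2 + n s' * v 2) * h2
    have f1 : (s' * m s' ^ 2 - s * m s ^ 2) * (v 0 ^ 2 + v 1 ^ 2) = 0 := by
      linear_combination m s ^ 2 * d1 - s' * e1
    have f2 : (s' * n s' ^ 2 - s * n s ^ 2) * v 2 ^ 2 = 0 := by
      linear_combination n s ^ 2 * d2 - s' * e2
    have g1 := (mul_eq_zero.1 f1).resolve_left (sub_pos.2 m1).ne'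
    have g2 := (mul_eq_zero.1 f2).resolve_left (sub_pos.2 n1).ne'
    rw [hnv] at hs'
    linarith
  intro u hu v hv h
  have hs : ‖u‖ ^ 2 = ‖v‖ ^ 2 :=
    le_antisymm (not_lt.1 (key v hv u hu h.symm)) (not_lt.1 (key u hu v hv h))
  have h0 := congrArg (fun x : E3 => x 0) h
  have h1 := congrArg (fun x : E3 => x 1) h
  have h2 := congrArg (fun x : E3 => x 2) h
  have pm := (hm.pos _ hv (sq_nonneg _)).ne'
  have pn := (hn.pos _ hv (sq_nonneg _)).ne'
  simp only [radialMap, PiLp.toLp_apply, Matrix.cons_val_zero, Matrix.cons_val_one,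
    Matrix.cons_val, hs] at h0 h1 h2
  exact E3_ext (mul_left_cancel₀ pm h0) (mul_left_cancel₀ pm h1) (mul_left_cancel₀ pn h2)

theorem IsProfile.injective_fderiv {m n : ℝ → ℝ} {S : Set ℝ} (hm : IsProfile m S)
    (hn : IsProfile n S) {u : E3} (hu : ‖u‖ ^ 2 ∈ S) :
    Function.Injective (fderiv ℝ (radialMap m n) u) := by
  have hu0 : (0 : ℝ) ≤ ‖u‖ ^ 2 := sq_nonneg _
  have pm := hm.pos _ hu hu0
  have pn := hn.pos _ hu hu0
  have dm := hm.deriv_pos _ hu hu0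
  have dn := hn.deriv_pos _ hu hu0
  refine injective_fderiv_radialMap (hm.differentiableAt hu) (hn.differentiableAt hu) pm.ne' pn.ne'
    (ne_of_gt ?_)
  have hnu := norm_sq_coords u
  set s := ‖u‖ ^ 2
  rcases hu0.eq_or_lt with h0 | h0
  · rw [← h0] at hnu
    have h1 : u 0 ^ 2 + u 1 ^ 2 = 0 := by nlinarith [sq_nonneg (u 0), sq_nonneg (u 1), sq_nonneg (u 2)]
    have h2 : u 2 ^ 2 = 0 := by nlinarith [sq_nonneg (u 0), sq_nonneg (u 1), sq_nonneg (u 2)]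
    rw [h1, h2]
    have := mul_pos pm pn
    linarith
  · have h1 : 0 ≤ n s * (u 0 ^ 2 + u 1 ^ 2) := by positivity
    have h2 : 0 ≤ m s * u 2 ^ 2 := by positivity
    have h3 : 0 < n s * (u 0 ^ 2 + u 1 ^ 2) + m s * u 2 ^ 2 := by
      rcases (sq_nonneg (u 2)).eq_or_lt with h | h
      · have : 0 < u 0 ^ 2 + u 1 ^ 2 := by linarith
        have := mul_pos pn this
        linarith
      · have := mul_pos pm h
        linarith
    -- `s` times the expression
    have key : 0 < (m s + 2 * s * deriv m s) * (n s * (u 0 ^ 2 + u 1 ^ 2)) +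
        (n s + 2 * s * deriv n s) * (m s * u 2 ^ 2) := by
      rcases h1.eq_or_lt with h | h
      · rw [← h] at h3 ⊢
        have := mul_pos dn (by linarith : 0 < m s * u 2 ^ 2)
        linarith
      · have := mul_pos dm h
        have := mul_nonneg dn.le h2
        linarith
    refine pos_of_mul_pos_right (a := s) ?_ h0.le
    refine lt_of_lt_of_eq key ?_
    linear_combination -(m s * n s) * hnu

/-- A profile for two factors gives a smooth open embedding. -/
theorem ImmOn.comp_radialMap {Y : Type*} [TopologicalSpace Y] [ChartedSpace E3 Y] {ψ : E3 → Y}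
    {U : Set E3} (h : ImmOn ψ U) {m n : ℝ → ℝ} {S : Set ℝ} (hm : IsProfile m S)
    (hn : IsProfile n S) (hU : ∀ u : E3, ‖u‖ ^ 2 ∈ S → radialMap m n u ∈ U) :
    ImmOn (ψ ∘ radialMap m n) {u | ‖u‖ ^ 2 ∈ S} :=
  h.comp (hm.isOpen.preimage (by fun_prop)) (contDiffOn_radialMap hm.contDiffOn hn.contDiffOn)
    (fun u hu => hm.injective_fderiv hn hu) hU

end Radial

/-! ### The handle coordinates -/

section Profiles

theorem IsProfile.mono {m : ℝ → ℝ} {S T : Set ℝ} (h : IsProfile m S) (hT : IsOpen T)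
    (hc : Convex ℝ T) (hTS : T ⊆ S) : IsProfile m T :=
  ⟨hT, hc, h.contDiffOn.mono hTS, fun s hs => h.pos s (hTS hs), fun s hs => h.deriv_pos s (hTS hs)⟩

theorem mul_rpow_sub_one {s : ℝ} (hs : 0 < s) (e : ℝ) : s * s ^ (e - 1) = s ^ e := by
  rw [Real.rpow_sub_one hs.ne']; field_simp

theorem isProfile_rpow {e : ℝ} (he : -(1 / 2) < e) : IsProfile (fun s => s ^ e) (Ioi 0) where
  isOpen := isOpen_Ioi
  convex := convex_Ioi 0
  contDiffOn := fun s hs => (Real.contDiffAt_rpow_const_of_ne (ne_of_gt hs)).contDiffWithinAt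
  pos := fun s hs _ => Real.rpow_pos_of_pos hs e
  deriv_pos := fun s hs _ => by
    rw [Real.deriv_rpow_const]
    have h1 := mul_rpow_sub_one hs e
    have h2 : 0 < s ^ e := Real.rpow_pos_of_pos hs e
    have h3 : s ^ e + 2 * s * (e * s ^ (e - 1)) = (1 + 2 * e) * s ^ e := by
      linear_combination 2 * e * h1
    rw [h3]
    exact mul_pos (by linarith) h2

/-- An interpolation between the constant `1/4` near `0` and the power `s ^ e` for `9/16 ≤ s`. -/
def blend (e s : ℝ) : ℝ :=
  cutoff (1 / 4) (9 / 16) s / 4 + (1 - cutoff (1 / 4) (9 / 16) s) * s ^ e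

theorem blend_of_le {e s : ℝ} (hs : s ≤ 1 / 4) : blend e s = 1 / 4 := by
  rw [blend, cutoff_eq_one (by norm_num) hs]; ring

theorem blend_of_ge {e s : ℝ} (hs : 9 / 16 ≤ s) : blend e s = s ^ e := by
  rw [blend, cutoff_eq_zero (by norm_num) hs]; ring

theorem deriv_cutoff_mul_nonpos {a b s y : ℝ} (hab : a < b) (hy : s ∈ Icc a b → 0 ≤ y) :
    deriv (cutoff a b) s * y ≤ 0 := by
  by_cases hs : s ∈ Icc a b
  · exact mul_nonpos_of_nonpos_of_nonneg (deriv_cutoff_nonpos hab s) (hy hs)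
  · rw [mem_Icc, not_and_or, not_le, not_le] at hs
    have : deriv (cutoff a b) s = 0 := by
      rcases hs with h | h
      · have e : cutoff a b =ᶠ[𝓝 s] fun _ => 1 := by
          filter_upwards [Iio_mem_nhds h] with x hx using cutoff_eq_one hab (le_of_lt hx)
        rw [e.deriv_eq, deriv_const]
      · have e : cutoff a b =ᶠ[𝓝 s] fun _ => 0 := by
          filter_upwards [Ioi_mem_nhds h] with x hx using cutoff_eq_zero hab (le_of_lt hx)
        rw [e.deriv_eq, deriv_const]
    rw [this, zero_mul]

/-- The distance `t ↦ t * blend e (t ^ 2)` is strictly increasing: both functions have this property,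
and the second lies above the first where they are interpolated. -/
theorem isProfile_blend {e : ℝ} (he : -(1 / 2) < e)
    (hb : ∀ s ∈ Icc (1 / 4 : ℝ) (9 / 16), 1 / 4 ≤ s ^ e) : IsProfile (blend e) univ where
  isOpen := isOpen_univ
  convex := convex_univ
  contDiffOn := fun s _ => by
    rcases lt_or_ge s (1 / 4) with h | h
    · have e' : blend e =ᶠ[𝓝 s] fun _ => 1 / 4 := by
        filter_upwards [Iio_mem_nhds h] with x hx using blend_of_le (le_of_lt hx)
      exact (contDiffAt_const.congr_of_eventuallyEq e').contDiffWithinAt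
    · have h1 : ContDiffAt ℝ ∞ (fun s : ℝ => s ^ e) s :=
        Real.contDiffAt_rpow_const_of_ne (by linarith)
      have h2 : ContDiffAt ℝ ∞ (cutoff (1 / 4) (9 / 16)) s := (contDiff_cutoff _ _).contDiffAt
      exact ((h2.div_const 4).add ((contDiffAt_const.sub h2).mul h1)).contDiffWithinAt
  pos := fun s _ _ => by
    rcases le_or_gt s (1 / 4) with h | h
    · rw [blend_of_le h]; norm_num
    · have h1 : 0 < s ^ e := Real.rpow_pos_of_pos (by linarith) e
      have h2 := cutoff_nonneg (1 / 4) (9 / 16) s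
      have h3 := cutoff_le_one (1 / 4) (9 / 16) s
      rw [blend]
      rcases h2.eq_or_lt with h4 | h4
      · rw [← h4]; simpa using h1
      · have : 0 ≤ (1 - cutoff (1 / 4) (9 / 16) s) * s ^ e := mul_nonneg (by linarith) h1.le
        linarith
  deriv_pos := fun s _ _ => by
    rcases lt_or_ge s (1 / 4) with h | h
    · have e' : blend e =ᶠ[𝓝 s] fun _ => 1 / 4 := by
        filter_upwards [Iio_mem_nhds h] with x hx using blend_of_le (le_of_lt hx)
      rw [e'.deriv_eq, deriv_const, blend_of_le h.le]
      norm_num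
    · have hs0 : 0 < s := by linarith
      set c := cutoff (1 / 4) (9 / 16) with hc
      have h1 : HasDerivAt (fun s : ℝ => s ^ e) (e * s ^ (e - 1)) s :=
        Real.hasDerivAt_rpow_const (Or.inl hs0.ne')
      have h2 : HasDerivAt c (deriv c s) s :=
        ((contDiff_cutoff _ _).differentiable (by simp) s).hasDerivAt
      have h3 : HasDerivAt (blend e) (deriv c s / 4 +
          ((0 - deriv c s) * s ^ e + (1 - c s) * (e * s ^ (e - 1)))) s :=
        (h2.div_const 4).add (((hasDerivAt_const s 1).sub h2).mul h1)
      rw [h3.deriv]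
      have h4 := mul_rpow_sub_one hs0 e
      have h5 : 0 < s ^ e := Real.rpow_pos_of_pos hs0 e
      have h6 := cutoff_nonneg (1 / 4) (9 / 16) s
      have h7 := cutoff_le_one (1 / 4) (9 / 16) s
      have h8 : deriv c s * (s ^ e - 1 / 4) ≤ 0 := deriv_cutoff_mul_nonpos (by norm_num) fun hs => by
        linarith [hb s hs]
      have h9 : blend e s + 2 * s * (deriv c s / 4 +
          ((0 - deriv c s) * s ^ e + (1 - c s) * (e * s ^ (e - 1)))) =
          c s / 4 + (1 + 2 * e) * ((1 - c s) * s ^ e) - 2 * (s * (deriv c s * (s ^ e - 1 / 4))) := by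
        rw [blend]
        linear_combination 2 * (1 - c s) * e * h4
      rw [h9]
      have h10 : s * (deriv c s * (s ^ e - 1 / 4)) ≤ 0 := mul_nonpos_of_nonneg_of_nonpos hs0.le h8
      rcases h6.eq_or_lt with h11 | h11
      · have : 0 < (1 + 2 * e) * ((1 - c s) * s ^ e) := by
          rw [hc, ← h11]
          exact mul_pos (by linarith) (by simpa using h5)
        have : 0 ≤ c s := h6
        linarith
      · have : 0 ≤ (1 + 2 * e) * ((1 - c s) * s ^ e) :=
          mul_nonneg (by linarith) (mul_nonneg (by linarith) h5.le)
        have : 0 < c s := h11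
        linarith

/-- The map sending `t w`, for a unit vector `w` and `t > 0`, to `handlePoint w t`. -/
def handleMap : E3 → E3 := radialMap (fun s => s ^ (-(1 / 4) : ℝ)) fun s => s ^ (1 / 2 : ℝ)

/-- A smooth embedding of `ℝ³` which is `handleMap` near and outside of the unit sphere. -/
def coreMap : E3 → E3 := radialMap (blend (-(1 / 4))) (blend (1 / 2))

theorem isProfile_handle_fst : IsProfile (fun s => s ^ (-(1 / 4) : ℝ)) (Ioi 0) :=
  isProfile_rpow (by norm_num)

theorem isProfile_handle_snd : IsProfile (fun s => s ^ (1 / 2 : ℝ)) (Ioi 0) :=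
  isProfile_rpow (by norm_num)

theorem isProfile_core_fst : IsProfile (blend (-(1 / 4))) univ :=
  isProfile_blend (by norm_num) fun s hs => by
    have : 1 ≤ s ^ (-(1 / 4) : ℝ) :=
      Real.one_le_rpow_of_pos_of_le_one_of_nonpos (by linarith [hs.1]) (by linarith [hs.2])
        (by norm_num)
    linarith

theorem isProfile_core_snd : IsProfile (blend (1 / 2)) univ :=
  isProfile_blend (by norm_num) fun s hs => by
    rw [← Real.sqrt_eq_rpow]
    refine Real.le_sqrt_of_sq_le ?_
    linarith [hs.1]

theorem coreMap_eq_smul {u : E3} (hu : ‖u‖ ^ 2 ≤ 1 / 4) : coreMap u = (1 / 4 : ℝ) • u := by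
  apply E3_ext <;> simp [coreMap, radialMap, blend_of_le hu]

theorem coreMap_eq_handleMap {u : E3} (hu : 9 / 16 ≤ ‖u‖ ^ 2) : coreMap u = handleMap u := by
  apply E3_ext <;> simp [coreMap, handleMap, radialMap, blend_of_ge hu]

theorem rpow_sq_mul {s : ℝ} (hs : 0 < s) : (s ^ (-(1 / 4) : ℝ)) ^ 2 * s = √s := by
  rw [← Real.rpow_natCast, ← Real.rpow_mul hs.le, Real.sqrt_eq_rpow]
  nth_rewrite 2 [← Real.rpow_one s]
  rw [← Real.rpow_add hs]
  norm_num

theorem norm_sq_handleMap {u : E3} (hu : u ≠ 0) : ∃ p : ℝ, p * ‖u‖ ^ 2 = ‖u‖ ∧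
    ‖handleMap u‖ ^ 2 = p * (u 0 ^ 2 + u 1 ^ 2) + ‖u‖ ^ 2 * u 2 ^ 2 := by
  have hs : 0 < ‖u‖ ^ 2 := by have := norm_pos_iff.2 hu; positivity
  refine ⟨((‖u‖ ^ 2) ^ (-(1 / 4) : ℝ)) ^ 2, ?_, ?_⟩
  · rw [rpow_sq_mul hs, Real.sqrt_sq (norm_nonneg _)]
  · rw [handleMap, norm_sq_radialMap, ← Real.sqrt_eq_rpow, Real.sq_sqrt hs.le]

theorem norm_handleMap_le {u : E3} (hu : u ≠ 0) (h1 : ‖u‖ ≤ 1) : ‖handleMap u‖ ≤ 1 := by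
  obtain ⟨p, hp, h⟩ := norm_sq_handleMap hu
  have ht := norm_pos_iff.2 hu
  have hn := norm_sq_coords u
  rw [← sq_le_one_iff₀ (norm_nonneg _), h]
  set t := ‖u‖
  have hpt : p * t = 1 := mul_right_cancel₀ ht.ne' (by linear_combination hp)
  have h2 : t ^ 2 ≤ p := by
    by_contra hc
    have : p * t < t ^ 2 * t := mul_lt_mul_of_pos_right (not_le.1 hc) ht
    have : t ^ 2 * t ≤ 1 := by
      have := pow_le_one₀ (n := 3) ht.le h1
      linarith [show t ^ 3 = t ^ 2 * t by ring]
    linarith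
  have := mul_le_mul_of_nonneg_right h2 (sq_nonneg (u 2))
  nlinarith

theorem one_lt_norm_handleMap {u : E3} (h1 : 1 < ‖u‖) : 1 < ‖handleMap u‖ := by
  have hu : u ≠ 0 := norm_pos_iff.1 (by linarith)
  obtain ⟨p, hp, h⟩ := norm_sq_handleMap hu
  have hn := norm_sq_coords u
  rw [← one_lt_sq_iff₀ (norm_nonneg _), h]
  set t := ‖u‖
  have ht : 0 < t := by linarith
  have hpt : p * t = 1 := mul_right_cancel₀ ht.ne' (by linear_combination hp)
  have h2 : p ≤ t ^ 2 := by
    have hp1 : p < 1 := by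
      by_contra hc
      nlinarith [not_lt.1 hc]
    nlinarith
  have := mul_le_mul_of_nonneg_right h2 (sq_nonneg (u 2))
  nlinarith

theorem norm_handleMap_le_sq {u : E3} (h1 : 1 ≤ ‖u‖) : ‖handleMap u‖ ≤ ‖u‖ ^ 2 := by
  have hu : u ≠ 0 := norm_pos_iff.1 (by linarith)
  obtain ⟨p, hp, h⟩ := norm_sq_handleMap hu
  have hn := norm_sq_coords u
  rw [← sq_le_sq₀ (norm_nonneg _) (by positivity), h]
  set t := ‖u‖
  have ht : 0 < t := by linarith
  have hpt : p * t = 1 := mul_right_cancel₀ ht.ne' (by linear_combination hp)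
  have h2 : p ≤ t ^ 2 := by
    have hp1 : p ≤ 1 := by
      by_contra hc
      nlinarith [not_le.1 hc]
    nlinarith
  have := mul_le_mul_of_nonneg_right h2 (add_nonneg (sq_nonneg (u 0)) (sq_nonneg (u 1)))
  nlinarith

theorem norm_coreMap_le {u : E3} (h1 : ‖u‖ ≤ 1) : ‖coreMap u‖ ≤ 1 := by
  have hs : ‖u‖ ^ 2 ≤ 1 := pow_le_one₀ (norm_nonneg _) h1
  have m1 := isProfile_core_fst.strictMonoOn.monotoneOn ⟨mem_univ (‖u‖ ^ 2), mem_Ici.2 (sq_nonneg ‖u‖)⟩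
    ⟨mem_univ 1, zero_le_one' ℝ⟩ hs
  have n1 := isProfile_core_snd.strictMonoOn.monotoneOn ⟨mem_univ (‖u‖ ^ 2), mem_Ici.2 (sq_nonneg ‖u‖)⟩
    ⟨mem_univ 1, zero_le_one' ℝ⟩ hs
  simp only [blend_of_ge (show (9 / 16 : ℝ) ≤ 1 by norm_num), Real.one_rpow] at m1 n1
  rw [← sq_le_one_iff₀ (norm_nonneg _), coreMap, norm_sq_radialMap]
  have hn := norm_sq_coords u
  set s := ‖u‖ ^ 2
  set a := blend (-(1 / 4)) s
  set b := blend (1 / 2) s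
  rcases (sq_nonneg ‖u‖).eq_or_lt with h0 | h0
  · have hh : 0 = s := h0
    rw [← hh] at hn
    have h1 : u 0 ^ 2 + u 1 ^ 2 = 0 := by nlinarith [sq_nonneg (u 0), sq_nonneg (u 1), sq_nonneg (u 2)]
    have h2 : u 2 ^ 2 = 0 := by nlinarith [sq_nonneg (u 0), sq_nonneg (u 1), sq_nonneg (u 2)]
    rw [h1, h2]; norm_num
  · have hh : 0 < s := h0
    refine le_of_mul_le_mul_left ?_ hh
    nlinarith [mul_le_mul_of_nonneg_right m1 (add_nonneg (sq_nonneg (u 0)) (sq_nonneg (u 1))),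
      mul_le_mul_of_nonneg_right n1 (sq_nonneg (u 2))]

theorem norm_coreMap_le_one_iff {u : E3} : ‖coreMap u‖ ≤ 1 ↔ ‖u‖ ≤ 1 := by
  refine ⟨fun h => ?_, norm_coreMap_le⟩
  by_contra hc
  rw [not_le] at hc
  rw [coreMap_eq_handleMap (by nlinarith)] at h
  exact absurd (one_lt_norm_handleMap hc) (not_lt.2 h)

theorem norm_sq_coreMap_lt {u : E3} {R : ℝ} (hR : 1 < R) (hu : ‖u‖ ^ 2 < R) :
    ‖coreMap u‖ ^ 2 < R ^ 2 := by
  rcases le_or_gt ‖u‖ 1 with h | h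
  · have := pow_le_one₀ (n := 2) (norm_nonneg _) (norm_coreMap_le h)
    nlinarith
  · rw [coreMap_eq_handleMap (by nlinarith)]
    have h1 := norm_handleMap_le_sq h.le
    exact pow_lt_pow_left₀ (lt_of_le_of_lt h1 hu) (norm_nonneg _) two_ne_zero

theorem norm_sq_handleMap_lt {u : E3} {R : ℝ} (hR : 1 < R) (h0 : u ≠ 0) (hu : ‖u‖ ^ 2 < R) :
    ‖handleMap u‖ ^ 2 < R ^ 2 := by
  rcases le_or_gt ‖u‖ 1 with h | h
  · have := pow_le_one₀ (n := 2) (norm_nonneg _) (norm_handleMap_le h0 h)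
    nlinarith
  · have h1 := norm_handleMap_le_sq h.le
    exact pow_lt_pow_left₀ (lt_of_le_of_lt h1 hu) (norm_nonneg _) two_ne_zero

theorem handleMap_smul {w : E3} (hw : ‖w‖ = 1) {t : ℝ} (ht : t ≠ 0) :
    handleMap (|t| • w) = handlePoint w t := by
  have ht0 : 0 < |t| := abs_pos.2 ht
  have hn : ‖|t| • w‖ ^ 2 = |t| ^ 2 := by rw [norm_smul, hw, mul_one, Real.norm_eq_abs, abs_abs]
  have h1 : (|t| ^ 2) ^ (-(1 / 4) : ℝ) * |t| = √|t| := by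
    rw [← Real.rpow_natCast, ← Real.rpow_mul ht0.le, Real.sqrt_eq_rpow]
    nth_rewrite 2 [← Real.rpow_one |t|]
    rw [← Real.rpow_add ht0]
    norm_num
  have h2 : (|t| ^ 2) ^ (1 / 2 : ℝ) * |t| = t ^ 2 := by
    rw [← Real.sqrt_eq_rpow, Real.sqrt_sq ht0.le, ← sq_abs t]; ring
  apply E3_ext
  · simp only [handleMap, radialMap, hn, handlePoint, PiLp.toLp_apply, Matrix.cons_val_zero,
      PiLp.smul_apply, smul_eq_mul]
    rw [← h1]; ring
  · simp only [handleMap, radialMap, hn, handlePoint, PiLp.toLp_apply, Matrix.cons_val_one,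
      PiLp.smul_apply, smul_eq_mul, Matrix.cons_val_zero]
    rw [← h1]; ring
  · simp only [handleMap, radialMap, hn, handlePoint, PiLp.toLp_apply, Matrix.cons_val,
      PiLp.smul_apply, smul_eq_mul]
    rw [← h2]; ring

/-- Every nonzero point of the unit ball is a handle point. -/
theorem exists_handlePoint_eq {x : E3} (hx : x ≠ 0) (h1 : ‖x‖ ≤ 1) :
    ∃ (w : E3) (t : ℝ), ‖w‖ = 1 ∧ t ∈ Ioc (0 : ℝ) 1 ∧ handlePoint w t = x := by
  have hn := norm_sq_coords x
  have hn1 : ‖x‖ ^ 2 ≤ 1 := pow_le_one₀ (norm_nonneg _) h1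
  have ht : ∃ t ∈ Ioc (0 : ℝ) 1, t ^ 4 - (x 0 ^ 2 + x 1 ^ 2) * t ^ 3 - x 2 ^ 2 = 0 := by
    rcases (sq_nonneg (x 2)).eq_or_lt with h2 | h2
    · have hp : 0 < ‖x‖ ^ 2 := by have := norm_pos_iff.2 hx; positivity
      refine ⟨x 0 ^ 2 + x 1 ^ 2, ⟨by linarith, by linarith⟩, ?_⟩
      rw [← h2]; ring
    · have hc : ContinuousOn (fun t : ℝ => t ^ 4 - (x 0 ^ 2 + x 1 ^ 2) * t ^ 3 - x 2 ^ 2)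
        (Icc 0 1) := by fun_prop
      obtain ⟨t, ht, h3⟩ := intermediate_value_Icc zero_le_one hc
        (show (0 : ℝ) ∈ _ from ⟨by simp; positivity, by simp; linarith⟩)
      refine ⟨t, ⟨lt_of_le_of_ne ht.1 fun h => ?_, ht.2⟩, h3⟩
      rw [← h] at h3
      simp at h3
      rw [h3] at h2
      simp at h2
  obtain ⟨t, ⟨ht0, ht1⟩, h⟩ := ht
  have hsq : 0 < √t := Real.sqrt_pos.2 ht0
  have hss : √t ^ 2 = t := Real.sq_sqrt ht0.le
  refine ⟨!₂[x 0 / √t, x 1 / √t, x 2 / t ^ 2], t, ?_, ⟨ht0, ht1⟩, ?_⟩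
  · rw [← sq_eq_sq₀ (norm_nonneg _) zero_le_one, norm_sq_coords]
    simp only [Matrix.cons_val_zero, Matrix.cons_val_one, Matrix.cons_val, div_pow,
      hss]
    field_simp
    linear_combination -h
  · apply E3_ext <;> simp [handlePoint, abs_of_pos ht0] <;> field_simp

/-- The radial map `u ↦ ± (1 - 2 / |u|) u`, which sends the sphere of radius `2 ± t` to the sphere of
radius `t`. -/
def shellMap (ε : ℝ) : E3 → E3 := radialMap (fun s => ε * (1 - 2 / √s)) fun s => ε * (1 - 2 / √s)

theorem shellMap_eq (ε : ℝ) (u : E3) : shellMap ε u = (ε * (1 - 2 / ‖u‖)) • u := by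
  apply E3_ext <;> simp [shellMap, radialMap, Real.sqrt_sq (norm_nonneg u)]

theorem shellMap_eq_smul (ε : ℝ) {u : E3} (hu : u ≠ 0) :
    shellMap ε u = (ε * (‖u‖ - 2)) • (‖u‖⁻¹ • u) := by
  have := norm_ne_zero_iff.2 hu
  rw [shellMap_eq, smul_smul]
  congr 1
  field_simp

theorem contDiffOn_shellMap (ε : ℝ) : ContDiffOn ℝ ∞ (shellMap ε) {u | ‖u‖ ^ 2 ∈ Ioi 0} := by
  have h : ContDiffOn ℝ ∞ (fun s : ℝ => ε * (1 - 2 / √s)) (Ioi 0) := fun s hs => by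
    have hs' : (0 : ℝ) < s := hs
    have h1 : ContDiffAt ℝ ∞ Real.sqrt s := Real.contDiffAt_sqrt hs'.ne'
    exact (contDiffAt_const.mul (contDiffAt_const.sub
      (contDiffAt_const.div h1 (Real.sqrt_pos.2 hs').ne'))).contDiffWithinAt
  exact contDiffOn_radialMap h h

theorem injective_fderiv_shellMap {ε : ℝ} (hε : ε ≠ 0) {u : E3} (hu : u ≠ 0) (h2 : ‖u‖ ≠ 2) :
    Function.Injective (fderiv ℝ (shellMap ε) u) := by
  have ht := norm_pos_iff.2 hu
  have hs : 0 < ‖u‖ ^ 2 := by positivity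
  have hsq : √(‖u‖ ^ 2) = ‖u‖ := Real.sqrt_sq ht.le
  have h1 := Real.hasDerivAt_sqrt hs.ne'
  have hd : HasDerivAt (fun s : ℝ => ε * (1 - 2 / √s)) (ε / ‖u‖ ^ 3) (‖u‖ ^ 2) := by
    have h3 := ((((hasDerivAt_const (‖u‖ ^ 2) (2 : ℝ)).div h1 (by rw [hsq]; exact ht.ne')).const_sub
      1).const_mul ε)
    refine HasDerivAt.congr_deriv h3 ?_
    rw [hsq]
    field_simp
    ring
  have hm : ε * (1 - 2 / √(‖u‖ ^ 2)) ≠ 0 := by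
    rw [hsq]
    refine mul_ne_zero hε fun h => h2 ?_
    field_simp at h
    linarith
  refine injective_fderiv_radialMap hd.differentiableAt hd.differentiableAt hm hm ?_
  rw [hd.deriv]
  rw [hsq] at hm ⊢
  have hn := norm_sq_coords u
  have e : ε * (1 - 2 / ‖u‖) * (ε * (1 - 2 / ‖u‖)) +
      2 * (ε / ‖u‖ ^ 3) * (ε * (1 - 2 / ‖u‖)) * (u 0 ^ 2 + u 1 ^ 2) +
      2 * (ε / ‖u‖ ^ 3) * (ε * (1 - 2 / ‖u‖)) * u 2 ^ 2 = (ε * (1 - 2 / ‖u‖)) * ε := by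
    have : u 0 ^ 2 + u 1 ^ 2 = ‖u‖ ^ 2 - u 2 ^ 2 := by linarith
    rw [this]
    field_simp
    ring
  rw [e]
  exact mul_ne_zero hm hε

end Profiles

/-! ### A disc of rotations -/

section Disc

/-- A disc of unit quaternions up to scaling: with `z = 1 + r (exp (2 π i φ) - 1) = x + i y`, the
quaternion `x + y k - (1 - |z|²) i`. On the boundary `r = 1`, it traverses the rotations about the
`z`-axis (twice), and it is real for `r = 0` and for `φ ∈ {0, 1}`. -/
def discQ (r φ : ℝ) : ℝ × E3 :=
  let x : ℝ := 1 + r * (Real.cos (2 * Real.pi * φ) - 1)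
  let y : ℝ := r * Real.sin (2 * Real.pi * φ)
  (x, !₂[-(1 - x ^ 2 - y ^ 2), 0, y])

theorem discQ_ne_zero (r φ : ℝ) : discQ r φ ≠ 0 := by
  intro h
  have h1 := congrArg Prod.fst h
  have h2 := congrArg (fun q : ℝ × E3 => q.2 0) h
  have h3 := congrArg (fun q : ℝ × E3 => q.2 2) h
  simp only [discQ, Prod.fst_zero, Prod.snd_zero, PiLp.zero_apply, Matrix.cons_val_zero,
    Matrix.cons_val] at h1 h2 h3
  rw [h1, h3] at h2
  norm_num at h2

theorem contDiff_discQ : ContDiff ℝ ∞ fun p : ℝ × ℝ => discQ p.1 p.2 := by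
  refine ContDiff.prodMk ?_ ?_
  · fun_prop
  · rw [contDiff_euclidean]
    intro i
    fin_cases i <;> simp <;> fun_prop

theorem qrot_discQ_of_eq_one {r φ : ℝ} (h : r = 0 ∨ Real.cos (2 * Real.pi * φ) = 1) :
    qrot (discQ r φ) = ContinuousLinearMap.id ℝ E3 := by
  have e : discQ r φ = (1, 0) := by
    rcases h with h | h
    · simp only [discQ, h]
      ext i <;> try fin_cases i
      all_goals simp
    · have h' : Real.sin (2 * Real.pi * φ) = 0 := by
        have := Real.sin_sq_add_cos_sq (2 * Real.pi * φ)
        rw [h] at this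
        simpa using this
      simp only [discQ, h, h']
      ext i <;> try fin_cases i
      all_goals simp
  rw [e, qrot_real one_ne_zero]

theorem exists_rotZ_discQ_one (φ : ℝ) :
    ∃ c s : ℝ, c ^ 2 + s ^ 2 = 1 ∧ qrot (discQ 1 φ) = rotZ c s := by
  set a := Real.cos (2 * Real.pi * φ) with ha
  set b := Real.sin (2 * Real.pi * φ) with hb
  have hab : b ^ 2 + a ^ 2 = 1 := Real.sin_sq_add_cos_sq _
  refine ⟨a ^ 2 - b ^ 2, 2 * a * b, by linear_combination (a ^ 2 + b ^ 2 + 1) * hab, ?_⟩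
  have h0 : -(1 - a ^ 2 - b ^ 2) = 0 := by linarith
  have e : discQ 1 φ = (a, !₂[0, 0, b]) := by
    simp only [discQ, ← ha, ← hb, one_mul, add_sub_cancel, h0]
  have hn : qnorm (a, !₂[0, 0, b]) = 1 := by simp [qnorm]; linarith
  ext v : 1
  rw [e, qrot_apply, hn]
  apply E3_ext <;> simp [inner_coords]
  · linear_combination v 0 * hab
  · linear_combination v 1 * hab
  · linear_combination 2 * v 2 * hab

variable {Y : Type*} [TopologicalSpace Y] [ChartedSpace E3 Y]

theorem pb_twisted {N : E3 → Y} {P P' : ∀ y : Y, Set (TangentSpace (𝓡 3) y)} {χ : ℝ → ℝ}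
    {r φ : ℝ} {u : E3} (h : pb N P u =
        fderiv ℝ (twist fun s => qrot (discQ (r * χ s) φ)) u ⁻¹'
          pb N P' (twist (fun s => qrot (discQ (r * χ s) φ)) u))
    (hχ : ∀ᶠ s in 𝓝 (‖u‖ ^ 2), χ s = 1) :
    pb N P u = qrot (discQ r φ) ⁻¹' pb N P' (qrot (discQ r φ) u) := by
  have e : (twist fun s => qrot (discQ (r * χ s) φ)) =ᶠ[𝓝 u] qrot (discQ r φ) := by
    have hc : ContinuousAt (fun x : E3 => ‖x‖ ^ 2) u := by fun_prop
    filter_upwards [hc.eventually hχ] with x hx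
    simp only [twist, hx, mul_one]
  rw [h, e.fderiv_eq, e.eq_of_nhds, ContinuousLinearMap.fderiv]

/-- Where `ξ` is invariant under rotations about the `z`-axis, the boundary of the twisted disc is
constant. -/
theorem pb_twisted_one {N : E3 → Y} {P P' : ∀ y : Y, Set (TangentSpace (𝓡 3) y)} {χ : ℝ → ℝ}
    {φ : ℝ} {u : E3} (h : pb N P u =
        fderiv ℝ (twist fun s => qrot (discQ (1 * χ s) φ)) u ⁻¹'
          pb N P' (twist (fun s => qrot (discQ (1 * χ s) φ)) u))
    (hχ : ∀ᶠ s in 𝓝 (‖u‖ ^ 2), χ s = 1)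
    (hinv : ∀ c s : ℝ, c ^ 2 + s ^ 2 = 1 → rotZ c s ⁻¹' pb N P' (rotZ c s u) = pb N P' u) :
    pb N P u = pb N P' u := by
  obtain ⟨c, s, hcs, e⟩ := exists_rotZ_discQ_one φ
  rw [pb_twisted h hχ, e, hinv c s hcs]

variable [IsManifold (𝓡 3) ∞ Y] [T2Space Y]

/-- The disc of contact structures obtained by twisting `ξ` by rotations inside a chart. -/
theorem exists_twisted_disc {N : E3 → Y} {J : Set ℝ} {a b : ℝ} {χ : ℝ → ℝ}
    (hN : ImmOn N {u | ‖u‖ ^ 2 ∈ J}) (hinj : InjOn N {u | ‖u‖ ^ 2 ∈ J}) (hJ : IsOpen J)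
    (hab : ∀ s, 0 ≤ s → s ∈ Icc a b → s ∈ J) (hχ : ContDiffOn ℝ ∞ χ J)
    (hχ0 : ∀ s ∈ J, 0 ≤ s → s ∉ Icc a b → χ s = 0) (ξ : ContactStructure Y) :
    ∃ D : C(unitInterval × unitInterval, ContactStructure Y),
      (∀ x u, ‖u‖ ^ 2 ∈ J → pb N (D x).pos u =
        fderiv ℝ (twist fun s => qrot (discQ (x.1 * χ s) x.2)) u ⁻¹'
          pb N ξ.pos (twist (fun s => qrot (discQ (x.1 * χ s) x.2)) u)) ∧
      (∀ x, ∀ y ∉ N '' {u | ‖u‖ ^ 2 ∈ Icc a b}, (D x).pos y = ξ.pos y) ∧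
      ∀ x, x.1 = 0 ∨ x.2 = 0 ∨ x.2 = 1 → D x = ξ := by
  set T : unitInterval × unitInterval → ℝ → E3 →L[ℝ] E3 :=
    fun x s => qrot (discQ (x.1 * χ s) x.2) with hT
  have hcos : ∀ φ : unitInterval, φ = 0 ∨ φ = 1 → Real.cos (2 * Real.pi * φ) = 1 := by
    rintro φ (rfl | rfl) <;> simp
  have hTF : FamS {q : (unitInterval × unitInterval) × ℝ | q.2 ∈ J} T := by
    refine FamS.of_contDiffOn_param (P := ℝ × ℝ)
      (p := fun x : unitInterval × unitInterval => ((x.1 : ℝ), (x.2 : ℝ)))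
      (f := fun y : (ℝ × ℝ) × ℝ => qrot (discQ (y.1.1 * χ y.2) y.1.2)) (U := {y | y.2 ∈ J})
      (by fun_prop) (hJ.preimage continuous_snd) (hJ.preimage continuous_snd) ?_ fun _ h => h
    have h1 : ContDiffOn ℝ ∞ (fun y : (ℝ × ℝ) × ℝ => χ y.2) {y | y.2 ∈ J} :=
      hχ.comp contDiff_snd.contDiffOn fun _ h => h
    have h2 : ContDiffOn ℝ ∞ (fun y : (ℝ × ℝ) × ℝ => (y.1.1 * χ y.2, y.1.2)) {y | y.2 ∈ J} :=
      ((contDiff_fst.comp contDiff_fst).contDiffOn.mul h1).prodMk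
        (contDiff_snd.comp contDiff_fst).contDiffOn
    exact contDiffOn_qrot.comp (contDiff_discQ.comp_contDiffOn h2) fun y _ => discQ_ne_zero _ _
  obtain ⟨D, H1, H2, H3⟩ := exists_twist hN hinj hab (η := fun _ => ξ) continuous_const hTF
    (fun k s v => norm_qrot (discQ_ne_zero _ _) v)
    (fun x s hs hs0 hsab => qrot_discQ_of_eq_one (Or.inl (by rw [hχ0 s hs hs0 hsab, mul_zero])))
  refine ⟨D, H1, H2, fun x hx => H3 x fun s hs => qrot_discQ_of_eq_one ?_⟩
  rcases hx with hx | hx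
  · left; rw [hx]; simp
  · right; exact hcos _ hx

end Disc

/-! ### The degree of the evaluation of a disc of rotations -/

section Degree

theorem stdE_two_eq : stdE 2 = stdVec 0 := by
  apply E3_ext <;> simp [stdE, stdVec]

/-- The map `z = x + i y ↦ (2 ν (-i) z̄, |z|² - ν²)`, `ν = max (1 - |z|²) 0`, to `ℝ² × ℝ = ℝ³`. Up to
normalization it maps the unit disc onto the sphere, with the boundary collapsed to the pole on the
positive `z`-axis, and everything outside the disc to this pole. -/
def hopfVec (x y : ℝ) : E3 :=
  let ν : ℝ := max (1 - x ^ 2 - y ^ 2) 0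
  !₂[-(2 * ν * y), -(2 * ν * x), x ^ 2 + y ^ 2 - ν ^ 2]

theorem continuous_hopfVec : Continuous fun p : ℝ × ℝ => hopfVec p.1 p.2 := by
  unfold hopfVec
  fun_prop

theorem hopfVec_of_le {x y : ℝ} (h : 1 ≤ x ^ 2 + y ^ 2) :
    hopfVec x y = (x ^ 2 + y ^ 2) • stdVec 0 := by
  have : max (1 - x ^ 2 - y ^ 2) 0 = 0 := max_eq_right (by linarith)
  apply E3_ext <;> simp [hopfVec, this, stdVec]

theorem hopfVec_ne_zero (x y : ℝ) : hopfVec x y ≠ 0 := by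
  intro h
  have h0 := congrArg (fun v : E3 => v 0) h
  have h1 := congrArg (fun v : E3 => v 1) h
  have h2 := congrArg (fun v : E3 => v 2) h
  simp only [hopfVec, Matrix.cons_val_zero, Matrix.cons_val_one, Matrix.cons_val,
    PiLp.zero_apply, neg_eq_zero, mul_eq_zero, OfNat.ofNat_ne_zero, false_or] at h0 h1 h2
  rcases h0 with h0 | h0
  · rw [h0] at h2
    have : 1 - x ^ 2 - y ^ 2 ≤ 0 := max_eq_right_iff.1 h0
    nlinarith
  · rcases h1 with h1 | h1
    · rw [h1] at h2
      have : 1 - x ^ 2 - y ^ 2 ≤ 0 := max_eq_right_iff.1 h1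
      nlinarith
    · rw [h0, h1] at h2
      norm_num at h2

/-- The rotations of the disc, applied inversely to the `z`-axis. -/
theorem adjoint_qrot_discQ (r φ : ℝ) (hr : r ∈ Icc (0 : ℝ) 1) :
    (qrot (discQ r φ)).adjoint (stdVec 0) = (qnorm (discQ r φ))⁻¹ •
      hopfVec (1 + r * (Real.cos (2 * Real.pi * φ) - 1)) (r * Real.sin (2 * Real.pi * φ)) := by
  refine ext_inner_right ℝ fun v => ?_
  rw [ContinuousLinearMap.adjoint_inner_left, inner_stdVec, qrot_apply]
  have hsc := Real.sin_sq_add_cos_sq (2 * Real.pi * φ)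
  have hc := Real.cos_le_one (2 * Real.pi * φ)
  simp only [discQ]
  set a := Real.cos (2 * Real.pi * φ)
  set b := Real.sin (2 * Real.pi * φ)
  have hν : 0 ≤ 1 - (1 + r * (a - 1)) ^ 2 - (r * b) ^ 2 := by
    have e : 1 - (1 + r * (a - 1)) ^ 2 - (r * b) ^ 2 = 2 * (r * (1 - r) * (1 - a)) := by
      linear_combination -r ^ 2 * hsc
    rw [e]
    have := mul_nonneg (mul_nonneg hr.1 (by linarith [hr.2] : 0 ≤ 1 - r)) (by linarith : 0 ≤ 1 - a)
    linarith
  rw [real_inner_smul_left]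
  simp only [hopfVec, max_eq_left hν]
  generalize 1 + r * (a - 1) = x
  generalize r * b = y
  simp [stdForm, inner_coords, qnorm]
  ring

/-- The transpose of a linear isometry of `ℝ³` is injective. -/
theorem adjoint_apply_ne_zero {L : E3 →L[ℝ] E3} (hL : ∀ v, ‖L v‖ = ‖v‖) {v : E3} (hv : v ≠ 0) :
    L.adjoint v ≠ 0 := by
  intro h
  obtain ⟨w, hw⟩ := surjective_of_injective (injective_of_norm_eq hL) v
  have h1 : inner ℝ (L.adjoint v) w = inner ℝ v (L w) := ContinuousLinearMap.adjoint_inner_left _ _ _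
  rw [h, hw, inner_zero_left] at h1
  exact hv (inner_self_eq_zero.1 h1.symm)

theorem adjoint_comp_self {L : E3 →L[ℝ] E3} (hL : ∀ v, ‖L v‖ = ‖v‖) (v : E3) :
    L.adjoint (L v) = v := by
  refine ext_inner_right ℝ fun w => ?_
  rw [ContinuousLinearMap.adjoint_inner_left, inner_of_norm_eq hL]

/-- The rotation given by the quaternion `discQ` at a point of the square. -/
def squareRot (x : Fin 2 → unitInterval) : E3 →L[ℝ] E3 := qrot (discQ (x 0) (x 1))

theorem norm_squareRot (x : Fin 2 → unitInterval) (v : E3) : ‖squareRot x v‖ = ‖v‖ :=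
  norm_qrot (discQ_ne_zero _ _) v

theorem continuous_squareRot : Continuous squareRot := by
  refine contDiffOn_qrot.continuousOn.comp_continuous ?_ fun x => discQ_ne_zero _ _
  exact contDiff_discQ.continuous.comp (by fun_prop :
    Continuous fun x : Fin 2 → unitInterval => (((x 0 : ℝ), (x 1 : ℝ)) : ℝ × ℝ))

theorem exists_rotZ_squareRot {x : Fin 2 → unitInterval} (hx : x ∈ Cube.boundary (Fin 2)) :
    ∃ c s : ℝ, c ^ 2 + s ^ 2 = 1 ∧ squareRot x = rotZ c s := by
  have hid : ContinuousLinearMap.id ℝ E3 = rotZ 1 0 := by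
    ext v : 1
    apply E3_ext <;> simp
  obtain ⟨i, hi⟩ := hx
  fin_cases i
  · rcases hi with hi | hi
    · refine ⟨1, 0, by norm_num, ?_⟩
      rw [← hid]
      exact qrot_discQ_of_eq_one (Or.inl (by simpa using hi))
    · have hi' : x 0 = 1 := hi
      obtain ⟨c, s, h, e⟩ := exists_rotZ_discQ_one (x 1)
      exact ⟨c, s, h, by rw [squareRot, hi', ← e]; rfl⟩
  · refine ⟨1, 0, by norm_num, ?_⟩
    rw [← hid]
    refine qrot_discQ_of_eq_one (Or.inr ?_)
    rcases hi with hi | hi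
    · have hi' : x 1 = 0 := hi
      simp [hi']
    · have hi' : x 1 = 1 := hi
      simp [hi']

/-- The inverse rotations at the points of the square, applied to the `z`-axis. -/
def squareAxis (x : Fin 2 → unitInterval) : E3 := (squareRot x).adjoint (stdVec 0)

theorem continuous_adjoint_squareRot : Continuous fun x => (squareRot x).adjoint :=
  (ContinuousLinearMap.adjoint (𝕜 := ℝ) (E := E3) (F := E3)).continuous.comp continuous_squareRot

theorem continuous_squareAxis : Continuous squareAxis :=
  continuous_adjoint_squareRot.clm_apply continuous_const

theorem squareAxis_ne_zero (x : Fin 2 → unitInterval) : squareAxis x ≠ 0 :=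
  adjoint_apply_ne_zero (norm_squareRot x) (stdVec_ne_zero 0)

theorem rotZ_stdVec (c s : ℝ) : rotZ c s (stdVec 0) = stdVec 0 := by
  apply E3_ext <;> simp [stdVec]

theorem squareAxis_boundary {x : Fin 2 → unitInterval} (hx : x ∈ Cube.boundary (Fin 2)) :
    squareAxis x = stdVec 0 := by
  obtain ⟨c, s, h, e⟩ := exists_rotZ_squareRot hx
  have h1 : squareRot x (stdVec 0) = stdVec 0 := by rw [e, rotZ_stdVec]
  rw [squareAxis]
  nth_rewrite 1 [← h1]
  rw [adjoint_comp_self (norm_squareRot x)]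

theorem toSphere_eq_northPole {v : E3} (hv : v ≠ 0) {c : ℝ} (hc : 0 < c) (h : v = c • stdVec 0) :
    toSphere v hv = northPole :=
  toSphere_eq_of_smul hv hc (by rw [h, coe_northPole])

/-- On the boundary of the square, the curves obtained by shearing the boundary of the disc in the
direction of `y` stay outside of the open unit disc. -/
theorem one_le_disc_aux {s r φ : ℝ} (hs : s ∈ Icc (0 : ℝ) 1) (hφ : φ ∈ Icc (0 : ℝ) 1)
    (h : r = 0 ∨ r = 1 ∨ φ = 0 ∨ φ = 1) :
    1 ≤ (1 + r * (Real.cos (2 * Real.pi * φ) - 1)) ^ 2 +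
      (r * Real.sin (2 * Real.pi * φ) - s * (4 * (2 * φ - 1))) ^ 2 := by
  rcases h with rfl | rfl | rfl | rfl
  · norm_num; positivity
  · have hsc := Real.sin_sq_add_cos_sq (2 * Real.pi * φ)
    have hp : 0 ≤ Real.sin (2 * Real.pi * φ) * (1 - 2 * φ) := by
      rcases le_total φ (1 / 2) with h | h
      · refine mul_nonneg (Real.sin_nonneg_of_nonneg_of_le_pi ?_ ?_) (by linarith)
        · have := Real.pi_pos; have := hφ.1; positivity
        · nlinarith [Real.pi_pos]
      · refine mul_nonneg_of_nonpos_of_nonpos ?_ (by linarith)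
        have e : Real.sin (2 * Real.pi * φ) = -Real.sin (2 * Real.pi * φ - Real.pi) := by
          rw [Real.sin_sub_pi]; ring
        rw [e, neg_nonpos]
        refine Real.sin_nonneg_of_nonneg_of_le_pi ?_ ?_ <;> nlinarith [Real.pi_pos, hφ.2]
    have := mul_nonneg hs.1 hp
    nlinarith [sq_nonneg (s * (4 * (2 * φ - 1)))]
  · norm_num; positivity
  · norm_num; positivity

/-- On the boundary of the square, the linear homotopy from the sheared disc to the rectangle
`(1 - 2 r, -4 (2 φ - 1))` stays outside of the open unit disc. -/
theorem one_le_rect_aux {s r φ : ℝ} (hs : s ∈ Icc (0 : ℝ) 1) (hφ : φ ∈ Icc (0 : ℝ) 1)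
    (h : r = 0 ∨ r = 1 ∨ φ = 0 ∨ φ = 1) :
    1 ≤ ((1 - s) * (1 + r * (Real.cos (2 * Real.pi * φ) - 1)) + s * (1 - 2 * r)) ^ 2 +
      ((1 - s) * (r * Real.sin (2 * Real.pi * φ)) - 4 * (2 * φ - 1)) ^ 2 := by
  rcases h with rfl | rfl | rfl | rfl
  · have : (1 - s) * (1 + 0 * (Real.cos (2 * Real.pi * φ) - 1)) + s * (1 - 2 * 0) = 1 := by ring
    rw [this]
    nlinarith [sq_nonneg ((1 - s) * (0 * Real.sin (2 * Real.pi * φ)) - 4 * (2 * φ - 1))]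
  · have hsc := Real.sin_sq_add_cos_sq (2 * Real.pi * φ)
    have hp : 0 ≤ Real.sin (2 * Real.pi * φ) * (1 - 2 * φ) := by
      rcases le_total φ (1 / 2) with h | h
      · refine mul_nonneg (Real.sin_nonneg_of_nonneg_of_le_pi ?_ ?_) (by linarith)
        · have := Real.pi_pos; have := hφ.1; positivity
        · nlinarith [Real.pi_pos]
      · refine mul_nonneg_of_nonpos_of_nonpos ?_ (by linarith)
        have e : Real.sin (2 * Real.pi * φ) = -Real.sin (2 * Real.pi * φ - Real.pi) := by
          rw [Real.sin_sub_pi]; ring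
        rw [e, neg_nonpos]
        refine Real.sin_nonneg_of_nonneg_of_le_pi ?_ ?_ <;> nlinarith [Real.pi_pos, hφ.2]
    have h1 := mul_nonneg (by linarith [hs.2] : 0 ≤ 1 - s) hp
    -- near the middle of the side, the cosine is close to `-1`
    have h2 : 1 + Real.cos (2 * Real.pi * φ) ≤ 5 * (2 * φ - 1) ^ 2 := by
      have e : Real.cos (2 * Real.pi * φ) = -Real.cos (2 * Real.pi * φ - Real.pi) := by
        rw [Real.cos_sub_pi]; ring
      have h3 := Real.one_sub_sq_div_two_le_cos (x := 2 * Real.pi * φ - Real.pi)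
      have h4 : (2 * Real.pi * φ - Real.pi) ^ 2 = Real.pi ^ 2 * (2 * φ - 1) ^ 2 := by ring
      have h5 : Real.pi ^ 2 ≤ 10 := by
        have := Real.pi_lt_d2
        nlinarith [Real.pi_pos]
      have h6 := mul_le_mul_of_nonneg_right h5 (sq_nonneg (2 * φ - 1))
      rw [h4] at h3
      linarith
    have h7 : 0 ≤ s * (1 - s) := mul_nonneg hs.1 (by linarith [hs.2])
    have h8 : s * (1 - s) ≤ 1 / 4 := by nlinarith [sq_nonneg (s - 1 / 2)]
    have h9 : 2 * (s * (1 - s)) * (1 + Real.cos (2 * Real.pi * φ)) ≤ 3 * (2 * φ - 1) ^ 2 := by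
      have h10 : 0 ≤ 1 + Real.cos (2 * Real.pi * φ) := by
        linarith [Real.neg_one_le_cos (2 * Real.pi * φ)]
      nlinarith [mul_le_mul_of_nonneg_right h8 h10, sq_nonneg (2 * φ - 1)]
    set a := Real.cos (2 * Real.pi * φ)
    set b := Real.sin (2 * Real.pi * φ)
    have e : ((1 - s) * (1 + 1 * (a - 1)) + s * (1 - 2 * 1)) ^ 2 +
        ((1 - s) * (1 * b) - 4 * (2 * φ - 1)) ^ 2 =
        1 - 2 * (s * (1 - s)) * (1 + a) + 8 * ((1 - s) * (b * (1 - 2 * φ))) +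
          16 * (2 * φ - 1) ^ 2 := by
      linear_combination (1 - s) ^ 2 * hsc
    rw [e]
    nlinarith [sq_nonneg (2 * φ - 1)]
  · norm_num; nlinarith [sq_nonneg (1 - s + s * (1 - 2 * r))]
  · norm_num; nlinarith [sq_nonneg (1 - s + s * (1 - 2 * r))]

theorem boundary_cases {x : Fin 2 → unitInterval} (hx : x ∈ Cube.boundary (Fin 2)) :
    (x 0 : ℝ) = 0 ∨ (x 0 : ℝ) = 1 ∨ (x 1 : ℝ) = 0 ∨ (x 1 : ℝ) = 1 := by
  obtain ⟨i, hi⟩ := hx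
  fin_cases i
  · rcases hi with hi | hi
    exacts [Or.inl (by simpa using hi), Or.inr (Or.inl (by simpa using hi))]
  · rcases hi with hi | hi
    exacts [Or.inr (Or.inr (Or.inl (by simpa using hi))),
      Or.inr (Or.inr (Or.inr (by simpa using hi)))]

theorem norm_smul_toSphere {v : E3} (hv : v ≠ 0) : v = ‖v‖ • (toSphere v hv : E3) := by
  change v = ‖v‖ • ‖v‖⁻¹ • v
  rw [smul_smul, mul_inv_cancel₀ (norm_ne_zero_iff.2 hv), one_smul]

/-- The map to the sphere given by `hopfVec`. -/
def hopfMap {X : Type*} [TopologicalSpace X] (p q : C(X, ℝ)) : C(X, S2) :=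
  ⟨fun x => toSphere (hopfVec (p x) (q x)) (hopfVec_ne_zero _ _),
    continuous_toSphere (continuous_hopfVec.comp (p.continuous.prodMk q.continuous) :) _⟩

theorem hopfMap_apply {X : Type*} [TopologicalSpace X] (p q : C(X, ℝ)) (x : X) :
    hopfMap p q x = toSphere (hopfVec (p x) (q x)) (hopfVec_ne_zero _ _) := rfl

theorem hopfMap_eq_northPole {X : Type*} [TopologicalSpace X] {p q : C(X, ℝ)} {x : X}
    (h : 1 ≤ p x ^ 2 + q x ^ 2) : hopfMap p q x = northPole :=
  toSphere_eq_northPole (hopfVec_ne_zero _ _) (by linarith) (hopfVec_of_le h)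

theorem hopfMap_homotopic {X : Type*} [TopologicalSpace X] {A : Set X} {p q p' q' : C(X, ℝ)}
    (P Q : C(unitInterval × X, ℝ)) (hp : ∀ x, P (0, x) = p x) (hq : ∀ x, Q (0, x) = q x)
    (hp' : ∀ x, P (1, x) = p' x) (hq' : ∀ x, Q (1, x) = q' x)
    (hA : ∀ s, ∀ x ∈ A, 1 ≤ P (s, x) ^ 2 + Q (s, x) ^ 2) :
    (hopfMap p q).HomotopicRel (hopfMap p' q') A := by
  refine ⟨{ toFun := hopfMap P Q
            continuous_toFun := (hopfMap P Q).continuous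
            map_zero_left := fun x => ?_
            map_one_left := fun x => ?_
            prop' := fun s x hx => ?_ }⟩
  · simp only [hopfMap, ContinuousMap.coe_mk, hp, hq]
  · simp only [hopfMap, ContinuousMap.coe_mk, hp', hq']
  · change hopfMap P Q (s, x) = hopfMap p q x
    have h0 := hA 0 x hx
    rw [hp, hq] at h0
    rw [hopfMap_eq_northPole (hA s x hx), hopfMap_eq_northPole h0]

theorem hopfMap_homotopic_of_linear {X : Type*} [TopologicalSpace X] {A : Set X} {p q : C(X, ℝ)}
    {g : C(X, S2)} {b : C(X, E3)} (hg : ∀ x, ∃ c > (0 : ℝ), b x = c • (g x : E3))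
    (h0 : ∀ x, ∀ s ∈ Icc (0 : ℝ) 1, (1 - s) • hopfVec (p x) (q x) + s • b x ≠ 0)
    (hA : ∀ x ∈ A, hopfMap p q x = g x) : (hopfMap p q).HomotopicRel g A := by
  have h1 : ∀ x, ∃ c > (0 : ℝ), hopfVec (p x) (q x) = c • (hopfMap p q x : E3) := by
    intro x
    rw [hopfMap_apply]
    generalize_proofs hv
    generalize hopfVec (p x) (q x) = v at hv
    exact ⟨‖v‖, norm_pos_iff.2 hv, norm_smul_toSphere hv⟩
  have h2 := continuous_hopfVec.comp (p.continuous.prodMk q.continuous)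
  exact homotopicRel_of_linear (a := ⟨fun x => hopfVec (p x) (q x), h2⟩) h1 hg h0 hA

/-- The vectors that define `hopfMap` on the rectangle and `squareToSphere` are nowhere opposite:
their horizontal parts are positively proportional in each coordinate. -/
theorem hopfVec_squareVec_ne_zero (x : Fin 2 → unitInterval) {s : ℝ} (hs : s ∈ Icc (0 : ℝ) 1) :
    (1 - s) • hopfVec (1 - 2 * x 0) (-(4 * (2 * (x 1 : ℝ) - 1))) + s • squareVec x ≠ 0 := by
  intro h
  have h0 := congrArg (fun v : E3 => v 0) h
  have h1 := congrArg (fun v : E3 => v 1) h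
  have h2 := congrArg (fun v : E3 => v 2) h
  simp only [hopfVec, squareVec, PiLp.add_apply, PiLp.smul_apply,
    Matrix.cons_val_zero, Matrix.cons_val_one, Matrix.cons_val,
    PiLp.zero_apply, smul_eq_mul] at h0 h1 h2
  clear h
  have hr := (x 0).2
  have ht := (x 1).2
  generalize (x 0 : ℝ) = r at *
  generalize (x 1 : ℝ) = t at *
  have hν : 0 ≤ max (1 - (1 - 2 * r) ^ 2 - (-(4 * (2 * t - 1))) ^ 2) 0 := le_max_right _ _
  have hν' : max (1 - (1 - 2 * r) ^ 2 - (-(4 * (2 * t - 1))) ^ 2) 0 = 0 →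
      1 ≤ (1 - 2 * r) ^ 2 + (-(4 * (2 * t - 1))) ^ 2 := fun h => by
    have := max_eq_right_iff.1 h
    linarith
  have hνmid : r = 1 / 2 → t = 1 / 2 →
      max (1 - (1 - 2 * r) ^ 2 - (-(4 * (2 * t - 1))) ^ 2) 0 = 1 := fun hr ht => by
    rw [hr, ht]; norm_num
  set ν := max (1 - (1 - 2 * r) ^ 2 - (-(4 * (2 * t - 1))) ^ 2) 0
  have hb0 : 0 ≤ r * (1 - r) * (t * (1 - t)) :=
    mul_nonneg (mul_nonneg hr.1 (by linarith [hr.2])) (mul_nonneg ht.1 (by linarith [ht.2]))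
  have hbmid : r = 1 / 2 → t = 1 / 2 → r * (1 - r) * (t * (1 - t)) = 1 / 16 := fun hr ht => by
    rw [hr, ht]; norm_num
  set b := r * (1 - r) * (t * (1 - t))
  have hs' : 0 ≤ 1 - s := by linarith [hs.2]
  -- if a combination vanishes, so do its horizontal components: then either both coefficients
  -- vanish, or the point is the centre of the square
  have k0 : ((1 - s) * (8 * ν) + s * (16 * b)) * (2 * t - 1) = 0 := by linear_combination h0
  have k1 : ((1 - s) * (2 * ν) + s * (16 * b)) * (2 * r - 1) = 0 := by linear_combination h1
  have p1 : 0 ≤ (1 - s) * ν := mul_nonneg hs' hν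
  have p2 : 0 ≤ s * b := mul_nonneg hs.1 hb0
  by_cases hz : (1 - s) * ν = 0 ∧ s * b = 0
  · obtain ⟨z1, z2⟩ := hz
    rcases mul_eq_zero.1 z1 with z1 | z1
    · have : s = 1 := by linarith
      subst this
      rw [one_mul] at z2
      rw [z2] at h2
      norm_num at h2
    · have h3 := hν' z1
      rw [z1] at h2
      have h4 : s * (1 - 2 * (16 * b)) = s := by linear_combination -32 * z2
      rw [h4] at h2
      nlinarith
  · have hne : 0 < (1 - s) * ν + s * b := by
      rcases p1.eq_or_lt with h3 | h3
      · rcases p2.eq_or_lt with h4 | h4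
        · exact absurd ⟨h3.symm, h4.symm⟩ hz
        · linarith
      · linarith
    have q0 : t = 1 / 2 := by
      have := (mul_eq_zero.1 k0).resolve_left (by nlinarith)
      linarith
    have q1 : r = 1 / 2 := by
      have := (mul_eq_zero.1 k1).resolve_left (by nlinarith)
      linarith
    rw [hνmid q1 q0, hbmid q1 q0, q0, q1] at h2
    norm_num at h2
    linarith

/-- The map from the square to the sphere that sends a point to the image of the north pole under
the inverse of the rotation `squareRot`. -/
def axisMap : C(Fin 2 → unitInterval, S2) :=
  ⟨fun x => toSphere (squareAxis x) (squareAxis_ne_zero x),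
    continuous_toSphere continuous_squareAxis _⟩

theorem axisMap_eq_hopfMap : axisMap = hopfMap
    ⟨fun x => 1 + x 0 * (Real.cos (2 * Real.pi * x 1) - 1), by fun_prop⟩
    ⟨fun x => x 0 * Real.sin (2 * Real.pi * x 1), by fun_prop⟩ := by
  ext1 x
  have hq := qnorm_pos (discQ_ne_zero (x 0) (x 1))
  have h : squareAxis x = (qnorm (discQ (x 0) (x 1)))⁻¹ • hopfVec
      (1 + x 0 * (Real.cos (2 * Real.pi * x 1) - 1)) (x 0 * Real.sin (2 * Real.pi * x 1)) :=
    adjoint_qrot_discQ _ _ (x 0).2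
  have hn := norm_pos_iff.2 (hopfVec_ne_zero (1 + x 0 * (Real.cos (2 * Real.pi * x 1) - 1))
    (x 0 * Real.sin (2 * Real.pi * x 1)))
  refine toSphere_eq_of_smul (squareAxis_ne_zero x) (mul_pos (inv_pos.2 hq) hn) ?_
  rw [h, mul_smul]
  congr 1
  exact norm_smul_toSphere (hopfVec_ne_zero _ _)

theorem axisMap_homotopic_sheared : axisMap.HomotopicRel (hopfMap
    ⟨fun x => 1 + x 0 * (Real.cos (2 * Real.pi * x 1) - 1), by fun_prop⟩
    ⟨fun x => x 0 * Real.sin (2 * Real.pi * x 1) - 4 * (2 * x 1 - 1), by fun_prop⟩)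
    (Cube.boundary (Fin 2)) := by
  rw [axisMap_eq_hopfMap]
  refine hopfMap_homotopic
    ⟨fun p => 1 + p.2 0 * (Real.cos (2 * Real.pi * p.2 1) - 1), by fun_prop⟩
    ⟨fun p => p.2 0 * Real.sin (2 * Real.pi * p.2 1) - p.1 * (4 * (2 * p.2 1 - 1)), by fun_prop⟩
    (fun x => ?_) (fun x => ?_) (fun x => ?_) (fun x => ?_)
    fun s x hx => one_le_disc_aux s.2 (x 1).2 (boundary_cases hx)
  · simp only [ContinuousMap.coe_mk]
  · simp only [ContinuousMap.coe_mk, Set.Icc.coe_zero, zero_mul, sub_zero]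
  · simp only [ContinuousMap.coe_mk]
  · simp only [ContinuousMap.coe_mk, Set.Icc.coe_one, one_mul]

theorem hopfMap_sheared_homotopic : (hopfMap
    ⟨fun x : Fin 2 → unitInterval => 1 + x 0 * (Real.cos (2 * Real.pi * x 1) - 1), by fun_prop⟩
    ⟨fun x => x 0 * Real.sin (2 * Real.pi * x 1) - 4 * (2 * x 1 - 1), by fun_prop⟩).HomotopicRel
    (hopfMap ⟨fun x => 1 - 2 * x 0, by fun_prop⟩
      ⟨fun x => -(4 * (2 * (x 1 : ℝ) - 1)), by fun_prop⟩) (Cube.boundary (Fin 2)) := by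
  refine hopfMap_homotopic
    ⟨fun p => (1 - p.1) * (1 + p.2 0 * (Real.cos (2 * Real.pi * p.2 1) - 1)) +
      p.1 * (1 - 2 * p.2 0), by fun_prop⟩
    ⟨fun p => (1 - p.1) * (p.2 0 * Real.sin (2 * Real.pi * p.2 1)) - 4 * (2 * p.2 1 - 1),
      by fun_prop⟩
    (fun x => ?_) (fun x => ?_) (fun x => ?_) (fun x => ?_)
    fun s x hx => one_le_rect_aux s.2 (x 1).2 (boundary_cases hx)
  · simp only [ContinuousMap.coe_mk, Set.Icc.coe_zero]; ring
  · simp only [ContinuousMap.coe_mk, Set.Icc.coe_zero]; ring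
  · simp only [ContinuousMap.coe_mk, Set.Icc.coe_one]; ring
  · simp only [ContinuousMap.coe_mk, Set.Icc.coe_one]; ring

theorem hopfMap_square_homotopic :
    (hopfMap ⟨fun x : Fin 2 → unitInterval => 1 - 2 * x 0, by fun_prop⟩
      ⟨fun x => -(4 * (2 * (x 1 : ℝ) - 1)), by fun_prop⟩).HomotopicRel
      squareToSphere.1 (Cube.boundary (Fin 2)) := by
  refine hopfMap_homotopic_of_linear (b := ⟨squareVec, by unfold squareVec; fun_prop⟩)
    (fun x => ⟨‖squareVec x‖, norm_pos_iff.2 (squareVec_ne_zero x), ?_⟩)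
    (fun x s hs => ?_) fun x hx => ?_
  · exact norm_smul_toSphere (squareVec_ne_zero x)
  · exact hopfVec_squareVec_ne_zero x hs
  · have := one_le_rect_aux (s := 1) (by simp) (x 1).2 (boundary_cases hx)
    rw [sub_self, zero_mul, zero_add, one_mul, zero_mul, zero_sub] at this
    exact (hopfMap_eq_northPole this).trans (squareToSphere.2 x hx).symm

/-- The map `axisMap` has degree one. -/
theorem axisMap_homotopic : axisMap.HomotopicRel squareToSphere.1 (Cube.boundary (Fin 2)) :=
  axisMap_homotopic_sheared.trans (hopfMap_sheared_homotopic.trans hopfMap_square_homotopic)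

end Degree

/-! ### Linear changes of coordinates and the degree -/

section LinearDegree

/-- A path of invertible linear maps that preserve the `z`-axis gives a homotopy between the
compositions of `squareAxis` with its ends. -/
theorem homotopicRel_of_linear_path (L : C(unitInterval, E3 →L[ℝ] E3))
    (hL : ∀ s v, v ≠ 0 → L s v ≠ 0) (hz : ∀ s, ∃ c > (0 : ℝ), L s (stdVec 0) = c • stdVec 0)
    {f g : C(Fin 2 → unitInterval, S2)}
    (hf : ∀ x, ∃ c > (0 : ℝ), L 0 (squareAxis x) = c • (f x : E3))
    (hg : ∀ x, ∃ c > (0 : ℝ), L 1 (squareAxis x) = c • (g x : E3))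
    (hA : ∀ x ∈ Cube.boundary (Fin 2), f x = northPole) :
    f.HomotopicRel g (Cube.boundary (Fin 2)) := by
  have hc : Continuous fun p : unitInterval × (Fin 2 → unitInterval) => L p.1 (squareAxis p.2) :=
    (L.continuous.comp continuous_fst).clm_apply (continuous_squareAxis.comp continuous_snd)
  have h0 : ∀ p : unitInterval × (Fin 2 → unitInterval), L p.1 (squareAxis p.2) ≠ 0 :=
    fun p => hL _ _ (squareAxis_ne_zero _)
  refine homotopicRel_of_ne_zero ⟨_, hc⟩ h0 (fun x => ?_) (fun x => ?_) fun s x hx => ?_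
  · obtain ⟨c, h, e⟩ := hf x
    exact toSphere_eq_of_smul (h0 (0, x)) h e
  · obtain ⟨c, h, e⟩ := hg x
    exact toSphere_eq_of_smul (h0 (1, x)) h e
  · obtain ⟨c, h, e⟩ := hz s
    rw [hA x hx]
    refine toSphere_eq_northPole (h0 (s, x)) h ?_
    change L s (squareAxis x) = _
    rw [squareAxis_boundary hx, e]

theorem rotZ_apply_ne_zero {p q : ℝ} (h : p ^ 2 + q ^ 2 ≠ 0) {v : E3} (hv : v ≠ 0) :
    rotZ p q v ≠ 0 := by
  intro e
  apply hv
  have e0 := congrArg (fun v : E3 => v 0) e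
  have e1 := congrArg (fun v : E3 => v 1) e
  have e2 := congrArg (fun v : E3 => v 2) e
  simp only [rotZ_zero, rotZ_one, rotZ_two, PiLp.zero_apply] at e0 e1 e2
  refine E3_ext (mul_left_cancel₀ h ?_) (mul_left_cancel₀ h ?_) e2
  · simp only [PiLp.zero_apply]; linear_combination p * e0 + q * e1
  · simp only [PiLp.zero_apply]; linear_combination p * e1 - q * e0

/-- A conformal linear map of the plane can be joined to the identity by conformal maps, along a
logarithm. -/
theorem rotZ_homotopic {p q : ℝ} (h : p ^ 2 + q ^ 2 ≠ 0) {f : C(Fin 2 → unitInterval, S2)}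
    (hf : ∀ x, ∃ c > (0 : ℝ), rotZ p q (squareAxis x) = c • (f x : E3))
    (hA : ∀ x ∈ Cube.boundary (Fin 2), f x = northPole) :
    f.HomotopicRel axisMap (Cube.boundary (Fin 2)) := by
  set ζ : ℂ := ⟨p, q⟩
  have hζ : ζ ≠ 0 := fun e => by
    have e1 : p = 0 := congrArg Complex.re e
    have e2 : q = 0 := congrArg Complex.im e
    apply h; rw [e1, e2]; norm_num
  let Z : unitInterval → ℂ := fun s => Complex.exp ((1 - ((s : ℝ) : ℂ)) * Complex.log ζ)
  have hZ : Continuous Z := by fun_prop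
  have hc : Continuous fun s => rotZ (Z s).re (Z s).im := by
    rw [continuous_clm_apply]
    intro v
    have h1 : Continuous fun s => (Z s).re := Complex.continuous_re.comp hZ
    have h2 : Continuous fun s => (Z s).im := Complex.continuous_im.comp hZ
    change Continuous fun s => (!₂[(Z s).re * v 0 - (Z s).im * v 1,
      (Z s).im * v 0 + (Z s).re * v 1, v 2] : E3)
    fun_prop
  refine homotopicRel_of_linear_path ⟨_, hc⟩ (fun s v hv => rotZ_apply_ne_zero ?_ hv)
    (fun s => ⟨1, one_pos, by rw [one_smul]; exact rotZ_stdVec _ _⟩) (fun x => ?_) (fun x => ?_) hA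
  · have := Complex.exp_ne_zero ((1 - ((s : ℝ) : ℂ)) * Complex.log ζ)
    rw [← Complex.normSq_pos, Complex.normSq_apply] at this
    nlinarith
  · have : Z 0 = ζ := by simp [Z, Complex.exp_log hζ]
    change ∃ c > (0 : ℝ), rotZ (Z 0).re (Z 0).im _ = _
    rw [this]
    exact hf x
  · have : Z 1 = 1 := by simp [Z]
    change ∃ c > (0 : ℝ), rotZ (Z 1).re (Z 1).im _ = _
    rw [this]
    refine ⟨_, norm_pos_iff.2 (squareAxis_ne_zero x), ?_⟩
    refine Eq.trans ?_ (norm_smul_toSphere (squareAxis_ne_zero x))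
    apply E3_ext <;> simp

/-- Linear maps of positive determinant that preserve the positive `z`-axis do not change the
homotopy class of `squareAxis`. -/
theorem linear_homotopic {M : E3 →L[ℝ] E3} (hM : 0 < LinearMap.det (M : E3 →ₗ[ℝ] E3)) {μ : ℝ}
    (hμ : 0 < μ) (hz : M (stdVec 0) = μ • stdVec 0) {f : C(Fin 2 → unitInterval, S2)}
    (hf : ∀ x, ∃ c > (0 : ℝ), M (squareAxis x) = c • (f x : E3))
    (hA : ∀ x ∈ Cube.boundary (Fin 2), f x = northPole) :
    f.HomotopicRel axisMap (Cube.boundary (Fin 2)) := by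
  rw [det_eq_coords, stdE_two_eq, hz] at hM
  set a := M (stdE 0) 0
  set c := M (stdE 0) 1
  set b := M (stdE 1) 0
  set d := M (stdE 1) 1
  have hdet : 0 < a * d - b * c := by
    have e : (stdVec 0) 0 = 0 ∧ (stdVec 0) 1 = 0 ∧ (stdVec 0) 2 = 1 := by simp [stdVec]
    simp only [PiLp.smul_apply, smul_eq_mul, e.1, e.2.1, e.2.2] at hM
    have : 0 < (a * d - b * c) * μ := by linarith
    exact pos_of_mul_pos_left this hμ.le
  set p := (a + d) / 2
  set q := (c - b) / 2
  have hpq : 0 < p ^ 2 + q ^ 2 := by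
    have : a * d - b * c ≤ p ^ 2 + q ^ 2 := by
      simp only [p, q]; nlinarith [sq_nonneg (a - d), sq_nonneg (b + c)]
    linarith
  have hMv : ∀ v : E3, M v 0 = a * v 0 + b * v 1 ∧ M v 1 = c * v 0 + d * v 1 ∧
      M v 2 = M (stdE 0) 2 * v 0 + M (stdE 1) 2 * v 1 + μ * v 2 := by
    intro v
    have e : v = v 0 • stdE 0 + v 1 • stdE 1 + v 2 • stdVec 0 := by
      rw [← stdE_two_eq]; exact sum_stdE v
    have e' : (stdVec 0) 0 = 0 ∧ (stdVec 0) 1 = 0 ∧ (stdVec 0) 2 = 1 := by simp [stdVec]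
    have h1 : M v = v 0 • M (stdE 0) + v 1 • M (stdE 1) + v 2 • μ • stdVec 0 := by
      conv_lhs => rw [e]
      rw [map_add, map_add, map_smul, map_smul, map_smul, hz]
    rw [h1]
    simp only [PiLp.add_apply, PiLp.smul_apply, smul_eq_mul, e'.1, e'.2.1, e'.2.2]
    refine ⟨?_, ?_, ?_⟩ <;> ring
  -- the linear homotopy to the conformal part of the planar block
  have hhom : ∃ g : C(Fin 2 → unitInterval, S2),
      (∀ x, ∃ c > (0 : ℝ), rotZ p q (squareAxis x) = c • (g x : E3)) := by
    have hne : ∀ x, rotZ p q (squareAxis x) ≠ 0 := fun x =>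
      rotZ_apply_ne_zero hpq.ne' (squareAxis_ne_zero x)
    exact ⟨⟨fun x => toSphere _ (hne x),
      continuous_toSphere ((rotZ p q).continuous.comp continuous_squareAxis) hne⟩,
      fun x => ⟨_, norm_pos_iff.2 (hne x), norm_smul_toSphere (hne x)⟩⟩
  obtain ⟨g, hg⟩ := hhom
  have h1 : f.HomotopicRel g (Cube.boundary (Fin 2)) := by
    refine homotopicRel_of_linear_path
      ⟨fun s => (1 - (s : ℝ)) • M + (s : ℝ) • rotZ p q, by fun_prop⟩ (fun s v hv h => ?_)
      (fun s => ⟨(1 - s) * μ + s, ?_, ?_⟩) (fun x => ?_) (fun x => ?_) hA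
    · have h0 := congrArg (fun v : E3 => v 0) h
      have h1 := congrArg (fun v : E3 => v 1) h
      have h2 := congrArg (fun v : E3 => v 2) h
      simp only [ContinuousMap.coe_mk, add_apply,
        smul_apply, PiLp.add_apply, PiLp.smul_apply, smul_eq_mul, rotZ_zero,
        rotZ_one, rotZ_two, (hMv v).1, (hMv v).2.1, (hMv v).2.2, PiLp.zero_apply] at h0 h1 h2
      have hs0 : (0 : ℝ) ≤ s := s.2.1
      have hs1 : 0 ≤ 1 - (s : ℝ) := sub_nonneg.2 s.2.2
      generalize (s : ℝ) = t at *
      have hD : 0 < ((1 - t) * a + t * p) * ((1 - t) * d + t * p) -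
          ((1 - t) * b - t * q) * ((1 - t) * c + t * q) := by
        have e : ((1 - t) * a + t * p) * ((1 - t) * d + t * p) -
            ((1 - t) * b - t * q) * ((1 - t) * c + t * q) =
            (a * d - b * c) + (1 - (1 - t) ^ 2) * (((a - d) / 2) ^ 2 + ((b + c) / 2) ^ 2) := by
          simp only [p, q]; ring
        rw [e]
        have : 0 ≤ 1 - (1 - t) ^ 2 := by nlinarith
        positivity
      have z0 : v 0 = 0 := mul_left_cancel₀ hD.ne' (by
        linear_combination ((1 - t) * d + t * p) * h0 - ((1 - t) * b - t * q) * h1)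
      have z1 : v 1 = 0 := mul_left_cancel₀ hD.ne' (by
        linear_combination ((1 - t) * a + t * p) * h1 - ((1 - t) * c + t * q) * h0)
      refine hv (E3_ext z0 z1 ?_)
      have hpos : 0 < (1 - t) * μ + t := by
        rcases hs0.eq_or_lt with h | h
        · rw [← h]; simpa using hμ
        · have := mul_nonneg hs1 hμ.le
          linarith
      refine mul_left_cancel₀ hpos.ne' ?_
      rw [z0, z1] at h2
      simp only [PiLp.zero_apply]
      linear_combination h2
    · rcases eq_or_lt_of_le s.2.1 with h | h
      · rw [← h]; simpa using hμ
      · have := mul_nonneg (by linarith [s.2.2] : (0 : ℝ) ≤ 1 - s) hμ.le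
        linarith
    · simp only [ContinuousMap.coe_mk, add_apply,
        smul_apply, hz, rotZ_stdVec, add_smul, mul_smul]
    · simpa using hf x
    · simpa using hg x
  refine h1.trans (rotZ_homotopic hpq.ne' hg fun x hx => ?_)
  obtain ⟨c, hc, e⟩ := hg x
  rw [squareAxis_boundary hx, rotZ_stdVec] at e
  refine (toSphere_coe _ (sphere_ne_zero _)).symm.trans ?_
  refine toSphere_eq_northPole _ (inv_pos.2 hc) ?_
  rw [e, smul_smul, inv_mul_cancel₀ hc.ne', one_smul]

theorem det_qrot {q : ℝ × E3} (hq : q ≠ 0) : LinearMap.det (qrot q : E3 →ₗ[ℝ] E3) = 1 := by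
  have h := (qnorm_pos hq).ne'
  have hn : qnorm q = q.1 ^ 2 + q.2 0 ^ 2 + q.2 1 ^ 2 + q.2 2 ^ 2 := rfl
  rw [det_eq_coords]
  simp only [qrot_apply, PiLp.smul_apply, PiLp.add_apply, smul_eq_mul, inner_coords, cross_zero,
    cross_one, cross_two]
  simp only [stdE, PiLp.single_apply]
  simp
  generalize q.2 0 = x at *
  generalize q.2 1 = y at *
  generalize q.2 2 = z at *
  generalize q.1 = w at *
  generalize qnorm q = n at *
  field_simp
  rw [hn]
  ring

/-- The evaluation of a disc of rotated contact structures has degree one. Here `W` is the normal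
vector field of an axially symmetric structure, `M` is the transpose of a change of coordinates and
`u₁` is the point of evaluation. -/
theorem homotopicRel_of_rotations {M : E3 →L[ℝ] E3}
    (hM : 0 < LinearMap.det (M : E3 →ₗ[ℝ] E3)) {W : E3 → E3} {u₁ : E3}
    (hW : Continuous fun x => W (squareRot x u₁))
    (hW0 : ∀ x, ∀ s ∈ Icc (0 : ℝ) 1, (1 - s) • W (squareRot x u₁) + s • stdVec 0 ≠ 0)
    (hWr : ∀ c s : ℝ, c ^ 2 + s ^ 2 = 1 → W (rotZ c s u₁) = rotZ c s (W u₁))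
    {l : ℝ} (hl : 0 < l) (hMW : M (W u₁) = l • stdVec 0)
    {f : C(Fin 2 → unitInterval, S2)}
    (hf : ∀ x, ∃ c > (0 : ℝ), M ((squareRot x).adjoint (W (squareRot x u₁))) = c • (f x : E3)) :
    (∀ x ∈ Cube.boundary (Fin 2), f x = northPole) ∧
      f.HomotopicRel squareToSphere.1 (Cube.boundary (Fin 2)) := by
  have hMi : ∀ v, M v = 0 → v = 0 := fun v h => by
    have h1 : Function.Injective M := by
      rw [← ContinuousLinearMap.coe_coe, ← LinearMap.ker_eq_bot]
      exact LinearMap.ker_eq_bot.2 (LinearMap.equivOfDetNeZero _ hM.ne').injective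
    exact h1 (by rw [h, map_zero])
  have hbd : ∀ x ∈ Cube.boundary (Fin 2),
      (squareRot x).adjoint (W (squareRot x u₁)) = W u₁ := by
    intro x hx
    -- on the boundary, the rotations are about the `z`-axis, for which `W` is equivariant
    obtain ⟨c, s, h, e⟩ := exists_rotZ_squareRot hx
    have h1 : W (squareRot x u₁) = squareRot x (W u₁) := by rw [e, hWr c s h]
    rw [h1, adjoint_comp_self (norm_squareRot x)]
  have hA : ∀ x ∈ Cube.boundary (Fin 2), f x = northPole := by
    intro x hx
    obtain ⟨c, hc, e⟩ := hf x
    rw [hbd x hx, hMW] at e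
    refine (toSphere_coe _ (sphere_ne_zero _)).symm.trans ?_
    refine toSphere_eq_northPole _ (mul_pos (inv_pos.2 hc) hl) ?_
    rw [mul_smul, e, smul_smul, inv_mul_cancel₀ hc.ne', one_smul]
  refine ⟨hA, ?_⟩
  have he : ‖stdVec 0‖ = 1 := by rw [← coe_northPole]; simp
  set e₀ : E3 := stdVec 0 with he₀
  -- the images of the normal vector on the boundary during the straightening of `W`
  set w : ℝ → E3 := fun s => ((1 - s) * l) • e₀ + s • M e₀ with hw
  have hww : ∀ s, w s = M ((1 - s) • W u₁ + s • e₀) := fun s => by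
    rw [map_add, map_smul, map_smul, hMW, hw, smul_smul]
  have hwc : ∀ s ∈ Icc (0 : ℝ) 1, ∀ c : ℝ, 0 ≤ c → w s + c • e₀ ≠ 0 := by
    intro s hs c hc h
    have h1 : M ((1 - s + c / l) • W u₁ + s • e₀) = 0 := by
      rw [map_add, map_smul, map_smul, hMW, ← h, hw]
      simp only [smul_smul]
      rw [add_mul, div_mul_cancel₀ c hl.ne', add_smul]
      abel
    have h2 := hMi _ h1
    have hcl : 0 ≤ c / l := div_nonneg hc hl.le
    have hD : 0 < 1 + c / l := by linarith
    have h3 := hW0 0 (s / (1 + c / l)) ⟨div_nonneg hs.1 hD.le, by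
      rw [div_le_one hD]; linarith [hs.2]⟩
    have hr : W (squareRot 0 u₁) = W u₁ := by
      have h0 : squareRot 0 = ContinuousLinearMap.id ℝ E3 :=
        qrot_discQ_of_eq_one (Or.inl (by simp))
      rw [h0]; rfl
    apply h3
    rw [hr]
    have h4 : (1 - s / (1 + c / l)) • W u₁ + (s / (1 + c / l)) • e₀ =
        (1 + c / l)⁻¹ • ((1 - s + c / l) • W u₁ + s • e₀) := by
      rw [smul_add, smul_smul, smul_smul]
      congr 2 <;> field_simp
      ring
    rw [h4, h2, smul_zero]
  have hw0 : ∀ s ∈ Icc (0 : ℝ) 1, w s ≠ 0 := fun s hs h => hwc s hs 0 le_rfl (by rw [h]; simp)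
  set g : ℝ → E3 := fun s => ‖w s‖⁻¹ • w s with hg
  have hg1 : ∀ s ∈ Icc (0 : ℝ) 1, ‖g s‖ = 1 := fun s hs => by
    rw [hg, norm_smul, norm_inv, norm_norm, inv_mul_cancel₀ (norm_ne_zero_iff.2 (hw0 s hs))]
  have hge : ∀ s ∈ Icc (0 : ℝ) 1, -1 < inner ℝ (g s) e₀ := by
    intro s hs
    by_contra h
    have h1 : ‖g s + e₀‖ ^ 2 ≤ 0 := by
      rw [norm_add_sq_real, hg1 s hs, he]; linarith
    have h2 : g s + e₀ = 0 := norm_eq_zero.1 (sq_eq_zero_iff.1 (le_antisymm h1 (sq_nonneg _)))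
    apply hwc s hs ‖w s‖ (norm_nonneg _)
    have h3 : ‖w s‖ • g s = w s := by
      rw [hg, smul_smul, mul_inv_cancel₀ (norm_ne_zero_iff.2 (hw0 s hs)), one_smul]
    have h4 : ‖w s‖ • (g s + e₀) = 0 := by rw [h2, smul_zero]
    rwa [smul_add, h3] at h4
  -- the rotation that takes the direction of `w s` back to the `z`-axis, so that the homotopy is
  -- constant on the boundary
  set Q : ℝ → ℝ × E3 := fun s => (1 + inner ℝ (g s) e₀, cross (g s) e₀)
  have hQ0 : ∀ s ∈ Icc (0 : ℝ) 1, Q s ≠ 0 := fun s hs h => by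
    have := congrArg Prod.fst h
    have h2 := hge s hs
    simp only [Q, Prod.fst_zero] at this
    linarith
  have hQc : Continuous fun s : unitInterval => Q s := by
    have h1 : Continuous fun s : unitInterval => w s := by fun_prop
    have h2 : Continuous fun s : unitInterval => g s :=
      (h1.norm.inv₀ fun s => norm_ne_zero_iff.2 (hw0 s s.2)).smul h1
    have h3 : Continuous fun s : unitInterval => cross (g s) e₀ := by
      have h3 : Continuous fun v : E3 => cross v e₀ := by unfold cross; fun_prop
      exact h3.comp h2
    exact (continuous_const.add (h2.inner continuous_const)).prodMk h3
  have hC : Continuous fun s : unitInterval => qrot (Q s) :=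
    contDiffOn_qrot.continuousOn.comp_continuous hQc fun s => hQ0 s s.2
  have hCg : ∀ s ∈ Icc (0 : ℝ) 1, qrot (Q s) (w s) = ‖w s‖ • e₀ := fun s hs => by
    have h3 : w s = ‖w s‖ • g s := by
      rw [hg, smul_smul, mul_inv_cancel₀ (norm_ne_zero_iff.2 (hw0 s hs)), one_smul]
    conv_lhs => rw [h3]
    rw [map_smul, qrot_between (hg1 s hs) he (hge s hs)]
  have hC0 : qrot (Q 0) = ContinuousLinearMap.id ℝ E3 := by
    have h1 : g 0 = e₀ := by
      simp only [hg, hw, sub_zero, one_mul, zero_smul, add_zero, norm_smul, he, mul_one,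
        Real.norm_of_nonneg hl.le, smul_smul, inv_mul_cancel₀ hl.ne', one_smul]
    simp only [Q, h1, cross_self, real_inner_self_eq_norm_sq, he]
    exact qrot_real (by norm_num)
  have h1I : (1 : ℝ) ∈ Icc (0 : ℝ) 1 := by simp
  set M' : E3 →L[ℝ] E3 := (qrot (Q 1)).comp M
  have hM' : 0 < LinearMap.det (M' : E3 →ₗ[ℝ] E3) := by
    have : (M' : E3 →ₗ[ℝ] E3) = (qrot (Q 1) : E3 →ₗ[ℝ] E3) ∘ₗ (M : E3 →ₗ[ℝ] E3) := rfl
    rw [this, LinearMap.det_comp, det_qrot (hQ0 1 h1I), one_mul]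
    exact hM
  have hM'i : ∀ v, v ≠ 0 → M' v ≠ 0 := fun v hv h => by
    have h1 : ‖qrot (Q 1) (M v)‖ = 0 := by rw [norm_eq_zero]; exact h
    rw [norm_qrot (hQ0 1 h1I), norm_eq_zero] at h1
    exact hv (hMi v h1)
  have hz : M' e₀ = ‖w 1‖ • e₀ := by
    have h1 := hCg 1 h1I
    nth_rewrite 1 [hww 1] at h1
    rwa [sub_self, zero_smul, zero_add, one_smul] at h1
  have hw1 : 0 < ‖w 1‖ := norm_pos_iff.2 (hw0 1 h1I)
  -- the map obtained by straightening `W` to the `z`-axis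
  have hne : ∀ x, M' (squareAxis x) ≠ 0 := fun x => hM'i _ (squareAxis_ne_zero x)
  let k : C(Fin 2 → unitInterval, S2) := ⟨fun x => toSphere (M' (squareAxis x)) (hne x),
    continuous_toSphere (M'.continuous.comp continuous_squareAxis) hne⟩
  have hk : ∀ x, ∃ c > (0 : ℝ), M' (squareAxis x) = c • (k x : E3) := fun x =>
    ⟨_, norm_pos_iff.2 (hne x), norm_smul_toSphere (hne x)⟩
  let H : unitInterval × (Fin 2 → unitInterval) → E3 := fun p => qrot (Q p.1) (M
    ((squareRot p.2).adjoint ((1 - (p.1 : ℝ)) • W (squareRot p.2 u₁) + (p.1 : ℝ) • e₀)))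
  have hH : Continuous H := by
    refine (hC.comp continuous_fst).clm_apply (M.continuous.comp ?_)
    refine (continuous_adjoint_squareRot.comp continuous_snd).clm_apply ?_
    have := hW.comp (continuous_snd (X := unitInterval))
    have h2 : Continuous fun p : unitInterval × (Fin 2 → unitInterval) =>
      W (squareRot p.2 u₁) := this
    have h3 : Continuous fun p : unitInterval × (Fin 2 → unitInterval) => (p.1 : ℝ) := by fun_prop
    exact ((continuous_const.sub h3).smul h2).add (h3.smul continuous_const)
  have hH0 : ∀ p, H p ≠ 0 := fun p h => by
    have h1 : ‖H p‖ = 0 := by rw [h, norm_zero]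
    rw [norm_qrot (hQ0 _ p.1.2), norm_eq_zero] at h1
    exact adjoint_apply_ne_zero (norm_squareRot p.2) (hW0 p.2 p.1 p.1.2) (hMi _ h1)
  have hfk : f.HomotopicRel k (Cube.boundary (Fin 2)) := by
    refine homotopicRel_of_ne_zero ⟨H, hH⟩ hH0 (fun x => ?_) (fun x => ?_) fun s x hx => ?_
    · obtain ⟨c, hc, e⟩ := hf x
      refine toSphere_eq_of_smul (hH0 (0, x)) hc ?_
      rw [← e]
      simp [H, hC0]
    · obtain ⟨c, hc, e⟩ := hk x
      refine toSphere_eq_of_smul (hH0 (1, x)) hc ?_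
      rw [← e]
      simp [H, M', squareAxis, he₀]
    · rw [hA x hx]
      refine toSphere_eq_northPole (hH0 (s, x)) (norm_pos_iff.2 (hw0 s s.2)) ?_
      have h1 : (squareRot x).adjoint e₀ = e₀ := squareAxis_boundary hx
      change qrot (Q s) (M ((squareRot x).adjoint _)) = _
      rw [map_add, map_smul, map_smul, hbd x hx, h1, ← hww, hCg s s.2]
  refine hfk.trans ((linear_homotopic hM' hw1 hz hk fun x hx => ?_).trans axisMap_homotopic)
  refine toSphere_eq_northPole (hne x) hw1 ?_
  rw [squareAxis_boundary hx, hz]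

end LinearDegree

/-! ### Obstruction classes from discs of rotations -/

section Evaluation

theorem det_adjoint (A : E3 →L[ℝ] E3) :
    LinearMap.det (A.adjoint : E3 →ₗ[ℝ] E3) = LinearMap.det (A : E3 →ₗ[ℝ] E3) := by
  have h : ∀ i j, A.adjoint (stdE j) i = A (stdE i) j := fun i j => by
    have h1 := ContinuousLinearMap.adjoint_inner_left A (stdE i) (stdE j)
    simpa [stdE, EuclideanSpace.inner_single_right, EuclideanSpace.inner_single_left] using h1
  rw [det_eq_coords, det_eq_coords]
  simp only [h]
  ring

/-- Positivity of a contact form depends on the co-oriented plane field only. -/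
theorem contactVol_pos_of_eq {a b : E3 → E3 →L[ℝ] ℝ} {u : E3} (ha : DifferentiableAt ℝ a u)
    (hb : DifferentiableAt ℝ b u) (hb0 : b u ≠ 0)
    (H : ∀ᶠ x in 𝓝 u, {v | 0 < a x v} = {v | 0 < b x v}) (hpos : 0 < contactVol a u) :
    0 < contactVol b u := by
  have ha0 := contactVol_ne_zero_imp hpos.ne'
  have h1 := contactVol_normal (h := fun x => {v | 0 < a x v}) ha ha0 (.of_forall fun x => rfl)
  have h2 := contactVol_normal (h := fun x => {v | 0 < a x v}) hb hb0 H
  have h3 : 0 < ‖a u‖⁻¹ ^ 2 * contactVol a u :=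
    mul_pos (pow_pos (inv_pos.2 (norm_pos_iff.2 ha0)) 2) hpos
  rw [← h1, h2] at h3
  exact pos_of_mul_pos_right h3 (by positivity)

variable {Y : Type*} [TopologicalSpace Y] [ChartedSpace E3 Y] [IsManifold (𝓡 3) ∞ Y] [T2Space Y]
  {ξ : ContactStructure Y}

/-- The coordinate change from a Darboux ball to a chart with contact form `⟪V, ·⟫` preserves or
reverses orientations according to the sign of the contact form. -/
theorem exists_center_transition (B : DarbouxBall ξ) {N : E3 → Y} {G U : Set E3} (hN : ImmOn N G)
    {u₁ : E3} (hu₁ : u₁ ∈ G) (hcen : N u₁ = B.center) {V : E3 → E3} (hU : IsOpen U) (hu₁U : u₁ ∈ U)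
    (hV : ContDiffOn ℝ ∞ V U) (hξ : ∀ u ∈ U, pb N ξ.pos u = {v | 0 < inner ℝ (V u) v})
    {ε : ℝ} (hvol : 0 < ε * volV (V u₁) (fderiv ℝ V u₁)) :
    ∃ A : E3 →L[ℝ] E3, 0 < ε * LinearMap.det (A : E3 →ₗ[ℝ] E3) ∧
      ∀ P : ∀ y : Y, Set (TangentSpace (𝓡 3) y), pb B.toFun P 0 = A ⁻¹' pb N P u₁ := by
  obtain ⟨R, hR, hBi, -⟩ := B.exists_collar_sq
  obtain ⟨τ, T, hTo, h0T, hTU, hτ, hτi, hτm, hτ0, hτe⟩ :=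
    hN.exists_transition hBi hu₁ (zero_mem_Iio hR) hcen
  have hτ0' : ContDiffAt ℝ ∞ τ 0 := hτ.contDiffAt (hTo.mem_nhds h0T)
  have hpb : ∀ x ∈ T, ∀ P : ∀ y : Y, Set (TangentSpace (𝓡 3) y),
      pb B.toFun P x = fderiv ℝ τ x ⁻¹' pb N P (τ x) := fun x hx P => by
    have e : B.toFun =ᶠ[𝓝 x] N ∘ τ :=
      Filter.eventually_of_mem (hTo.mem_nhds hx) fun y hy => hτe y hy
    rw [pb_congr e, pb_comp (hN.mdifferentiableAt (hτm hx))
      ((hτ.contDiffAt (hTo.mem_nhds hx)).differentiableAt (by simp))]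
  refine ⟨fderiv ℝ τ 0, ?_, fun P => by rw [hpb 0 h0T, hτ0]⟩
  have hVd : DifferentiableAt ℝ V (τ 0) := by
    rw [hτ0]; exact (hV.contDiffAt (hU.mem_nhds hu₁U)).differentiableAt (by simp)
  have hcV : DifferentiableAt ℝ (fun x => covec (V x)) (τ 0) :=
    (innerSL ℝ : E3 →L[ℝ] E3 →L[ℝ] ℝ).differentiableAt.comp _ hVd
  have hV0 : V u₁ ≠ 0 := fun h => by
    rw [h] at hvol; simp [volV] at hvol
  -- the contact volumes of `stdVec` and of `V` differ by the determinant of the transition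
  have hpull := contactVol_pullback hcV (hτ0'.of_le ENat.LEInfty.out : ContDiffAt ℝ 2 τ 0)
  rw [contactVol_covec hVd, hτ0] at hpull
  have hpos : 0 < contactVol (fun x => (covec (V (τ x))).comp (fderiv ℝ τ x)) 0 := by
    refine contactVol_pos_of_eq (a := fun x => covec (stdVec x)) ?_ ?_ ?_ ?_ ?_
    · exact (innerSL ℝ : E3 →L[ℝ] E3 →L[ℝ] ℝ).differentiableAt.comp _
        (contDiff_stdVec.differentiable (by simp) _)
    · refine DifferentiableAt.clm_comp
        (hcV.comp (0 : E3) (hτ0'.differentiableAt (by simp))) ?_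
      exact (hτ0'.fderiv_right (m := 1) (by norm_num; exact ENat.LEInfty.out)).differentiableAt (by simp)
    · intro h
      obtain ⟨w, hw⟩ := surjective_of_injective (hτi 0 h0T) (V u₁)
      have h1 := DFunLike.congr_fun h w
      rw [ContinuousLinearMap.comp_apply, hw, hτ0] at h1
      exact hV0 (inner_self_eq_zero.1 h1)
    · have hUn : ∀ᶠ x in 𝓝 (0 : E3), τ x ∈ U :=
        hτ0'.continuousAt.eventually_mem (hU.mem_nhds (by rw [hτ0]; exact hu₁U))
      filter_upwards [hUn, hTo.mem_nhds h0T, closedBall_mem_nhds (0 : E3) one_pos] with x h1 h2 h3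
      have h4 := hpb x h2 ξ.pos
      rw [B.pb_eq h3, hξ _ h1, setOf_stdForm] at h4
      exact h4
    · rw [contactVol_covec (contDiff_stdVec.differentiable (by simp) _), volV_stdVec]
      exact one_pos
  rw [hpull] at hpos
  set d := LinearMap.det (fderiv ℝ τ 0 : E3 →ₗ[ℝ] E3)
  set w := volV (V u₁) (fderiv ℝ V u₁)
  have h1 : 0 < (ε * d) * (w * w) := by
    have := mul_pos hvol hpos
    linarith
  exact pos_of_mul_pos_left h1 (mul_self_nonneg w)

/-- The boundary loop of a disc of rotations inside a chart lies in the obstruction class, if on the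
sphere through the centre of the ball the contact structure is given by an axially symmetric vector
field `V`, with `ε V` nowhere opposite to the `z`-axis, for the orientation `ε` of the chart. -/
theorem exists_obstruction_path (B : DarbouxBall ξ) {N : E3 → Y} {J : Set ℝ} {χ : ℝ → ℝ}
    (hN : ImmOn N {u | ‖u‖ ^ 2 ∈ J}) {D : C(unitInterval × unitInterval, ContactStructure Y)}
    (hD : ∀ x u, ‖u‖ ^ 2 ∈ J → pb N (D x).pos u =
        fderiv ℝ (twist fun s => qrot (discQ (x.1 * χ s) x.2)) u ⁻¹'
          pb N ξ.pos (twist (fun s => qrot (discQ (x.1 * χ s) x.2)) u))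
    (hD0 : ∀ x, x.1 = 0 ∨ x.2 = 0 ∨ x.2 = 1 → D x = ξ)
    (hD1 : ∀ φ, ∀ p ∈ B.image, (D (1, φ)).pos p = ξ.pos p)
    {u₁ : E3} (hu₁ : ‖u₁‖ ^ 2 ∈ J) (hχ : ∀ᶠ s in 𝓝 (‖u₁‖ ^ 2), χ s = 1)
    (hcen : N u₁ = B.center) {U : Set E3} {V : E3 → E3} (hU : IsOpen U)
    (hUs : ∀ u : E3, ‖u‖ = ‖u₁‖ → u ∈ U)
    (hV : ContDiffOn ℝ ∞ V U) (hξ : ∀ u ∈ U, pb N ξ.pos u = {v | 0 < inner ℝ (V u) v})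
    {ε : ℝ} (hε : ε = 1 ∨ ε = -1) (hvol : 0 < ε * volV (V u₁) (fderiv ℝ V u₁))
    (hst : ∀ u : E3, ‖u‖ = ‖u₁‖ → ∀ s ∈ Icc (0 : ℝ) 1, (1 - s) • ε • V u + s • stdVec 0 ≠ 0)
    (hrot : ∀ c s : ℝ, c ^ 2 + s ^ 2 = 1 → V (rotZ c s u₁) = rotZ c s (V u₁)) :
    ∃ γ : Path (baseCB B) (baseCB B), (∀ φ, (γ φ).1.1 = D (1, φ)) ∧
      IsObstructionClass B (FundamentalGroup.fromPath (Path.Homotopic.Quotient.mk γ)) := by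
  obtain ⟨A, hA, hAP⟩ := exists_center_transition B hN hu₁ hcen hU (hUs _ rfl) hV hξ hvol
  have hε2 : ε * ε = 1 := by rcases hε with rfl | rfl <;> norm_num
  set M : E3 →L[ℝ] E3 := ε • A.adjoint with hMdef
  have hM : 0 < LinearMap.det (M : E3 →ₗ[ℝ] E3) := by
    have e : (M : E3 →ₗ[ℝ] E3) = ε • (A.adjoint : E3 →ₗ[ℝ] E3) := rfl
    rw [e, LinearMap.det_smul, det_adjoint, finrank_euclideanSpace_fin, pow_succ, pow_two, hε2,
      one_mul]
    exact hA
  -- the normal vectors at the centre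
  have hne : ∀ x : Fin 2 → unitInterval, M ((squareRot x).adjoint (ε • V (squareRot x u₁))) ≠ 0 :=
    fun x h => by
      have h1 : Function.Injective M := by
        have := (LinearMap.equivOfDetNeZero _ hM.ne').injective
        exact this
      have h2 := h1 (h.trans (map_zero M).symm)
      have h3 : ε • V (squareRot x u₁) ≠ 0 := by
        have := hst (squareRot x u₁) (norm_squareRot x u₁) 0 (by simp)
        simpa using this
      exact adjoint_apply_ne_zero (norm_squareRot x) h3 h2
  have hpb : ∀ x : Fin 2 → unitInterval, pb B.toFun (D (x 0, x 1)).pos 0 =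
      {v | 0 < inner ℝ (M ((squareRot x).adjoint (ε • V (squareRot x u₁)))) v} := by
    intro x
    rw [hAP, pb_twisted (hD (x 0, x 1) u₁ hu₁) hχ]
    change A ⁻¹' (squareRot x ⁻¹' pb N ξ.pos (squareRot x u₁)) = _
    rw [hξ _ (hUs _ (norm_squareRot x u₁))]
    ext v
    simp only [mem_preimage, mem_ofPred_eq, hMdef, smul_apply, map_smul, smul_smul, hε2, one_smul,
      ContinuousLinearMap.adjoint_inner_left]
  have hnorm : ∀ x : Fin 2 → unitInterval, M ((squareRot x).adjoint (ε • V (squareRot x u₁))) =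
      ‖M ((squareRot x).adjoint (ε • V (squareRot x u₁)))‖ •
        (normalS B (D (x 0, x 1)) : E3) := by
    intro x
    have h1 : (normalS B (D (x 0, x 1)) : E3) = unitNormal (pb B.toFun (D (x 0, x 1)).pos 0) := rfl
    rw [h1, unitNormal_eq (hne x) (hpb x), smul_smul, mul_inv_cancel₀ (norm_ne_zero_iff.2 (hne x)),
      one_smul]
  let f : C(Fin 2 → unitInterval, S2) := ⟨fun x => normalS B (D (x 0, x 1)),
    (continuous_normalS B).comp (D.continuous.comp (by fun_prop))⟩
  have hW : Continuous fun x => ε • V (squareRot x u₁) := by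
    have h1 : Continuous fun x => squareRot x u₁ :=
      continuous_squareRot.clm_apply continuous_const
    have h2 := hV.continuousOn.comp_continuous h1 fun x => hUs _ (norm_squareRot x u₁)
    exact h2.const_smul ε
  have h00 : ∀ v, squareRot 0 v = v := fun v => by
    have h0 : squareRot 0 = ContinuousLinearMap.id ℝ E3 :=
      qrot_discQ_of_eq_one (Or.inl (by simp))
    rw [h0]; rfl
  have h01 : (squareRot 0).adjoint (ε • V (squareRot 0 u₁)) = ε • V u₁ := by
    rw [h00]
    have := adjoint_comp_self (norm_squareRot 0) (ε • V u₁)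
    rwa [h00] at this
  have hbase : M (ε • V u₁) = ‖M (ε • V u₁)‖ • stdVec 0 := by
    have h1 := hnorm 0
    have h2 : D ((0 : Fin 2 → unitInterval) 0, (0 : Fin 2 → unitInterval) 1) = ξ :=
      hD0 _ (Or.inl rfl)
    rw [h2, normalS_of_agree B fun _ _ => rfl, coe_northPole, h01] at h1
    exact h1
  have hbase0 : 0 < ‖M (ε • V u₁)‖ := by
    have h1 := hne 0
    rw [h01] at h1
    exact norm_pos_iff.2 h1
  obtain ⟨hfb, hfh⟩ := homotopicRel_of_rotations (W := fun u => ε • V u) (u₁ := u₁) hM hW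
    (fun x s hs => hst _ (norm_squareRot x u₁) s hs)
    (fun c s h => by simp only [hrot c s h, map_smul]) hbase0 hbase
    (f := f) (fun x => ⟨_, norm_pos_iff.2 (hne x), hnorm x⟩)
  have hmem : ∀ x, D x ∈ pathComponent ξ :=
    mem_pathComponent_of_continuous D.continuous (hD0 0 (Or.inl rfl))
  let γ : Path (baseCB B) (baseCB B) :=
    { toFun := fun φ => ⟨⟨D (1, φ), hmem _⟩, hD1 φ⟩
      continuous_toFun := by fun_prop
      source' := Subtype.ext (Subtype.ext (hD0 _ (Or.inr (Or.inl rfl))))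
      target' := Subtype.ext (Subtype.ext (hD0 _ (Or.inr (Or.inr rfl)))) }
  refine ⟨γ, fun φ => rfl, ⟨fun x => ⟨D x, hmem x⟩, by fun_prop⟩, ⟨f, hfb⟩, γ, hfh, fun r φ => ?_,
    fun φ => Subtype.ext (hD0 _ (Or.inl rfl)), fun r => ⟨Subtype.ext (hD0 _ (Or.inr (Or.inl rfl))),
      Subtype.ext (hD0 _ (Or.inr (Or.inr rfl)))⟩, fun φ => rfl, rfl⟩
  rw [evB_eq_normalS]
  rfl

end Evaluation

/-! ### The obstruction class of a Darboux ball -/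

section Summand

/-- The linear map `(x, y, z) ↦ (x, y, ε z)`. -/
def scaleZ (ε : ℝ) : E3 →L[ℝ] E3 :=
  LinearMap.toContinuousLinearMap
    { toFun := fun v => !₂[v 0, v 1, ε * v 2]
      map_add' := fun v w => by apply E3_ext <;> simp; ring
      map_smul' := fun t v => by apply E3_ext <;> simp; ring }

@[simp] theorem scaleZ_zero (ε : ℝ) (v : E3) : scaleZ ε v 0 = v 0 := rfl
@[simp] theorem scaleZ_one (ε : ℝ) (v : E3) : scaleZ ε v 1 = v 1 := rfl
@[simp] theorem scaleZ_two (ε : ℝ) (v : E3) : scaleZ ε v 2 = ε * v 2 := rfl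

theorem scaleZ_of_one (v : E3) : scaleZ 1 v = v := by apply E3_ext <;> simp

theorem scaleZ_of_neg_one (v : E3) : scaleZ (-1) v = reflectZ v := by
  apply E3_ext <;> simp [reflectZ]

theorem norm_scaleZ {ε : ℝ} (hε : ε = 1 ∨ ε = -1) (v : E3) : ‖scaleZ ε v‖ = ‖v‖ := by
  rw [← sq_eq_sq₀ (norm_nonneg _) (norm_nonneg _), norm_sq_coords, norm_sq_coords]
  rcases hε with rfl | rfl <;> simp

theorem scaleZ_rotZ (ε c s : ℝ) (v : E3) : scaleZ ε (rotZ c s v) = rotZ c s (scaleZ ε v) := by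
  apply E3_ext <;> simp

/-- The coordinates around a Darboux ball, which are the ones of the handle close to the boundary
of the ball. -/
def coreChart {Y : Type*} (f : E3 → Y) (ε : ℝ) : E3 → Y := f ∘ scaleZ ε ∘ coreMap

theorem coreMap_rotZ {c s : ℝ} (h : c ^ 2 + s ^ 2 = 1) (u : E3) :
    coreMap (rotZ c s u) = rotZ c s (coreMap u) := radialMap_rotZ _ _ h u

theorem contDiff_coreMap : ContDiff ℝ ∞ coreMap := by
  have h := contDiffOn_radialMap isProfile_core_fst.contDiffOn isProfile_core_snd.contDiffOn
  rw [← contDiffOn_univ]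
  exact h.mono fun u _ => mem_univ _

theorem norm_sq_scaleZ_coreMap_lt {ε : ℝ} (hε : ε = 1 ∨ ε = -1) {R R' : ℝ} (hR : 1 < R)
    (hRR : R ^ 2 ≤ R') {u : E3} (hu : ‖u‖ ^ 2 ∈ Iio R) :
    ‖scaleZ ε (coreMap u)‖ ^ 2 ∈ Iio R' := by
  rw [norm_scaleZ hε]
  exact (norm_sq_coreMap_lt hR hu).trans_le hRR

theorem injOn_coreChart {Y : Type*} {f : E3 → Y} {ε : ℝ} (hε : ε = 1 ∨ ε = -1) {R R' : ℝ}
    (hR : 1 < R) (hRR : R ^ 2 ≤ R') (hf : InjOn f {u | ‖u‖ ^ 2 ∈ Iio R'}) :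
    InjOn (coreChart f ε) {u | ‖u‖ ^ 2 ∈ Iio R} := by
  intro u hu v hv h
  have h1 := hf (norm_sq_scaleZ_coreMap_lt hε hR hRR hu)
    (norm_sq_scaleZ_coreMap_lt hε hR hRR hv) h
  have h2 := injective_of_norm_eq (norm_scaleZ hε) h1
  exact isProfile_core_fst.injOn isProfile_core_snd (mem_univ _) (mem_univ _) h2

variable {Y : Type*} [TopologicalSpace Y] [ChartedSpace E3 Y]

theorem immOn_coreChart {f : E3 → Y} {ε : ℝ} (hε : ε = 1 ∨ ε = -1) {R R' : ℝ}
    (hR : 1 < R) (hRR : R ^ 2 ≤ R') (hf : ImmOn f {u | ‖u‖ ^ 2 ∈ Iio R'}) :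
    ImmOn (coreChart f ε) {u | ‖u‖ ^ 2 ∈ Iio R} := by
  have h1 : ImmOn (f ∘ scaleZ ε) {u | ‖u‖ ^ 2 ∈ Iio R'} := by
    refine hf.comp hf.isOpen (scaleZ ε).contDiff.contDiffOn (fun u _ => ?_) fun u hu => ?_
    · rw [ContinuousLinearMap.fderiv]
      exact injective_of_norm_eq (norm_scaleZ hε)
    · change ‖scaleZ ε u‖ ^ 2 < R'
      rw [norm_scaleZ hε]; exact hu
  refine h1.comp_radialMap (isProfile_core_fst.mono isOpen_Iio (convex_Iio R) (subset_univ _))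
    (isProfile_core_snd.mono isOpen_Iio (convex_Iio R) (subset_univ _)) fun u hu => ?_
  exact (norm_sq_coreMap_lt hR hu).trans_le hRR

variable {ξ : ContactStructure Y} (B : DarbouxBall ξ)

theorem pb_coreChart {ε : ℝ} (hε : ε = 1 ∨ ε = -1) {R : ℝ} (hR : 1 < R)
    (hf : ImmOn B.toFun {u | ‖u‖ ^ 2 ∈ Iio R}) {u : E3} (hu : ‖u‖ ≤ 1) :
    pb (coreChart B.toFun ε) ξ.pos u =
      {v | 0 < stdForm (scaleZ ε (coreMap u)) (fderiv ℝ (scaleZ ε ∘ coreMap) u v)} := by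
  have hn : ‖scaleZ ε (coreMap u)‖ ≤ 1 := by
    rw [norm_scaleZ hε]; exact norm_coreMap_le_one_iff.2 hu
  rw [coreChart, pb_comp (hf.mdifferentiableAt ?_) ?_]
  · rw [Function.comp_apply, B.pb_eq (by simpa using hn)]
    rfl
  · exact lt_of_le_of_lt (pow_le_one₀ (norm_nonneg _) hn) hR
  · exact ((scaleZ ε).contDiff.comp contDiff_coreMap).differentiable (by simp) u

theorem pb_coreChart_rotZ {ε : ℝ} (hε : ε = 1 ∨ ε = -1) {R : ℝ} (hR : 1 < R)
    (hf : ImmOn B.toFun {u | ‖u‖ ^ 2 ∈ Iio R}) {u : E3} (hu : ‖u‖ ≤ 1) {c s : ℝ}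
    (h : c ^ 2 + s ^ 2 = 1) :
    rotZ c s ⁻¹' pb (coreChart B.toFun ε) ξ.pos (rotZ c s u) =
      pb (coreChart B.toFun ε) ξ.pos u := by
  rw [pb_coreChart B hε hR hf hu, pb_coreChart B hε hR hf (by rwa [norm_rotZ h])]
  have hd : Differentiable ℝ (scaleZ ε ∘ coreMap) :=
    ((scaleZ ε).contDiff.comp contDiff_coreMap).differentiable (by simp)
  ext v
  have := stdForm_fderiv_rotZ (F := scaleZ ε ∘ coreMap) h (hd u) (hd _)
    (fun x => by simp only [Function.comp_apply, coreMap_rotZ h, scaleZ_rotZ]) v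
  simp only [Function.comp_apply] at this
  simp only [mem_preimage, mem_ofPred_eq, this]

/-- The normal vector field of the contact structure in the coordinates `coreChart`, close to
`0`. -/
def coreVec (ε : ℝ) (u : E3) : E3 := (1 / 16 : ℝ) • stdVec u + (ε / 4 - 1 / 16) • stdE 2

theorem contDiff_coreVec (ε : ℝ) : ContDiff ℝ ∞ (coreVec ε) :=
  (contDiff_stdVec.const_smul _).add contDiff_const

theorem volV_coreVec {ε : ℝ} (hε : ε = 1 ∨ ε = -1) :
    0 < ε * volV (coreVec ε 0) (fderiv ℝ (coreVec ε) 0) := by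
  have h : HasFDerivAt (coreVec ε) ((1 / 16 : ℝ) • fderiv ℝ stdVec 0) 0 :=
    ((contDiff_stdVec.differentiable (by simp) 0).hasFDerivAt.const_smul
      (1 / 16 : ℝ)).add_const ((ε / 4 - 1 / 16) • stdE 2)
  rw [h.fderiv, volV_smul]
  simp only [volV, hasFDerivAt_stdVec_apply]
  simp [coreVec, stdVec, stdE]
  rcases hε with rfl | rfl <;> norm_num

theorem pb_coreChart_zero {ε : ℝ} (hε : ε = 1 ∨ ε = -1) {R : ℝ} (hR : 1 < R)
    (hf : ImmOn B.toFun {u | ‖u‖ ^ 2 ∈ Iio R}) {u : E3} (hu : ‖u‖ ^ 2 < 1 / 4) :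
    pb (coreChart B.toFun ε) ξ.pos u = {v | 0 < inner ℝ (coreVec ε u) v} := by
  have hu1 : ‖u‖ ≤ 1 := by nlinarith [norm_nonneg u]
  have hc : ContinuousAt (fun x : E3 => ‖x‖ ^ 2) u := by fun_prop
  have he : scaleZ ε ∘ coreMap =ᶠ[𝓝 u] ((1 / 4 : ℝ) • scaleZ ε : E3 →L[ℝ] E3) := by
    filter_upwards [hc.eventually_lt continuousAt_const hu] with x hx
    simp [coreMap_eq_smul hx.le]
  rw [pb_coreChart B hε hR hf hu1, he.fderiv_eq, ContinuousLinearMap.fderiv,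
    coreMap_eq_smul hu.le]
  ext v
  simp only [mem_ofPred_eq]
  have : stdForm (scaleZ ε ((1 / 4 : ℝ) • u)) (((1 / 4 : ℝ) • scaleZ ε : E3 →L[ℝ] E3) v) =
      inner ℝ (coreVec ε u) v := by
    rw [inner_coords]
    simp [stdForm, coreVec, stdVec, stdE]
    ring
  rw [this]

variable [IsManifold (𝓡 3) ∞ Y] [T2Space Y]

/-- A loop in the obstruction class of a Darboux ball: the boundary of the disc of rotations inside
the ball, which is supported in a collar of the ball. -/
theorem exists_core_disc {ε : ℝ} (hε : ε = 1 ∨ ε = -1) {R R' α β : ℝ} (hRR : R ^ 2 ≤ R')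
    (hα : 1 < α) (hαβ : α < β) (hβ : β < R) (hf : ImmOn B.toFun {u | ‖u‖ ^ 2 ∈ Iio R'})
    (hfi : InjOn B.toFun {u | ‖u‖ ^ 2 ∈ Iio R'}) :
    ∃ γ : Path (baseCB B) (baseCB B),
      IsObstructionClass B (FundamentalGroup.fromPath (Path.Homotopic.Quotient.mk γ)) ∧
      (∀ φ u, ‖u‖ ^ 2 < R → pb (coreChart B.toFun ε) (γ φ).1.1.pos u =
        fderiv ℝ (twist fun s => qrot (discQ (1 * cutoff α β s) φ)) u ⁻¹'
          pb (coreChart B.toFun ε) ξ.pos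
            (twist (fun s => qrot (discQ (1 * cutoff α β s) φ)) u)) ∧
      ∀ φ, ∀ y ∉ coreChart B.toFun ε '' {u | ‖u‖ ^ 2 ≤ β}, (γ φ).1.1.pos y = ξ.pos y := by
  have hR : 1 < R := by linarith
  have hR' : 1 < R' := by nlinarith
  have hN := immOn_coreChart hε hR hRR hf
  have hinj := injOn_coreChart hε hR hRR hfi
  obtain ⟨D, hD, hD', hD0⟩ := exists_twisted_disc (a := -1) (b := β) (χ := cutoff α β) hN hinj
    isOpen_Iio (fun s _ hs => hs.2.trans_lt hβ) (contDiff_cutoff α β).contDiffOn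
    (fun s _ h0 hs => cutoff_eq_zero hαβ (by
      by_contra h
      exact hs ⟨by linarith, (not_le.1 h).le⟩)) ξ
  have hsupp : ∀ x, ∀ y ∉ coreChart B.toFun ε '' {u | ‖u‖ ^ 2 ≤ β}, (D x).pos y = ξ.pos y := by
    refine fun x y hy => hD' x y fun h => hy ?_
    obtain ⟨u, hu, rfl⟩ := h
    exact ⟨u, hu.2, rfl⟩
  have hD1 : ∀ φ, ∀ p ∈ B.image, (D (1, φ)).pos p = ξ.pos p := by
    intro φ p hp
    -- inside the ball, the twist is by rotations about the `z`-axis, under which `ξ` is invariant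
    by_cases hps : p ∈ coreChart B.toFun ε '' {u | ‖u‖ ^ 2 ≤ β}
    · obtain ⟨u, hu, rfl⟩ := hps
      obtain ⟨v, hv, hvu⟩ := hp
      have huR : ‖u‖ ^ 2 ∈ Iio R := lt_of_le_of_lt hu hβ
      have hv1 : ‖v‖ ≤ 1 := by simpa using hv
      have hvu' : v = scaleZ ε (coreMap u) :=
        hfi (lt_of_le_of_lt (pow_le_one₀ (norm_nonneg _) hv1) hR')
          (norm_sq_scaleZ_coreMap_lt hε hR hRR huR) hvu
      have hu1 : ‖u‖ ≤ 1 := by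
        rw [hvu', norm_scaleZ hε] at hv1
        exact norm_coreMap_le_one_iff.1 hv1
      refine hN.field_eq_of_pb_eq huR (pb_twisted_one (hD (1, φ) u huR) ?_
        fun c s h => pb_coreChart_rotZ B hε hR' hf hu1 h)
      filter_upwards [Iio_mem_nhds (lt_of_le_of_lt (pow_le_one₀ (norm_nonneg _) hu1) hα)] with s hs
      exact cutoff_eq_one hαβ hs.le
    · exact hsupp _ _ hps
  have h0 : coreChart B.toFun ε 0 = B.center := by
    simp [coreChart, coreMap_eq_smul, DarbouxBall.center]
  obtain ⟨γ, hγ, ho⟩ := exists_obstruction_path B (N := coreChart B.toFun ε) (χ := cutoff α β)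
    (u₁ := 0) (U := {u | ‖u‖ ^ 2 < 1 / 4}) (V := coreVec ε) (ε := ε) hN hD hD0 hD1
    (by simp; linarith) (by
      filter_upwards [Iio_mem_nhds (show ‖(0 : E3)‖ ^ 2 < α by simp; linarith)] with s hs
      exact cutoff_eq_one hαβ hs.le) h0
    (isOpen_lt (by fun_prop) continuous_const)
    (fun u hu => by
      rw [norm_zero, norm_eq_zero] at hu
      rw [hu]; norm_num)
    (contDiff_coreVec ε).contDiffOn (fun u hu => pb_coreChart_zero B hε hR' hf hu) hε
    (volV_coreVec hε)
    (fun u hu s hs h => by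
      rw [norm_zero, norm_eq_zero] at hu
      have h2 := congrArg (fun v : E3 => v 2) h
      rw [hu] at h2
      simp [coreVec, stdVec, stdE] at h2
      rcases hε with rfl | rfl <;> linarith [hs.1, hs.2])
    (fun c s h => by
      rw [map_zero]
      apply E3_ext <;> simp [coreVec, stdVec, stdE])
  exact ⟨γ, ho, fun φ u hu => by rw [hγ]; exact hD (1, φ) u hu,
    fun φ y hy => by rw [hγ]; exact hsupp _ _ hy⟩

end Summand

/-! ### Polar coordinates -/

section Polar

theorem fact_finrank : Fact (Module.finrank ℝ E3 = 2 + 1) := ⟨by simp⟩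

open Classical in
/-- The direction of a nonzero vector. -/
def dir (u : E3) : S2 := if h : u = 0 then northPole else toSphere u h

theorem dir_coe {u : E3} (hu : u ≠ 0) : (dir u : E3) = ‖u‖⁻¹ • u := by
  rw [dir, dif_neg hu]; rfl

theorem norm_smul_dir (u : E3) : ‖u‖ • (dir u : E3) = u := by
  by_cases h : u = 0
  · rw [h, norm_zero, zero_smul]
  · rw [dir_coe h, smul_smul, mul_inv_cancel₀ (norm_ne_zero_iff.2 h), one_smul]

theorem dir_smul {r : ℝ} (hr : 0 < r) (w : S2) : dir (r • (w : E3)) = w := by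
  have hne : r • (w : E3) ≠ 0 := smul_ne_zero hr.ne' (sphere_ne_zero w)
  rw [dir, dif_neg hne]
  exact toSphere_eq_of_smul hne hr rfl

theorem contMDiffAt_dir {u : E3} (hu : u ≠ 0) : ContMDiffAt (𝓡 3) (𝓡 2) ∞ dir u := by
  have := fact_finrank
  have hr : 0 < ‖u‖ := norm_pos_iff.2 hu
  -- smoothness of maps to the sphere is available for maps defined on all of `ℝ³` only: extend the
  -- direction by means of a bump function
  let b : ContDiffBump u := ⟨‖u‖ / 2, ‖u‖, by linarith, by linarith⟩
  have hne : ∀ x, u + b x • (x - u) ≠ 0 := by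
    intro x h
    by_cases hx : x ∈ ball u ‖u‖
    · have h1 : ‖u‖ = b x * ‖x - u‖ := by
        rw [← norm_neg u, neg_eq_of_add_eq_zero_right h, norm_smul, Real.norm_of_nonneg b.nonneg]
      rw [mem_ball_iff_norm] at hx
      nlinarith [b.le_one (x := x), norm_nonneg (x - u)]
    · have h1 : b x = 0 := b.zero_of_le_dist (not_lt.1 hx)
      rw [h1, zero_smul, add_zero] at h
      exact hu h
  have hc : ContDiff ℝ ∞ fun x => u + b x • (x - u) :=
    contDiff_const.add (b.contDiff.smul (contDiff_id.sub contDiff_const))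
  have hF : ContDiff ℝ ∞ fun x => ‖u + b x • (x - u)‖⁻¹ • (u + b x • (x - u)) :=
    ((hc.norm ℝ hne).inv fun x => norm_ne_zero_iff.2 (hne x)).smul hc
  have h1 : ContMDiff (𝓡 3) (𝓡 2) ∞ (Set.codRestrict
      (fun x => ‖u + b x • (x - u)‖⁻¹ • (u + b x • (x - u))) (sphere (0 : E3) 1) fun x => by
        rw [mem_sphere_zero_iff_norm, norm_smul, norm_inv, norm_norm,
          inv_mul_cancel₀ (norm_ne_zero_iff.2 (hne x))]) :=
    ContMDiff.codRestrict_sphere hF.contMDiff _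
  refine h1.contMDiffAt.congr_of_eventuallyEq ?_
  filter_upwards [closedBall_mem_nhds u (half_pos hr), isOpen_ne.mem_nhds hu] with x hx hx0
  have h2 : u + b x • (x - u) = x := by
    rw [b.one_of_mem_closedBall hx, one_smul, add_sub_cancel]
  apply Subtype.ext
  rw [dir_coe hx0]
  simp only [val_codRestrict_apply, h2]

theorem hasFDerivAt_norm {u : E3} (hu : u ≠ 0) :
    HasFDerivAt (fun x : E3 => ‖x‖) (‖u‖⁻¹ • covec u) u := by
  have h1 : HasFDerivAt (fun x : E3 => ‖x‖ ^ 2) ((2 : ℝ) • innerSL ℝ u) u :=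
    (hasStrictFDerivAt_norm_sq u).hasFDerivAt.congr_fderiv (by ext v; simp)
  have hn : 0 < ‖u‖ := norm_pos_iff.2 hu
  have h2 := h1.sqrt (by positivity)
  simp only [Real.sqrt_sq (norm_nonneg _)] at h2
  refine h2.congr_fderiv ?_
  ext v
  simp [covec]
  field_simp

theorem hasFDerivAt_inv_norm {u : E3} (hu : u ≠ 0) :
    HasFDerivAt (fun x : E3 => ‖x‖⁻¹) (-(‖u‖⁻¹ ^ 3) • covec u) u := by
  have hn : ‖u‖ ≠ 0 := norm_ne_zero_iff.2 hu
  have h := (hasDerivAt_inv hn).comp_hasFDerivAt u (hasFDerivAt_norm hu)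
  refine HasFDerivAt.congr_fderiv h ?_
  rw [smul_smul]
  congr 1
  field_simp

theorem mfderiv_coe_dir {u : E3} (hu : u ≠ 0) (v : E3) :
    mfderiv (𝓡 2) 𝓘(ℝ, E3) (fun p : S2 => (p : E3)) (dir u) (mfderiv (𝓡 3) (𝓡 2) dir u v) =
      ‖u‖⁻¹ • v - (‖u‖⁻¹ ^ 3 * inner ℝ u v) • u := by
  have := fact_finrank
  have hn : ‖u‖ ≠ 0 := norm_ne_zero_iff.2 hu
  have hd := (contMDiffAt_dir hu).mdifferentiableAt (by simp)
  have h1 := mfderiv_comp u ((contMDiff_coe_sphere (E := E3) (n := 2) (m := 1)).mdifferentiableAt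
    (by simp)) hd
  have h2 : ((fun p : S2 => (p : E3)) ∘ dir) =ᶠ[𝓝 u] fun x => ‖x‖⁻¹ • x := by
    filter_upwards [isOpen_ne.mem_nhds hu] with x hx using dir_coe hx
  rw [h2.mfderiv_eq, mfderiv_eq_fderiv] at h1
  have h3 : HasFDerivAt (fun x : E3 => ‖x‖⁻¹ • x) _ u :=
    (hasFDerivAt_inv_norm hu).smul (hasFDerivAt_id u)
  rw [h3.fderiv] at h1
  have h4 := DFunLike.congr_fun h1 v
  have h5 : (‖u‖⁻¹ • ContinuousLinearMap.id ℝ E3 + (-‖u‖⁻¹ ^ 3 • covec u).smulRight u) v =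
      ‖u‖⁻¹ • v - (‖u‖⁻¹ ^ 3 * inner ℝ u v) • u := by
    simp [covec, sub_eq_add_neg]
  exact h4.symm.trans h5

end Polar

/-! ### The contact structure on the neck -/

section NeckForm

/-- The normal vector field of the contact structure of the handle, in the coordinates `(2 + t) w`
on the neck. -/
def neckVec (u : E3) : E3 :=
  stdVec u + (‖u‖ ^ 2 - 2 * ‖u‖ - 1) • stdE 2 + ((1 + 2 * ‖u‖⁻¹) * u 2) • u

theorem neckVec_coords (u : E3) : neckVec u 0 = -(1 / 2) * u 1 + (1 + 2 * ‖u‖⁻¹) * u 2 * u 0 ∧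
    neckVec u 1 = 1 / 2 * u 0 + (1 + 2 * ‖u‖⁻¹) * u 2 * u 1 ∧
    neckVec u 2 = ‖u‖ ^ 2 - 2 * ‖u‖ + (1 + 2 * ‖u‖⁻¹) * u 2 * u 2 := by
  simp [neckVec, stdVec, stdE]

theorem inner_neckVec {u : E3} (hu : u ≠ 0) (v : E3) :
    inner ℝ (neckVec u) v = ‖u‖ ^ 2 * liouvilleForm (dir u) (‖u‖ - 2)
      (‖u‖⁻¹ • v - (‖u‖⁻¹ ^ 3 * inner ℝ u v) • u) (‖u‖⁻¹ * inner ℝ u v) := by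
  have hn : ‖u‖ ≠ 0 := norm_ne_zero_iff.2 hu
  obtain ⟨h0, h1, h2⟩ := neckVec_coords u
  rw [inner_coords (neckVec u), h0, h1, h2, liouvilleForm, dir_coe hu]
  simp only [PiLp.smul_apply, PiLp.sub_apply, smul_eq_mul]
  have hi := inner_coords u v
  generalize hI : (inner ℝ u v : ℝ) = I at *
  generalize ‖u‖ = r at *
  field_simp
  linear_combination (-4 * r * u 2 - 2 * r ^ 2 * u 2) * hi

theorem neckVec_rotZ {c s : ℝ} (h : c ^ 2 + s ^ 2 = 1) (u : E3) :
    neckVec (rotZ c s u) = rotZ c s (neckVec u) := by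
  obtain ⟨h0, h1, h2⟩ := neckVec_coords u
  obtain ⟨k0, k1, k2⟩ := neckVec_coords (rotZ c s u)
  apply E3_ext
  all_goals
    simp only [k0, k1, k2, rotZ_zero, rotZ_one, rotZ_two, h0, h1, h2, norm_rotZ h]
    try ring

theorem contDiffOn_neckVec : ContDiffOn ℝ ∞ neckVec {0}ᶜ := by
  have hn : ContDiffOn ℝ ∞ (fun u : E3 => ‖u‖) {0}ᶜ := contDiffOn_id.norm ℝ fun u hu => hu
  have hi : ContDiffOn ℝ ∞ (fun u : E3 => ‖u‖⁻¹) {0}ᶜ :=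
    hn.inv fun u hu => norm_ne_zero_iff.2 hu
  have h2 : ContDiffOn ℝ ∞ (fun u : E3 => u 2) {0}ᶜ := by fun_prop
  exact (contDiff_stdVec.contDiffOn.add
    ((((hn.pow 2).sub (contDiffOn_const.mul hn)).sub contDiffOn_const).smul contDiffOn_const)).add
      (((contDiffOn_const.add (contDiffOn_const.mul hi)).mul h2).smul contDiffOn_id)

theorem volV_neckVec {u : E3} (hu : u ≠ 0) : 0 < volV (neckVec u) (fderiv ℝ neckVec u) := by
  have hr : 0 < ‖u‖ := norm_pos_iff.2 hu
  have hn := hasFDerivAt_norm hu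
  have h2 : HasFDerivAt (fun x : E3 => x 2) (EuclideanSpace.proj 2 : E3 →L[ℝ] ℝ) u :=
    (EuclideanSpace.proj 2 : E3 →L[ℝ] ℝ).hasFDerivAt
  have h := (((contDiff_stdVec.differentiable (by simp) u).hasFDerivAt).add
    ((((hn.pow 2).sub (hn.const_mul 2)).sub_const 1).smul_const (stdE 2))).add
      (((((hasFDerivAt_inv_norm hu).const_mul 2).const_add 1).mul h2).smul (hasFDerivAt_id u))
  have h' : HasFDerivAt neckVec _ u := h
  rw [h'.fderiv]
  obtain ⟨k0, k1, k2⟩ := neckVec_coords u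
  have hq := norm_sq_coords u
  have key : ∀ L : E3 →L[ℝ] E3, L = fderiv ℝ neckVec u → volV (neckVec u) L =
    1 / 2 * (u 0 ^ 2 + u 1 ^ 2) + 2 * u 2 ^ 2 := by
    rintro L rfl
    rw [h'.fderiv, volV, k0, k1, k2]
    simp [hasFDerivAt_stdVec_apply, covec, stdE, EuclideanSpace.inner_single_right]
    field_simp
    linear_combination (2 * ‖u‖ ^ 4 - 4 * ‖u‖ ^ 3) * hq
  rw [key _ h'.fderiv.symm]
  have : 0 < u 0 ^ 2 + u 1 ^ 2 + u 2 ^ 2 := by rw [← hq]; positivity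
  nlinarith [sq_nonneg (u 0), sq_nonneg (u 1), sq_nonneg (u 2)]

/-- The normal field `neckVec` of the neck is nowhere opposite to the `z`-axis: where its horizontal
part vanishes, its last component is positive. -/
theorem neckVec_ne {u : E3} (hu : u ≠ 0) {s : ℝ} (hs : s ∈ Icc (0 : ℝ) 1) :
    (1 - s) • neckVec u + s • stdVec 0 ≠ 0 := by
  intro h
  have hr : 0 < ‖u‖ := norm_pos_iff.2 hu
  obtain ⟨k0, k1, k2⟩ := neckVec_coords u
  have h0 := congrArg (fun v : E3 => v 0) h
  have h1 := congrArg (fun v : E3 => v 1) h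
  have h2 := congrArg (fun v : E3 => v 2) h
  simp only [PiLp.add_apply, PiLp.smul_apply, smul_eq_mul, k0, k1, k2, PiLp.zero_apply] at h0 h1 h2
  simp [stdVec] at h0 h1 h2
  have hq := norm_sq_coords u
  rcases hs.2.eq_or_lt with rfl | hs1
  · norm_num at h2
  · have hs0 : 1 - s ≠ 0 := by linarith
    have h3 : u 0 ^ 2 + u 1 ^ 2 = 0 := by
      linear_combination 2 * u 0 * h1.resolve_left hs0 - 2 * u 1 * h0.resolve_left hs0
    have h4 : u 2 * u 2 = ‖u‖ ^ 2 := by rw [hq]; linear_combination -h3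
    have h5 : ‖u‖ ^ 2 - 2 * ‖u‖ + (1 + 2 * ‖u‖⁻¹) * u 2 * u 2 = 2 * ‖u‖ ^ 2 := by
      rw [mul_assoc, h4]; field_simp; ring
    rw [h5] at h2
    have : 0 < (1 - s) * (2 * ‖u‖ ^ 2) := mul_pos (by linarith) (by positivity)
    linarith [hs.1]

end NeckForm

/-! ### Coordinates on the neck -/

section Shell

theorem norm_shellMap {ε : ℝ} (hε : ε = 1 ∨ ε = -1) {u : E3} (hu : u ≠ 0) :
    ‖shellMap ε u‖ = |‖u‖ - 2| := by
  rw [shellMap_eq_smul ε hu, norm_smul, norm_smul, norm_inv, norm_norm,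
    inv_mul_cancel₀ (norm_ne_zero_iff.2 hu), mul_one, Real.norm_eq_abs, abs_mul]
  rcases hε with rfl | rfl <;> simp

/-- The points at distance less than `√R` from the sphere of radius `2`, on the side given by
`ε`. -/
def shell (ε R : ℝ) : Set E3 := {u | u ≠ 0 ∧ 0 < ε * (‖u‖ - 2) ∧ (‖u‖ - 2) ^ 2 < R}

theorem isOpen_shell (ε R : ℝ) : IsOpen (shell ε R) :=
  isOpen_ne.inter (IsOpen.inter
    (isOpen_lt continuous_const (by fun_prop : Continuous fun u : E3 => ε * (‖u‖ - 2)))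
    (isOpen_lt (by fun_prop : Continuous fun u : E3 => (‖u‖ - 2) ^ 2) continuous_const))

variable {ε R R' : ℝ}

theorem shellMap_of_mem (hε : ε = 1 ∨ ε = -1) {u : E3} (hu : u ∈ shell ε R) :
    shellMap ε u ≠ 0 ∧ ‖shellMap ε u‖ = ε * (‖u‖ - 2) ∧ ‖shellMap ε u‖ ^ 2 ∈ Ioo 0 R := by
  obtain ⟨h0, h1, h2⟩ := hu
  have h3 : ‖shellMap ε u‖ = ε * (‖u‖ - 2) := by
    rw [shellMap_eq_smul ε h0, norm_smul, norm_smul, norm_inv, norm_norm,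
      inv_mul_cancel₀ (norm_ne_zero_iff.2 h0), mul_one, Real.norm_of_nonneg h1.le]
  refine ⟨norm_pos_iff.1 (by rw [h3]; exact h1), h3, by rw [h3]; positivity, ?_⟩
  rw [norm_shellMap hε h0, sq_abs]
  exact h2

theorem injOn_shellMap (hε : ε = 1 ∨ ε = -1) : InjOn (shellMap ε) (shell ε R) := by
  intro u hu v hv h
  have h1 := (shellMap_of_mem hε hu).2.1
  have h2 := (shellMap_of_mem hε hv).2.1
  rw [h, h2] at h1
  have hε0 : ε ≠ 0 := by rcases hε with rfl | rfl <;> norm_num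
  have h3 : ‖u‖ = ‖v‖ := by linarith [mul_left_cancel₀ hε0 h1]
  rw [shellMap_eq_smul ε hu.1, shellMap_eq_smul ε hv.1, h3] at h
  have h4 : ε * (‖v‖ - 2) ≠ 0 := hv.2.1.ne'
  have h5 : ‖v‖⁻¹ ≠ 0 := inv_ne_zero (norm_ne_zero_iff.2 hv.1)
  exact smul_right_injective _ h5 (smul_right_injective _ h4 h)

theorem handleMap_ne_zero {v : E3} (hv : v ≠ 0) : handleMap v ≠ 0 := by
  have hn := norm_pos_iff.2 hv
  have h := handleMap_smul (w := (dir v : E3)) (by simp) hn.ne'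
  rw [abs_of_pos hn, norm_smul_dir] at h
  rw [h]
  exact handlePoint_ne_zero (by simp) hn.ne'

theorem handleMap_rotZ {c s : ℝ} (h : c ^ 2 + s ^ 2 = 1) (u : E3) :
    handleMap (rotZ c s u) = rotZ c s (handleMap u) := radialMap_rotZ _ _ h u

theorem contDiffAt_handleMap {u : E3} (hu : u ≠ 0) : ContDiffAt ℝ ∞ handleMap u := by
  have h := contDiffOn_radialMap isProfile_handle_fst.contDiffOn isProfile_handle_snd.contDiffOn
  refine h.contDiffAt (IsOpen.mem_nhds (isOpen_Ioi.preimage (by fun_prop)) ?_)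
  change 0 < ‖u‖ ^ 2
  have := norm_pos_iff.2 hu
  positivity

theorem contDiffAt_shellMap {u : E3} (hu : u ≠ 0) : ContDiffAt ℝ ∞ (shellMap ε) u := by
  refine (contDiffOn_shellMap ε).contDiffAt
    (IsOpen.mem_nhds (isOpen_Ioi.preimage (by fun_prop)) ?_)
  change 0 < ‖u‖ ^ 2
  have := norm_pos_iff.2 hu
  positivity

theorem shellMap_rotZ {c s : ℝ} (h : c ^ 2 + s ^ 2 = 1) (u : E3) :
    shellMap ε (rotZ c s u) = rotZ c s (shellMap ε u) := radialMap_rotZ _ _ h u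

/-- The coordinates around a Darboux ball without its centre that are given by the flow on the
handle and by the identification of spheres of radius `2 ± t` with spheres of radius `t`. -/
def shellMap' (ε : ℝ) : E3 → E3 := scaleZ ε ∘ handleMap ∘ shellMap ε

theorem shellMap'_rotZ {c s : ℝ} (h : c ^ 2 + s ^ 2 = 1) (u : E3) :
    shellMap' ε (rotZ c s u) = rotZ c s (shellMap' ε u) := by
  simp only [shellMap', Function.comp_apply, shellMap_rotZ h, handleMap_rotZ h, scaleZ_rotZ]

theorem shellMap'_of_mem (hε : ε = 1 ∨ ε = -1) (hR : 1 < R) (hRR : R ^ 2 ≤ R') {u : E3}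
    (hu : u ∈ shell ε R) : shellMap' ε u ≠ 0 ∧ ‖shellMap' ε u‖ ^ 2 ∈ Iio R' := by
  obtain ⟨h0, -, h1⟩ := shellMap_of_mem hε hu
  have h2 : ‖shellMap' ε u‖ = ‖handleMap (shellMap ε u)‖ := norm_scaleZ hε _
  refine ⟨norm_pos_iff.1 (by rw [h2]; exact norm_pos_iff.2 (handleMap_ne_zero h0)), ?_⟩
  rw [h2]
  exact (norm_sq_handleMap_lt hR h0 h1.2).trans_le hRR

theorem injOn_shellMap' (hε : ε = 1 ∨ ε = -1) : InjOn (shellMap' ε) (shell ε R) := by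
  intro u hu v hv h
  refine injOn_shellMap hε hu hv ?_
  have h1 := injective_of_norm_eq (norm_scaleZ hε) h
  exact isProfile_handle_fst.injOn isProfile_handle_snd (shellMap_of_mem hε hu).2.2.1
    (shellMap_of_mem hε hv).2.2.1 h1

theorem shellMap'_eq (hε : ε = 1 ∨ ε = -1) {u : E3} (hu : u ∈ shell ε R) :
    shellMap' ε u = scaleZ ε (handlePoint (dir u) (‖u‖ - 2)) := by
  obtain ⟨h0, h1, h2⟩ := hu
  have e : shellMap ε u = |‖u‖ - 2| • (dir u : E3) := by
    rw [shellMap_eq_smul ε h0, dir_coe h0]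
    congr 1
    rcases hε with rfl | rfl
    · rw [abs_of_pos (by linarith), one_mul]
    · rw [abs_of_neg (by linarith)]; ring
  have h3 : ‖u‖ - 2 ≠ 0 := fun h => by rw [h, mul_zero] at h1; exact lt_irrefl _ h1
  simp only [shellMap', Function.comp_apply, e, handleMap_smul (w := (dir u : E3)) (by simp) h3]

theorem contDiffAt_shellMap' (hε : ε = 1 ∨ ε = -1) {u : E3} (hu : u ∈ shell ε R) :
    ContDiffAt ℝ ∞ (shellMap' ε) u :=
  (scaleZ ε).contDiff.contDiffAt.comp u
    ((contDiffAt_handleMap (shellMap_of_mem hε hu).1).comp u (contDiffAt_shellMap hu.1))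

/-- Inside the unit ball, the distance to the sphere of radius `2` is at most `1`. -/
theorem norm_shellMap'_le_one_iff (hε : ε = 1 ∨ ε = -1) {u : E3} (hu : u ∈ shell ε R) :
    ‖shellMap' ε u‖ ≤ 1 ↔ ε * (‖u‖ - 2) ≤ 1 := by
  obtain ⟨h0, h1, -⟩ := shellMap_of_mem hε hu
  have h2 : ‖shellMap' ε u‖ = ‖handleMap (shellMap ε u)‖ := norm_scaleZ hε _
  rw [h2, ← h1]
  refine ⟨fun h => ?_, norm_handleMap_le h0⟩
  by_contra h3
  exact absurd h (not_le.2 (one_lt_norm_handleMap (not_le.1 h3)))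

variable {Y : Type*} [TopologicalSpace Y] [ChartedSpace E3 Y]

theorem ImmOn.of_local {ψ : E3 → Y} {U : Set E3} (hU : IsOpen U)
    (h : ∀ u ∈ U, ∃ V, u ∈ V ∧ ImmOn ψ V) : ImmOn ψ U := by
  refine ⟨hU, fun u hu => ?_, fun u hu => ?_⟩
  · obtain ⟨V, huV, hV⟩ := h u hu
    exact (hV.contMDiffAt huV).contMDiffWithinAt
  · obtain ⟨V, huV, hV⟩ := h u hu
    exact hV.injective u huV

theorem immOn_comp_shellMap' {f : E3 → Y} (hε : ε = 1 ∨ ε = -1) (hR : 1 < R) (hRR : R ^ 2 ≤ R')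
    (hf : ImmOn f {u | ‖u‖ ^ 2 ∈ Iio R'}) : ImmOn (f ∘ shellMap' ε) (shell ε R) := by
  have hε0 : ε ≠ 0 := by rcases hε with rfl | rfl <;> norm_num
  refine hf.comp (isOpen_shell ε R) (fun u hu => (contDiffAt_shellMap' hε hu).contDiffWithinAt)
    (fun u hu => ?_) fun u hu => (shellMap'_of_mem hε hR hRR hu).2
  obtain ⟨h0, -, h1⟩ := shellMap_of_mem hε hu
  have e1 : HasFDerivAt (shellMap ε) _ u :=
    ((contDiffAt_shellMap hu.1).differentiableAt (by simp)).hasFDerivAt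
  have e2 : HasFDerivAt handleMap _ (shellMap ε u) :=
    ((contDiffAt_handleMap h0).differentiableAt (by simp)).hasFDerivAt
  have e3 : HasFDerivAt (shellMap' ε) _ u :=
    (scaleZ ε).hasFDerivAt.comp u (e2.comp u e1)
  rw [e3.fderiv]
  have i2 : Function.Injective (fderiv ℝ handleMap (shellMap ε u)) :=
    isProfile_handle_fst.injective_fderiv isProfile_handle_snd h1.1
  have i1 := injective_fderiv_shellMap hε0 hu.1 fun h => by
    have := hu.2.1
    rw [h, sub_self, mul_zero] at this
    exact lt_irrefl _ this
  exact (injective_of_norm_eq (norm_scaleZ hε)).comp (i2.comp i1)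

end Shell

section NeckChart

variable {Ym Yp Y : Type*} [TopologicalSpace Ym] [ChartedSpace E3 Ym]
  [TopologicalSpace Yp] [ChartedSpace E3 Yp] [TopologicalSpace Y] [ChartedSpace E3 Y]
  {ξm : ContactStructure Ym} {Bm : DarbouxBall ξm}
  {ξp : ContactStructure Yp} {Bp : DarbouxBall ξp} {ξ : ContactStructure Y}

namespace ContactConnectedSum

open Classical in
/-- The neck and collars of the two summands in polar coordinates, with the sphere `{t = 0}` of the
neck at distance `2` from the origin. -/
def neckChart (S : ContactConnectedSum ξm Bm ξp Bp ξ) (u : E3) : Y :=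
  if ‖u‖ = 2 then S.neck (dir u, 0)
  else if 2 < ‖u‖ then S.inr (Bp.toFun (shellMap' 1 u)) else S.inl (Bm.toFun (shellMap' (-1) u))

variable (S : ContactConnectedSum ξm Bm ξp Bp ξ)

theorem neckChart_of_eq {u : E3} (hu : ‖u‖ = 2) : S.neckChart u = S.neck (dir u, 0) :=
  if_pos hu

theorem neckChart_of_gt {u : E3} (hu : 2 < ‖u‖) :
    S.neckChart u = S.inr (Bp.toFun (shellMap' 1 u)) := by
  rw [neckChart, if_neg hu.ne', if_pos hu]

theorem neckChart_of_lt {u : E3} (hu : ‖u‖ < 2) :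
    S.neckChart u = S.inl (Bm.toFun (shellMap' (-1) u)) := by
  rw [neckChart, if_neg hu.ne, if_neg hu.not_gt]

/-- The part of the neck where `t` is between `-1` and `1`. -/
def neckDom : Set E3 := {u | |‖u‖ - 2| < 1}

theorem isOpen_neckDom : IsOpen neckDom := isOpen_lt (by fun_prop) continuous_const

theorem ne_zero_of_mem_neckDom {u : E3} (hu : u ∈ neckDom) : u ≠ 0 := by
  rintro rfl
  have : |‖(0 : E3)‖ - 2| < 1 := hu
  norm_num at this

theorem mem_shell_one {R : ℝ} {u : E3} (h : 2 < ‖u‖) (hR : (‖u‖ - 2) ^ 2 < R) :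
    u ∈ shell 1 R :=
  ⟨fun h0 => by rw [h0, norm_zero] at h; linarith, by linarith, hR⟩

theorem mem_shell_neg_one {R : ℝ} {u : E3} (h0 : u ≠ 0) (h : ‖u‖ < 2) (hR : (‖u‖ - 2) ^ 2 < R) :
    u ∈ shell (-1) R := ⟨h0, by linarith, hR⟩

theorem neckChart_eq_neck {u : E3} (hu : u ∈ neckDom) :
    S.neckChart u = S.neck (dir u, ‖u‖ - 2) := by
  have hu' := abs_lt.1 (show |‖u‖ - 2| < 1 from hu)
  have h0 := ne_zero_of_mem_neckDom hu
  have hR : (‖u‖ - 2) ^ 2 < 1 := by rw [← sq_abs]; exact pow_lt_one₀ (abs_nonneg _) hu two_ne_zero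
  rcases lt_trichotomy ‖u‖ 2 with h | h | h
  · rw [S.neckChart_of_lt h, S.neck_neg _ _ ⟨hu'.1, by linarith⟩,
      shellMap'_eq (Or.inr rfl) (mem_shell_neg_one h0 h hR), scaleZ_of_neg_one]
  · rw [S.neckChart_of_eq h, h, sub_self]
  · rw [S.neckChart_of_gt h, S.neck_pos _ _ ⟨by linarith, hu'.2⟩,
      shellMap'_eq (Or.inl rfl) (mem_shell_one h hR), scaleZ_of_one]

theorem contMDiffAt_polar {u : E3} (hu : u ≠ 0) :
    ContMDiffAt (𝓡 3) ((𝓡 2).prod 𝓘(ℝ, ℝ)) ∞ (fun x => (dir x, ‖x‖ - 2)) u :=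
  (contMDiffAt_dir hu).prodMk ((contDiffAt_id.norm ℝ hu).sub contDiffAt_const).contMDiffAt

theorem mfderiv_polar {u : E3} (hu : u ≠ 0) (v : E3) :
    mfderiv (𝓡 3) ((𝓡 2).prod 𝓘(ℝ, ℝ)) (fun x => (dir x, ‖x‖ - 2)) u v =
      (mfderiv (𝓡 3) (𝓡 2) dir u v, ‖u‖⁻¹ * inner ℝ u v) := by
  have h2 : HasFDerivAt (fun x : E3 => ‖x‖ - 2) _ u := (hasFDerivAt_norm hu).sub_const 2
  rw [mfderiv_prodMk ((contMDiffAt_dir hu).mdifferentiableAt (by simp))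
    h2.differentiableAt.mdifferentiableAt, mfderiv_eq_fderiv, h2.fderiv]
  rfl

theorem neckChart_eventuallyEq {u : E3} (hu : u ∈ neckDom) :
    S.neckChart =ᶠ[𝓝 u] S.neck ∘ fun x => (dir x, ‖x‖ - 2) :=
  Filter.eventually_of_mem (isOpen_neckDom.mem_nhds hu) fun _ hx => S.neckChart_eq_neck hx

theorem mem_Ioo_of_mem_neckDom {u : E3} (hu : u ∈ neckDom) :
    (dir u, ‖u‖ - 2) ∈ (univ ×ˢ Ioo (-1) 1 : Set (S2 × ℝ)) := ⟨mem_univ _, abs_lt.1 hu⟩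

theorem mfderiv_neckChart {u : E3} (hu : u ∈ neckDom) (v : E3) :
    mfderiv (𝓡 3) (𝓡 3) S.neckChart u v =
      mfderiv ((𝓡 2).prod 𝓘(ℝ, ℝ)) (𝓡 3) S.neck (dir u, ‖u‖ - 2)
        (mfderiv (𝓡 3) (𝓡 2) dir u v, ‖u‖⁻¹ * inner ℝ u v) := by
  have h0 := ne_zero_of_mem_neckDom hu
  rw [(S.neckChart_eventuallyEq hu).mfderiv_eq, mfderiv_comp u
    ((S.neck_diffeo ⟨_, mem_Ioo_of_mem_neckDom hu⟩).mdifferentiableAt (by simp))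
    ((contMDiffAt_polar h0).mdifferentiableAt (by simp))]
  exact congrArg _ (mfderiv_polar h0 v)

theorem immOn_neckChart_neckDom : ImmOn S.neckChart neckDom := by
  refine ⟨isOpen_neckDom, fun u hu => ?_, fun u hu => ?_⟩
  · refine ContMDiffAt.contMDiffWithinAt (ContMDiffAt.congr_of_eventuallyEq ?_
      (S.neckChart_eventuallyEq hu))
    exact ContMDiffAt.comp u (S.neck_diffeo ⟨_, mem_Ioo_of_mem_neckDom hu⟩).contMDiffAt
      (contMDiffAt_polar (ne_zero_of_mem_neckDom hu))
  · have h0 := ne_zero_of_mem_neckDom hu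
    have hinj : Function.Injective
        (mfderiv ((𝓡 2).prod 𝓘(ℝ, ℝ)) (𝓡 3) S.neck (dir u, ‖u‖ - 2)) := by
      have := IsLocalDiffeomorphAt.mfderivToContinuousLinearEquiv_coe
        (S.neck_diffeo ⟨_, mem_Ioo_of_mem_neckDom hu⟩) (by simp)
      rw [← this]
      exact ContinuousLinearEquiv.injective _
    have key : ∀ v : E3, mfderiv (𝓡 3) (𝓡 3) S.neckChart u v = 0 → v = 0 := by
      intro v hv
      rw [S.mfderiv_neckChart hu] at hv
      have h1 := hinj (hv.trans (map_zero _).symm)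
      have h2 : mfderiv (𝓡 3) (𝓡 2) dir u v = 0 := congrArg Prod.fst h1
      have h3 : ‖u‖⁻¹ * inner ℝ u v = 0 := congrArg Prod.snd h1
      have h4 := mfderiv_coe_dir h0 v
      rw [h2, map_zero] at h4
      have hn := inv_ne_zero (norm_ne_zero_iff.2 h0)
      rw [(mul_eq_zero.1 h3).resolve_left hn, mul_zero, zero_smul, sub_zero] at h4
      exact (smul_eq_zero.1 h4.symm).resolve_left hn
    intro v w hvw
    have := key (v - w) (by
      refine (map_sub (mfderiv (𝓡 3) (𝓡 3) S.neckChart u) v w).trans ?_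
      rw [hvw, sub_self])
    exact sub_eq_zero.1 this

theorem pb_neckChart {u : E3} (hu : u ∈ neckDom) :
    pb S.neckChart ξ.pos u = {v | 0 < inner ℝ (neckVec u) v} := by
  have h0 := ne_zero_of_mem_neckDom hu
  have hn : 0 < ‖u‖ ^ 2 := by have := norm_pos_iff.2 h0; positivity
  ext v
  have h1 := S.neck_contact (dir u) (‖u‖ - 2) (abs_lt.1 hu) (mfderiv (𝓡 3) (𝓡 2) dir u v)
    (‖u‖⁻¹ * inner ℝ u v)
  rw [mfderiv_coe_dir h0] at h1
  rw [mem_ofPred_eq, inner_neckVec h0, mul_pos_iff_of_pos_left hn]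
  refine Iff.trans (Eq.to_iff ?_) h1
  exact mem_congr_point ξ.pos (S.neckChart_eq_neck hu) (S.mfderiv_neckChart hu v)

end ContactConnectedSum

end NeckChart

section

section NeckDisc

variable {Y : Type*} [TopologicalSpace Y] [ChartedSpace E3 Y] {ξ : ContactStructure Y}

theorem DarbouxBall.shellMap'_ne_center (B : DarbouxBall ξ) {ε R R' : ℝ} (hε : ε = 1 ∨ ε = -1)
    (hR : 1 < R) (hRR : R ^ 2 ≤ R') (hi : InjOn B.toFun {u | ‖u‖ ^ 2 ∈ Iio R'}) {u : E3}
    (hu : u ∈ shell ε R) : B.toFun (shellMap' ε u) ≠ B.center := by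
  obtain ⟨h0, h1⟩ := shellMap'_of_mem hε hR hRR hu
  have h2 : (0 : E3) ∈ {u : E3 | ‖u‖ ^ 2 ∈ Iio R'} := zero_mem_Iio (by nlinarith)
  exact fun h => h0 (hi h1 h2 h)

/-- In the coordinates `shellMap'`, the contact structure is invariant under rotations about the
`z`-axis. -/
theorem DarbouxBall.pb_shellMap'_rotZ (B : DarbouxBall ξ) {ε R R' : ℝ} (hε : ε = 1 ∨ ε = -1)
    (hR : 1 < R) (hRR : R ^ 2 ≤ R') (hf : ImmOn B.toFun {u | ‖u‖ ^ 2 ∈ Iio R'}) {u : E3}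
    (hu : u ∈ shell ε R) (hu1 : ε * (‖u‖ - 2) ≤ 1) {c s : ℝ} (h : c ^ 2 + s ^ 2 = 1) :
    rotZ c s ⁻¹' pb (B.toFun ∘ shellMap' ε) ξ.pos (rotZ c s u) =
      pb (B.toFun ∘ shellMap' ε) ξ.pos u := by
  have hn : ∀ x ∈ shell ε R, ε * (‖x‖ - 2) ≤ 1 → pb (B.toFun ∘ shellMap' ε) ξ.pos x =
      {v | 0 < stdForm (shellMap' ε x) (fderiv ℝ (shellMap' ε) x v)} := by
    intro x hx hx1
    have hx' : shellMap' ε x ∈ closedBall (0 : E3) 1 := by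
      simpa using (norm_shellMap'_le_one_iff hε hx).2 hx1
    rw [pb_comp (hf.mdifferentiableAt (shellMap'_of_mem hε hR hRR hx).2)
      ((contDiffAt_shellMap' hε hx).differentiableAt (by simp)), B.pb_eq hx']
    rfl
  have hr : ‖rotZ c s u‖ = ‖u‖ := norm_rotZ h u
  have hu' : rotZ c s u ∈ shell ε R := by
    refine ⟨norm_ne_zero_iff.1 ?_, ?_, ?_⟩
    · rw [hr]; exact norm_ne_zero_iff.2 hu.1
    · rw [hr]; exact hu.2.1
    · rw [hr]; exact hu.2.2
  rw [hn u hu hu1, hn _ hu' (by rwa [hr])]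
  ext v
  simp only [mem_preimage, mem_ofPred_eq]
  rw [stdForm_fderiv_rotZ h ((contDiffAt_shellMap' hε hu).differentiableAt (by simp))
    ((contDiffAt_shellMap' hε hu').differentiableAt (by simp)) (shellMap'_rotZ h) v]

end NeckDisc

/-- The squares of the radii in the domain of the chart `neckChart`. -/
def neckJ (R : ℝ) : Set ℝ := {s | (√s - 2) ^ 2 < R}

theorem isOpen_neckJ (R : ℝ) : IsOpen (neckJ R) :=
  isOpen_lt (by fun_prop) continuous_const

theorem norm_sq_mem_neckJ {R : ℝ} {u : E3} : ‖u‖ ^ 2 ∈ neckJ R ↔ (‖u‖ - 2) ^ 2 < R := by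
  rw [neckJ, mem_ofPred_eq, Real.sqrt_sq (norm_nonneg u)]

theorem pos_of_mem_neckJ {R s : ℝ} (hR : R ≤ 4) (hs : s ∈ neckJ R) : 0 < s := by
  by_contra h
  have h1 : (√s - 2) ^ 2 < R := hs
  rw [Real.sqrt_eq_zero_of_nonpos (not_lt.1 h)] at h1
  linarith

theorem ne_zero_of_mem_neckJ {R : ℝ} {u : E3} (hR : R ≤ 4) (hu : ‖u‖ ^ 2 ∈ neckJ R) : u ≠ 0 := by
  rintro rfl
  have := pos_of_mem_neckJ hR hu
  simp at this

variable {Ym Yp Y : Type*} [TopologicalSpace Ym] [ChartedSpace E3 Ym]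
  [TopologicalSpace Yp] [ChartedSpace E3 Yp] [TopologicalSpace Y] [ChartedSpace E3 Y]
  {ξm : ContactStructure Ym} {Bm : DarbouxBall ξm}
  {ξp : ContactStructure Yp} {Bp : DarbouxBall ξp} {ξ : ContactStructure Y}
  {R Rm Rp : ℝ}

namespace ContactConnectedSum

variable (S : ContactConnectedSum ξm Bm ξp Bp ξ)

theorem neckChart_eventuallyEq_inr {u : E3} (hu : u ∈ shell 1 R) :
    S.neckChart =ᶠ[𝓝 u] S.inr ∘ (Bp.toFun ∘ shellMap' 1) := by
  filter_upwards [(isOpen_shell 1 R).mem_nhds hu] with x hx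
  exact S.neckChart_of_gt (by linarith [hx.2.1])

theorem neckChart_eventuallyEq_inl {u : E3} (hu : u ∈ shell (-1) R) :
    S.neckChart =ᶠ[𝓝 u] S.inl ∘ (Bm.toFun ∘ shellMap' (-1)) := by
  filter_upwards [(isOpen_shell (-1) R).mem_nhds hu] with x hx
  exact S.neckChart_of_lt (by linarith [hx.2.1])

theorem mem_neckDom_of_eq {u : E3} (h : ‖u‖ = 2) : u ∈ neckDom := by
  change |‖u‖ - 2| < 1
  rw [h]; norm_num

theorem immOn_neckChart (hR : 1 < R) (hR4 : R ≤ 4) (hm : R ^ 2 ≤ Rm) (hp : R ^ 2 ≤ Rp)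
    (hfm : ImmOn Bm.toFun {u | ‖u‖ ^ 2 ∈ Iio Rm}) (him : InjOn Bm.toFun {u | ‖u‖ ^ 2 ∈ Iio Rm})
    (hfp : ImmOn Bp.toFun {u | ‖u‖ ^ 2 ∈ Iio Rp}) (hip : InjOn Bp.toFun {u | ‖u‖ ^ 2 ∈ Iio Rp}) :
    ImmOn S.neckChart {u | ‖u‖ ^ 2 ∈ neckJ R} := by
  refine ImmOn.of_local ((isOpen_neckJ R).preimage (by fun_prop)) fun u hu => ?_
  have h0 := ne_zero_of_mem_neckJ hR4 hu
  have hu' := norm_sq_mem_neckJ.1 hu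
  rcases lt_trichotomy ‖u‖ 2 with h | h | h
  · refine ⟨shell (-1) R, mem_shell_neg_one h0 h hu', ImmOn.congr (S.inl_emb.immOn_comp
      (immOn_comp_shellMap' (Or.inr rfl) hR hm hfm) fun x hx =>
        Bm.shellMap'_ne_center (Or.inr rfl) hR hm him hx) fun x hx => ?_⟩
    exact S.neckChart_of_lt (by linarith [hx.2.1])
  · exact ⟨neckDom, mem_neckDom_of_eq h, S.immOn_neckChart_neckDom⟩
  · refine ⟨shell 1 R, mem_shell_one h hu', ImmOn.congr (S.inr_emb.immOn_comp
      (immOn_comp_shellMap' (Or.inl rfl) hR hp hfp) fun x hx =>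
        Bp.shellMap'_ne_center (Or.inl rfl) hR hp hip hx) fun x hx => ?_⟩
    exact S.neckChart_of_gt (by linarith [hx.2.1])

theorem injOn_neckChart (hR : 1 < R) (hR4 : R ≤ 4) (hm : R ^ 2 ≤ Rm) (hp : R ^ 2 ≤ Rp)
    (him : InjOn Bm.toFun {u | ‖u‖ ^ 2 ∈ Iio Rm}) (hip : InjOn Bp.toFun {u | ‖u‖ ^ 2 ∈ Iio Rp}) :
    InjOn S.neckChart {u | ‖u‖ ^ 2 ∈ neckJ R} := by
  have key : ∀ u v : E3, ‖u‖ ^ 2 ∈ neckJ R → ‖v‖ ^ 2 ∈ neckJ R → ‖u‖ ≤ ‖v‖ →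
      S.neckChart u = S.neckChart v → u = v := by
    intro u v hu hv huv h
    have hu0 := ne_zero_of_mem_neckJ hR4 hu
    have hv0 := ne_zero_of_mem_neckJ hR4 hv
    rw [norm_sq_mem_neckJ] at hu hv
    have cm : ∀ x : E3, x ≠ 0 → ‖x‖ < 2 → (‖x‖ - 2) ^ 2 < R →
        Bm.toFun (shellMap' (-1) x) ≠ Bm.center := fun x hx0 hx hxR =>
      Bm.shellMap'_ne_center (Or.inr rfl) hR hm him (mem_shell_neg_one hx0 hx hxR)
    have cp : ∀ x : E3, 2 < ‖x‖ → (‖x‖ - 2) ^ 2 < R →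
        Bp.toFun (shellMap' 1 x) ≠ Bp.center := fun x hx hxR =>
      Bp.shellMap'_ne_center (Or.inl rfl) hR hp hip (mem_shell_one hx hxR)
    -- the parts inside, on and outside of the sphere of radius `2` have disjoint images
    rcases lt_trichotomy ‖u‖ 2 with h1 | h1 | h1 <;> rcases lt_trichotomy ‖v‖ 2 with h2 | h2 | h2
    · rw [S.neckChart_of_lt h1, S.neckChart_of_lt h2] at h
      have hus := mem_shell_neg_one hu0 h1 hu
      have hvs := mem_shell_neg_one hv0 h2 hv
      exact injOn_shellMap' (Or.inr rfl) hus hvs (him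
        (shellMap'_of_mem (Or.inr rfl) hR hm hus).2 (shellMap'_of_mem (Or.inr rfl) hR hm hvs).2
        (S.inl_emb.injOn (cm u hu0 h1 hu) (cm v hv0 h2 hv) h))
    · rw [S.neckChart_of_lt h1, S.neckChart_of_eq h2] at h
      exact absurd h.symm (S.neck_ne_inl _ _ (cm u hu0 h1 hu))
    · rw [S.neckChart_of_lt h1, S.neckChart_of_gt h2] at h
      exact absurd h (S.inl_ne_inr _ (cm u hu0 h1 hu) _ (cp v h2 hv))
    · linarith
    · rw [S.neckChart_of_eq h1, S.neckChart_of_eq h2] at h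
      have h3 := S.neck_inj (show (dir u, (0 : ℝ)) ∈ _ from ⟨mem_univ _, by norm_num⟩)
        (show (dir v, (0 : ℝ)) ∈ _ from ⟨mem_univ _, by norm_num⟩) h
      have h4 : dir u = dir v := congrArg Prod.fst h3
      rw [← norm_smul_dir u, ← norm_smul_dir v, h4, h1, h2]
    · rw [S.neckChart_of_eq h1, S.neckChart_of_gt h2] at h
      exact absurd h (S.neck_ne_inr _ _ (cp v h2 hv))
    · linarith
    · linarith
    · rw [S.neckChart_of_gt h1, S.neckChart_of_gt h2] at h
      have hus := mem_shell_one h1 hu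
      have hvs := mem_shell_one h2 hv
      exact injOn_shellMap' (Or.inl rfl) hus hvs (hip
        (shellMap'_of_mem (Or.inl rfl) hR hp hus).2 (shellMap'_of_mem (Or.inl rfl) hR hp hvs).2
        (S.inr_emb.injOn (cp u h1 hu) (cp v h2 hv) h))
  intro u hu v hv h
  rcases le_total ‖u‖ ‖v‖ with h1 | h1
  · exact key u v hu hv h1 h
  · exact (key v u hv hu h1 h.symm).symm

theorem pb_neckChart_inr (hR : 1 < R) (hp : R ^ 2 ≤ Rp)
    (hfp : ImmOn Bp.toFun {u | ‖u‖ ^ 2 ∈ Iio Rp}) (hip : InjOn Bp.toFun {u | ‖u‖ ^ 2 ∈ Iio Rp})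
    {u : E3} (hu : u ∈ shell 1 R) :
    pb S.neckChart ξ.pos u = pb (Bp.toFun ∘ shellMap' 1) ξp.pos u := by
  rw [pb_congr (S.neckChart_eventuallyEq_inr hu)]
  exact S.inr_emb.pb_contact ((immOn_comp_shellMap' (Or.inl rfl) hR hp hfp).mdifferentiableAt hu)
    (Bp.shellMap'_ne_center (Or.inl rfl) hR hp hip hu)

theorem pb_neckChart_inl (hR : 1 < R) (hm : R ^ 2 ≤ Rm)
    (hfm : ImmOn Bm.toFun {u | ‖u‖ ^ 2 ∈ Iio Rm}) (him : InjOn Bm.toFun {u | ‖u‖ ^ 2 ∈ Iio Rm})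
    {u : E3} (hu : u ∈ shell (-1) R) :
    pb S.neckChart ξ.pos u = pb (Bm.toFun ∘ shellMap' (-1)) ξm.pos u := by
  rw [pb_congr (S.neckChart_eventuallyEq_inl hu)]
  exact S.inl_emb.pb_contact ((immOn_comp_shellMap' (Or.inr rfl) hR hm hfm).mdifferentiableAt hu)
    (Bm.shellMap'_ne_center (Or.inr rfl) hR hm him hu)

/-- In the coordinates `neckChart`, the contact structure on the closed neck is invariant under
rotations about the `z`-axis. -/
theorem pb_neckChart_rotZ (hR : 1 < R) (hR4 : R ≤ 4) (hm : R ^ 2 ≤ Rm) (hp : R ^ 2 ≤ Rp)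
    (hfm : ImmOn Bm.toFun {u | ‖u‖ ^ 2 ∈ Iio Rm}) (him : InjOn Bm.toFun {u | ‖u‖ ^ 2 ∈ Iio Rm})
    (hfp : ImmOn Bp.toFun {u | ‖u‖ ^ 2 ∈ Iio Rp}) (hip : InjOn Bp.toFun {u | ‖u‖ ^ 2 ∈ Iio Rp})
    {u : E3} (hu : |‖u‖ - 2| ≤ 1) {c s : ℝ} (h : c ^ 2 + s ^ 2 = 1) :
    rotZ c s ⁻¹' pb S.neckChart ξ.pos (rotZ c s u) = pb S.neckChart ξ.pos u := by
  have hr : ‖rotZ c s u‖ = ‖u‖ := norm_rotZ h u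
  have hu2 : (‖u‖ - 2) ^ 2 < R := by
    rw [← sq_abs]; exact lt_of_le_of_lt (pow_le_one₀ (abs_nonneg _) hu) hR
  have hu0 := ne_zero_of_mem_neckJ hR4 (norm_sq_mem_neckJ.2 hu2)
  have hu' := abs_le.1 hu
  rcases lt_trichotomy ‖u‖ 2 with h1 | h1 | h1
  · have hus := mem_shell_neg_one hu0 h1 hu2
    have hus' : rotZ c s u ∈ shell (-1) R := mem_shell_neg_one
      (norm_ne_zero_iff.1 (by rw [hr]; exact norm_ne_zero_iff.2 hu0)) (by rwa [hr]) (by rwa [hr])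
    rw [S.pb_neckChart_inl hR hm hfm him hus, S.pb_neckChart_inl hR hm hfm him hus',
      Bm.pb_shellMap'_rotZ (Or.inr rfl) hR hm hfm hus (by linarith) h]
  · have hus := mem_neckDom_of_eq h1
    have hus' : rotZ c s u ∈ neckDom := mem_neckDom_of_eq (by rwa [hr])
    rw [S.pb_neckChart hus, S.pb_neckChart hus', neckVec_rotZ h]
    ext v
    have e : inner ℝ (rotZ c s (neckVec u)) (rotZ c s v) = inner ℝ (neckVec u) v := by
      rw [inner_coords, inner_coords]
      simp only [rotZ_zero, rotZ_one, rotZ_two]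
      linear_combination (neckVec u 0 * v 0 + neckVec u 1 * v 1) * h
    simp only [mem_preimage, mem_ofPred_eq, e]
  · have hus := mem_shell_one h1 hu2
    have hus' : rotZ c s u ∈ shell 1 R := mem_shell_one (by rwa [hr]) (by rwa [hr])
    rw [S.pb_neckChart_inr hR hp hfp hip hus, S.pb_neckChart_inr hR hp hfp hip hus',
      Bp.pb_shellMap'_rotZ (Or.inl rfl) hR hp hfp hus (by linarith) h]

theorem abs_le_of_neckChart_mem (hR : 1 < R) (hR4 : R ≤ 4) (hm : R ^ 2 ≤ Rm) (hp : R ^ 2 ≤ Rp)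
    (him : InjOn Bm.toFun {u | ‖u‖ ^ 2 ∈ Iio Rm}) (hip : InjOn Bp.toFun {u | ‖u‖ ^ 2 ∈ Iio Rp})
    {u : E3} (hu : ‖u‖ ^ 2 ∈ neckJ R) (h : S.neckChart u ∈ S.neckRegion) : |‖u‖ - 2| ≤ 1 := by
  have hu0 := ne_zero_of_mem_neckJ hR4 hu
  rw [norm_sq_mem_neckJ] at hu
  have hR2 : 1 < R ^ 2 := by nlinarith
  have key : ∀ R' : ℝ, R ^ 2 ≤ R' → ∀ v : E3, ‖v‖ ≤ 1 → ‖v‖ ^ 2 ∈ Iio R' := fun R' hR' v hv =>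
    lt_of_le_of_lt (pow_le_one₀ (norm_nonneg _) hv) (hR2.trans_le hR')
  rcases lt_trichotomy ‖u‖ 2 with h1 | h1 | h1
  · have hus := mem_shell_neg_one hu0 h1 hu
    rw [S.neckChart_of_lt h1,
      S.inl_mem_neckRegion (Bm.shellMap'_ne_center (Or.inr rfl) hR hm him hus)] at h
    obtain ⟨v, hv, e⟩ := h
    have hv1 : ‖v‖ ≤ 1 := by simpa using hv
    rw [him (key Rm hm v hv1) (shellMap'_of_mem (Or.inr rfl) hR hm hus).2 e,
      norm_shellMap'_le_one_iff (Or.inr rfl) hus] at hv1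
    exact abs_le.2 ⟨by linarith, by linarith⟩
  · rw [h1]; norm_num
  · have hus := mem_shell_one h1 hu
    rw [S.neckChart_of_gt h1,
      S.inr_mem_neckRegion (Bp.shellMap'_ne_center (Or.inl rfl) hR hp hip hus)] at h
    obtain ⟨v, hv, e⟩ := h
    have hv1 : ‖v‖ ≤ 1 := by simpa using hv
    rw [hip (key Rp hp v hv1) (shellMap'_of_mem (Or.inl rfl) hR hp hus).2 e,
      norm_shellMap'_le_one_iff (Or.inl rfl) hus] at hv1
    exact abs_le.2 ⟨by linarith, by linarith⟩

end ContactConnectedSum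

end

/-! ### The obstruction class of a ball in the neck -/

section

/-- The cutoff function on the neck: a function of the distance to the sphere of radius `2`, in
terms of the square of the distance to the origin. -/
def neckCutoff (α β s : ℝ) : ℝ := cutoff α β ((√s - 2) ^ 2)

theorem neckCutoff_norm_sq (α β : ℝ) (u : E3) :
    neckCutoff α β (‖u‖ ^ 2) = cutoff α β ((‖u‖ - 2) ^ 2) := by
  rw [neckCutoff, Real.sqrt_sq (norm_nonneg u)]

theorem contDiffOn_neckCutoff {R : ℝ} (hR : R ≤ 4) (α β : ℝ) :
    ContDiffOn ℝ ∞ (neckCutoff α β) (neckJ R) := by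
  have h1 : ContDiffOn ℝ ∞ (fun s : ℝ => (√s - 2) ^ 2) (neckJ R) :=
    ((contDiffOn_id.sqrt fun s hs => (pos_of_mem_neckJ hR hs).ne').sub contDiffOn_const).pow 2
  exact (contDiff_cutoff α β).comp_contDiffOn h1

theorem neckCutoff_eventually_eq_one {α β : ℝ} (hα : 1 < α) (hαβ : α < β) {u : E3}
    (hu : |‖u‖ - 2| ≤ 1) : ∀ᶠ s in 𝓝 (‖u‖ ^ 2), neckCutoff α β s = 1 := by
  have hc : ContinuousAt (fun s : ℝ => (√s - 2) ^ 2) (‖u‖ ^ 2) := by fun_prop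
  have hlt : (√(‖u‖ ^ 2) - 2) ^ 2 < α := by
    rw [Real.sqrt_sq (norm_nonneg u), ← sq_abs]
    exact lt_of_le_of_lt (pow_le_one₀ (abs_nonneg _) hu) hα
  filter_upwards [hc.eventually_lt continuousAt_const hlt] with s hs
  exact cutoff_eq_one hαβ hs.le

/-- The annulus on which the cutoff function on the neck is supported, in terms of squares of
radii. -/
theorem mem_Icc_sq_iff {β s : ℝ} (hβ0 : 0 ≤ β) (hβ : β ≤ 4) (hs : 0 ≤ s) :
    s ∈ Icc ((2 - √β) ^ 2) ((2 + √β) ^ 2) ↔ (√s - 2) ^ 2 ≤ β := by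
  have h1 : √β ≤ 2 := by
    rw [Real.sqrt_le_left (by norm_num)]; linarith
  have h2 := Real.sqrt_nonneg β
  have h3 := Real.sqrt_nonneg s
  have h4 : (√s - 2) ^ 2 ≤ β ↔ |√s - 2| ≤ √β := by
    rw [← Real.sqrt_sq_eq_abs]
    exact (Real.sqrt_le_sqrt_iff hβ0).symm
  rw [h4, abs_le, mem_Icc]
  conv_lhs => rw [← Real.sq_sqrt hs]
  rw [sq_le_sq₀ (by linarith) h3, sq_le_sq₀ h3 (by linarith)]
  constructor <;> rintro ⟨a, b⟩ <;> constructor <;> linarith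

section Interior

variable {Y : Type*} [TopologicalSpace Y] [ChartedSpace E3 Y] [IsManifold (𝓡 3) ∞ Y]
  [T2Space Y] {ξ : ContactStructure Y}

/-- Interior points of the image of a Darboux ball are images of interior points. -/
theorem DarbouxBall.norm_lt_one_of_mem_nhds (B : DarbouxBall ξ) {x : E3} (hx : ‖x‖ ≤ 1)
    (h : B.image ∈ 𝓝 (B.toFun x)) : ‖x‖ < 1 := by
  obtain ⟨R, hR, hB, hi⟩ := B.exists_collar_sq
  by_contra hx1
  have hx1 : ‖x‖ = 1 := le_antisymm hx (not_lt.1 hx1)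
  have hxR : ‖x‖ ^ 2 ∈ Iio R := by rw [hx1]; simpa using hR
  have hc : ContinuousAt (fun s : ℝ => B.toFun (s • x)) 1 := by
    have h1 : ContinuousAt B.toFun ((1 : ℝ) • x) := by
      rw [one_smul]; exact (hB.contMDiffAt hxR).continuousAt
    exact ContinuousAt.comp (f := fun s : ℝ => s • x) h1 (by fun_prop)
  have h2 : ∀ᶠ s : ℝ in 𝓝 1, B.toFun (s • x) ∈ B.image :=
    hc.eventually (show ∀ᶠ y in 𝓝 (B.toFun ((1 : ℝ) • x)), y ∈ B.image by rw [one_smul]; exact h)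
  have h3 : ∀ᶠ s : ℝ in 𝓝 1, ‖s • x‖ ^ 2 < R := by
    have : ContinuousAt (fun s : ℝ => ‖s • x‖ ^ 2) 1 := by fun_prop
    exact this.eventually_lt continuousAt_const (by simpa using hxR)
  obtain ⟨s, ⟨h4, h5⟩, hs⟩ := (((h2.and h3).filter_mono nhdsWithin_le_nhds).and
    (self_mem_nhdsWithin : Ioi (1 : ℝ) ∈ 𝓝[>] 1)).exists
  obtain ⟨y, hy, e⟩ := h4
  have hy1 : ‖y‖ ≤ 1 := by simpa using hy
  have hys := hi (lt_of_le_of_lt (pow_le_one₀ (norm_nonneg _) hy1) hR) h5 e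
  rw [hys, norm_smul, hx1, mul_one, Real.norm_eq_abs] at hy1
  exact absurd (le_of_abs_le hy1) (not_le.2 (mem_Ioi.1 hs))

theorem DarbouxBall.image_mem_nhds (B : DarbouxBall ξ) : B.image ∈ 𝓝 B.center := by
  obtain ⟨R, hR, hB, -⟩ := B.exists_collar_sq
  have hB' : ImmOn B.toFun (ball 0 1) := hB.mono isOpen_ball fun u hu =>
    lt_of_le_of_lt (pow_le_one₀ (norm_nonneg _) (mem_ball_zero_iff.1 hu).le) hR
  set c := chartAt E3 B.center with hc
  obtain ⟨τ, T, hT, hcT, hTt, -, -, hτm, -, hτ⟩ := hB'.exists_transition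
    (immOn_chart_symm B.center) (mem_ball_self one_pos) (mem_chart_target E3 B.center)
    (c.left_inv (mem_chart_source E3 B.center)).symm
  refine Filter.mem_of_superset ((c.isOpen_inter_preimage hT).mem_nhds
    ⟨mem_chart_source E3 B.center, hcT⟩) fun p hp => ?_
  refine ⟨τ (c p), ball_subset_closedBall (hτm hp.2), ?_⟩
  rw [← hτ _ hp.2]
  exact c.left_inv hp.1

end Interior

variable {Ym Yp Y : Type*} [TopologicalSpace Ym] [ChartedSpace E3 Ym]
  [TopologicalSpace Yp] [ChartedSpace E3 Yp] [TopologicalSpace Y] [ChartedSpace E3 Y]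
  {ξm : ContactStructure Ym} {Bm : DarbouxBall ξm}
  {ξp : ContactStructure Yp} {Bp : DarbouxBall ξp} {ξ : ContactStructure Y}
  {R Rm Rp : ℝ}

theorem IsContactEmbeddingOn.continuousAt {Y₁ Y₂ : Type*} [TopologicalSpace Y₁] [ChartedSpace E3 Y₁]
    [TopologicalSpace Y₂] [ChartedSpace E3 Y₂] {ξ₁ : ContactStructure Y₁} {ξ₂ : ContactStructure Y₂}
    {f : Y₁ → Y₂} {U : Set Y₁} (h : IsContactEmbeddingOn ξ₁ ξ₂ f U) {p : Y₁} (hp : p ∈ U) :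
    ContinuousAt f p :=
  (h.isLocalDiffeomorphOn ⟨p, hp⟩).contMDiffAt.continuousAt

namespace ContactConnectedSum

variable (S : ContactConnectedSum ξm Bm ξp Bp ξ)

/-- The interior of the closed neck is the open neck. -/
theorem exists_neck_eq [IsManifold (𝓡 3) ∞ Ym] [IsManifold (𝓡 3) ∞ Yp] [T2Space Ym] [T2Space Yp]
    {y : Y} (h : S.neckRegion ∈ 𝓝 y) :
    ∃ (w : S2) (t : ℝ), t ∈ Ioo (-1 : ℝ) 1 ∧ S.neck (w, t) = y := by
  have hlt : ∀ (w : E3) (t : ℝ), ‖w‖ = 1 → t ∈ Ioc (0 : ℝ) 1 → ‖handlePoint w t‖ < 1 → t < 1 := by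
    intro w t hw ht h1
    refine lt_of_le_of_ne ht.2 ?_
    rintro rfl
    have : handlePoint w 1 = w := by apply E3_ext <;> simp [handlePoint]
    rw [this, hw] at h1
    exact lt_irrefl _ h1
  rcases S.cover y with ⟨p, hp, rfl⟩ | ⟨q, hq, rfl⟩ | ⟨w, rfl⟩
  · have h1 : Bm.image ∈ 𝓝 p := by
      filter_upwards [(S.inl_emb.continuousAt (p := p) hp).preimage_mem_nhds h,
        isOpen_ne.mem_nhds hp] with x hx hx0
      exact (S.inl_mem_neckRegion hx0).1 hx
    obtain ⟨x, hx, rfl⟩ := mem_of_mem_nhds h1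
    have hx1 := Bm.norm_lt_one_of_mem_nhds (by simpa using hx) h1
    have hx0 : reflectZ x ≠ 0 := by
      rw [← norm_ne_zero_iff, norm_reflectZ, norm_ne_zero_iff]
      rintro rfl
      exact hp rfl
    -- interior points of the balls are handle points with `t < 1`
    obtain ⟨w, t, hw, ht, e⟩ := exists_handlePoint_eq hx0 (by rw [norm_reflectZ]; exact hx1.le)
    have ht1 := hlt w t hw ht (by rw [e, norm_reflectZ]; exact hx1)
    have e' : handlePoint w (-t) = reflectZ x := by rw [← e]; simp [handlePoint]
    refine ⟨⟨w, by simpa using hw⟩, -t, ⟨by linarith, by linarith [ht.1]⟩, ?_⟩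
    rw [S.neck_neg _ _ ⟨by linarith, by linarith [ht.1]⟩, e']
    congr 2
    apply E3_ext <;> simp [reflectZ]
  · have h1 : Bp.image ∈ 𝓝 q := by
      filter_upwards [(S.inr_emb.continuousAt (p := q) hq).preimage_mem_nhds h,
        isOpen_ne.mem_nhds hq] with x hx hx0
      exact (S.inr_mem_neckRegion hx0).1 hx
    obtain ⟨x, hx, rfl⟩ := mem_of_mem_nhds h1
    have hx1 := Bp.norm_lt_one_of_mem_nhds (by simpa using hx) h1
    have hx0 : x ≠ 0 := by
      rintro rfl
      exact hq rfl
    obtain ⟨w, t, hw, ht, e⟩ := exists_handlePoint_eq hx0 hx1.le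
    have ht1 := hlt w t hw ht (by rw [e]; exact hx1)
    refine ⟨⟨w, by simpa using hw⟩, t, ⟨by linarith [ht.1], ht1⟩, ?_⟩
    rw [S.neck_pos _ _ ⟨ht.1, ht1⟩, e]
  · exact ⟨w, 0, by norm_num, rfl⟩

theorem mem_shell_of_neckChart_eq_inl (hR : 1 < R) (hR4 : R ≤ 4) (hp : R ^ 2 ≤ Rp)
    (hip : InjOn Bp.toFun {u | ‖u‖ ^ 2 ∈ Iio Rp}) {u : E3} (hu : ‖u‖ ^ 2 ∈ neckJ R) {p : Ym}
    (hpc : p ≠ Bm.center) (h : S.neckChart u = S.inl p) : u ∈ shell (-1) R := by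
  have hu' := norm_sq_mem_neckJ.1 hu
  rcases lt_trichotomy ‖u‖ 2 with h1 | h1 | h1
  · exact mem_shell_neg_one (ne_zero_of_mem_neckJ hR4 hu) h1 hu'
  · rw [S.neckChart_of_eq h1] at h
    exact absurd h (S.neck_ne_inl _ _ hpc)
  · rw [S.neckChart_of_gt h1] at h
    exact absurd h.symm (S.inl_ne_inr _ hpc _
      (Bp.shellMap'_ne_center (Or.inl rfl) hR hp hip (mem_shell_one h1 hu')))

theorem mem_shell_of_neckChart_eq_inr (hR : 1 < R) (hR4 : R ≤ 4) (hm : R ^ 2 ≤ Rm)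
    (him : InjOn Bm.toFun {u | ‖u‖ ^ 2 ∈ Iio Rm}) {u : E3} (hu : ‖u‖ ^ 2 ∈ neckJ R) {q : Yp}
    (hqc : q ≠ Bp.center) (h : S.neckChart u = S.inr q) : u ∈ shell 1 R := by
  have hu' := norm_sq_mem_neckJ.1 hu
  rcases lt_trichotomy ‖u‖ 2 with h1 | h1 | h1
  · rw [S.neckChart_of_lt h1] at h
    exact absurd h (S.inl_ne_inr _ (Bm.shellMap'_ne_center (Or.inr rfl) hR hm him
      (mem_shell_neg_one (ne_zero_of_mem_neckJ hR4 hu) h1 hu')) _ hqc)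
  · rw [S.neckChart_of_eq h1] at h
    exact absurd h (S.neck_ne_inr _ _ hqc)
  · exact mem_shell_one h1 hu'

variable [IsManifold (𝓡 3) ∞ Ym] [IsManifold (𝓡 3) ∞ Yp] [T2Space Ym] [T2Space Yp]
  [IsManifold (𝓡 3) ∞ Y] [T2Space Y]

/-- A loop in the obstruction class of a Darboux ball in the neck: the boundary of the disc of
rotations of the neck. -/
theorem exists_neck_disc (B : DarbouxBall ξ) (hB : B.image ⊆ S.neckRegion) (hR4 : R ≤ 4)
    (hm : R ^ 2 ≤ Rm) (hp : R ^ 2 ≤ Rp) {α β : ℝ} (hα : 1 < α) (hαβ : α < β) (hβ : β < R)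
    (hfm : ImmOn Bm.toFun {u | ‖u‖ ^ 2 ∈ Iio Rm}) (him : InjOn Bm.toFun {u | ‖u‖ ^ 2 ∈ Iio Rm})
    (hfp : ImmOn Bp.toFun {u | ‖u‖ ^ 2 ∈ Iio Rp}) (hip : InjOn Bp.toFun {u | ‖u‖ ^ 2 ∈ Iio Rp}) :
    ∃ γ : Path (baseCB B) (baseCB B),
      IsObstructionClass B (FundamentalGroup.fromPath (Path.Homotopic.Quotient.mk γ)) ∧
      (∀ φ u, ‖u‖ ^ 2 ∈ neckJ R → pb S.neckChart (γ φ).1.1.pos u =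
        fderiv ℝ (twist fun s => qrot (discQ (1 * neckCutoff α β s) φ)) u ⁻¹'
          pb S.neckChart ξ.pos (twist (fun s => qrot (discQ (1 * neckCutoff α β s) φ)) u)) ∧
      (∀ φ, ∀ y ∉ S.neckChart '' {u | (‖u‖ - 2) ^ 2 ≤ β}, (γ φ).1.1.pos y = ξ.pos y) ∧
      ∀ φ, ∀ y ∈ S.neckRegion, (γ φ).1.1.pos y = ξ.pos y := by
  have hR : 1 < R := by linarith
  have hN := S.immOn_neckChart hR hR4 hm hp hfm him hfp hip
  have hinj := S.injOn_neckChart hR hR4 hm hp him hip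
  have hβ4 : β ≤ 4 := by linarith
  have hβ0 : 0 ≤ β := by linarith
  obtain ⟨D, hD, hD', hD0⟩ := exists_twisted_disc (a := (2 - √β) ^ 2) (b := (2 + √β) ^ 2)
    (χ := neckCutoff α β) hN hinj (isOpen_neckJ R)
    (fun s h0 hs => lt_of_le_of_lt ((mem_Icc_sq_iff hβ0 hβ4 h0).1 hs) hβ)
    (contDiffOn_neckCutoff hR4 α β) (fun s _ h0 hs => cutoff_eq_zero hαβ (by
      rw [mem_Icc_sq_iff hβ0 hβ4 h0] at hs
      exact (not_le.1 hs).le)) ξ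
  have hsupp : ∀ x, ∀ y ∉ S.neckChart '' {u | (‖u‖ - 2) ^ 2 ≤ β}, (D x).pos y = ξ.pos y := by
    refine fun x y hy => hD' x y fun h => hy ?_
    obtain ⟨u, hu, rfl⟩ := h
    refine ⟨u, ?_, rfl⟩
    have := (mem_Icc_sq_iff hβ0 hβ4 (sq_nonneg ‖u‖)).1 hu
    rwa [Real.sqrt_sq (norm_nonneg u)] at this
  have hneck : ∀ φ, ∀ y ∈ S.neckRegion, (D (1, φ)).pos y = ξ.pos y := by
    intro φ y hy
    -- on the neck, the twist is by rotations about the `z`-axis, under which `ξ` is invariant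
    by_cases hys : y ∈ S.neckChart '' {u | (‖u‖ - 2) ^ 2 ≤ β}
    · obtain ⟨u, hu, rfl⟩ := hys
      have huR : ‖u‖ ^ 2 ∈ neckJ R := norm_sq_mem_neckJ.2 (lt_of_le_of_lt hu hβ)
      have hu1 := S.abs_le_of_neckChart_mem hR hR4 hm hp him hip huR hy
      exact hN.field_eq_of_pb_eq huR (pb_twisted_one (hD (1, φ) u huR)
        (neckCutoff_eventually_eq_one hα hαβ hu1)
        fun c s h => S.pb_neckChart_rotZ hR hR4 hm hp hfm him hfp hip hu1 h)
    · exact hsupp _ _ hys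
  -- the centre of the ball in polar coordinates
  obtain ⟨w, t, ht, hwt⟩ := S.exists_neck_eq (Filter.mem_of_superset B.image_mem_nhds hB)
  have hpos : 0 < 2 + t := by linarith [ht.1]
  set u₁ : E3 := (2 + t) • (w : E3) with hu₁
  have hn₁ : ‖u₁‖ = 2 + t := by
    rw [hu₁, norm_smul, Real.norm_of_nonneg hpos.le]; simp
  have habs : |‖u₁‖ - 2| < 1 := by
    rw [hn₁, add_sub_cancel_left]; exact abs_lt.2 ht
  have hdom : ∀ u : E3, ‖u‖ = ‖u₁‖ → u ∈ neckDom := fun u hu => by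
    change |‖u‖ - 2| < 1
    rwa [hu]
  have hcen : S.neckChart u₁ = B.center := by
    rw [S.neckChart_eq_neck (hdom _ rfl), hn₁, hu₁, dir_smul hpos, add_sub_cancel_left, hwt]
  have h0 := ne_zero_of_mem_neckDom (hdom u₁ rfl)
  obtain ⟨γ, hγ, ho⟩ := exists_obstruction_path B (N := S.neckChart) (χ := neckCutoff α β)
    (u₁ := u₁) (U := neckDom) (V := neckVec) (ε := 1) hN hD hD0
    (fun φ p hp => hneck φ p (hB hp))
    (norm_sq_mem_neckJ.2 (by
      rw [← sq_abs]; exact (pow_lt_one₀ (abs_nonneg _) habs two_ne_zero).trans hR))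
    (neckCutoff_eventually_eq_one hα hαβ habs.le) hcen isOpen_neckDom hdom
    (contDiffOn_neckVec.mono fun u hu => ne_zero_of_mem_neckDom hu)
    (fun u hu => S.pb_neckChart hu) (Or.inl rfl) (by rw [one_mul]; exact volV_neckVec h0)
    (fun u hu s hs => by
      rw [one_smul]; exact neckVec_ne (ne_zero_of_mem_neckDom (hdom u hu)) hs)
    (fun c s h => neckVec_rotZ h u₁)
  exact ⟨γ, ho, fun φ u hu => by rw [hγ]; exact hD (1, φ) u hu,
    fun φ y hy => by rw [hγ]; exact hsupp _ _ hy, fun φ y hy => by rw [hγ]; exact hneck _ _ hy⟩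

end ContactConnectedSum

end

/-! ### The loop of the neck as a sum of the loops of the balls -/

theorem differentiableAt_qrot_discQ {χ : ℝ → ℝ} {s r φ : ℝ} (h : DifferentiableAt ℝ χ s) :
    DifferentiableAt ℝ (fun s => qrot (discQ (r * χ s) φ)) s := by
  have h1 : DifferentiableAt ℝ qrot (discQ (r * χ s) φ) :=
    (contDiffOn_qrot.contDiffAt (isOpen_compl_singleton.mem_nhds (discQ_ne_zero _ _))).differentiableAt
      (by simp)
  have h2 : DifferentiableAt ℝ (fun p : ℝ × ℝ => discQ p.1 p.2) (r * χ s, φ) :=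
    contDiff_discQ.differentiable (by simp) _
  have h3 : DifferentiableAt ℝ (fun s => (r * χ s, φ)) s := by fun_prop
  have h4 : DifferentiableAt ℝ (fun s => discQ (r * χ s) φ) s :=
    h2.comp (f := fun s => (r * χ s, φ)) s h3
  exact DifferentiableAt.comp (g := qrot) (f := fun s => discQ (r * χ s) φ) s h1 h4

section Shell

variable {ε R : ℝ} {α β φ : ℝ}

/-- The identification of spheres of radius `2 ± t` with spheres of radius `t` intertwines the
rotations of the neck with those of the ball. -/
theorem shellMap_twist (hε : ε = 1 ∨ ε = -1) {u : E3} (hu : u ≠ 0) :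
    shellMap ε (twist (fun s => qrot (discQ (1 * neckCutoff α β s) φ)) u) =
      twist (fun s => qrot (discQ (1 * cutoff α β s) φ)) (shellMap ε u) := by
  have h1 : ‖twist (fun s => qrot (discQ (1 * neckCutoff α β s) φ)) u‖ = ‖u‖ :=
    norm_twist (fun s v => norm_qrot (discQ_ne_zero _ _) v) u
  have h2 : ‖shellMap ε u‖ ^ 2 = (‖u‖ - 2) ^ 2 := by rw [norm_shellMap hε hu, sq_abs]
  rw [shellMap_eq, h1, twist, twist, neckCutoff_norm_sq, h2, shellMap_eq, map_smul]

theorem shellMap_smul (hε : ε = 1 ∨ ε = -1) {v : E3} (hv : v ≠ 0) (h : 0 < 2 + ε * ‖v‖) :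
    shellMap ε (((2 + ε * ‖v‖) * ‖v‖⁻¹) • v) = v ∧ ‖((2 + ε * ‖v‖) * ‖v‖⁻¹) • v‖ = 2 + ε * ‖v‖ := by
  have hv' := norm_pos_iff.2 hv
  have hn : ‖((2 + ε * ‖v‖) * ‖v‖⁻¹) • v‖ = 2 + ε * ‖v‖ := by
    rw [norm_smul, Real.norm_of_nonneg (by positivity), mul_assoc, inv_mul_cancel₀ hv'.ne', mul_one]
  refine ⟨?_, hn⟩
  have hε2 : ε * ε = 1 := by rcases hε with rfl | rfl <;> norm_num
  have h2 : ε * (1 - 2 / (2 + ε * ‖v‖)) * ((2 + ε * ‖v‖) * ‖v‖⁻¹) = 1 := by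
    field_simp
    linear_combination ‖v‖ * hε2
  rw [shellMap_eq, hn, smul_smul, h2, one_smul]

theorem comp_shellMap'_eq {Y₁ : Type*} (f : E3 → Y₁) (hε : ε = 1 ∨ ε = -1) {u : E3} (hu : u ≠ 0)
    (h : 3 / 4 ≤ |‖u‖ - 2|) : f (shellMap' ε u) = coreChart f ε (shellMap ε u) := by
  have h1 : 9 / 16 ≤ ‖shellMap ε u‖ ^ 2 := by
    rw [norm_shellMap hε hu]; nlinarith
  simp only [shellMap', coreChart, Function.comp_apply, coreMap_eq_handleMap h1]

variable {Y₁ Y : Type*} [TopologicalSpace Y₁] [ChartedSpace E3 Y₁] [TopologicalSpace Y]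
  [ChartedSpace E3 Y] {ξ₁ : ContactStructure Y₁} {ξ : ContactStructure Y} {i : Y₁ → Y} {U : Set Y₁}

theorem IsContactEmbeddingOn.mem_iff_of_pb_eq (h : IsContactEmbeddingOn ξ₁ ξ i U) {ψ : E3 → Y₁}
    {A : Set E3} (hψ : ImmOn ψ A) {u : E3} (hu : u ∈ A) (hU : ψ u ∈ U)
    {P : ∀ y : Y, Set (TangentSpace (𝓡 3) y)} {Q : ∀ y : Y₁, Set (TangentSpace (𝓡 3) y)}
    (e : pb (i ∘ ψ) P u = pb ψ Q u) (v : TangentSpace (𝓡 3) (ψ u)) :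
    mfderiv (𝓡 3) (𝓡 3) i (ψ u) v ∈ P (i (ψ u)) ↔ v ∈ Q (ψ u) := by
  obtain ⟨w, rfl⟩ := hψ.surjective hu v
  have h1 := Set.ext_iff.1 e w
  simp only [pb, mfderiv_comp u (h.mdifferentiableAt hU) (hψ.mdifferentiableAt hu)]
    at h1
  exact h1

variable (B : DarbouxBall ξ₁) {R' : ℝ} {N : E3 → Y}
  {P : ∀ y : Y, Set (TangentSpace (𝓡 3) y)} {Q : ∀ y : Y₁, Set (TangentSpace (𝓡 3) y)}

/-- In a collar of the ball, the disc of rotations of the neck is the disc of rotations of the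
ball. -/
theorem pb_neck_eq_pb_core (h : IsContactEmbeddingOn ξ₁ ξ i {B.center}ᶜ) (hε : ε = 1 ∨ ε = -1)
    (hR : 1 < R) (hRR : R ^ 2 ≤ R') (hf : ImmOn B.toFun {u | ‖u‖ ^ 2 ∈ Iio R'})
    (hfi : InjOn B.toFun {u | ‖u‖ ^ 2 ∈ Iio R'})
    (hN : ∀ u ∈ shell ε R, N =ᶠ[𝓝 u] i ∘ (B.toFun ∘ shellMap' ε))
    (hQ : ∀ u, ‖u‖ ^ 2 < R → pb (coreChart B.toFun ε) Q u =
        fderiv ℝ (twist fun s => qrot (discQ (1 * cutoff α β s) φ)) u ⁻¹'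
          pb (coreChart B.toFun ε) ξ₁.pos
            (twist (fun s => qrot (discQ (1 * cutoff α β s) φ)) u))
    (hP : ∀ u, ‖u‖ ^ 2 ∈ neckJ R → pb N P u =
        fderiv ℝ (twist fun s => qrot (discQ (1 * neckCutoff α β s) φ)) u ⁻¹'
          pb N ξ.pos (twist (fun s => qrot (discQ (1 * neckCutoff α β s) φ)) u))
    {u : E3} (hu : u ∈ shell ε R) (hu1 : 1 < ε * (‖u‖ - 2)) :
    pb (i ∘ (B.toFun ∘ shellMap' ε)) P u = pb (B.toFun ∘ shellMap' ε) Q u := by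
  set T : ℝ → E3 →L[ℝ] E3 := fun s => qrot (discQ (1 * cutoff α β s) φ) with hT
  set T' : ℝ → E3 →L[ℝ] E3 := fun s => qrot (discQ (1 * neckCutoff α β s) φ) with hT'
  have hC := immOn_coreChart hε hR hRR hf
  have hG := immOn_comp_shellMap' hε hR hRR hf
  -- the two parametrizations of the collar
  have key : ∀ x ∈ shell ε R, 1 < ε * (‖x‖ - 2) →
      B.toFun ∘ shellMap' ε =ᶠ[𝓝 x] coreChart B.toFun ε ∘ shellMap ε := by
    intro x hx hx1
    have hc : ContinuousAt (fun y : E3 => ε * (‖y‖ - 2)) x := by fun_prop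
    filter_upwards [(isOpen_shell ε R).mem_nhds hx, continuousAt_const.eventually_lt hc hx1]
      with y hy hy1
    refine comp_shellMap'_eq B.toFun hε hy.1 ?_
    rcases hε with rfl | rfl
    · linarith [le_abs_self (‖y‖ - 2)]
    · linarith [neg_le_abs (‖y‖ - 2)]
  have hσ : ∀ x ∈ shell ε R, DifferentiableAt ℝ (shellMap ε) x := fun x hx =>
    (contDiffAt_shellMap hx.1).differentiableAt (by simp)
  have hcore : ∀ x ∈ shell ε R, 1 < ε * (‖x‖ - 2) → ∀ P' : ∀ y : Y₁, Set (TangentSpace (𝓡 3) y),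
      pb (B.toFun ∘ shellMap' ε) P' x =
        fderiv ℝ (shellMap ε) x ⁻¹' pb (coreChart B.toFun ε) P' (shellMap ε x) := by
    intro x hx hx1 P'
    rw [pb_congr (key x hx hx1), pb_comp (hC.mdifferentiableAt (shellMap_of_mem hε hx).2.2.2)
      (hσ x hx)]
  have hn : ‖twist T' u‖ = ‖u‖ := norm_twist (fun s v => norm_qrot (discQ_ne_zero _ _) v) u
  have hu' : twist T' u ∈ shell ε R := by
    refine ⟨norm_ne_zero_iff.1 ?_, ?_, ?_⟩
    · rw [hn]; exact norm_ne_zero_iff.2 hu.1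
    · rw [hn]; exact hu.2.1
    · rw [hn]; exact hu.2.2
  have hu1' : 1 < ε * (‖twist T' u‖ - 2) := by rwa [hn]
  have e0 : shellMap ε (twist T' u) = twist T (shellMap ε u) := shellMap_twist hε hu.1
  have hun := norm_pos_iff.2 hu.1
  have hdχ : DifferentiableAt ℝ (neckCutoff α β) (‖u‖ ^ 2) := by
    have h1 : DifferentiableAt ℝ (fun s : ℝ => (√s - 2) ^ 2) (‖u‖ ^ 2) :=
      (((differentiableAt_id).sqrt (pow_pos hun 2).ne').sub_const 2).pow 2
    exact (((contDiff_cutoff α β).differentiable (by simp)) _).comp _ h1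
  have hd' : DifferentiableAt ℝ (twist T') u :=
    (hasFDerivAt_twist (differentiableAt_qrot_discQ hdχ)).differentiableAt
  have hd : DifferentiableAt ℝ (twist T) (shellMap ε u) :=
    (hasFDerivAt_twist (differentiableAt_qrot_discQ
      ((contDiff_cutoff α β).differentiable (by simp) _))).differentiableAt
  -- the derivative of the identity `shellMap ∘ twist = twist ∘ shellMap`
  have e1 : (fderiv ℝ (shellMap ε) (twist T' u)).comp (fderiv ℝ (twist T') u) =
      (fderiv ℝ (twist T) (shellMap ε u)).comp (fderiv ℝ (shellMap ε) u) := by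
    rw [← fderiv_comp u (hσ _ hu') hd', ← fderiv_comp u hd (hσ u hu)]
    refine Filter.EventuallyEq.fderiv_eq ?_
    filter_upwards [isOpen_ne.mem_nhds hu.1] with x hx
    exact shellMap_twist hε hx
  have hG0 : ∀ x ∈ shell ε R, (B.toFun ∘ shellMap' ε) x ∈ ({B.center}ᶜ : Set Y₁) := fun x hx =>
    B.shellMap'_ne_center hε hR hRR hfi hx
  rw [← pb_congr (hN u hu), hP u (norm_sq_mem_neckJ.2 hu.2.2), pb_congr (hN _ hu'),
    h.pb_contact (hG.mdifferentiableAt hu') (hG0 _ hu'), hcore _ hu' hu1', hcore _ hu hu1,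
    hQ _ (shellMap_of_mem hε hu).2.2.2, e0, ← preimage_comp, ← preimage_comp]
  congr 1
  funext v
  exact DFunLike.congr_fun e1 v

/-- Outside the ball, the boundary of the disc of rotations of the neck is the boundary of the disc
of rotations of the ball. -/
theorem mem_neck_iff_mem_core (h : IsContactEmbeddingOn ξ₁ ξ i {B.center}ᶜ) (hε : ε = 1 ∨ ε = -1)
    (hR4 : R ≤ 4) (hRR : R ^ 2 ≤ R') (hα : 1 < α) (hαβ : α < β) (hβ : β < R)
    (hf : ImmOn B.toFun {u | ‖u‖ ^ 2 ∈ Iio R'}) (hfi : InjOn B.toFun {u | ‖u‖ ^ 2 ∈ Iio R'})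
    (hN : ∀ u ∈ shell ε R, N =ᶠ[𝓝 u] i ∘ (B.toFun ∘ shellMap' ε))
    (hN' : ∀ u p, ‖u‖ ^ 2 ∈ neckJ R → p ≠ B.center → N u = i p → u ∈ shell ε R)
    (hQ : ∀ u, ‖u‖ ^ 2 < R → pb (coreChart B.toFun ε) Q u =
        fderiv ℝ (twist fun s => qrot (discQ (1 * cutoff α β s) φ)) u ⁻¹'
          pb (coreChart B.toFun ε) ξ₁.pos
            (twist (fun s => qrot (discQ (1 * cutoff α β s) φ)) u))
    (hQ' : ∀ y ∉ coreChart B.toFun ε '' {u | ‖u‖ ^ 2 ≤ β}, Q y = ξ₁.pos y)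
    (hP : ∀ u, ‖u‖ ^ 2 ∈ neckJ R → pb N P u =
        fderiv ℝ (twist fun s => qrot (discQ (1 * neckCutoff α β s) φ)) u ⁻¹'
          pb N ξ.pos (twist (fun s => qrot (discQ (1 * neckCutoff α β s) φ)) u))
    (hP' : ∀ y ∉ N '' {u | (‖u‖ - 2) ^ 2 ≤ β}, P y = ξ.pos y)
    {p : Y₁} (hp : p ∉ B.image) (v : TangentSpace (𝓡 3) p) :
    mfderiv (𝓡 3) (𝓡 3) i p v ∈ P (i p) ↔ v ∈ Q p := by
  have hR : 1 < R := by linarith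
  have hG := immOn_comp_shellMap' hε hR hRR hf
  by_cases hpN : i p ∈ N '' {u | (‖u‖ - 2) ^ 2 ≤ β}
  · obtain ⟨u, hu, e⟩ := hpN
    have hus := hN' u p (norm_sq_mem_neckJ.2 (lt_of_le_of_lt hu hβ)) (B.ne_center hp) e
    have hc := B.shellMap'_ne_center hε hR hRR hfi hus
    rw [(hN u hus).eq_of_nhds] at e
    obtain rfl := h.injOn hc (B.ne_center hp) e
    have hu1 : 1 < ε * (‖u‖ - 2) := by
      by_contra h1
      refine hp (mem_image_of_mem _ ?_)
      rw [mem_closedBall_zero_iff]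
      exact (norm_shellMap'_le_one_iff hε hus).2 (not_lt.1 h1)
    exact h.mem_iff_of_pb_eq hG hus hc (pb_neck_eq_pb_core B h hε hR hRR hf hfi hN hQ hP hus hu1) v
  · rw [hP' _ hpN, h.contact p (B.ne_center hp), hQ' p ?_]
    -- a point in the support of the loop of the ball, but outside of the ball, is in the support of
    -- the loop of the neck
    rintro ⟨x, hx, rfl⟩
    refine hpN ?_
    have hx1 : 1 < ‖x‖ := by
      by_contra h1
      refine hp (mem_image_of_mem _ ?_)
      rw [mem_closedBall_zero_iff, Function.comp_apply, norm_scaleZ hε]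
      exact norm_coreMap_le_one_iff.2 (not_lt.1 h1)
    have hx0 : x ≠ 0 := norm_pos_iff.1 (by linarith)
    have hx2 : ‖x‖ < 2 := by
      have h1 : ‖x‖ ^ 2 ≤ β := hx
      nlinarith
    have hpos : 0 < 2 + ε * ‖x‖ := by
      rcases hε with rfl | rfl <;> linarith
    have hε2 : ε * ε = 1 := by rcases hε with rfl | rfl <;> norm_num
    obtain ⟨e1, e2⟩ := shellMap_smul hε hx0 hpos
    set u : E3 := ((2 + ε * ‖x‖) * ‖x‖⁻¹) • x with hu
    have e3 : (‖u‖ - 2) ^ 2 = ‖x‖ ^ 2 := by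
      rw [e2]; linear_combination ‖x‖ ^ 2 * hε2
    have hu0 : u ≠ 0 := norm_pos_iff.1 (by rw [e2]; exact hpos)
    have hus : u ∈ shell ε R := by
      refine ⟨hu0, ?_, by rw [e3]; exact lt_of_le_of_lt hx hβ⟩
      rw [e2, add_sub_cancel_left, ← mul_assoc, hε2, one_mul]
      linarith
    refine ⟨u, by rw [mem_ofPred_eq, e3]; exact hx, ?_⟩
    rw [(hN u hus).eq_of_nhds, Function.comp_apply, Function.comp_apply,
      comp_shellMap'_eq B.toFun hε hu0, e1]
    rw [e2, add_sub_cancel_left, abs_mul, abs_norm]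
    rcases hε with rfl | rfl <;> norm_num <;> linarith

end Shell

/-! ### Products of loops -/

section Loops

variable {X Z W : Type*} [TopologicalSpace X] [TopologicalSpace Z] [TopologicalSpace W]

/-- The image of a pair of loops under a map from a product is the product of the images of the
two loops. -/
theorem fromPath_eq_mul (F : C(X × Z, W)) {x : X} {z : Z} {w : W} (p : Path x x) (q : Path z z)
    (γ : Path w w) (hγ : ∀ t, γ t = F (p t, q t))
    (hL : (F.comp ((ContinuousMap.id X).prodMk (ContinuousMap.const X z))) x = w)
    (hR : (F.comp ((ContinuousMap.const Z x).prodMk (ContinuousMap.id Z))) z = w) :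
    FundamentalGroup.fromPath (Path.Homotopic.Quotient.mk γ) =
      FundamentalGroup.mapOfEq _ hL (FundamentalGroup.fromPath (Path.Homotopic.Quotient.mk p)) *
        FundamentalGroup.mapOfEq _ hR (FundamentalGroup.fromPath (Path.Homotopic.Quotient.mk q)) := by
  subst hL
  rw [FundamentalGroup.mapOfEq_apply, FundamentalGroup.mapOfEq_apply, FundamentalGroup.mul_def]
  have h1 : γ = (p.prod q).map F.continuous := Path.ext (funext hγ)
  -- the loop `(p, q)` is homotopic to `(1, q)` followed by `(p, 1)`, the order of multiplication in
  -- `FundamentalGroup`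
  have h2 : Path.Homotopic.Quotient.mk (p.prod q) =
      (Path.Homotopic.Quotient.mk ((Path.refl x).prod q)).trans
        (Path.Homotopic.Quotient.mk (p.prod (Path.refl z))) := by
    rw [← Path.Homotopic.prod_lift, ← Path.Homotopic.prod_lift, ← Path.Homotopic.prod_lift,
      Path.Homotopic.comp_prod_eq_prod_comp]
    simp
  have h3 : Path.Homotopic.Quotient.mk γ = (Path.Homotopic.Quotient.mk (p.prod q)).map F := by
    rw [h1]; rfl
  rw [h3, h2, ← Path.Homotopic.Quotient.mk_trans, ← Path.Homotopic.Quotient.mk_map, Path.map_trans,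
    Path.Homotopic.Quotient.mk_trans]
  rfl

end Loops

end ContactSum

end

open ContactSum in
theorem mainTheorem10
    {Ym Yp Y : Type*}
    [TopologicalSpace Ym] [T2Space Ym] [CompactSpace Ym] [ConnectedSpace Ym]
    [ChartedSpace E3 Ym] [IsManifold (𝓡 3) ∞ Ym]
    [TopologicalSpace Yp] [T2Space Yp] [CompactSpace Yp] [ConnectedSpace Yp]
    [ChartedSpace E3 Yp] [IsManifold (𝓡 3) ∞ Yp]
    [TopologicalSpace Y] [T2Space Y] [CompactSpace Y] [ConnectedSpace Y]
    [ChartedSpace E3 Y] [IsManifold (𝓡 3) ∞ Y]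
    (ξm : ContactStructure Ym) (Bm : DarbouxBall ξm)
    (ξp : ContactStructure Yp) (Bp : DarbouxBall ξp)
    (ξ : ContactStructure Y) (S : ContactConnectedSum ξm Bm ξp Bp ξ)
    (B : DarbouxBall ξ) (hB : B.image ⊆ S.neckRegion) :
    -- the natural inclusions `(-) # ξp` and `ξm # (-)` are well-defined continuous based maps,
    ∃ (iL : C(SpaceCB Bm, SpaceCB B)) (iR : C(SpaceCB Bp, SpaceCB B))
      (hL : iL (baseCB Bm) = baseCB B) (hR : iR (baseCB Bp) = baseCB B),
      (∀ η, S.IsSumLeft η.1.1 (iL η).1.1) ∧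
      (∀ η, S.IsSumRight η.1.1 (iR η).1.1) ∧
      -- the obstruction classes of the summands are well-defined,
      ∃ (om : FundamentalGroup (SpaceCB Bm) (baseCB Bm))
        (op : FundamentalGroup (SpaceCB Bp) (baseCB Bp)),
        (∀ o, IsObstructionClass Bm o ↔ o = om) ∧
        (∀ o, IsObstructionClass Bp o ↔ o = op) ∧
        -- and the one of the sum is the product of their images
        (∀ o, IsObstructionClass B o ↔
          o = FundamentalGroup.mapOfEq iL hL om * FundamentalGroup.mapOfEq iR hR op) := by
  obtain ⟨Rm, hRm, hfm, him⟩ := Bm.exists_collar_sq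
  obtain ⟨Rp, hRp, hfp, hip⟩ := Bp.exists_collar_sq
  -- radii at which the collars of both balls and the neck are defined
  obtain ⟨R, hR, hR4, hm, hp⟩ : ∃ R : ℝ, 1 < R ∧ R ≤ 4 ∧ R ^ 2 ≤ Rm ∧ R ^ 2 ≤ Rp := by
    have h1 : (1 : ℝ) < min (√(min Rm Rp)) 4 := lt_min
      (Real.lt_sqrt_of_sq_lt (by rw [one_pow]; exact lt_min hRm hRp)) (by norm_num)
    have h2 : min (√(min Rm Rp)) 4 ^ 2 ≤ min Rm Rp := by
      have h3 : 0 ≤ min Rm Rp := le_min (by linarith) (by linarith)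
      exact (pow_le_pow_left₀ (zero_le_one.trans h1.le) (min_le_left _ _) 2).trans_eq
        (Real.sq_sqrt h3)
    exact ⟨_, h1, min_le_right _ _, h2.trans (min_le_left _ _), h2.trans (min_le_right _ _)⟩
  obtain ⟨α, hα, hα'⟩ := exists_between hR
  obtain ⟨β, hαβ, hβ⟩ := exists_between hα'
  obtain ⟨γm, hom, hγm, hγm'⟩ := exists_core_disc Bm (Or.inr rfl) hm hα hαβ hβ hfm him
  obtain ⟨γp, hop, hγp, hγp'⟩ := exists_core_disc Bp (Or.inl rfl) hp hα hαβ hβ hfp hip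
  obtain ⟨γ, ho, hγ, hγ', hγn⟩ := S.exists_neck_disc B hB hR4 hm hp hα hαβ hβ hfm him hfp hip
  obtain ⟨F, hF0, hF⟩ := S.exists_sumMap B hB
  have hγF : ∀ φ, γ φ = F (γm φ, γp φ) := by
    intro φ
    refine Subtype.ext (Subtype.ext (ContactStructure.ext ?_))
    rw [hF]
    refine S.eq_sumPos (γm φ).2 (γp φ).2 (hγn φ) (fun p hpB v => ?_) fun p hpB v => ?_
    · refine mem_neck_iff_mem_core Bm S.inl_emb (Or.inr rfl) hR4 hm hα hαβ hβ hfm him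
        (fun u hu => S.neckChart_eventuallyEq_inl hu) (fun u q hu hq e => ?_) (hγm φ) (hγm' φ)
        (hγ φ) (hγ' φ) hpB v
      exact S.mem_shell_of_neckChart_eq_inl hR hR4 hp hip hu hq e
    · refine mem_neck_iff_mem_core Bp S.inr_emb (Or.inl rfl) hR4 hp hα hαβ hβ hfp hip
        (fun u hu => S.neckChart_eventuallyEq_inr hu) (fun u q hu hq e => ?_) (hγp φ) (hγp' φ)
        (hγ φ) (hγ' φ) hpB v
      exact S.mem_shell_of_neckChart_eq_inr hR hR4 hm him hu hq e
  refine ⟨F.comp ((ContinuousMap.id _).prodMk (ContinuousMap.const _ (baseCB Bp))),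
    F.comp ((ContinuousMap.const _ (baseCB Bm)).prodMk (ContinuousMap.id _)), hF0, hF0,
    fun η => S.isSumLeft η.2 (hF _), fun η => S.isSumRight η.2 (hF _), _, _,
    fun o => ⟨fun h => h.unique hom, fun h => h ▸ hom⟩,
    fun o => ⟨fun h => h.unique hop, fun h => h ▸ hop⟩, fun o => ?_⟩
  rw [← fromPath_eq_mul F γm γp γ hγF hF0 hF0]
  exact ⟨fun h => h.unique ho, fun h => h ▸ ho⟩
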